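/- Let $0<q<1$ and $[z]:=(q^z-q^{-z})/(q-q^{-1})$. **Algebras.** $\mathcal A(S^4_q)$ is the complex unital $*$-algebra generated by $x_0=x_0^*,x_1,x_1^*,x_2,x_2^*$ with relations $x_ix_j=q^2x_jx_i$ ($0\le i<j\le 2$), $x_i^*x_j=q^2x_jx_i^*$ ($i\ne j$), $[x_1^*,x_1]=(1-q^4)x_0^2$, $[x_2^*,x_2]=x_1^*x_1-q^4x_1x_1^*$, $x_0^2+x_1x_1^*+x_2x_2^*=1$ (and their adjoints). $U_q(so(5))$ is the complex unital $*$-algebra generated by $K_i=K_i^*$, $K_i^{-1}$, $E_i$, $F_i=E_i^*$ ($i=1,2$) with relations $[K_1,K_2]=0$, $K_iK_i^{-1}=K_i^{-1}K_i=1$, $[E_i,F_j]=\delta_{ij}\frac{K_j^2-K_j^{-2}}{q^j-q^{-j}}$, $K_iE_iK_i^{-1}=q^iE_i$, $K_iE_jK_i^{-1}=q^{-1}E_j$ ($i\neq j$), $E_1E_2^2-(q^2+q^{-2})E_2E_1E_2+E_2^2E_1=0$, $E_1^3E_2-(q^2+1+q^{-2})(E_1^2E_2E_1-E_1E_2E_1^2)-E_2E_1^3=0$,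 and their adjoints; its antipode $S$ is the complex linear anti-automorphism with $S(K_i)=K_i^{-1}$, $S(E_i)=-q^iE_i$, $S(F_i)=-q^{-i}F_i$. **Hilbert space.** $\mathcal H=\mathcal H_+\oplus\mathcal H_-$, where $\mathcal H_\pm$ has orthonormal basis $|l,m_1,m_2;j\rangle_\pm$ labelled by $l\in\mathbb N+\frac12$, $j\in\{\frac12,\frac32,\dots,l\}$, $j-|m_1|\in\mathbb N$, $l+\frac12-j-|m_2|\in\mathbb N$; symbols $|\dots\rangle_\pm$ with other labels denote $0$. $\mathcal M\subset\mathcal H$ is the linear span of the basis. Let $\gamma=\pm1$ on $\mathcal H_\pm$, let $D$ be the selfadjoint operator $D|l,m_1,m_2;j\rangle_\pm=(l+\frac32)|l,m_1,m_2;j\rangle_\mp$, so that $|D|$ is diagonal with eigenvalue $l+\frac32$, and let $J$ be the antilinear isometry $$J|l,m_1,m_2;j\rangle_\pm=i^{2l+1}(-1)^{j+m_1}|l,-m_1,-m_2;j\rangle_\pm .$$ **Smoothing operators.** With $\delta(T):=[|D|,T]$, put $\mathrm{OP}^0:=\bigcap_{n\in\mathbb N}\mathrm{dom}\,\delta^n\subset\mathcal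 B(\mathcal H)$ and $\mathrm{OP}^{-\infty}:=\{T\in\mathcal B(\mathcal H): |D|^kT\in\mathrm{OP}^0\ \forall k\in\mathbb N\}$. Here $T\in\mathrm{dom}\,\delta$ means that $T$ is bounded, preserves $\mathrm{dom}|D|$, and $[|D|,T]$ extends to a bounded operator. **Coefficients.** For a triple $(l,j,m_2)$ let $\epsilon\in\{\pm\frac12\}$ be determined by $l+\epsilon-j-m_2\in2\mathbb Z$; in each coefficient below $\epsilon$ is the one of its own subscripts. Put $$A^+_{j,m_1}=q^{m_1-1}\tfrac{\sqrt{[j+m_1+1][j-m_1+1]}}{[2j+2]},\qquad A^0_{j,m_1}=q^{-2}\tfrac{q^{j+m_1+1}[2][j-m_1]-[2j]}{[2j][2j+2]},$$ $$B^+_{j,m_1}=q^{-j+m_1-\frac12}\tfrac{\sqrt{[j+m_1+1][j+m_1+2]}}{[2j+2]},\quad B^0_{j,m_1}=(1+q^2)q^{m_1-\frac12}\tfrac{\sqrt{[j-m_1][j+m_1+1]}}{[2j][2j+2]},\quad B^-_{j,m_1}=-q^{j+m_1+\frac12}\tfrac{\sqrt{[j-m_1][j-m_1-1]}}{[2j]},$$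 $$C^+_{l,j,m_2}=-q^{m_2-1-\epsilon}\tfrac{\sqrt{[l+j+m_2+3+\epsilon][l+j-m_2+3-\epsilon]}}{[2l+4]},$$ $$C^0_{l,j,m_2}=[4\epsilon]\,q^{2\epsilon l+m_2-1+3\epsilon}\tfrac{\sqrt{[l+\frac12+j-2\epsilon m_2+2][l+\frac12-j-2\epsilon m_2]}}{[2l+2][2l+4]},$$ $$C^-_{l,j,m_2}=-q^{m_2-1+\epsilon}\tfrac{\sqrt{[l-j+m_2-\epsilon][l-j-m_2+\epsilon]}}{[2l+2]},$$ $$H^+_{l,j,m_2}=q^{m_2-1+\epsilon(2j+1)}\tfrac{\sqrt{[l+2\epsilon j-m_2+2+\epsilon][l-2\epsilon j+m_2+2-\epsilon]}}{[2l+4]},$$ $$H^0_{l,j,m_2}=\tfrac{[l-\epsilon(2j+1)-m_2+1][l-\epsilon(2j+1)+m_2+2]-q^{-2}[l+\epsilon(2j+1)-m_2+2][l+\epsilon(2j+1)+m_2+1]}{[2l+2][2l+4]},$$ $$D^+_{l,j,m_2}=q^{-l+m_2-\frac32}\tfrac{\sqrt{[l+j+m_2+3+\epsilon][l-j+m_2+2-\epsilon]}}{[2l+4]},$$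 $$D^0_{l,j,m_2}=[2]q^{m_2+\frac12}\tfrac{\sqrt{[l-2\epsilon j-m_2+1-\epsilon][l-2\epsilon j+m_2+2-\epsilon]}}{[2l+2][2l+4]},$$ $$D^-_{l,j,m_2}=-q^{l+m_2+\frac32}\tfrac{\sqrt{[l-j-m_2+\epsilon][l+j-m_2+1-\epsilon]}}{[2l+2]},$$ $$a_l(j,m_2)=\tfrac1{[2]}\sqrt{\tfrac{[l-j-m_2+\epsilon][l+j+m_2+3+\epsilon]}{[2(j+|\epsilon|)+1][2(j-|\epsilon|)+3]}},\qquad b_l(j,m_2)=2|\epsilon|\tfrac{\sqrt{[l-\epsilon(2j+1)-m_2+1][l-\epsilon(2j+1)+m_2+2]}}{[2j][2j+2]},$$ $$c_l(j,m_2)=\tfrac{(-1)^{2\epsilon}}{[2]}\sqrt{\tfrac{[l-j+m_2+2-\epsilon][l+j-m_2+1-\epsilon]}{[2(j+|\epsilon|)-1][2(j-|\epsilon|)+1]}}.$$ **Claim.** There are a (necessarily unique) $*$-representation $\pi$ of $\mathcal A(S^4_q)$ by bounded operators on $\mathcal H$ and a (necessarily unique) $*$-representation $\sigma$ of $U_q(so(5))$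 on $\mathcal M$ (that is, $\langle\sigma(h)v,w\rangle=\langle v,\sigma(h^*)w\rangle$) such that $$\begin{aligned} \pi(x_0)|l,m_1,m_2;j\rangle_\pm={}&A^+_{j,m_1}C^+_{l,j,m_2}|l{+}1,m_1,m_2;j{+}1\rangle_\pm\mp A^+_{j,m_1}C^0_{l,j,m_2}|l,m_1,m_2;j{+}1\rangle_\pm+A^+_{j,m_1}C^-_{l,j,m_2}|l{-}1,m_1,m_2;j{+}1\rangle_\pm\\ &+A^0_{j,m_1}H^+_{l,j,m_2}|l{+}1,m_1,m_2;j\rangle_\pm\pm A^0_{j,m_1}H^0_{l,j,m_2}|l,m_1,m_2;j\rangle_\pm+A^0_{j,m_1}H^+_{l-1,j,m_2}|l{-}1,m_1,m_2;j\rangle_\pm\\ &+A^+_{j-1,m_1}C^-_{l+1,j-1,m_2}|l{+}1,m_1,m_2;j{-}1\rangle_\pm\mp A^+_{j-1,m_1}C^0_{l,j-1,m_2}|l,m_1,m_2;j{-}1\rangle_\pm+A^+_{j-1,m_1}C^+_{l-1,j-1,m_2}|l{-}1,m_1,m_2;j{-}1\rangle_\pm,\\ \pi(x_1)|l,m_1,m_2;j\rangle_\pm={}&B^+_{j,m_1}C^+_{l,j,m_2}|l{+}1,m_1{+}1,m_2;j{+}1\rangle_\pm\mp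 B^+_{j,m_1}C^0_{l,j,m_2}|l,m_1{+}1,m_2;j{+}1\rangle_\pm+B^+_{j,m_1}C^-_{l,j,m_2}|l{-}1,m_1{+}1,m_2;j{+}1\rangle_\pm\\ &+B^0_{j,m_1}H^+_{l,j,m_2}|l{+}1,m_1{+}1,m_2;j\rangle_\pm\pm B^0_{j,m_1}H^0_{l,j,m_2}|l,m_1{+}1,m_2;j\rangle_\pm+B^0_{j,m_1}H^+_{l-1,j,m_2}|l{-}1,m_1{+}1,m_2;j\rangle_\pm\\ &+B^-_{j,m_1}C^-_{l+1,j-1,m_2}|l{+}1,m_1{+}1,m_2;j{-}1\rangle_\pm\mp B^-_{j,m_1}C^0_{l,j-1,m_2}|l,m_1{+}1,m_2;j{-}1\rangle_\pm+B^-_{j,m_1}C^+_{l-1,j-1,m_2}|l{-}1,m_1{+}1,m_2;j{-}1\rangle_\pm,\\ \pi(x_2)|l,m_1,m_2;j\rangle_\pm={}&D^+_{l,j,m_2}|l{+}1,m_1,m_2{+}1;j\rangle_\pm\pm D^0_{l,j,m_2}|l,m_1,m_2{+}1;j\rangle_\pm+D^-_{l,j,m_2}|l{-}1,m_1,m_2{+}1;j\rangle_\pm,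 \end{aligned}$$ and $$\begin{aligned} \sigma(K_1)|l,m_1,m_2;j\rangle_\pm&=q^{m_1}|l,m_1,m_2;j\rangle_\pm,\qquad \sigma(K_2)|l,m_1,m_2;j\rangle_\pm=q^{m_2-m_1}|l,m_1,m_2;j\rangle_\pm,\\ \sigma(E_1)|l,m_1,m_2;j\rangle_\pm&=\sqrt{[j-m_1][j+m_1+1]}\,|l,m_1{+}1,m_2;j\rangle_\pm,\\ \sigma(E_2)|l,m_1,m_2;j\rangle_\pm&=\sqrt{[j-m_1+1][j-m_1+2]}\,a_l(j,m_2)|l,m_1{-}1,m_2{+}1;j{+}1\rangle_\pm\\ &\quad+\sqrt{[j+m_1][j-m_1+1]}\,b_l(j,m_2)|l,m_1{-}1,m_2{+}1;j\rangle_\pm\\ &\quad+\sqrt{[j+m_1][j+m_1-1]}\,c_l(j,m_2)|l,m_1{-}1,m_2{+}1;j{-}1\rangle_\pm , \end{aligned}$$ and the following hold. 1. $J^2=-1$, $J\gamma=\gamma J$ and $JD=DJ$ (including equality of domains). 2. The antilinear operator $T$ on $\mathcal M$ with $T|l,m_1,m_2;j\rangle_\pm=i^{2l+1}(-1)^{j+m_1}q^{m_1+3m_2}|l,-m_1,-m_2;j\rangle_\pm$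 is equivariant, $T\sigma(h)=\sigma(S(h)^*)T$ for all $h\in U_q(so(5))$, and $J$ is its antiunitary part: $T=J|T|$ is the polar decomposition of (the closure of) $T$. 3. For all $a,b\in\mathcal A(S^4_q)$ (acting through $\pi$), $[D,a]$ extends to a bounded operator and $$[a,JbJ]\in\mathrm{OP}^{-\infty},\qquad [[D,a],JbJ]\in\mathrm{OP}^{-\infty}.$$ -/

import Mathlib

open scoped ComplexConjugate InnerProductSpace ENNReal

noncomputable section

namespace S4q

/-! ### Conjugate-linear maps out of free algebras -/

/-- The complex algebra structure on `B` in which a scalar acts through its conjugate. -/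
abbrev conjAlgebra (B : Type*) [Ring B] [Algebra ℂ B] : Algebra ℂ B :=
  ((algebraMap ℂ B).comp (starRingEnd ℂ)).toAlgebra' fun c x =>
    Algebra.commutes (R := ℂ) (A := B) (conj c) x

/-- The antilinear ring homomorphism out of the free complex algebra with prescribed
values on the generators. -/
def conjLift {X B : Type*} [Ring B] [Algebra ℂ B] (g : X → B) : FreeAlgebra ℂ X →+* B :=
  letI := conjAlgebra B
  (FreeAlgebra.lift ℂ g).toRingHom

theorem conjLift_ι {X B : Type*} [Ring B] [Algebra ℂ B] (g : X → B) (x : X) :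
    conjLift g (FreeAlgebra.ι ℂ x) = g x := by
  let := conjAlgebra B
  exact FreeAlgebra.lift_ι_apply g x

theorem conjLift_algebraMap {X B : Type*} [Ring B] [Algebra ℂ B] (g : X → B) (c : ℂ) :
    conjLift g (algebraMap ℂ (FreeAlgebra ℂ X) c) = algebraMap ℂ B (conj c) := by
  let := conjAlgebra B
  exact (FreeAlgebra.lift ℂ g).commutes c

theorem conjLift_smul {X B : Type*} [Ring B] [Algebra ℂ B] (g : X → B) (c : ℂ)
    (x : FreeAlgebra ℂ X) : conjLift g (c • x) = conj c • conjLift g x := by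
  rw [Algebra.smul_def, map_mul, conjLift_algebraMap, Algebra.smul_def]

/-! ### The coordinate algebra of the quantum 4-sphere -/

/-- Symbols `x₀, x₁, x₂` and `x₀*, x₁*, x₂*`. -/
inductive SphereGen
  | x (i : Fin 3)
  | xs (i : Fin 3)

namespace SphereGen

/-- The symbol `xᵢ` in the free algebra. -/
abbrev X (i : Fin 3) : FreeAlgebra ℂ SphereGen := FreeAlgebra.ι ℂ (x i)

/-- The symbol `xᵢ*` in the free algebra. -/
abbrev Xs (i : Fin 3) : FreeAlgebra ℂ SphereGen := FreeAlgebra.ι ℂ (xs i)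

/-- The formal adjoint of a symbol. -/
def adj : SphereGen → SphereGen
  | x i => xs i
  | xs i => x i

end SphereGen

open SphereGen in
/-- The defining relations of the quantum 4-sphere, together with their adjoints. -/
inductive SphereRel (q : ℝ) : FreeAlgebra ℂ SphereGen → FreeAlgebra ℂ SphereGen → Prop
  | selfadjoint : SphereRel q (Xs 0) (X 0)
  | comm (i j : Fin 3) (h : i < j) : SphereRel q (X i * X j) ((q ^ 2 : ℂ) • (X j * X i))
  | comm_adj (i j : Fin 3) (h : i < j) : SphereRel q (Xs j * Xs i) ((q ^ 2 : ℂ) • (Xs i * Xs j))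
  | mixed (i j : Fin 3) (h : i ≠ j) : SphereRel q (Xs i * X j) ((q ^ 2 : ℂ) • (X j * Xs i))
  | radial₁ : SphereRel q (Xs 1 * X 1 - X 1 * Xs 1) ((1 - q ^ 4 : ℂ) • (X 0 * X 0))
  | radial₂ : SphereRel q (Xs 2 * X 2 - X 2 * Xs 2) (Xs 1 * X 1 - (q ^ 4 : ℂ) • (X 1 * Xs 1))
  | sphere : SphereRel q (X 0 * X 0 + X 1 * Xs 1 + X 2 * Xs 2) 1

/-- The complex algebra `𝒜(S⁴_q)`. -/
def Sphere (q : ℝ) : Type := RingQuot (SphereRel q)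

namespace Sphere

instance (q : ℝ) : Ring (Sphere q) := inferInstanceAs (Ring (RingQuot (SphereRel q)))

instance (q : ℝ) : Algebra ℂ (Sphere q) := inferInstanceAs (Algebra ℂ (RingQuot (SphereRel q)))

/-- The quotient map from noncommutative polynomials to `𝒜(S⁴_q)`. -/
def mk (q : ℝ) : FreeAlgebra ℂ SphereGen →ₐ[ℂ] Sphere q := RingQuot.mkAlgHom ℂ (SphereRel q)

theorem mk_surjective (q : ℝ) : Function.Surjective (mk q) :=
  RingQuot.mkAlgHom_surjective ℂ (SphereRel q)

theorem mk_rel (q : ℝ) {a b : FreeAlgebra ℂ SphereGen} (h : SphereRel q a b) : mk q a = mk q b :=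
  RingQuot.mkAlgHom_rel ℂ h

/-- The generator `xᵢ` of `𝒜(S⁴_q)`. -/
def x (q : ℝ) (i : Fin 3) : Sphere q := mk q (SphereGen.X i)

/-- The adjoint generator `xᵢ*` of `𝒜(S⁴_q)`. -/
def xs (q : ℝ) (i : Fin 3) : Sphere q := mk q (SphereGen.Xs i)

/-- The involution on noncommutative polynomials, with values in the quotient. -/
def preStar (q : ℝ) : FreeAlgebra ℂ SphereGen →+* (Sphere q)ᵐᵒᵖ :=
  conjLift fun g => MulOpposite.op (mk q (FreeAlgebra.ι ℂ g.adj))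

theorem preStar_rel (q : ℝ) ⦃a b : FreeAlgebra ℂ SphereGen⦄ (h : SphereRel q a b) :
    preStar q a = preStar q b := by
  apply MulOpposite.unop_injective
  have hr := fun {a b} (h : SphereRel q a b) => mk_rel q h
  cases h with
  | selfadjoint =>
    simpa [preStar, conjLift_ι, SphereGen.adj] using (hr .selfadjoint).symm
  | comm i j h =>
    simpa [preStar, conjLift_ι, conjLift_smul, SphereGen.adj] using hr (.comm_adj i j h)
  | comm_adj i j h =>
    simpa [preStar, conjLift_ι, conjLift_smul, SphereGen.adj] using hr (.comm i j h)
  | mixed i j h =>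
    simpa [preStar, conjLift_ι, conjLift_smul, SphereGen.adj] using hr (.mixed j i h.symm)
  | radial₁ =>
    simpa [preStar, conjLift_ι, conjLift_smul, SphereGen.adj, (hr .selfadjoint)] using hr .radial₁
  | radial₂ =>
    simpa [preStar, conjLift_ι, conjLift_smul, SphereGen.adj] using hr .radial₂
  | sphere =>
    simpa [preStar, conjLift_ι, conjLift_smul, SphereGen.adj, (hr .selfadjoint)] using hr .sphere

/-- The involution of `𝒜(S⁴_q)` as a ring homomorphism to the opposite algebra. -/
def starHom (q : ℝ) : Sphere q →+* (Sphere q)ᵐᵒᵖ :=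
  RingQuot.lift ⟨preStar q, preStar_rel q⟩

theorem starHom_mk (q : ℝ) (a : FreeAlgebra ℂ SphereGen) : starHom q (mk q a) = preStar q a := by
  have := RingQuot.lift_mkRingHom_apply (preStar q) (preStar_rel q) a
  rwa [← RingQuot.mkAlgHom_coe ℂ] at this

theorem starHom_smul (q : ℝ) (c : ℂ) (a : Sphere q) :
    (starHom q (c • a)).unop = conj c • (starHom q a).unop := by
  obtain ⟨a, rfl⟩ := mk_surjective q a
  rw [← map_smul, starHom_mk, starHom_mk, preStar, conjLift_smul, MulOpposite.unop_smul]

theorem starHom_starHom (q : ℝ) (a : Sphere q) :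
    (starHom q (starHom q a).unop).unop = a := by
  obtain ⟨a, rfl⟩ := mk_surjective q a
  induction a using FreeAlgebra.induction with
  | grade0 c =>
    rw [AlgHom.commutes, Algebra.algebraMap_eq_smul_one, starHom_smul, map_one, MulOpposite.unop_one,
      starHom_smul, map_one, MulOpposite.unop_one, Complex.conj_conj]
  | grade1 g =>
    rw [starHom_mk, preStar, conjLift_ι, MulOpposite.unop_op, starHom_mk, preStar, conjLift_ι]
    cases g <;> rfl
  | mul a b ha hb => rw [map_mul, map_mul, MulOpposite.unop_mul, map_mul, MulOpposite.unop_mul, ha, hb]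
  | add a b ha hb => rw [map_add, map_add, MulOpposite.unop_add, map_add, MulOpposite.unop_add, ha, hb]

instance (q : ℝ) : StarRing (Sphere q) where
  star a := (starHom q a).unop
  star_involutive := starHom_starHom q
  star_mul a b := by rw [map_mul, MulOpposite.unop_mul]
  star_add a b := by rw [map_add, MulOpposite.unop_add]

instance (q : ℝ) : StarModule ℂ (Sphere q) where
  star_smul c a := starHom_smul q c a

theorem star_x (q : ℝ) (i : Fin 3) : star (x q i) = xs q i := by
  change (starHom q (mk q _)).unop = _
  rw [starHom_mk, preStar, conjLift_ι]
  rfl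

end Sphere

/-! ### The symmetry Hopf algebra `U_q(so(5))` -/

/-- Symbols `K₁, K₂`, their inverses, `E₁, E₂` and `F₁, F₂`; the index `i : Fin 2` stands
for `i + 1`. -/
inductive UqGen
  | K (i : Fin 2)
  | Kinv (i : Fin 2)
  | E (i : Fin 2)
  | F (i : Fin 2)

namespace UqGen

/-- The symbol `Kᵢ` in the free algebra. -/
abbrev k (i : Fin 2) : FreeAlgebra ℂ UqGen := FreeAlgebra.ι ℂ (K i)

/-- The symbol `Kᵢ⁻¹` in the free algebra. -/
abbrev k' (i : Fin 2) : FreeAlgebra ℂ UqGen := FreeAlgebra.ι ℂ (Kinv i)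

/-- The symbol `Eᵢ` in the free algebra. -/
abbrev e (i : Fin 2) : FreeAlgebra ℂ UqGen := FreeAlgebra.ι ℂ (E i)

/-- The symbol `Fᵢ` in the free algebra. -/
abbrev f (i : Fin 2) : FreeAlgebra ℂ UqGen := FreeAlgebra.ι ℂ (F i)

/-- The formal adjoint of a symbol: `Kᵢ* = Kᵢ` and `Eᵢ* = Fᵢ`. -/
def adj : UqGen → UqGen
  | K i => K i
  | Kinv i => Kinv i
  | E i => F i
  | F i => E i

end UqGen

/-- The number `qⁱ` attached to the index `i ∈ {1, 2}`. -/
def qi (q : ℝ) (i : Fin 2) : ℂ := (q : ℂ) ^ ((i : ℕ) + 1)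

/-- The two sides `E₁E₂² + E₂²E₁` and `(q² + q⁻²) E₂E₁E₂` of the first Serre relation. -/
def serre₁ (q : ℝ) {B : Type*} [Ring B] [Algebra ℂ B] (a b : B) : B × B :=
  (a * b * b + b * b * a, ((q : ℂ) ^ 2 + ((q : ℂ) ^ 2)⁻¹) • (b * a * b))

/-- The two sides `E₁³E₂ - E₂E₁³` and `(q² + 1 + q⁻²)(E₁²E₂E₁ - E₁E₂E₁²)` of the second
Serre relation. -/
def serre₂ (q : ℝ) {B : Type*} [Ring B] [Algebra ℂ B] (a b : B) : B × B :=
  (a * a * a * b - b * a * a * a,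
    ((q : ℂ) ^ 2 + 1 + ((q : ℂ) ^ 2)⁻¹) • (a * a * b * a - a * b * a * a))

open UqGen in
/-- The defining relations of `U_q(so(5))`, together with their adjoints. -/
inductive UqRel (q : ℝ) : FreeAlgebra ℂ UqGen → FreeAlgebra ℂ UqGen → Prop
  | K_comm : UqRel q (k 0 * k 1) (k 1 * k 0)
  | K_mul_inv (i : Fin 2) : UqRel q (k i * k' i) 1
  | K_inv_mul (i : Fin 2) : UqRel q (k' i * k i) 1
  | EF (i : Fin 2) : UqRel q (e i * f i - f i * e i)
      ((qi q i - (qi q i)⁻¹)⁻¹ • (k i * k i - k' i * k' i))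
  | EF_comm (i j : Fin 2) (h : i ≠ j) : UqRel q (e i * f j) (f j * e i)
  | KE (i : Fin 2) : UqRel q (k i * e i * k' i) (qi q i • e i)
  | KE' (i j : Fin 2) (h : i ≠ j) : UqRel q (k i * e j * k' i) ((q : ℂ)⁻¹ • e j)
  | KF (i : Fin 2) : UqRel q (k' i * f i * k i) (qi q i • f i)
  | KF' (i j : Fin 2) (h : i ≠ j) : UqRel q (k' i * f j * k i) ((q : ℂ)⁻¹ • f j)
  | serre_E₁ : UqRel q (serre₁ q (e 0) (e 1)).1 (serre₁ q (e 0) (e 1)).2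
  | serre_E₂ : UqRel q (serre₂ q (e 0) (e 1)).1 (serre₂ q (e 0) (e 1)).2
  | serre_F₁ : UqRel q (serre₁ q (f 0) (f 1)).1 (serre₁ q (f 0) (f 1)).2
  | serre_F₂ : UqRel q (serre₂ q (f 0) (f 1)).1 (serre₂ q (f 0) (f 1)).2

/-- The complex algebra `U_q(so(5))`. -/
def Uq (q : ℝ) : Type := RingQuot (UqRel q)

namespace Uq

instance (q : ℝ) : Ring (Uq q) := inferInstanceAs (Ring (RingQuot (UqRel q)))

instance (q : ℝ) : Algebra ℂ (Uq q) := inferInstanceAs (Algebra ℂ (RingQuot (UqRel q)))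

/-- The quotient map from noncommutative polynomials to `U_q(so(5))`. -/
def mk (q : ℝ) : FreeAlgebra ℂ UqGen →ₐ[ℂ] Uq q := RingQuot.mkAlgHom ℂ (UqRel q)

theorem mk_surjective (q : ℝ) : Function.Surjective (mk q) :=
  RingQuot.mkAlgHom_surjective ℂ (UqRel q)

theorem mk_rel (q : ℝ) {a b : FreeAlgebra ℂ UqGen} (h : UqRel q a b) : mk q a = mk q b :=
  RingQuot.mkAlgHom_rel ℂ h

/-- The generators `K₁, K₂`. -/
def K (q : ℝ) (i : Fin 2) : Uq q := mk q (UqGen.k i)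

/-- The inverses `K₁⁻¹, K₂⁻¹`. -/
def Kinv (q : ℝ) (i : Fin 2) : Uq q := mk q (UqGen.k' i)

/-- The generators `E₁, E₂`. -/
def E (q : ℝ) (i : Fin 2) : Uq q := mk q (UqGen.e i)

/-- The generators `F₁, F₂`. -/
def F (q : ℝ) (i : Fin 2) : Uq q := mk q (UqGen.f i)

/-- The involution on noncommutative polynomials, with values in the quotient. -/
def preStar (q : ℝ) : FreeAlgebra ℂ UqGen →+* (Uq q)ᵐᵒᵖ :=
  conjLift fun g => MulOpposite.op (mk q (FreeAlgebra.ι ℂ g.adj))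

theorem conj_qi (q : ℝ) (i : Fin 2) : conj (qi q i) = qi q i := by simp [qi]

theorem preStar_rel (q : ℝ) ⦃a b : FreeAlgebra ℂ UqGen⦄ (h : UqRel q a b) :
    preStar q a = preStar q b := by
  apply MulOpposite.unop_injective
  have hr := fun {a b} (h : UqRel q a b) => mk_rel q h
  cases h with
  | K_comm => simpa [preStar, conjLift_ι, UqGen.adj] using (hr .K_comm).symm
  | K_mul_inv i => simpa [preStar, conjLift_ι, UqGen.adj] using hr (.K_inv_mul i)
  | K_inv_mul i => simpa [preStar, conjLift_ι, UqGen.adj] using hr (.K_mul_inv i)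
  | EF i =>
    simpa [preStar, conjLift_ι, conjLift_smul, UqGen.adj, conj_qi] using hr (.EF i)
  | EF_comm i j h =>
    simpa [preStar, conjLift_ι, conjLift_smul, UqGen.adj] using hr (.EF_comm j i h.symm)
  | KE i =>
    simpa [preStar, conjLift_ι, conjLift_smul, UqGen.adj, conj_qi, mul_assoc] using hr (.KF i)
  | KE' i j h =>
    simpa [preStar, conjLift_ι, conjLift_smul, UqGen.adj, mul_assoc] using hr (.KF' i j h)
  | KF i =>
    simpa [preStar, conjLift_ι, conjLift_smul, UqGen.adj, conj_qi, mul_assoc] using hr (.KE i)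
  | KF' i j h =>
    simpa [preStar, conjLift_ι, conjLift_smul, UqGen.adj, mul_assoc] using hr (.KE' i j h)
  | serre_E₁ =>
    simpa [preStar, conjLift_ι, conjLift_smul, UqGen.adj, serre₁, mul_assoc, add_comm]
      using hr .serre_F₁
  | serre_E₂ =>
    have h := congrArg Neg.neg (hr .serre_F₂)
    simp only [serre₂, map_sub, map_mul, map_smul, neg_sub, ← smul_neg] at h
    simpa [preStar, conjLift_ι, conjLift_smul, UqGen.adj, serre₂, mul_assoc] using h
  | serre_F₁ =>
    simpa [preStar, conjLift_ι, conjLift_smul, UqGen.adj, serre₁, mul_assoc, add_comm]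
      using hr .serre_E₁
  | serre_F₂ =>
    have h := congrArg Neg.neg (hr .serre_E₂)
    simp only [serre₂, map_sub, map_mul, map_smul, neg_sub, ← smul_neg] at h
    simpa [preStar, conjLift_ι, conjLift_smul, UqGen.adj, serre₂, mul_assoc] using h

/-- The involution of `U_q(so(5))` as a ring homomorphism to the opposite algebra. -/
def starHom (q : ℝ) : Uq q →+* (Uq q)ᵐᵒᵖ :=
  RingQuot.lift ⟨preStar q, preStar_rel q⟩

theorem starHom_mk (q : ℝ) (a : FreeAlgebra ℂ UqGen) : starHom q (mk q a) = preStar q a := by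
  have := RingQuot.lift_mkRingHom_apply (preStar q) (preStar_rel q) a
  rwa [← RingQuot.mkAlgHom_coe ℂ] at this

theorem starHom_smul (q : ℝ) (c : ℂ) (a : Uq q) :
    (starHom q (c • a)).unop = conj c • (starHom q a).unop := by
  obtain ⟨a, rfl⟩ := mk_surjective q a
  rw [← map_smul, starHom_mk, starHom_mk, preStar, conjLift_smul, MulOpposite.unop_smul]

theorem starHom_starHom (q : ℝ) (a : Uq q) : (starHom q (starHom q a).unop).unop = a := by
  obtain ⟨a, rfl⟩ := mk_surjective q a
  induction a using FreeAlgebra.induction with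
  | grade0 c =>
    rw [AlgHom.commutes, Algebra.algebraMap_eq_smul_one, starHom_smul, map_one, MulOpposite.unop_one,
      starHom_smul, map_one, MulOpposite.unop_one, Complex.conj_conj]
  | grade1 g =>
    rw [starHom_mk, preStar, conjLift_ι, MulOpposite.unop_op, starHom_mk, preStar, conjLift_ι]
    cases g <;> rfl
  | mul a b ha hb => rw [map_mul, map_mul, MulOpposite.unop_mul, map_mul, MulOpposite.unop_mul, ha, hb]
  | add a b ha hb => rw [map_add, map_add, MulOpposite.unop_add, map_add, MulOpposite.unop_add, ha, hb]

instance (q : ℝ) : StarRing (Uq q) where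
  star a := (starHom q a).unop
  star_involutive := starHom_starHom q
  star_mul a b := by rw [map_mul, MulOpposite.unop_mul]
  star_add a b := by rw [map_add, MulOpposite.unop_add]

instance (q : ℝ) : StarModule ℂ (Uq q) where
  star_smul c a := starHom_smul q c a

theorem star_mk_ι (q : ℝ) (g : UqGen) :
    star (mk q (FreeAlgebra.ι ℂ g)) = mk q (FreeAlgebra.ι ℂ g.adj) := by
  change (starHom q (mk q _)).unop = _
  rw [starHom_mk, preStar, conjLift_ι]
  rfl

/-- The values of the antipode on the generators: `S(Kᵢ) = Kᵢ⁻¹`, `S(Eᵢ) = -qⁱ Eᵢ`,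
`S(Fᵢ) = -q⁻ⁱ Fᵢ`. -/
def antipodeGen (q : ℝ) : UqGen → Uq q
  | .K i => Kinv q i
  | .Kinv i => K q i
  | .E i => -(qi q i • E q i)
  | .F i => -((qi q i)⁻¹ • F q i)

/-- The antipode on noncommutative polynomials, with values in the quotient. -/
def preAntipode (q : ℝ) : FreeAlgebra ℂ UqGen →ₐ[ℂ] (Uq q)ᵐᵒᵖ :=
  FreeAlgebra.lift ℂ fun g => MulOpposite.op (antipodeGen q g)

theorem K_mul_Kinv (q : ℝ) (i : Fin 2) : K q i * Kinv q i = 1 := by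
  simpa [K, Kinv] using mk_rel q (UqRel.K_mul_inv  i)

theorem Kinv_mul_K (q : ℝ) (i : Fin 2) : Kinv q i * K q i = 1 := by
  simpa [K, Kinv] using mk_rel q (UqRel.K_inv_mul  i)

theorem Kinv_comm (q : ℝ) : Kinv q 0 * Kinv q 1 = Kinv q 1 * Kinv q 0 := by
  have h : K q 0 * K q 1 = K q 1 * K q 0 := by
    simpa [K] using mk_rel q (UqRel.K_comm )
  have h1 : (Kinv q 0 * Kinv q 1) * (K q 1 * K q 0) = 1 := by
    rw [mul_assoc, ← mul_assoc (Kinv q 1), Kinv_mul_K, one_mul, Kinv_mul_K]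
  have h2 : (K q 1 * K q 0) * (Kinv q 1 * Kinv q 0) = 1 := by
    rw [← h, mul_assoc, ← mul_assoc (K q 1), K_mul_Kinv, one_mul, K_mul_Kinv]
  exact left_inv_eq_right_inv h1 h2

theorem qi_EF (q : ℝ) (i : Fin 2) :
    (qi q i * (qi q i)⁻¹) • (F q i * E q i - E q i * F q i) =
      (qi q i - (qi q i)⁻¹)⁻¹ • (Kinv q i * Kinv q i - K q i * K q i) := by
  have h : E q i * F q i - F q i * E q i =
      (qi q i - (qi q i)⁻¹)⁻¹ • (K q i * K q i - Kinv q i * Kinv q i) := by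
    simpa [K, Kinv, E, F] using mk_rel q (UqRel.EF  i)
  by_cases h0 : qi q i = 0
  · simp [h0]
  · rw [mul_inv_cancel₀ h0, one_smul, ← neg_sub, h, ← smul_neg, neg_sub]

theorem op_serre₁ (q : ℝ) {A B : Type*} [Ring A] [Algebra ℂ A] [Ring B] [Algebra ℂ B]
    (φ : A →ₐ[ℂ] Bᵐᵒᵖ) {x y : A} {a b : B} {c d : ℂ}
    (hx : φ x = MulOpposite.op (c • a)) (hy : φ y = MulOpposite.op (d • b))
    (h : (serre₁ q a b).1 = (serre₁ q a b).2) :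
    (φ (serre₁ q x y).1).unop = (φ (serre₁ q x y).2).unop := by
  have h := congrArg (fun z => (c * d * d) • z) h
  simp only [serre₁, map_add, map_mul, map_smul, hx, hy, MulOpposite.unop_add,
    MulOpposite.unop_mul, MulOpposite.unop_smul, MulOpposite.unop_op, smul_mul_assoc,
    mul_smul_comm, smul_smul, smul_add, mul_assoc] at h ⊢
  linear_combination (norm := module) h

theorem op_serre₂ (q : ℝ) {A B : Type*} [Ring A] [Algebra ℂ A] [Ring B] [Algebra ℂ B]
    (φ : A →ₐ[ℂ] Bᵐᵒᵖ) {x y : A} {a b : B} {c d : ℂ}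
    (hx : φ x = MulOpposite.op (c • a)) (hy : φ y = MulOpposite.op (d • b))
    (h : (serre₂ q a b).1 = (serre₂ q a b).2) :
    (φ (serre₂ q x y).1).unop = (φ (serre₂ q x y).2).unop := by
  have h := congrArg (fun z => -((c * c * c * d) • z)) h
  simp only [serre₂, map_sub, map_mul, map_smul, hx, hy, MulOpposite.unop_sub,
    MulOpposite.unop_mul, MulOpposite.unop_smul, MulOpposite.unop_op, smul_mul_assoc,
    mul_smul_comm, smul_smul, smul_sub, mul_assoc, neg_sub] at h ⊢
  linear_combination (norm := module) h

theorem preAntipode_rel (q : ℝ) ⦃a b : FreeAlgebra ℂ UqGen⦄ (h : UqRel q a b) :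
    preAntipode q a = preAntipode q b := by
  apply MulOpposite.unop_injective
  have hr := fun {a b} (h : UqRel q a b) => mk_rel q h
  cases h with
  | K_comm => simpa [preAntipode, antipodeGen] using (Kinv_comm q).symm
  | K_mul_inv i => simpa [preAntipode, antipodeGen] using K_mul_Kinv q i
  | K_inv_mul i => simpa [preAntipode, antipodeGen] using Kinv_mul_K q i
  | EF i => simpa [preAntipode, antipodeGen, smul_sub, smul_smul, mul_comm] using qi_EF q i
  | EF_comm i j h =>
    have h := hr (.EF_comm i j h)
    simp only [map_mul] at h
    simp [preAntipode, antipodeGen, E, F, h, smul_smul, mul_comm]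
  | KE i =>
    have h := hr (.KE i)
    simp only [map_mul, map_smul] at h
    simp [preAntipode, antipodeGen, E, K, Kinv, ← mul_assoc, h, smul_smul]
  | KE' i j hij =>
    have h := hr (.KE' i j hij)
    simp only [map_mul, map_smul] at h
    simp [preAntipode, antipodeGen, E, K, Kinv, ← mul_assoc, h, smul_smul, mul_comm]
  | KF i =>
    have h := hr (.KF i)
    simp only [map_mul, map_smul] at h
    simp [preAntipode, antipodeGen, F, K, Kinv, ← mul_assoc, h, smul_smul, mul_comm]
  | KF' i j hij =>
    have h := hr (.KF' i j hij)
    simp only [map_mul, map_smul] at h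
    simp [preAntipode, antipodeGen, F, K, Kinv, ← mul_assoc, h, smul_smul, mul_comm]
  | serre_E₁ =>
    exact op_serre₁ q (preAntipode q) (a := E q 0) (b := E q 1) (c := -qi q 0) (d := -qi q 1)
      (by simp [preAntipode, antipodeGen, E]) (by simp [preAntipode, antipodeGen, E])
      (by simpa [serre₁, E] using hr .serre_E₁)
  | serre_E₂ =>
    exact op_serre₂ q (preAntipode q) (a := E q 0) (b := E q 1) (c := -qi q 0) (d := -qi q 1)
      (by simp [preAntipode, antipodeGen, E]) (by simp [preAntipode, antipodeGen, E])
      (by simpa [serre₂, E] using hr .serre_E₂)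
  | serre_F₁ =>
    exact op_serre₁ q (preAntipode q) (a := F q 0) (b := F q 1) (c := -(qi q 0)⁻¹) (d := -(qi q 1)⁻¹)
      (by simp [preAntipode, antipodeGen, F]) (by simp [preAntipode, antipodeGen, F])
      (by simpa [serre₁, F] using hr .serre_F₁)
  | serre_F₂ =>
    exact op_serre₂ q (preAntipode q) (a := F q 0) (b := F q 1) (c := -(qi q 0)⁻¹) (d := -(qi q 1)⁻¹)
      (by simp [preAntipode, antipodeGen, F]) (by simp [preAntipode, antipodeGen, F])
      (by simpa [serre₂, F] using hr .serre_F₂)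

/-- The antipode of `U_q(so(5))` as an algebra homomorphism to the opposite algebra. -/
def antipodeHom (q : ℝ) : Uq q →ₐ[ℂ] (Uq q)ᵐᵒᵖ :=
  RingQuot.liftAlgHom ℂ ⟨preAntipode q, preAntipode_rel q⟩

/-- The antipode `S` of `U_q(so(5))`. -/
def antipode (q : ℝ) (h : Uq q) : Uq q := (antipodeHom q h).unop

theorem antipode_mk_ι (q : ℝ) (g : UqGen) :
    antipode q (mk q (FreeAlgebra.ι ℂ g)) = antipodeGen q g := by
  have h : antipodeHom q (mk q (FreeAlgebra.ι ℂ g)) = preAntipode q (FreeAlgebra.ι ℂ g) :=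
    RingQuot.liftAlgHom_mkAlgHom_apply ℂ (preAntipode q) (preAntipode_rel q) _
  rw [antipode, h, preAntipode, FreeAlgebra.lift_ι_apply, MulOpposite.unop_op]

end Uq

/-! ### The Hilbert space of spinors -/

/-- The labels `(l, m₁, m₂; j)` of the basis vectors of `ℋ₊` and of `ℋ₋`. -/
def Admissible (l m₁ m₂ j : ℝ) : Prop :=
  (∃ n : ℕ, l = n + 1 / 2) ∧ (∃ n : ℕ, j = n + 1 / 2) ∧ j ≤ l ∧
    (∃ n : ℕ, j - |m₁| = n) ∧ ∃ n : ℕ, l + 1 / 2 - j - |m₂| = n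

theorem Admissible.neg {l m₁ m₂ j : ℝ} (h : Admissible l m₁ m₂ j) :
    Admissible l (-m₁) (-m₂) j := by
  simpa only [Admissible, abs_neg] using h

/-- A label together with the sign `s = ±1` that tells `ℋ₊` from `ℋ₋`. -/
@[ext]
structure Label where
  s : ℤˣ
  l : ℝ
  m₁ : ℝ
  m₂ : ℝ
  j : ℝ
  adm : Admissible l m₁ m₂ j

namespace Label

/-- Exchange of the two signs. -/
def flip : Equiv.Perm Label :=
  Function.Involutive.toPerm (fun i => ⟨-i.s, i.l, i.m₁, i.m₂, i.j, i.adm⟩)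
    fun i => by ext <;> simp

/-- The map `(l, m₁, m₂; j) ↦ (l, -m₁, -m₂; j)`. -/
def neg : Equiv.Perm Label :=
  Function.Involutive.toPerm (fun i => ⟨i.s, i.l, -i.m₁, -i.m₂, i.j, i.adm.neg⟩)
    fun i => by ext <;> simp

end Label

/-- The Hilbert space `ℋ = ℋ₊ ⊕ ℋ₋`. -/
abbrev H : Type := lp (fun _ : Label => ℂ) 2

open Classical in
/-- The vector `|l, m₁, m₂; j⟩` of `ℋ₊` or `ℋ₋`; it is zero if the label is not admissible. -/
def ket (s : ℤˣ) (l m₁ m₂ j : ℝ) : H :=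
  if h : Admissible l m₁ m₂ j then lp.single 2 ⟨s, l, m₁, m₂, j, h⟩ 1 else 0

/-- The linear span of the basis vectors. -/
def M : Submodule ℂ H := Submodule.span ℂ {v | ∃ s l m₁ m₂ j, ket s l m₁ m₂ j = v}

/-- The basis vectors as elements of their linear span. -/
def mket (s : ℤˣ) (l m₁ m₂ j : ℝ) : M :=
  ⟨ket s l m₁ m₂ j, Submodule.subset_span ⟨s, l, m₁, m₂, j, rfl⟩⟩

theorem memℓp_perm {f : Label → ℂ} (hf : Memℓp f 2) (c : Label → ℂ) (hc : ∀ i, ‖c i‖ = 1)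
    (e : Equiv.Perm Label) : Memℓp (fun i => c i * f (e i)) 2 := by
  have h2 : 0 < (2 : ℝ≥0∞).toReal := by norm_num
  rw [memℓp_gen_iff h2] at hf ⊢
  simp only [norm_mul, hc, one_mul]
  exact (e.summable_iff (f := fun i => ‖f i‖ ^ (2 : ℝ≥0∞).toReal)).2 hf

/-- The operator sending the basis vector with label `i` to `c i` times the basis vector with
label `e i`, where the numbers `c i` have modulus one. -/
def phasePerm (c : Label → ℂ) (hc : ∀ i, ‖c i‖ = 1) (e : Equiv.Perm Label) : H ≃ₗᵢ[ℂ] H where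
  toFun f := ⟨fun i => c (e.symm i) * f (e.symm i),
    memℓp_perm (lp.memℓp f) (fun i => c (e.symm i)) (fun _ => hc _) e.symm⟩
  invFun f := ⟨fun i => conj (c i) * f (e i),
    memℓp_perm (lp.memℓp f) (fun i => conj (c i)) (fun i => by simp [hc]) e⟩
  left_inv f := by
    ext i
    simp [← mul_assoc, Complex.conj_mul', hc]
  right_inv f := by
    ext i
    simp [← mul_assoc, Complex.mul_conj', hc]
  map_add' f g := by
    ext i
    exact mul_add _ _ _
  map_smul' a f := by
    ext i
    simp [mul_left_comm]
  norm_map' f := by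
    have h2 : 0 < (2 : ℝ≥0∞).toReal := by norm_num
    rw [lp.norm_eq_tsum_rpow h2, lp.norm_eq_tsum_rpow h2]
    congr 1
    rw [← e.tsum_eq]
    simp [hc]

theorem phasePerm_apply (c : Label → ℂ) (hc : ∀ i, ‖c i‖ = 1) (e : Equiv.Perm Label) (f : H)
    (i : Label) : phasePerm c hc e f i = c (e.symm i) * f (e.symm i) := rfl

theorem ket_apply {s : ℤˣ} {l m₁ m₂ j : ℝ} (h : Admissible l m₁ m₂ j) [DecidableEq Label]
    (i : Label) : ket s l m₁ m₂ j i = if i = ⟨s, l, m₁, m₂, j, h⟩ then 1 else 0 := by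
  rw [ket, dif_pos h]
  simp only [lp.coeFn_single, Pi.single_apply]
  congr

/-- The grading: `±1` on `ℋ±`. -/
def γ : H ≃ₗᵢ[ℂ] H :=
  phasePerm (fun i => ((i.s : ℤ) : ℂ))
    (fun i => by rcases Int.units_eq_one_or i.s with h | h <;> simp [h]) (Equiv.refl _)

theorem γ_ket (s : ℤˣ) (l m₁ m₂ j : ℝ) :
    γ (ket s l m₁ m₂ j) = ((s : ℤ) : ℂ) • ket s l m₁ m₂ j := by
  classical
  by_cases h : Admissible l m₁ m₂ j
  · ext i
    rw [γ, phasePerm_apply, lp.coeFn_smul, Pi.smul_apply, Equiv.refl_symm, Equiv.refl_apply,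
      ket_apply h]
    by_cases hi : i = ⟨s, l, m₁, m₂, j, h⟩ <;> simp [hi]
  · simp [ket, h]

/-- The phase `i^{2l+1} (-1)^{j+m₁}`; both exponents are integers. -/
def phase (l m₁ j : ℝ) : ℂ :=
  Complex.I ^ ((2 * l + 1 : ℝ) : ℂ) * (-1 : ℂ) ^ ((j + m₁ : ℝ) : ℂ)

theorem norm_phase (l m₁ j : ℝ) : ‖phase l m₁ j‖ = 1 := by
  rw [phase, norm_mul, Complex.norm_cpow_of_ne_zero Complex.I_ne_zero,
    Complex.norm_cpow_of_ne_zero (by norm_num)]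
  simp only [Complex.ofReal_re, Complex.ofReal_im]
  simp

/-- The antilinear isometry `J`. -/
def J : H ≃ₗᵢ⋆[ℂ] H :=
  (starₗᵢ ℂ : H ≃ₗᵢ⋆[ℂ] H).trans
    (phasePerm (fun i => phase i.l i.m₁ i.j) (fun _ => norm_phase _ _ _) Label.neg)

theorem J_ket (s : ℤˣ) (l m₁ m₂ j : ℝ) :
    J (ket s l m₁ m₂ j) = phase l m₁ j • ket s l (-m₁) (-m₂) j := by
  classical
  by_cases h : Admissible l m₁ m₂ j
  · ext i
    rw [lp.coeFn_smul, Pi.smul_apply, ket_apply h.neg]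
    change phase _ _ _ * star (ket s l m₁ m₂ j (Label.neg.symm i)) = _
    rw [ket_apply h]
    have e : Label.neg.symm i = ⟨s, l, m₁, m₂, j, h⟩ ↔ i = ⟨s, l, -m₁, -m₂, j, h.neg⟩ := by
      rw [Equiv.symm_apply_eq]
      rfl
    by_cases hi : i = ⟨s, l, -m₁, -m₂, j, h.neg⟩
    · rw [if_pos hi, if_pos (e.2 hi), e.2 hi]
      simp
    · rw [if_neg hi, if_neg (mt e.1 hi)]
      simp
  · have h' : ¬Admissible l (-m₁) (-m₂) j := fun h' => h (by simpa using h'.neg)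
    simp [ket, h, h']

/-! ### Unbounded operators -/

/-- The closed operator, with its maximal domain, sending the basis vector with label `i` to
`w i` times the basis vector with label `e i`. -/
def weightedPerm (w : Label → ℝ) (e : Equiv.Perm Label) : H →ₗ.[ℂ] H where
  domain :=
    { carrier := {f | Memℓp (fun i => (w (e.symm i) : ℂ) * f (e.symm i)) 2}
      zero_mem' := by
        have h : Memℓp (0 : Label → ℂ) 2 := zero_memℓp
        simpa [Pi.zero_def] using h
      add_mem' := fun {f g} hf hg => by
        have h := Memℓp.add hf hg
        simpa [mul_add, Pi.add_def] using h
      smul_mem' := fun a f hf => by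
        have h := Memℓp.const_smul hf a
        simpa [mul_left_comm, Pi.smul_def] using h }
  toFun :=
    { toFun := fun f => ⟨fun i => (w (e.symm i) : ℂ) * (f : H) (e.symm i), f.2⟩
      map_add' := fun f g => by
        ext i
        exact mul_add _ _ _
      map_smul' := fun a f => by
        ext i
        simp [mul_left_comm] }

/-- The Dirac operator `D |l, m₁, m₂; j⟩± = (l + 3/2) |l, m₁, m₂; j⟩∓`. -/
def D : H →ₗ.[ℂ] H := weightedPerm (fun i => i.l + 3 / 2) Label.flip

/-- The operator `|D|ᵏ`. -/
def absD (k : ℕ) : H →ₗ.[ℂ] H := weightedPerm (fun i => (i.l + 3 / 2) ^ k) (Equiv.refl _)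

/-- The bounded operator `T` preserves the domain of `A`, and `[A, T] = A T - T A` extends to
the bounded operator `S`. -/
def IsCommutator (A : H →ₗ.[ℂ] H) (T S : H →L[ℂ] H) : Prop :=
  ∀ v : A.domain, ∃ h : T v ∈ A.domain, S v = A ⟨T v, h⟩ - T (A v)

/-- The bounded operator `T` is in the domain of the `n`-th power of the derivation
`δ = [|D|, ·]`. -/
def DomDelta : ℕ → (H →L[ℂ] H) → Prop
  | 0, _ => True
  | n + 1, T => ∃ S, IsCommutator (absD 1) T S ∧ DomDelta n S

/-- The class `OP⁰`. -/
def OP0 (T : H →L[ℂ] H) : Prop := ∀ n, DomDelta n T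

/-- The class `OP^{-∞}` of smoothing operators: `|D|ᵏ T ∈ OP⁰` for all `k`. -/
def Smoothing (T : H →L[ℂ] H) : Prop :=
  ∀ k : ℕ, ∃ S : H →L[ℂ] H, OP0 S ∧
    ∀ v, ∃ h : T v ∈ (absD k).domain, S v = absD k ⟨T v, h⟩

/-- The bounded linear operator `J b J`. -/
def JbJ (b : H →L[ℂ] H) : H →L[ℂ] H :=
  (J : H →L⋆[ℂ] H).comp (b.comp (J : H →L⋆[ℂ] H))

/-- The antiunitary `U` is the phase in the polar decomposition `T = U |T|` of (the closure of)
the antilinear operator `T` with domain `M`: here `P = |T|` on `M`, and `M` is a core of the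
positive selfadjoint operator `|T|`. -/
def IsAntiunitaryPart (U : H ≃ₗᵢ⋆[ℂ] H) (T : M →ₛₗ[starRingEnd ℂ] M) : Prop :=
  ∃ P : M →ₗ[ℂ] H, (∀ v : M, 0 ≤ (⟪(v : H), P v⟫_ℂ).re) ∧
    IsSelfAdjoint (LinearPMap.mk M P).closure ∧ DenseRange P ∧ ∀ v : M, (T v : H) = U (P v)

/-! ### Coefficients -/

/-- The `q`-number `[z]`. -/
def br (q z : ℝ) : ℝ := (q ^ z - q ^ (-z)) / (q - q⁻¹)

open Classical in
/-- The number `ϵ = ±1/2` for which `l + ϵ - j - m₂` is an even integer. -/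
def eps (l j m₂ : ℝ) : ℝ := if ∃ n : ℤ, l + 1 / 2 - j - m₂ = 2 * n then 1 / 2 else -(1 / 2)

/-- `A⁺_{j,m₁}` -/
def Ap (q j m : ℝ) : ℝ :=
  q ^ (m - 1) * (√(br q (j + m + 1) * br q (j - m + 1)) / br q (2 * j + 2))

/-- `A⁰_{j,m₁}` -/
def A0 (q j m : ℝ) : ℝ :=
  q ^ (-2 : ℝ) * ((q ^ (j + m + 1) * br q 2 * br q (j - m) - br q (2 * j)) /
    (br q (2 * j) * br q (2 * j + 2)))

/-- `B⁺_{j,m₁}` -/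
def Bp (q j m : ℝ) : ℝ :=
  q ^ (-j + m - 1 / 2) * (√(br q (j + m + 1) * br q (j + m + 2)) / br q (2 * j + 2))

/-- `B⁰_{j,m₁}` -/
def B0 (q j m : ℝ) : ℝ :=
  (1 + q ^ (2 : ℝ)) * q ^ (m - 1 / 2) * (√(br q (j - m) * br q (j + m + 1)) /
    (br q (2 * j) * br q (2 * j + 2)))

/-- `B⁻_{j,m₁}` -/
def Bm (q j m : ℝ) : ℝ :=
  -(q ^ (j + m + 1 / 2) * (√(br q (j - m) * br q (j - m - 1)) / br q (2 * j)))

/-- `C⁺_{l,j,m₂}` -/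
def Cp (q l j m : ℝ) : ℝ :=
  let ε := eps l j m;
  -(q ^ (m - 1 - ε) * (√(br q (l + j + m + 3 + ε) * br q (l + j - m + 3 - ε)) /
    br q (2 * l + 4)))

/-- `C⁰_{l,j,m₂}` -/
def C0 (q l j m : ℝ) : ℝ :=
  let ε := eps l j m;
  br q (4 * ε) * q ^ (2 * ε * l + m - 1 + 3 * ε) *
    (√(br q (l + 1 / 2 + j - 2 * ε * m + 2) * br q (l + 1 / 2 - j - 2 * ε * m)) /
      (br q (2 * l + 2) * br q (2 * l + 4)))

/-- `C⁻_{l,j,m₂}` -/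
def Cm (q l j m : ℝ) : ℝ :=
  let ε := eps l j m;
  -(q ^ (m - 1 + ε) * (√(br q (l - j + m - ε) * br q (l - j - m + ε)) / br q (2 * l + 2)))

/-- `H⁺_{l,j,m₂}` -/
def Hp (q l j m : ℝ) : ℝ :=
  let ε := eps l j m;
  q ^ (m - 1 + ε * (2 * j + 1)) *
    (√(br q (l + 2 * ε * j - m + 2 + ε) * br q (l - 2 * ε * j + m + 2 - ε)) / br q (2 * l + 4))

/-- `H⁰_{l,j,m₂}` -/
def H0 (q l j m : ℝ) : ℝ :=
  let ε := eps l j m;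
  (br q (l - ε * (2 * j + 1) - m + 1) * br q (l - ε * (2 * j + 1) + m + 2) -
    q ^ (-2 : ℝ) * br q (l + ε * (2 * j + 1) - m + 2) * br q (l + ε * (2 * j + 1) + m + 1)) /
      (br q (2 * l + 2) * br q (2 * l + 4))

/-- `D⁺_{l,j,m₂}` -/
def Dp (q l j m : ℝ) : ℝ :=
  let ε := eps l j m;
  q ^ (-l + m - 3 / 2) * (√(br q (l + j + m + 3 + ε) * br q (l - j + m + 2 - ε)) /
    br q (2 * l + 4))

/-- `D⁰_{l,j,m₂}` -/
def D0 (q l j m : ℝ) : ℝ :=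
  let ε := eps l j m;
  br q 2 * q ^ (m + 1 / 2) *
    (√(br q (l - 2 * ε * j - m + 1 - ε) * br q (l - 2 * ε * j + m + 2 - ε)) /
      (br q (2 * l + 2) * br q (2 * l + 4)))

/-- `D⁻_{l,j,m₂}` -/
def Dm (q l j m : ℝ) : ℝ :=
  let ε := eps l j m;
  -(q ^ (l + m + 3 / 2) * (√(br q (l - j - m + ε) * br q (l + j - m + 1 - ε)) /
    br q (2 * l + 2)))

/-- `a_l(j,m₂)` -/
def al (q l j m : ℝ) : ℝ :=
  let ε := eps l j m;
  1 / br q 2 * √(br q (l - j - m + ε) * br q (l + j + m + 3 + ε) /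
    (br q (2 * (j + |ε|) + 1) * br q (2 * (j - |ε|) + 3)))

/-- `b_l(j,m₂)` -/
def bl (q l j m : ℝ) : ℝ :=
  let ε := eps l j m;
  2 * |ε| * (√(br q (l - ε * (2 * j + 1) - m + 1) * br q (l - ε * (2 * j + 1) + m + 2)) /
    (br q (2 * j) * br q (2 * j + 2)))

/-- `c_l(j,m₂)`; since `ϵ = ±1/2`, the sign `(-1)^{2ϵ}` is `-1`. -/
def cl (q l j m : ℝ) : ℝ :=
  let ε := eps l j m;
  -1 / br q 2 * √(br q (l - j + m + 2 - ε) * br q (l + j - m + 1 - ε) /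
    (br q (2 * (j + |ε|) - 1) * br q (2 * (j - |ε|) + 1)))

/-! ### The representations of the two algebras -/

/-- `π` is the direct sum of the two chiral spinorial representations of `𝒜(S⁴_q)` on `ℋ±`. -/
structure IsSpinorRep (q : ℝ) (π : Sphere q →⋆ₐ[ℂ] (H →L[ℂ] H)) : Prop where
  x₀ (s : ℤˣ) (l m₁ m₂ j : ℝ) (h : Admissible l m₁ m₂ j) :
    π (Sphere.x q 0) (ket s l m₁ m₂ j) =
      (Ap q j m₁ * Cp q l j m₂) • ket s (l + 1) m₁ m₂ (j + 1)
      - (s * Ap q j m₁ * C0 q l j m₂) • ket s l m₁ m₂ (j + 1)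
      + (Ap q j m₁ * Cm q l j m₂) • ket s (l - 1) m₁ m₂ (j + 1)
      + (A0 q j m₁ * Hp q l j m₂) • ket s (l + 1) m₁ m₂ j
      + (s * A0 q j m₁ * H0 q l j m₂) • ket s l m₁ m₂ j
      + (A0 q j m₁ * Hp q (l - 1) j m₂) • ket s (l - 1) m₁ m₂ j
      + (Ap q (j - 1) m₁ * Cm q (l + 1) (j - 1) m₂) • ket s (l + 1) m₁ m₂ (j - 1)
      - (s * Ap q (j - 1) m₁ * C0 q l (j - 1) m₂) • ket s l m₁ m₂ (j - 1)
      + (Ap q (j - 1) m₁ * Cp q (l - 1) (j - 1) m₂) • ket s (l - 1) m₁ m₂ (j - 1)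
  x₁ (s : ℤˣ) (l m₁ m₂ j : ℝ) (h : Admissible l m₁ m₂ j) :
    π (Sphere.x q 1) (ket s l m₁ m₂ j) =
      (Bp q j m₁ * Cp q l j m₂) • ket s (l + 1) (m₁ + 1) m₂ (j + 1)
      - (s * Bp q j m₁ * C0 q l j m₂) • ket s l (m₁ + 1) m₂ (j + 1)
      + (Bp q j m₁ * Cm q l j m₂) • ket s (l - 1) (m₁ + 1) m₂ (j + 1)
      + (B0 q j m₁ * Hp q l j m₂) • ket s (l + 1) (m₁ + 1) m₂ j
      + (s * B0 q j m₁ * H0 q l j m₂) • ket s l (m₁ + 1) m₂ j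
      + (B0 q j m₁ * Hp q (l - 1) j m₂) • ket s (l - 1) (m₁ + 1) m₂ j
      + (Bm q j m₁ * Cm q (l + 1) (j - 1) m₂) • ket s (l + 1) (m₁ + 1) m₂ (j - 1)
      - (s * Bm q j m₁ * C0 q l (j - 1) m₂) • ket s l (m₁ + 1) m₂ (j - 1)
      + (Bm q j m₁ * Cp q (l - 1) (j - 1) m₂) • ket s (l - 1) (m₁ + 1) m₂ (j - 1)
  x₂ (s : ℤˣ) (l m₁ m₂ j : ℝ) (h : Admissible l m₁ m₂ j) :
    π (Sphere.x q 2) (ket s l m₁ m₂ j) =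
      (Dp q l j m₂) • ket s (l + 1) m₁ (m₂ + 1) j
      + (s * D0 q l j m₂) • ket s l m₁ (m₂ + 1) j
      + (Dm q l j m₂) • ket s (l - 1) m₁ (m₂ + 1) j

/-- `σ` is the direct sum of the `*`-representations of `U_q(so(5))` on `ℋ±` (with domain the
span `M` of the basis vectors) of half-integer highest weights `(1/2, l)`. -/
structure IsSpinorAction (q : ℝ) (σ : Uq q →ₐ[ℂ] Module.End ℂ M) : Prop where
  star_rep (h : Uq q) (v w : M) : ⟪(σ h v : H), (w : H)⟫_ℂ = ⟪(v : H), (σ (star h) w : H)⟫_ℂ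
  K₁ (s : ℤˣ) (l m₁ m₂ j : ℝ) (h : Admissible l m₁ m₂ j) :
    (σ (Uq.K q 0) (mket s l m₁ m₂ j) : H) = (q ^ m₁) • ket s l m₁ m₂ j
  K₂ (s : ℤˣ) (l m₁ m₂ j : ℝ) (h : Admissible l m₁ m₂ j) :
    (σ (Uq.K q 1) (mket s l m₁ m₂ j) : H) = (q ^ (m₂ - m₁)) • ket s l m₁ m₂ j
  E₁ (s : ℤˣ) (l m₁ m₂ j : ℝ) (h : Admissible l m₁ m₂ j) :
    (σ (Uq.E q 0) (mket s l m₁ m₂ j) : H) =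
      (√(br q (j - m₁) * br q (j + m₁ + 1))) • ket s l (m₁ + 1) m₂ j
  E₂ (s : ℤˣ) (l m₁ m₂ j : ℝ) (h : Admissible l m₁ m₂ j) :
    (σ (Uq.E q 1) (mket s l m₁ m₂ j) : H) =
      (√(br q (j - m₁ + 1) * br q (j - m₁ + 2)) * al q l j m₂) •
          ket s l (m₁ - 1) (m₂ + 1) (j + 1)
      + (√(br q (j + m₁) * br q (j - m₁ + 1)) * bl q l j m₂) • ket s l (m₁ - 1) (m₂ + 1) j
      + (√(br q (j + m₁) * br q (j + m₁ - 1)) * cl q l j m₂) •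
          ket s l (m₁ - 1) (m₂ + 1) (j - 1)

end S4q

end

open scoped ComplexConjugate InnerProductSpace ENNReal

noncomputable section

set_option linter.all false

namespace S4q

/-! ### Formal coefficients -/

/-! In the integer coordinates a = j - 1/2, u = j + m₁, b = l - j, p = l + 1/2 - j + m₂ the labels
are the points of ℤ⁴ with 0 ≤ u ≤ 2a+1 and 0 ≤ p ≤ 2b+1, the sign ε is the parity of p, and each
generator is a finite sum of weighted shifts. The weights are built from powers of q, roots of 1 -
q^{2n} and inverses of such numbers with odd n.

Existence of π and σ. With principal complex roots the weights make sense on all of ℤ⁴, where the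
defining relations are algebraic identities without boundary terms. They descend to the labels
because a weight contains a factor √(1 - q⁰) = 0 whenever its shift leaves the region
(`pres_latSum`, `compr_mul`), and bounded operators are determined on the dense span M
(`Rep.unique`). For the sphere, x₀, x₁, x₁* split into a factor depending on (a, u) and operators c,
h, cᵗ in the (b, p) directions that raise, keep and lower j, while x₂ = d acts in (b, p) alone. The
algebra of c, h, cᵗ, d is `fib_relations`; it expresses h² and d dᵗ through cᵗc and c cᵗ, which
reduces the remaining relations to scalar identities in (a, u) (`sphere_relations`). The relations
of the symmetry algebra are `uq_relations`. On the labels all weights are real, so transposed shifts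
are adjoints; this gives the `*`-property and half of the relations.

Commutant and first order condition. Conjugation by J turns a shift with weight g and displacement e
into a shift with weight g evaluated at the reflected point (u ↦ 2a+1-u, p ↦ 2b+1-p) and with
reflected displacement e'. The commutator of two shifts (f, d) and (g, e) has weight (f(x+e) - f(x))
g(x) - (g(x+d) - g(x)) f(x) (`nearComm_wsh`). It therefore suffices that the oscillation of f in the
direction e', times the reflected size of g, is O(q^{2(a+b)}): this beats every power of l. `Est`
lists the estimates that make all pairs work, and `Est.pair` combines them. Weights proportional to
the sign ± are of that order by themselves. For the other weights f the commutator of D with the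
shift is the same shift, multiplied by its change of l and followed by the exchange of the two
signs, so it is bounded and obeys the same estimates (`isCommutator_D_even`). Shifts with rapidly
decaying weights span a two-sided ideal `SM` in the algebra `FP` of finite propagation operators;
its members are smoothing (`smoothing_of_SM`), and commutation modulo an ideal passes from
generators to all words (`first_order`).

Equivariance. T is the reflection with weight q^{m₁+3m₂} and phase J. The generators E₁ and E₂
change m₁ + 3m₂ by 1 and by 2, which produces the factors q and q² of the antipode; the relations
for F follow from T² = -1. The modulus of T is diagonal and positive with core M, whence the polar
decomposition. -/

/-- `1 - q^{2n}` -/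
def bt (q : ℝ) (n : ℤ) : ℂ := 1 - (q : ℂ) ^ (2 * n)

/-- The complex square root of `1 - q^{2n}`. -/
def sq (q : ℝ) (n : ℤ) : ℂ := (bt q n) ^ (1 / 2 : ℂ)

/-- The principal complex root squares back for every integer n, also for negative n where 1 -
q^{2n} < 0. This is what allows the relations to be verified on the whole lattice, without regard to
the boundary of the set of labels. -/
theorem sq_sq (q : ℝ) (n : ℤ) : sq q n ^ 2 = bt q n := by
  rw [sq, ← Complex.cpow_nat_mul]; simp

theorem bt_ne_zero {q : ℝ} (hq0 : 0 < q) (hq1 : q < 1) {n : ℤ} (hn : n ≠ 0) : bt q n ≠ 0 := by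
  rw [bt, sub_ne_zero]
  intro h
  have h : (1 : ℝ) = q ^ (2 * n) := by exact_mod_cast h
  rw [eq_comm, zpow_eq_one_iff_right₀ hq0.le hq1.ne] at h
  omega

/-- This and the next seven definitions are the coefficients C, H, D of the theorem in the
coordinates a = j - 1/2, b = l - j, p = l + 1/2 - j + m₂. Odd p means ε = 1/2. The powers of q
contained in the numbers [z] are collected in front, and the total exponent is an integer. -/
def fCp (q : ℝ) (a b p : ℤ) : ℂ :=
  if Odd p then -((q : ℂ) ^ (p - 1) * sq q (2 * a + p + 4) * sq q (2 * a + 2 * b + 4 - p)) /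
    bt q (2 * a + 2 * b + 5)
  else -((q : ℂ) ^ p * sq q (2 * a + p + 3) * sq q (2 * a + 2 * b + 5 - p)) /
    bt q (2 * a + 2 * b + 5)

def fC0 (q : ℝ) (a b p : ℤ) : ℂ :=
  if Odd p then ((q : ℂ) ^ (-2 : ℤ) - (q : ℂ) ^ 2) * (q : ℂ) ^ (4 * a + 2 * b + 2 * p + 6) *
    (sq q (2 * a + 2 * b + 4 - p) * sq q (2 * b + 1 - p)) /
    (bt q (2 * a + 2 * b + 3) * bt q (2 * a + 2 * b + 5))
  else -(((q : ℂ) ^ (-2 : ℤ) - (q : ℂ) ^ 2) * (q : ℂ) ^ (2 * a + 2 * b + 3) *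
    (sq q (2 * a + p + 3) * sq q p)) /
    (bt q (2 * a + 2 * b + 3) * bt q (2 * a + 2 * b + 5))

def fCm (q : ℝ) (a b p : ℤ) : ℂ :=
  if Odd p then -((q : ℂ) ^ (2 * a + p + 2) * sq q (p - 1) * sq q (2 * b + 1 - p)) /
    bt q (2 * a + 2 * b + 3)
  else -((q : ℂ) ^ (2 * a + p + 1) * sq q p * sq q (2 * b - p)) /
    bt q (2 * a + 2 * b + 3)

def fHp (q : ℝ) (a b p : ℤ) : ℂ :=
  if Odd p then (q : ℂ) ^ (2 * a + p + 2) * sq q (2 * a + 2 * b + 4 - p) * sq q (p + 1) /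
    bt q (2 * a + 2 * b + 5)
  else (q : ℂ) ^ p * sq q (2 * b + 2 - p) * sq q (2 * a + p + 3) /
    bt q (2 * a + 2 * b + 5)

def fH0 (q : ℝ) (a b p : ℤ) : ℂ :=
  if Odd p then ((q : ℂ) ^ (4 * a + 2 * b + 6) * bt q (2 * b + 1 - p) * bt q (p + 1) -
      (q : ℂ) ^ (2 * b) * bt q (2 * a + 2 * b + 4 - p) * bt q (2 * a + p + 2)) /
    (bt q (2 * a + 2 * b + 3) * bt q (2 * a + 2 * b + 5))
  else ((q : ℂ) ^ (2 * b + 2) * bt q (2 * a + 2 * b + 3 - p) * bt q (2 * a + p + 3) -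
      (q : ℂ) ^ (4 * a + 2 * b + 4) * bt q (2 * b + 2 - p) * bt q p) /
    (bt q (2 * a + 2 * b + 3) * bt q (2 * a + 2 * b + 5))

def fDp (q : ℝ) (a b p : ℤ) : ℂ :=
  if Odd p then sq q (2 * a + p + 4) * sq q (p + 1) / bt q (2 * a + 2 * b + 5)
  else sq q (2 * a + p + 3) * sq q (p + 2) / bt q (2 * a + 2 * b + 5)

def fD0 (q : ℝ) (a b p : ℤ) : ℂ :=
  if Odd p then ((q : ℂ) ^ (-2 : ℤ) - (q : ℂ) ^ 2) * (q : ℂ) ^ (4 * a + 2 * b + p + 7) *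
    (sq q (2 * b + 1 - p) * sq q (p + 1)) /
    (bt q (2 * a + 2 * b + 3) * bt q (2 * a + 2 * b + 5))
  else ((q : ℂ) ^ (-2 : ℤ) - (q : ℂ) ^ 2) * (q : ℂ) ^ (2 * a + 2 * b + p + 5) *
    (sq q (2 * a + 2 * b + 3 - p) * sq q (2 * a + p + 3)) /
    (bt q (2 * a + 2 * b + 3) * bt q (2 * a + 2 * b + 5))

def fDm (q : ℝ) (a b p : ℤ) : ℂ :=
  if Odd p then -((q : ℂ) ^ (2 * a + 2 * p + 3) *
    (sq q (2 * b + 1 - p) * sq q (2 * a + 2 * b + 2 - p))) / bt q (2 * a + 2 * b + 3)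
  else -((q : ℂ) ^ (2 * a + 2 * p + 3) *
    (sq q (2 * b - p) * sq q (2 * a + 2 * b + 3 - p))) / bt q (2 * a + 2 * b + 3)

/-! ### Weighted shifts on finitely supported functions -/

/-- The operator sending the basis vector at `x` to `f x` times the basis vector at `x + d`. -/
def fshift {G : Type*} [Add G] (f : G → ℂ) (d : G) : (G →₀ ℂ) →ₗ[ℂ] (G →₀ ℂ) :=
  Finsupp.lsum ℂ fun x => f x • Finsupp.lsingle (x + d)

theorem fshift_single {G : Type*} [Add G] (f : G → ℂ) (d : G) (x : G) (c : ℂ) :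
    fshift f d (Finsupp.single x c) = (f x * c) • Finsupp.single (x + d) 1 := by
  simp [fshift]

/-- The fibre space. -/
abbrev Fib : Type := (ℤ × ℤ) →₀ ℂ

/-- The part common to x₀ and x₁ that raises j, seen in the coordinates (b, p); `s` is the
chirality. `opct` at `a` is the transpose of `opc` at `a - 1`, and `opd`, `opdt` are x₂ and its
transpose. -/
def opc (q : ℝ) (s : ℂ) (a : ℤ) : Fib →ₗ[ℂ] Fib :=
  fshift (fun x => fCp q a x.1 x.2) (0, 0) + fshift (fun x => -(s * fC0 q a x.1 x.2)) (-1, -1) +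
    fshift (fun x => fCm q a x.1 x.2) (-2, -2)

def opct (q : ℝ) (s : ℂ) (a : ℤ) : Fib →ₗ[ℂ] Fib :=
  fshift (fun x => fCm q (a - 1) (x.1 + 2) (x.2 + 2)) (2, 2) +
    fshift (fun x => -(s * fC0 q (a - 1) (x.1 + 1) (x.2 + 1))) (1, 1) +
    fshift (fun x => fCp q (a - 1) x.1 x.2) (0, 0)

def oph (q : ℝ) (s : ℂ) (a : ℤ) : Fib →ₗ[ℂ] Fib :=
  fshift (fun x => fHp q a x.1 x.2) (1, 1) + fshift (fun x => s * fH0 q a x.1 x.2) (0, 0) +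
    fshift (fun x => fHp q a (x.1 - 1) (x.2 - 1)) (-1, -1)

def opd (q : ℝ) (s : ℂ) (a : ℤ) : Fib →ₗ[ℂ] Fib :=
  fshift (fun x => fDp q a x.1 x.2) (1, 2) + fshift (fun x => s * fD0 q a x.1 x.2) (0, 1) +
    fshift (fun x => fDm q a x.1 x.2) (-1, 0)

def opdt (q : ℝ) (s : ℂ) (a : ℤ) : Fib →ₗ[ℂ] Fib :=
  fshift (fun x => fDp q a (x.1 - 1) (x.2 - 2)) (-1, -2) +
    fshift (fun x => s * fD0 q a x.1 (x.2 - 1)) (0, -1) +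
    fshift (fun x => fDm q a (x.1 + 1) x.2) (1, 0)

/-- To prove that two linear maps on the fibre agree, it suffices to compare basis vectors. -/
theorem fib_ext {M : Type*} [AddCommMonoid M] [Module ℂ M] {f g : Fib →ₗ[ℂ] M}
    (h : ∀ b p, f (Finsupp.single (b, p) 1) = g (Finsupp.single (b, p) 1)) : f = g := by
  ext ⟨b, p⟩
  simp [h]

theorem bt_eq (q : ℝ) (n : ℤ) : bt q n = 1 - ((q : ℂ) ^ n) ^ 2 := by
  rw [bt, mul_comm, zpow_mul]; norm_cast

set_option maxHeartbeats 40000000 in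
-- All that the sphere relations need from the (b, p) directions. The last two identities are
-- quadratic: one eliminates h², the other d dᵗ, in favour of cᵗc and c cᵗ. Each is checked by
-- comparing the coefficients of every basis vector.
theorem fib_relations {q : ℝ} (hq0 : 0 < q) (hq1 : q < 1) {s : ℂ} (hs : s ^ 2 = 1) (a : ℤ) :
    (opc q s a ∘ₗ opd q s a = (q : ℂ) ^ 2 • (opd q s (a + 1) ∘ₗ opc q s a)) ∧
    (oph q s a ∘ₗ opd q s a = (q : ℂ) ^ 2 • (opd q s a ∘ₗ oph q s a)) ∧
    (opct q s a ∘ₗ opd q s a = (q : ℂ) ^ 2 • (opd q s (a - 1) ∘ₗ opct q s a)) ∧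
    (opc q s a ∘ₗ oph q s a = oph q s (a + 1) ∘ₗ opc q s a) ∧
    (opct q s a ∘ₗ oph q s a = oph q s (a - 1) ∘ₗ opct q s a) ∧
    (opdt q s a ∘ₗ opd q s a =
      (q : ℂ) ^ 4 • (opd q s a ∘ₗ opdt q s a) + (1 - (q : ℂ) ^ 4) • LinearMap.id) ∧
    ((bt q (2 * a) * bt q (2 * a + 3) ^ 2) • (opc q s (a - 1) ∘ₗ opct q s a) +
      ((q : ℂ) ^ (4 * a) * (1 - (q : ℂ) ^ 2) ^ 3 * (1 + (q : ℂ) ^ 2) * (1 + (q : ℂ) ^ (4 * a + 4))) •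
        (oph q s a ∘ₗ oph q s a) =
      (bt q (2 * a + 4) * bt q (2 * a + 1) ^ 2) • (opct q s (a + 1) ∘ₗ opc q s a)) ∧
    (bt q (2 * a + 3) ^ 2 • (opd q s a ∘ₗ opdt q s a) =
      bt q (2 * a + 3) ^ 2 • LinearMap.id -
      ((q : ℂ) ^ (4 * a + 4) * (1 - (q : ℂ) ^ 2) ^ 2) • (oph q s a ∘ₗ oph q s a) -
      (bt q (2 * a + 2) * bt q (2 * a + 4)) • (opct q s (a + 1) ∘ₗ opc q s a)) := by
  refine ⟨fib_ext ?_, fib_ext ?_, fib_ext ?_, fib_ext ?_, fib_ext ?_, fib_ext ?_, fib_ext ?_, fib_ext ?_⟩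
  all_goals
    intro b p
    have hq : (q : ℂ) ≠ 0 := by exact_mod_cast hq0.ne'
    have hb := fun n => @bt_ne_zero q hq0 hq1 n
    simp only [opc, opct, oph, opd, opdt, LinearMap.comp_apply, LinearMap.add_apply,
      LinearMap.sub_apply, LinearMap.smul_apply, LinearMap.id_apply, map_add, map_smul,
      fshift_single, Prod.mk_add_mk, mul_one, sub_eq_add_neg, add_assoc, add_zero, Int.reduceAdd,
      Int.reduceNeg]
    -- The possible denominators have odd index, hence never vanish on the lattice. They are kept as
    -- atoms while denominators are cleared and are unfolded into powers of q only for the final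
    -- polynomial identity.
    obtain ⟨Dm, hm⟩ : ∃ D, D = bt q (2 * a + 2 * b + -1) := ⟨_, rfl⟩
    have hm0 : Dm ≠ 0 := hm ▸ hb _ (by omega)
    obtain ⟨D1, h1⟩ : ∃ D, D = bt q (2 * a + 2 * b + 1) := ⟨_, rfl⟩
    have h10 : D1 ≠ 0 := h1 ▸ hb _ (by omega)
    obtain ⟨D3, h3⟩ : ∃ D, D = bt q (2 * a + 2 * b + 3) := ⟨_, rfl⟩
    have h30 : D3 ≠ 0 := h3 ▸ hb _ (by omega)
    obtain ⟨D5, h5⟩ : ∃ D, D = bt q (2 * a + 2 * b + 5) := ⟨_, rfl⟩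
    have h50 : D5 ≠ 0 := h5 ▸ hb _ (by omega)
    obtain ⟨D7, h7⟩ : ∃ D, D = bt q (2 * a + 2 * b + 7) := ⟨_, rfl⟩
    have h70 : D7 ≠ 0 := h7 ▸ hb _ (by omega)
    obtain ⟨A, hA⟩ : ∃ A, A = (q : ℂ) ^ a := ⟨_, rfl⟩
    obtain ⟨B, hB⟩ : ∃ A, A = (q : ℂ) ^ b := ⟨_, rfl⟩
    obtain ⟨P, hP⟩ : ∃ A, A = (q : ℂ) ^ p := ⟨_, rfl⟩
    have hA0 : A ≠ 0 := hA ▸ zpow_ne_zero _ hq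
    have hB0 : B ≠ 0 := hB ▸ zpow_ne_zero _ hq
    have hP0 : P ≠ 0 := hP ▸ zpow_ne_zero _ hq
    match_scalars
    all_goals
      simp only [fCp, fC0, fCm, fDp, fD0, fDm, fHp, fH0]
      -- Displacements change p by known integers, so the parity of p settles every case distinction
      -- in the coefficients at once.
      rcases Int.even_or_odd p with hp | hp
    all_goals
      have hp' := hp
      try rw [← Int.not_odd_iff_even] at hp'
      simp only [Int.odd_add, hp, hp', even_neg, odd_neg, even_two, if_true, if_false, iff_true,
        iff_false, not_true, not_false_iff, Int.not_even_one, Int.not_odd_iff_even,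
        Int.not_even_iff_odd, odd_one,
        show ¬Even (3 : ℤ) by decide, show Even (4 : ℤ) by decide]
      clear hp hp'
      try simp +arith only []
      try simp only [← hm, ← h1, ← h3, ← h5, ← h7]
      try simp only [zpow_add₀ hq, zpow_sub₀ hq, zpow_neg, zpow_mul', zpow_ofNat, zpow_one, ← hA,
        ← hB, ← hP]
      try field_simp (disch := assumption)
      try simp only [sq_sq, hs]
      try simp only [hm, h1, h3, h5, h7]
      try simp only [bt_eq, zpow_add₀ hq, zpow_sub₀ hq, zpow_neg, zpow_mul', zpow_ofNat, zpow_one,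
        ← hA, ← hB, ← hP]
      try field_simp (disch := assumption)
      try ring1

theorem opc_comp_opd {q : ℝ} (hq0 : 0 < q) (hq1 : q < 1) {s : ℂ} (hs : s ^ 2 = 1) (a : ℤ) :
    opc q s a ∘ₗ opd q s a = (q : ℂ) ^ 2 • (opd q s (a + 1) ∘ₗ opc q s a) :=
  (fib_relations hq0 hq1 hs a).1

theorem oph_comp_opd {q : ℝ} (hq0 : 0 < q) (hq1 : q < 1) {s : ℂ} (hs : s ^ 2 = 1) (a : ℤ) :
    oph q s a ∘ₗ opd q s a = (q : ℂ) ^ 2 • (opd q s a ∘ₗ oph q s a) :=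
  (fib_relations hq0 hq1 hs a).2.1

theorem opct_comp_opd {q : ℝ} (hq0 : 0 < q) (hq1 : q < 1) {s : ℂ} (hs : s ^ 2 = 1) (a : ℤ) :
    opct q s a ∘ₗ opd q s a = (q : ℂ) ^ 2 • (opd q s (a - 1) ∘ₗ opct q s a) :=
  (fib_relations hq0 hq1 hs a).2.2.1

theorem opc_comp_oph {q : ℝ} (hq0 : 0 < q) (hq1 : q < 1) {s : ℂ} (hs : s ^ 2 = 1) (a : ℤ) :
    opc q s a ∘ₗ oph q s a = oph q s (a + 1) ∘ₗ opc q s a :=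
  (fib_relations hq0 hq1 hs a).2.2.2.1

theorem opct_comp_oph {q : ℝ} (hq0 : 0 < q) (hq1 : q < 1) {s : ℂ} (hs : s ^ 2 = 1) (a : ℤ) :
    opct q s a ∘ₗ oph q s a = oph q s (a - 1) ∘ₗ opct q s a :=
  (fib_relations hq0 hq1 hs a).2.2.2.2.1

theorem opdt_comp_opd {q : ℝ} (hq0 : 0 < q) (hq1 : q < 1) {s : ℂ} (hs : s ^ 2 = 1) (a : ℤ) :
    opdt q s a ∘ₗ opd q s a =
      (q : ℂ) ^ 4 • (opd q s a ∘ₗ opdt q s a) + (1 - (q : ℂ) ^ 4) • LinearMap.id :=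
  (fib_relations hq0 hq1 hs a).2.2.2.2.2.1

theorem opc_comp_opct {q : ℝ} (hq0 : 0 < q) (hq1 : q < 1) {s : ℂ} (hs : s ^ 2 = 1) (a : ℤ) :
    (bt q (2 * a) * bt q (2 * a + 3) ^ 2) • (opc q s (a - 1) ∘ₗ opct q s a) +
      ((q : ℂ) ^ (4 * a) * (1 - (q : ℂ) ^ 2) ^ 3 * (1 + (q : ℂ) ^ 2) * (1 + (q : ℂ) ^ (4 * a + 4))) •
        (oph q s a ∘ₗ oph q s a) =
      (bt q (2 * a + 4) * bt q (2 * a + 1) ^ 2) • (opct q s (a + 1) ∘ₗ opc q s a) :=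
  (fib_relations hq0 hq1 hs a).2.2.2.2.2.2.1

theorem opd_comp_opdt {q : ℝ} (hq0 : 0 < q) (hq1 : q < 1) {s : ℂ} (hs : s ^ 2 = 1) (a : ℤ) :
    bt q (2 * a + 3) ^ 2 • (opd q s a ∘ₗ opdt q s a) =
      bt q (2 * a + 3) ^ 2 • LinearMap.id -
      ((q : ℂ) ^ (4 * a + 4) * (1 - (q : ℂ) ^ 2) ^ 2) • (oph q s a ∘ₗ oph q s a) -
      (bt q (2 * a + 2) * bt q (2 * a + 4)) • (opct q s (a + 1) ∘ₗ opc q s a) :=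
  (fib_relations hq0 hq1 hs a).2.2.2.2.2.2.2

/-! ### The factors in (a, u) and the sphere relations on the lattice -/

def fAp (q : ℝ) (a u : ℤ) : ℂ :=
  (q : ℂ) ^ u * (sq q (u + 1) * sq q (2 * a + 2 - u)) / bt q (2 * a + 3)

def fA0 (q : ℝ) (a u : ℤ) : ℂ :=
  (q : ℂ) ^ (2 * a + 1) * ((q : ℂ) ^ (2 * u + 1) * ((q : ℂ) ^ (-2 : ℤ) - (q : ℂ) ^ 2) *
    bt q (2 * a + 1 - u) - ((q : ℂ) ^ (-1 : ℤ) - q) * bt q (2 * a + 1)) /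
    (bt q (2 * a + 1) * bt q (2 * a + 3))

def fBp (q : ℝ) (a u : ℤ) : ℂ := sq q (u + 1) * sq q (u + 2) / bt q (2 * a + 3)

def fB0 (q : ℝ) (a u : ℤ) : ℂ :=
  (1 + (q : ℂ) ^ 2) * ((q : ℂ) ^ (-1 : ℤ) - q) * (q : ℂ) ^ (2 * a + u + 2) *
    (sq q (2 * a + 1 - u) * sq q (u + 1)) / (bt q (2 * a + 1) * bt q (2 * a + 3))

def fBm (q : ℝ) (a u : ℤ) : ℂ :=
  -((q : ℂ) ^ (2 * u + 1) * (sq q (2 * a + 1 - u) * sq q (2 * a - u))) / bt q (2 * a + 1)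

/-- The space of finitely supported functions on the lattice, as a direct sum of fibres. -/
abbrev Lat : Type := (ℤˣ × ℤ × ℤ) →₀ Fib

/-- The formal operator with three components of degrees `1, 0, -1` in `j`. -/
def latOp (q : ℝ) (f g h : ℤ → ℤ → ℂ) (d e k : ℤ) : Module.End ℂ Lat :=
  Finsupp.lsum ℂ fun x =>
    f x.2.1 x.2.2 • (Finsupp.lsingle (x.1, x.2.1 + 1, x.2.2 + d) ∘ₗ opc q (x.1 : ℤ) x.2.1) +
    g x.2.1 x.2.2 • (Finsupp.lsingle (x.1, x.2.1, x.2.2 + e) ∘ₗ oph q (x.1 : ℤ) x.2.1) +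
    h x.2.1 x.2.2 • (Finsupp.lsingle (x.1, x.2.1 - 1, x.2.2 + k) ∘ₗ opct q (x.1 : ℤ) x.2.1)

/-- The formal operator acting in the fibres. -/
def latFib (T : ℂ → ℤ → Fib →ₗ[ℂ] Fib) : Module.End ℂ Lat :=
  Finsupp.lsum ℂ fun x => Finsupp.lsingle x ∘ₗ T (x.1 : ℤ) x.2.1

/-- x₀ is its own transpose, so the weight that lowers j is the weight that raises j, read at the
target. For the pair x₁, x₁* the raising weight of one is the transposed lowering weight of the
other. -/
def X0 (q : ℝ) : Module.End ℂ Lat :=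
  latOp q (fAp q) (fA0 q) (fun a u => fAp q (a - 1) (u - 1)) 1 0 (-1)

def X1 (q : ℝ) : Module.End ℂ Lat := latOp q (fBp q) (fB0 q) (fBm q) 2 1 0

def X1s (q : ℝ) : Module.End ℂ Lat :=
  latOp q (fun a u => fBm q (a + 1) u) (fun a u => fB0 q a (u - 1))
    (fun a u => fBp q (a - 1) (u - 2)) 0 (-1) (-2)

def X2 (q : ℝ) : Module.End ℂ Lat := latFib (opd q)

def X2s (q : ℝ) : Module.End ℂ Lat := latFib (opdt q)

theorem latOp_single (q : ℝ) (f g h : ℤ → ℤ → ℂ) (d e k : ℤ) (s : ℤˣ) (a u : ℤ) (w : Fib) :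
    latOp q f g h d e k (Finsupp.lsingle (R := ℂ) (s, a, u) w) =
      f a u • Finsupp.lsingle (R := ℂ) (s, a + 1, u + d) (opc q (s : ℤ) a w) +
      g a u • Finsupp.lsingle (R := ℂ) (s, a, u + e) (oph q (s : ℤ) a w) +
      h a u • Finsupp.lsingle (R := ℂ) (s, a - 1, u + k) (opct q (s : ℤ) a w) := by
  simp [latOp]

theorem latFib_single (T : ℂ → ℤ → Fib →ₗ[ℂ] Fib) (s : ℤˣ) (a u : ℤ) (w : Fib) :
    latFib T (Finsupp.lsingle (R := ℂ) (s, a, u) w) =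
      Finsupp.lsingle (R := ℂ) (s, a, u) (T (s : ℤ) a w) := by
  simp [latFib]

theorem lat_ext {M : Type*} [AddCommMonoid M] [Module ℂ M] {f g : Lat →ₗ[ℂ] M}
    (h : ∀ s a u w, f (Finsupp.lsingle (R := ℂ) (s, a, u) w) =
      g (Finsupp.lsingle (R := ℂ) (s, a, u) w)) : f = g :=
  Finsupp.lhom_ext fun ⟨s, a, u⟩ w => h s a u w

theorem unit_sq (s : ℤˣ) : (((s : ℤ) : ℂ)) ^ 2 = 1 := by
  rcases Int.units_eq_one_or s with rfl | rfl <;> simp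

/-- x₂ does not see the (a, u) factors, and each of c, h, cᵗ separately q²-commutes with it. One
computation thus serves x₀, x₁ and x₁*. -/
theorem latOp_mul_X2 {q : ℝ} (hq0 : 0 < q) (hq1 : q < 1) (f g h : ℤ → ℤ → ℂ) (d e k : ℤ) :
    latOp q f g h d e k * X2 q = (q : ℂ) ^ 2 • (X2 q * latOp q f g h d e k) := by
  refine lat_ext fun s a u w => ?_
  have h1 := LinearMap.congr_fun (opc_comp_opd hq0 hq1 (unit_sq s) a) w
  have h2 := LinearMap.congr_fun (oph_comp_opd hq0 hq1 (unit_sq s) a) w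
  have h3 := LinearMap.congr_fun (opct_comp_opd hq0 hq1 (unit_sq s) a) w
  simp only [LinearMap.comp_apply, LinearMap.smul_apply] at h1 h2 h3
  simp only [X2, Module.End.mul_apply, LinearMap.smul_apply, latFib_single, latOp_single, map_add,
    map_smul, h1, h2, h3]
  module

theorem X2s_mul_X2 {q : ℝ} (hq0 : 0 < q) (hq1 : q < 1) :
    X2s q * X2 q = (q : ℂ) ^ 4 • (X2 q * X2s q) + (1 - (q : ℂ) ^ 4) • 1 := by
  refine lat_ext fun s a u w => ?_
  have h1 := LinearMap.congr_fun (opdt_comp_opd hq0 hq1 (unit_sq s) a) w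
  simp only [LinearMap.comp_apply, LinearMap.smul_apply, LinearMap.add_apply,
    LinearMap.id_apply] at h1
  simp only [X2, X2s, Module.End.mul_apply, LinearMap.smul_apply, LinearMap.add_apply,
    latFib_single, h1, map_add, map_smul, Module.End.one_apply]

/-- `opc_comp_opct` solved for h²; the coefficient of h² there is positive for every integer a, so
the division is legitimate on the whole lattice. -/
theorem oph_oph {q : ℝ} (hq0 : 0 < q) (hq1 : q < 1) {s : ℂ} (hs : s ^ 2 = 1) (a : ℤ) (w : Fib) :
    oph q s a (oph q s a w) =
      ((q : ℂ) ^ (4 * a) * (1 - (q : ℂ) ^ 2) ^ 3 * (1 + (q : ℂ) ^ 2) *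
        (1 + (q : ℂ) ^ (4 * a + 4)))⁻¹ •
      ((bt q (2 * a + 4) * bt q (2 * a + 1) ^ 2) • opct q s (a + 1) (opc q s a w) -
        (bt q (2 * a) * bt q (2 * a + 3) ^ 2) • opc q s (a - 1) (opct q s a w)) := by
  have h := LinearMap.congr_fun (opc_comp_opct hq0 hq1 hs a) w
  simp only [LinearMap.comp_apply, LinearMap.smul_apply, LinearMap.add_apply] at h
  rw [← h, add_sub_cancel_left, inv_smul_smul₀]
  have hp : 0 < q ^ (4 * a) * (1 - q ^ 2) ^ 3 * (1 + q ^ 2) * (1 + q ^ (4 * a + 4)) := by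
    have : 0 < 1 - q ^ 2 := by nlinarith
    positivity
  exact_mod_cast hp.ne'

theorem opd_opdt {q : ℝ} (hq0 : 0 < q) (hq1 : q < 1) {s : ℂ} (hs : s ^ 2 = 1) (a : ℤ) (w : Fib) :
    opd q s a (opdt q s a w) =
      (bt q (2 * a + 3) ^ 2)⁻¹ • (bt q (2 * a + 3) ^ 2 • w -
      ((q : ℂ) ^ (4 * a + 4) * (1 - (q : ℂ) ^ 2) ^ 2) • oph q s a (oph q s a w) -
      (bt q (2 * a + 2) * bt q (2 * a + 4)) • opct q s (a + 1) (opc q s a w)) := by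
  have h := LinearMap.congr_fun (opd_comp_opdt hq0 hq1 hs a) w
  simp only [LinearMap.comp_apply, LinearMap.smul_apply, LinearMap.sub_apply,
    LinearMap.id_apply] at h
  rw [← h, inv_smul_smul₀]
  exact pow_ne_zero _ (bt_ne_zero hq0 hq1 (by omega))

set_option maxHeartbeats 40000000 in
-- Once h is moved past c and cᵗ and the products h², d dᵗ are eliminated, both sides involve the
-- same vectors of the fibre. What remains for each of them is a rational identity in q^a and q^u.
-- The second radial relation is absent because it follows from these and from the relation between
-- x₂* and x₂.
theorem sphere_relations {q : ℝ} (hq0 : 0 < q) (hq1 : q < 1) :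
    (X0 q * X1 q = (q : ℂ) ^ 2 • (X1 q * X0 q)) ∧
    (X1s q * X1 q = X1 q * X1s q + (1 - (q : ℂ) ^ 4) • (X0 q * X0 q)) ∧
    (X0 q * X0 q + X1 q * X1s q + X2 q * X2s q = 1) := by
  refine ⟨lat_ext ?_, lat_ext ?_, lat_ext ?_⟩
  all_goals
    intro s a u w
    have h1 := LinearMap.congr_fun (opc_comp_oph hq0 hq1 (unit_sq s) a) w
    have h2 := LinearMap.congr_fun (opct_comp_oph hq0 hq1 (unit_sq s) a) w
    have h3 := oph_oph hq0 hq1 (unit_sq s) a w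
    have h4 := opd_opdt hq0 hq1 (unit_sq s) a w
    simp only [LinearMap.comp_apply, LinearMap.smul_apply] at h1 h2
    simp only [X0, X1, X1s, X2, X2s, Module.End.mul_apply, LinearMap.smul_apply,
      LinearMap.add_apply, LinearMap.sub_apply, Module.End.one_apply, latFib_single, latOp_single,
      map_add, map_smul, map_sub, h1, h2, h3, h4]
    simp only [sub_eq_add_neg, add_assoc, add_zero, Int.reduceAdd, Int.reduceNeg]
    have hq : (q : ℂ) ≠ 0 := by exact_mod_cast hq0.ne'
    have hb := fun n => @bt_ne_zero q hq0 hq1 n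
    have hx : (1 + (q : ℂ) ^ (4 * a + 4)) ≠ 0 := by
      have : 0 < 1 + q ^ (4 * a + 4) := by positivity
      exact_mod_cast this.ne'
    have hy : (1 - (q : ℂ) ^ 2) ≠ 0 := by
      have : 0 < 1 - q ^ 2 := by nlinarith
      exact_mod_cast this.ne'
    have hz : (1 + (q : ℂ) ^ 2) ≠ 0 := by
      have : 0 < 1 + q ^ 2 := by positivity
      exact_mod_cast this.ne'
    obtain ⟨Dm, hm⟩ : ∃ D, D = bt q (2 * a + -1) := ⟨_, rfl⟩
    have hm0 : Dm ≠ 0 := hm ▸ hb _ (by omega)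
    obtain ⟨D1, h1⟩ : ∃ D, D = bt q (2 * a + 1) := ⟨_, rfl⟩
    have h10 : D1 ≠ 0 := h1 ▸ hb _ (by omega)
    obtain ⟨D3, h3⟩ : ∃ D, D = bt q (2 * a + 3) := ⟨_, rfl⟩
    have h30 : D3 ≠ 0 := h3 ▸ hb _ (by omega)
    obtain ⟨D5, h5⟩ : ∃ D, D = bt q (2 * a + 5) := ⟨_, rfl⟩
    have h50 : D5 ≠ 0 := h5 ▸ hb _ (by omega)
    obtain ⟨Y, hY⟩ : ∃ D, D = (1 - (q : ℂ) ^ 2) := ⟨_, rfl⟩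
    obtain ⟨Z, hZ⟩ : ∃ D, D = (1 + (q : ℂ) ^ 2) := ⟨_, rfl⟩
    obtain ⟨X, hX⟩ : ∃ D, D = (1 + (q : ℂ) ^ (4 * a + 4)) := ⟨_, rfl⟩
    obtain ⟨A, hA⟩ : ∃ A, A = (q : ℂ) ^ a := ⟨_, rfl⟩
    obtain ⟨U, hU⟩ : ∃ A, A = (q : ℂ) ^ u := ⟨_, rfl⟩
    have hA0 : A ≠ 0 := hA ▸ zpow_ne_zero _ hq
    have hU0 : U ≠ 0 := hU ▸ zpow_ne_zero _ hq
    try simp only [← sub_eq_add_neg, ← hY, ← hZ]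
    rw [← hY] at hy
    rw [← hZ] at hz
    rw [← hX] at hx
    try simp only [← hX]
    match_scalars
    all_goals
      try simp only [fAp, fA0, fBp, fB0, fBm]
      try simp +arith only []
      try simp only [← hm, ← h1, ← h3, ← h5]
      try simp only [zpow_add₀ hq, zpow_sub₀ hq, zpow_neg, zpow_mul', zpow_ofNat, zpow_one, ← hA, ← hU]
      try field_simp (disch := assumption)
      try simp only [sq_sq]
      try simp only [hm, h1, h3, h5, hX, hY, hZ]
      try simp only [bt_eq, zpow_add₀ hq, zpow_sub₀ hq, zpow_neg, zpow_mul', zpow_ofNat, zpow_one,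
        ← hA, ← hU]
      try field_simp (disch := assumption)
      try ring1

theorem X0_mul_X1 {q : ℝ} (hq0 : 0 < q) (hq1 : q < 1) :
    X0 q * X1 q = (q : ℂ) ^ 2 • (X1 q * X0 q) :=
  (sphere_relations hq0 hq1).1

theorem X1s_mul_X1 {q : ℝ} (hq0 : 0 < q) (hq1 : q < 1) :
    X1s q * X1 q = X1 q * X1s q + (1 - (q : ℂ) ^ 4) • (X0 q * X0 q) :=
  (sphere_relations hq0 hq1).2.1

theorem sphere_rel {q : ℝ} (hq0 : 0 < q) (hq1 : q < 1) :
    X0 q * X0 q + X1 q * X1s q + X2 q * X2s q = 1 :=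
  (sphere_relations hq0 hq1).2.2

/-! ### The symmetry algebra on the lattice -/

/-- The complex number `[n]`. -/
def nb (q : ℝ) (n : ℤ) : ℂ := ((q : ℂ) ^ n - ((q : ℂ) ^ n)⁻¹) / ((q : ℂ) - (q : ℂ)⁻¹)

/-- The complex square root of `[n]`. -/
def sn (q : ℝ) (n : ℤ) : ℂ := (nb q n) ^ (1 / 2 : ℂ)

theorem sn_sq (q : ℝ) (n : ℤ) : sn q n ^ 2 = nb q n := by
  rw [sn, ← Complex.cpow_nat_mul]; simp

theorem sub_inv_ne_zero {q : ℝ} (hq0 : 0 < q) (hq1 : q < 1) : (q : ℂ) - (q : ℂ)⁻¹ ≠ 0 := by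
  have : q < q⁻¹ := hq1.trans (one_lt_inv₀ hq0 |>.2 hq1)
  exact_mod_cast (sub_neg.2 this).ne

theorem nb_ne_zero {q : ℝ} (hq0 : 0 < q) (hq1 : q < 1) {n : ℤ} (hn : n ≠ 0) : nb q n ≠ 0 := by
  have hq : (q : ℂ) ≠ 0 := by exact_mod_cast hq0.ne'
  refine div_ne_zero (fun h => ?_) (sub_inv_ne_zero hq0 hq1)
  apply bt_ne_zero hq0 hq1 hn
  rw [bt_eq]
  have := zpow_ne_zero n hq
  field_simp at h
  linear_combination -h

/-- Since |ε| = 1/2, the two factors under the root in the denominator of a_l are both [2a+3], and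
those of c_l are both [2a+1]. The denominators are therefore free of roots. -/
def fal (q : ℝ) (a b p : ℤ) : ℂ :=
  (if Odd p then sn q (2 * b + 1 - p) * sn q (2 * a + p + 4)
    else sn q (2 * b - p) * sn q (2 * a + p + 3)) / (nb q 2 * nb q (2 * a + 3))

def fbl (q : ℝ) (a b p : ℤ) : ℂ :=
  (if Odd p then sn q (2 * b + 1 - p) * sn q (p + 1)
    else sn q (2 * a + 2 * b + 3 - p) * sn q (2 * a + p + 3)) / (nb q (2 * a + 1) * nb q (2 * a + 3))

def fcl (q : ℝ) (a b p : ℤ) : ℂ :=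
  -((if Odd p then sn q (p + 1) * sn q (2 * a + 2 * b + 2 - p)
    else sn q (p + 2) * sn q (2 * a + 2 * b + 3 - p)) / (nb q 2 * nb q (2 * a + 1)))

/-- The basis vector of the lattice space. -/
def vec (s : ℤˣ) (a u b p : ℤ) : Lat := Finsupp.single (s, a, u) (Finsupp.single (b, p) 1)

theorem lat_ext' {M : Type*} [AddCommMonoid M] [Module ℂ M] {f g : Lat →ₗ[ℂ] M}
    (h : ∀ s a u b p, f (vec s a u b p) = g (vec s a u b p)) : f = g := by
  refine lat_ext fun s a u w => ?_
  exact LinearMap.congr_fun (f := f ∘ₗ Finsupp.lsingle (R := ℂ) (s, a, u))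
    (g := g ∘ₗ Finsupp.lsingle (R := ℂ) (s, a, u)) (fib_ext fun b p => h s a u b p) w

/-- The linear map with prescribed values on the basis vectors of the lattice space. -/
def latLift {M : Type*} [AddCommMonoid M] [Module ℂ M] (f : ℤˣ → ℤ → ℤ → ℤ → ℤ → M) :
    Lat →ₗ[ℂ] M :=
  Finsupp.lsum ℂ fun x => Finsupp.lsum ℂ fun y =>
    (LinearMap.id : ℂ →ₗ[ℂ] ℂ).smulRight (f x.1 x.2.1 x.2.2 y.1 y.2)

theorem latLift_vec {M : Type*} [AddCommMonoid M] [Module ℂ M] (f : ℤˣ → ℤ → ℤ → ℤ → ℤ → M)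
    (s : ℤˣ) (a u b p : ℤ) : latLift f (vec s a u b p) = f s a u b p := by
  rw [latLift, vec, Finsupp.lsum_single, Finsupp.lsum_single]
  simp

/-- `Y1`, `Y2` extend E₁, E₂ to the lattice. `Y1s`, `Y2s` are obtained by transposing the shifts and
represent F₁, F₂. -/
def Y1 (q : ℝ) : Module.End ℂ Lat := latLift fun s a u b p =>
  (sn q (2 * a + 1 - u) * sn q (u + 1)) • vec s a (u + 1) b p

def Y1s (q : ℝ) : Module.End ℂ Lat := latLift fun s a u b p =>
  (sn q (2 * a + 2 - u) * sn q u) • vec s a (u - 1) b p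

def Y2 (q : ℝ) : Module.End ℂ Lat := latLift fun s a u b p =>
  (sn q (2 * a + 2 - u) * sn q (2 * a + 3 - u) * fal q a b p) • vec s (a + 1) u (b - 1) p +
  (sn q u * sn q (2 * a + 2 - u) * fbl q a b p) • vec s a (u - 1) b (p + 1) +
  (sn q u * sn q (u - 1) * fcl q a b p) • vec s (a - 1) (u - 2) (b + 1) (p + 2)

def Y2s (q : ℝ) : Module.End ℂ Lat := latLift fun s a u b p =>
  (sn q (2 * a - u) * sn q (2 * a + 1 - u) * fal q (a - 1) (b + 1) p) • vec s (a - 1) u (b + 1) p +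
  (sn q (u + 1) * sn q (2 * a + 1 - u) * fbl q a b (p - 1)) • vec s a (u + 1) b (p - 1) +
  (sn q (u + 2) * sn q (u + 1) * fcl q (a + 1) (b - 1) (p - 2)) •
    vec s (a + 1) (u + 2) (b - 1) (p - 2)

/-- The formal diagonal operators. -/
def latDiag (f : ℤ → ℤ → ℤ → ℤ → ℂ) : Module.End ℂ Lat := latLift fun s a u b p =>
  f a u b p • vec s a u b p

/-- The square root of `q⁻¹`. -/
def qhalf (q : ℝ) : ℂ := ((q ^ (-1 / 2 : ℝ) : ℝ) : ℂ)

theorem qhalf_sq {q : ℝ} (hq0 : 0 < q) : qhalf q ^ 2 = (q : ℂ)⁻¹ := by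
  rw [qhalf, ← Complex.ofReal_pow, ← Real.rpow_natCast, ← Real.rpow_mul hq0.le]
  norm_num [Real.rpow_neg_one]

theorem qhalf_ne_zero {q : ℝ} (hq0 : 0 < q) : qhalf q ≠ 0 := by
  rw [qhalf]
  exact_mod_cast (Real.rpow_pos_of_pos hq0 _).ne'

/-- m₁ = u - a - 1/2 is a half-integer, hence the factor q^{-1/2}. In m₂ - m₁ the two halves cancel,
and no such factor appears in `Z2`. -/
def Z1 (q : ℝ) : Module.End ℂ Lat := latDiag fun a u _ _ => qhalf q * (q : ℂ) ^ (u - a)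

def Z1' (q : ℝ) : Module.End ℂ Lat := latDiag fun a u _ _ => (qhalf q * (q : ℂ) ^ (u - a))⁻¹

def Z2 (q : ℝ) : Module.End ℂ Lat := latDiag fun a u b p => (q : ℂ) ^ (p - b - u + a)

def Z2' (q : ℝ) : Module.End ℂ Lat := latDiag fun a u b p => ((q : ℂ) ^ (p - b - u + a))⁻¹

theorem sn_cube (q : ℝ) (n : ℤ) : sn q n ^ 3 = nb q n * sn q n := by
  rw [← sn_sq]; ring

set_option maxRecDepth 4000 in
set_option maxHeartbeats 40000000 in
-- The same coefficient comparison as for the sphere. Only half of the relations is listed: those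
-- among the F's, between K and F, and between E₂ and F₁ are obtained later as adjoints on M.
theorem uq_relations {q : ℝ} (hq0 : 0 < q) (hq1 : q < 1) :
    (Y1 q * Y1s q = Y1s q * Y1 q +
      ((q : ℂ) - (q : ℂ)⁻¹)⁻¹ • (Z1 q * Z1 q + (-1 : ℂ) • (Z1' q * Z1' q))) ∧
    (Y1 q * Y2s q = Y2s q * Y1 q) ∧
    (Y2 q * Y2s q = Y2s q * Y2 q +
      ((q : ℂ) ^ 2 - ((q : ℂ) ^ 2)⁻¹)⁻¹ • (Z2 q * Z2 q + (-1 : ℂ) • (Z2' q * Z2' q))) ∧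
    (Y1 q * Y2 q * Y2 q + Y2 q * Y2 q * Y1 q =
      ((q : ℂ) ^ 2 + ((q : ℂ) ^ 2)⁻¹) • (Y2 q * Y1 q * Y2 q)) ∧
    (Y1 q * Y1 q * Y1 q * Y2 q + (((q : ℂ) ^ 2 + 1 + ((q : ℂ) ^ 2)⁻¹)) • (Y1 q * Y2 q * Y1 q * Y1 q) =
      Y2 q * Y1 q * Y1 q * Y1 q + (((q : ℂ) ^ 2 + 1 + ((q : ℂ) ^ 2)⁻¹)) • (Y1 q * Y1 q * Y2 q * Y1 q)) ∧
    (Z1 q * Z2 q = Z2 q * Z1 q) ∧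
    (Z1 q * Z1' q = 1) ∧
    (Z1' q * Z1 q = 1) ∧
    (Z2 q * Z2' q = 1) ∧
    (Z2' q * Z2 q = 1) ∧
    (Z1 q * Y1 q * Z1' q = (q : ℂ) • Y1 q) ∧
    (Z2 q * Y2 q * Z2' q = (q : ℂ) ^ 2 • Y2 q) ∧
    (Z1 q * Y2 q * Z1' q = (q : ℂ)⁻¹ • Y2 q) ∧
    (Z2 q * Y1 q * Z2' q = (q : ℂ)⁻¹ • Y1 q) := by
  refine ⟨lat_ext' ?_, lat_ext' ?_, lat_ext' ?_, lat_ext' ?_, lat_ext' ?_, lat_ext' ?_, lat_ext' ?_, lat_ext' ?_, lat_ext' ?_, lat_ext' ?_, lat_ext' ?_, lat_ext' ?_, lat_ext' ?_, lat_ext' ?_⟩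
  all_goals
    intro s a u b p
    have hq : (q : ℂ) ≠ 0 := by exact_mod_cast hq0.ne'
    simp only [Y1, Y1s, Y2, Y2s, Z1, Z1', Z2, Z2', latDiag, latLift_vec,
      Module.End.mul_apply, Module.End.one_apply, LinearMap.add_apply, LinearMap.smul_apply,
      map_add, map_smul, map_sub]
    simp only [sub_eq_add_neg, add_assoc, add_zero, Int.reduceAdd, Int.reduceNeg,
      neg_add_cancel, add_neg_cancel]
    have hs := sub_inv_ne_zero hq0 hq1
    have hb := fun n => @nb_ne_zero q hq0 hq1 n
    obtain ⟨Dm, hm⟩ : ∃ D, D = nb q (2 * a + -1) := ⟨_, rfl⟩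
    obtain ⟨Dm3, hm3⟩ : ∃ D, D = nb q (2 * a + -3) := ⟨_, rfl⟩
    obtain ⟨D1, h1⟩ : ∃ D, D = nb q (2 * a + 1) := ⟨_, rfl⟩
    obtain ⟨D3, h3⟩ : ∃ D, D = nb q (2 * a + 3) := ⟨_, rfl⟩
    obtain ⟨D5, h5⟩ : ∃ D, D = nb q (2 * a + 5) := ⟨_, rfl⟩
    have hm0 : Dm ≠ 0 := hm ▸ hb _ (by omega)
    have hm30 : Dm3 ≠ 0 := hm3 ▸ hb _ (by omega)
    have h10 : D1 ≠ 0 := h1 ▸ hb _ (by omega)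
    have h30 : D3 ≠ 0 := h3 ▸ hb _ (by omega)
    have h50 : D5 ≠ 0 := h5 ▸ hb _ (by omega)
    obtain ⟨A, hA⟩ : ∃ A, A = (q : ℂ) ^ a := ⟨_, rfl⟩
    obtain ⟨U, hU⟩ : ∃ A, A = (q : ℂ) ^ u := ⟨_, rfl⟩
    obtain ⟨B, hB⟩ : ∃ A, A = (q : ℂ) ^ b := ⟨_, rfl⟩
    obtain ⟨P, hP⟩ : ∃ A, A = (q : ℂ) ^ p := ⟨_, rfl⟩
    obtain ⟨I, hI⟩ : ∃ A, A = (q : ℂ) - (q : ℂ)⁻¹ := ⟨_, rfl⟩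
    obtain ⟨N, hN⟩ : ∃ A, A = nb q 2 := ⟨_, rfl⟩
    have hN0 : N ≠ 0 := hN ▸ hb _ (by omega)
    have hN' : N = (q : ℂ) + (q : ℂ)⁻¹ := by
      rw [hN, nb, div_eq_iff hs]
      norm_cast
      push_cast
      field_simp
      ring
    have hq4 : (q : ℂ) ^ 4 - 1 ≠ 0 := by
      have : q ^ 4 - 1 < 0 := by linarith [pow_lt_one₀ hq0.le hq1 (show 4 ≠ 0 by norm_num)]
      exact_mod_cast this.ne
    have hq2 : (q : ℂ) ^ 2 - 1 ≠ 0 := by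
      have : q ^ 2 - 1 < 0 := by linarith [pow_lt_one₀ hq0.le hq1 (show 2 ≠ 0 by norm_num)]
      exact_mod_cast this.ne
    have hA0 : A ≠ 0 := hA ▸ zpow_ne_zero _ hq
    have hU0 : U ≠ 0 := hU ▸ zpow_ne_zero _ hq
    have hB0 : B ≠ 0 := hB ▸ zpow_ne_zero _ hq
    have hP0 : P ≠ 0 := hP ▸ zpow_ne_zero _ hq
    have hh0 := qhalf_ne_zero hq0
    have hh2 := qhalf_sq hq0
    have hh4 : qhalf q ^ 4 = (q : ℂ)⁻¹ ^ 2 := by rw [← hh2]; ring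
    try rw [← hI]
    rw [← hI] at hs
    match_scalars
    all_goals
      try simp only [fal, fbl, fcl]
      rcases Int.even_or_odd p with hp | hp
    all_goals
      have hp' := hp
      try rw [← Int.not_odd_iff_even] at hp'
      try simp only [Int.odd_add, hp, hp', even_neg, odd_neg, even_two, if_true, if_false, iff_true,
        iff_false, not_true, not_false_iff, Int.not_even_one, Int.not_odd_iff_even,
        Int.not_even_iff_odd, odd_one,
        show ¬Even (3 : ℤ) by decide, show Even (4 : ℤ) by decide]
      clear hp hp'
      try simp +arith only []
      try simp only [← hm, ← h1, ← h3, ← h5, ← hm3, ← hN]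
      try simp only [zpow_add₀ hq, zpow_sub₀ hq, zpow_neg, zpow_mul', zpow_ofNat, zpow_one, ← hA, ← hU,
        ← hB, ← hP]
      try simp only [← sub_eq_add_neg]
      try field_simp (disch := assumption)
      try simp only [sn_sq, sn_cube, hh2, hh4]
      try simp only [hm, h1, h3, h5, hm3, hN']
      try simp only [nb, ← hI, zpow_add₀ hq, zpow_sub₀ hq, zpow_neg, zpow_mul', zpow_ofNat, zpow_one,
        ← hA, ← hU, ← hB, ← hP]
      try field_simp (disch := assumption)
      try simp only [hI, ← sub_eq_add_neg]
      try field_simp (disch := assumption)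
      try ring1

theorem Y1_mul_Y1s {q : ℝ} (hq0 : 0 < q) (hq1 : q < 1) :
    Y1 q * Y1s q = Y1s q * Y1 q +
      ((q : ℂ) - (q : ℂ)⁻¹)⁻¹ • (Z1 q * Z1 q + (-1 : ℂ) • (Z1' q * Z1' q)) :=
  (uq_relations hq0 hq1).1

theorem Y1_mul_Y2s {q : ℝ} (hq0 : 0 < q) (hq1 : q < 1) :
    Y1 q * Y2s q = Y2s q * Y1 q :=
  (uq_relations hq0 hq1).2.1

theorem Y2_mul_Y2s {q : ℝ} (hq0 : 0 < q) (hq1 : q < 1) :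
    Y2 q * Y2s q = Y2s q * Y2 q +
      ((q : ℂ) ^ 2 - ((q : ℂ) ^ 2)⁻¹)⁻¹ • (Z2 q * Z2 q + (-1 : ℂ) • (Z2' q * Z2' q)) :=
  (uq_relations hq0 hq1).2.2.1

theorem Y_serre₁ {q : ℝ} (hq0 : 0 < q) (hq1 : q < 1) :
    Y1 q * Y2 q * Y2 q + Y2 q * Y2 q * Y1 q =
      ((q : ℂ) ^ 2 + ((q : ℂ) ^ 2)⁻¹) • (Y2 q * Y1 q * Y2 q) :=
  (uq_relations hq0 hq1).2.2.2.1

theorem Y_serre₂ {q : ℝ} (hq0 : 0 < q) (hq1 : q < 1) :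
    Y1 q * Y1 q * Y1 q * Y2 q + (((q : ℂ) ^ 2 + 1 + ((q : ℂ) ^ 2)⁻¹)) • (Y1 q * Y2 q * Y1 q * Y1 q) =
      Y2 q * Y1 q * Y1 q * Y1 q + (((q : ℂ) ^ 2 + 1 + ((q : ℂ) ^ 2)⁻¹)) • (Y1 q * Y1 q * Y2 q * Y1 q) :=
  (uq_relations hq0 hq1).2.2.2.2.1

theorem Z1_mul_Z2 {q : ℝ} (hq0 : 0 < q) (hq1 : q < 1) :
    Z1 q * Z2 q = Z2 q * Z1 q :=
  (uq_relations hq0 hq1).2.2.2.2.2.1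

theorem Z1_mul_Z1' {q : ℝ} (hq0 : 0 < q) (hq1 : q < 1) :
    Z1 q * Z1' q = 1 :=
  (uq_relations hq0 hq1).2.2.2.2.2.2.1

theorem Z1'_mul_Z1 {q : ℝ} (hq0 : 0 < q) (hq1 : q < 1) :
    Z1' q * Z1 q = 1 :=
  (uq_relations hq0 hq1).2.2.2.2.2.2.2.1

theorem Z2_mul_Z2' {q : ℝ} (hq0 : 0 < q) (hq1 : q < 1) :
    Z2 q * Z2' q = 1 :=
  (uq_relations hq0 hq1).2.2.2.2.2.2.2.2.1

theorem Z2'_mul_Z2 {q : ℝ} (hq0 : 0 < q) (hq1 : q < 1) :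
    Z2' q * Z2 q = 1 :=
  (uq_relations hq0 hq1).2.2.2.2.2.2.2.2.2.1

theorem Z1_Y1 {q : ℝ} (hq0 : 0 < q) (hq1 : q < 1) :
    Z1 q * Y1 q * Z1' q = (q : ℂ) • Y1 q :=
  (uq_relations hq0 hq1).2.2.2.2.2.2.2.2.2.2.1

theorem Z2_Y2 {q : ℝ} (hq0 : 0 < q) (hq1 : q < 1) :
    Z2 q * Y2 q * Z2' q = (q : ℂ) ^ 2 • Y2 q :=
  (uq_relations hq0 hq1).2.2.2.2.2.2.2.2.2.2.2.1

theorem Z1_Y2 {q : ℝ} (hq0 : 0 < q) (hq1 : q < 1) :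
    Z1 q * Y2 q * Z1' q = (q : ℂ)⁻¹ • Y2 q :=
  (uq_relations hq0 hq1).2.2.2.2.2.2.2.2.2.2.2.2.1

theorem Z2_Y1 {q : ℝ} (hq0 : 0 < q) (hq1 : q < 1) :
    Z2 q * Y1 q * Z2' q = (q : ℂ)⁻¹ • Y1 q :=
  (uq_relations hq0 hq1).2.2.2.2.2.2.2.2.2.2.2.2.2

/-! ### Comparison of the coefficients -/

/-- `1 - q^{2x}` for real `x`. -/
def btr (q x : ℝ) : ℝ := 1 - q ^ (2 * x)

theorem btr_nonneg {q : ℝ} (hq0 : 0 < q) (hq1 : q < 1) {x : ℝ} (hx : 0 ≤ x) : 0 ≤ btr q x :=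
  sub_nonneg.2 (Real.rpow_le_one hq0.le hq1.le (by linarith))

theorem bt_eq_btr {q : ℝ} (n : ℤ) : bt q n = (btr q n : ℝ) := by
  rw [bt, btr]
  push_cast
  congr 1
  have : (2 * (n : ℝ)) = ((2 * n : ℤ) : ℝ) := by push_cast; ring
  rw [this, Real.rpow_intCast]
  push_cast
  rfl

theorem sq_eq_sqrt {q : ℝ} (hq0 : 0 < q) (hq1 : q < 1) {n : ℤ} (hn : 0 ≤ n) :
    sq q n = (√(btr q n) : ℝ) := by
  rw [sq, bt_eq_btr, Real.sqrt_eq_rpow,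
    Complex.ofReal_cpow (btr_nonneg hq0 hq1 (by exact_mod_cast hn))]
  norm_num

theorem br_eq {q : ℝ} (hq0 : 0 < q) (x : ℝ) : br q x = q ^ (-x) * btr q x / (q⁻¹ - q) := by
  rw [br, btr, mul_sub, ← Real.rpow_add hq0, mul_one, ← neg_sub q q⁻¹, div_neg, ← neg_div, neg_sub]
  ring_nf

theorem inv_sub_pos {q : ℝ} (hq0 : 0 < q) (hq1 : q < 1) : 0 < q⁻¹ - q :=
  sub_pos.2 (hq1.trans (one_lt_inv₀ hq0 |>.2 hq1))

theorem br_nonneg {q : ℝ} (hq0 : 0 < q) (hq1 : q < 1) {x : ℝ} (hx : 0 ≤ x) : 0 ≤ br q x := by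
  rw [br_eq hq0]
  have := btr_nonneg hq0 hq1 hx
  have := inv_sub_pos hq0 hq1
  positivity

theorem sqrt_br_mul {q : ℝ} (hq0 : 0 < q) (hq1 : q < 1) {x y : ℝ} (hx : 0 ≤ x) (hy : 0 ≤ y) :
    √(br q x * br q y) = q ^ (-(x + y) / 2) * (√(btr q x) * √(btr q y)) / (q⁻¹ - q) := by
  have h1 := btr_nonneg hq0 hq1 hx
  have h2 := btr_nonneg hq0 hq1 hy
  have h3 := inv_sub_pos hq0 hq1
  have : br q x * br q y = (q ^ (-(x + y) / 2) / (q⁻¹ - q)) ^ 2 * (btr q x * btr q y) := by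
    rw [br_eq hq0, br_eq hq0, div_pow, ← Real.rpow_natCast, ← Real.rpow_mul hq0.le,
      show -(x + y) / 2 * ((2 : ℕ) : ℝ) = -x + -y by push_cast; ring, Real.rpow_add hq0]
    field_simp
  rw [this, Real.sqrt_mul (sq_nonneg _), Real.sqrt_sq (by positivity), Real.sqrt_mul h1]
  ring

/-- Writing [x] = q^{-x}(1 - q^{2x})/(q⁻¹ - q), the root contributes q^{-(x+y)/2} and the
denominator q^{z}. The factors q⁻¹ - q cancel, and the half-integers in the exponents add up to an
integer n. -/
theorem rpow_mul_sqrt_div {q : ℝ} (hq0 : 0 < q) (hq1 : q < 1) (e : ℝ) {x y : ℝ} (z : ℝ)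
    (hx : 0 ≤ x) (hy : 0 ≤ y) {n : ℤ} (hn : e - (x + y) / 2 + z = n) :
    q ^ e * (√(br q x * br q y) / br q z) = q ^ n * (√(btr q x) * √(btr q y)) / btr q z := by
  have h3 := inv_sub_pos hq0 hq1
  rw [sqrt_br_mul hq0 hq1 hx hy, br_eq hq0, ← Real.rpow_intCast, ← hn, Real.rpow_add hq0,
    sub_eq_add_neg e, Real.rpow_add hq0, Real.rpow_neg hq0.le z, neg_div]
  have := Real.rpow_pos_of_pos hq0 z
  generalize q⁻¹ - q = K at *
  field_simp

theorem rpow_mul_sqrt_div_mul {q : ℝ} (hq0 : 0 < q) (hq1 : q < 1) (e : ℝ) {x y : ℝ} (z w : ℝ)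
    (hx : 0 ≤ x) (hy : 0 ≤ y) {n : ℤ} (hn : e - (x + y) / 2 + z + w = n) :
    q ^ e * (√(br q x * br q y) / (br q z * br q w)) =
      (q⁻¹ - q) * q ^ n * (√(btr q x) * √(btr q y)) / (btr q z * btr q w) := by
  have h3 := inv_sub_pos hq0 hq1
  rw [sqrt_br_mul hq0 hq1 hx hy, br_eq hq0, br_eq hq0, ← Real.rpow_intCast, ← hn,
    Real.rpow_add hq0, Real.rpow_add hq0,
    sub_eq_add_neg e, Real.rpow_add hq0, Real.rpow_neg hq0.le z, Real.rpow_neg hq0.le w, neg_div]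
  have := Real.rpow_pos_of_pos hq0 z
  have := Real.rpow_pos_of_pos hq0 w
  field_simp

theorem br_two {q : ℝ} (hq0 : 0 < q) (hq1 : q < 1) :
    br q 2 * (q⁻¹ - q) = q ^ (-2 : ℤ) - q ^ 2 := by
  have := inv_sub_pos hq0 hq1
  rw [br, ← neg_sub q⁻¹ q, div_neg, neg_mul, div_mul_cancel₀ _ this.ne', neg_sub,
    show (-2 : ℝ) = ((-2 : ℤ) : ℝ) by norm_num, Real.rpow_intCast]
  norm_cast

theorem eps_eq (a b p : ℤ) :
    eps (a + b + 1 / 2) (a + 1 / 2) (p - b - 1 / 2) = if Odd p then 1 / 2 else -(1 / 2) := by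
  rw [eps]
  congr 1
  rw [eq_iff_iff]
  constructor
  · rintro ⟨n, hn⟩
    have : 2 * b + 1 - p = 2 * n := by
      have : ((2 * b + 1 - p : ℤ) : ℝ) = ((2 * n : ℤ) : ℝ) := by push_cast; linarith
      exact_mod_cast this
    exact ⟨b - n, by omega⟩
  · rintro ⟨n, hn⟩
    exact ⟨b - n, by rw [hn]; push_cast; ring⟩

/-- The common step from the real coefficients to the formal ones. The real root of a product agrees
with the product of principal complex roots only for nonnegative arguments; this is the origin of
the range conditions in the comparisons below. -/
theorem link_div {q : ℝ} (hq0 : 0 < q) (hq1 : q < 1) {e x y z : ℝ} {n : ℤ} (i j k : ℤ) (hi : 0 ≤ i)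
    (hj : 0 ≤ j) (hx : x = i) (hy : y = j) (hz : z = k) (hn : e - (i + j) / 2 + k = n) :
    ((q ^ e * (√(br q x * br q y) / br q z) : ℝ) : ℂ) =
      (q : ℂ) ^ n * (sq q i * sq q j) / bt q k := by
  subst hx hy hz
  rw [rpow_mul_sqrt_div hq0 hq1 e _ (by exact_mod_cast hi) (by exact_mod_cast hj) hn,
    sq_eq_sqrt hq0 hq1 hi, sq_eq_sqrt hq0 hq1 hj, bt_eq_btr]
  push_cast
  rfl

theorem link_div_mul {q : ℝ} (hq0 : 0 < q) (hq1 : q < 1) {e x y z w : ℝ} {n : ℤ} (i j k m : ℤ)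
    (hi : 0 ≤ i) (hj : 0 ≤ j) (hx : x = i) (hy : y = j) (hz : z = k) (hw : w = m)
    (hn : e - (i + j) / 2 + k + m = n) :
    ((q ^ e * (√(br q x * br q y) / (br q z * br q w)) : ℝ) : ℂ) =
      ((q : ℂ) ^ (-1 : ℤ) - q) * (q : ℂ) ^ n * (sq q i * sq q j) / (bt q k * bt q m) := by
  subst hx hy hz hw
  rw [rpow_mul_sqrt_div_mul hq0 hq1 e _ _ (by exact_mod_cast hi) (by exact_mod_cast hj) hn,
    sq_eq_sqrt hq0 hq1 hi, sq_eq_sqrt hq0 hq1 hj, bt_eq_btr, bt_eq_btr]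
  push_cast
  rw [zpow_neg_one]

theorem br_two_mul {q : ℝ} (hq0 : 0 < q) (hq1 : q < 1) :
    ((br q 2 : ℝ) : ℂ) * ((q : ℂ) ^ (-1 : ℤ) - q) = (q : ℂ) ^ (-2 : ℤ) - (q : ℂ) ^ 2 := by
  have := br_two hq0 hq1
  rw [zpow_neg_one]
  exact_mod_cast this

theorem Ap_eq {q : ℝ} (hq0 : 0 < q) (hq1 : q < 1) {a u : ℤ} (h0 : 0 ≤ u) (h1 : u ≤ 2 * a + 1) :
    ((Ap q (a + 1 / 2) (u - a - 1 / 2) : ℝ) : ℂ) = fAp q a u := by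
  refine (link_div hq0 hq1 (n := u) (u+1) (2*a+2-u) (2*a+3) (by omega) (by omega)
    (by push_cast; ring) (by push_cast; ring) (by push_cast; ring) (by push_cast; ring)).trans ?_
  rw [fAp]

theorem Bp_eq {q : ℝ} (hq0 : 0 < q) (hq1 : q < 1) {a u : ℤ} (h0 : 0 ≤ u) :
    ((Bp q (a + 1 / 2) (u - a - 1 / 2) : ℝ) : ℂ) = fBp q a u := by
  refine (link_div hq0 hq1 (n := 0) (u+1) (u+2) (2*a+3) (by omega) (by omega)
    (by push_cast; ring) (by push_cast; ring) (by push_cast; ring) (by push_cast; ring)).trans ?_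
  rw [fBp, zpow_zero, one_mul]

theorem Bm_eq {q : ℝ} (hq0 : 0 < q) (hq1 : q < 1) {a u : ℤ} (h1 : u ≤ 2 * a) :
    ((Bm q (a + 1 / 2) (u - a - 1 / 2) : ℝ) : ℂ) = fBm q a u := by
  rw [Bm, Complex.ofReal_neg, fBm, neg_div, neg_inj]
  exact link_div hq0 hq1 (2 * a + 1 - u) (2 * a - u) (2 * a + 1) (by omega) (by omega)
    (by push_cast; ring) (by push_cast; ring) (by push_cast; ring) (by push_cast; ring)

theorem B0_eq {q : ℝ} (hq0 : 0 < q) (hq1 : q < 1) {a u : ℤ} (h0 : 0 ≤ u) (h1 : u ≤ 2 * a + 1) :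
    ((B0 q (a + 1 / 2) (u - a - 1 / 2) : ℝ) : ℂ) = fB0 q a u := by
  rw [B0, mul_assoc, Complex.ofReal_mul, link_div_mul hq0 hq1 (n := 2 * a + u + 2) (2 * a + 1 - u)
    (u + 1) (2 * a + 1) (2 * a + 3) (by omega) (by omega), fB0, Real.rpow_two]
  · push_cast
    ring
  all_goals
    push_cast
    ring

theorem A0_eq {q : ℝ} (hq0 : 0 < q) (hq1 : q < 1) {a u : ℤ} : ((A0 q (a + 1 / 2) (u - a - 1 / 2) : ℝ) : ℂ) = fA0 q a u := by
  have e1 : (a : ℝ) + 1 / 2 + (u - a - 1 / 2) + 1 = ((u + 1 : ℤ) : ℝ) := by push_cast; ring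
  have e2 : (a : ℝ) + 1 / 2 - (u - a - 1 / 2) = ((2 * a + 1 - u : ℤ) : ℝ) := by push_cast; ring
  have e3 : 2 * ((a : ℝ) + 1 / 2) = ((2 * a + 1 : ℤ) : ℝ) := by push_cast; ring
  have e4 : ((2 * a + 1 : ℤ) : ℝ) + 2 = ((2 * a + 3 : ℤ) : ℝ) := by push_cast; ring
  have h3 := inv_sub_pos hq0 hq1
  have h2 : br q 2 = (q ^ (-2 : ℤ) - q ^ 2) / (q⁻¹ - q) := by
    rw [← br_two hq0 hq1, mul_div_cancel_right₀ _ h3.ne']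
  have key : A0 q (a + 1 / 2) (u - a - 1 / 2) = q ^ (2 * a + 1) * (q ^ (2 * u + 1) *
      (q ^ (-2 : ℤ) - q ^ 2) * btr q (2 * a + 1 - u : ℤ) -
      (q ^ (-1 : ℤ) - q) * btr q (2 * a + 1 : ℤ)) /
      (btr q (2 * a + 1 : ℤ) * btr q (2 * a + 3 : ℤ)) := by
    rw [A0, e1, e2, e3, e4, h2]
    simp only [br_eq hq0]
    simp only [← Int.cast_neg, Real.rpow_intCast, show (-2 : ℝ) = ((-2 : ℤ) : ℝ) by norm_num]
    have hq := hq0.ne'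
    have h4 : 1 - q ^ 2 ≠ 0 := (sub_pos.2 (pow_lt_one₀ hq0.le hq1 two_ne_zero)).ne'
    have ne {n : ℤ} (hn : n ≠ 0) : btr q n ≠ 0 := fun h => by
      have := bt_ne_zero hq0 hq1 hn
      rw [bt_eq_btr, h] at this
      exact this rfl
    have h5 := ne (n := 2 * a + 1) (by omega)
    have h6 := ne (n := 2 * a + 3) (by omega)
    have h7 : q⁻¹ - q = (1 - q ^ 2) / q := by field_simp
    rw [h7]
    generalize btr q (2 * a + 1 : ℤ) = A at *
    generalize btr q (2 * a + 3 : ℤ) = B at *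
    generalize btr q (2 * a + 1 - u : ℤ) = C at *
    simp only [two_mul, zpow_add₀ hq, zpow_sub₀ hq, zpow_neg, zpow_one, zpow_ofNat]
    have := zpow_pos hq0 a
    have := zpow_pos hq0 u
    field_simp
  rw [key, fA0]
  simp only [bt_eq_btr]
  push_cast
  ring

theorem Cp_eq {q : ℝ} (hq0 : 0 < q) (hq1 : q < 1) {a b p : ℤ} (ha : 0 ≤ a) (h0 : 0 ≤ p) (h1 : p ≤ 2 * b + 1) :
    ((Cp q (a + b + 1 / 2) (a + 1 / 2) (p - b - 1 / 2) : ℝ) : ℂ) = fCp q a b p := by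
  rw [Cp, eps_eq, fCp]
  split_ifs with hp
  · rw [Complex.ofReal_neg, neg_div, neg_inj, link_div hq0 hq1 (n := p - 1) (2 * a + p + 4) (2 * a + 2 * b + 4 - p)
      (2 * a + 2 * b + 5) (by omega) (by omega)]
    · ring
    all_goals
      push_cast
      ring
  · rw [Complex.ofReal_neg, neg_div, neg_inj, link_div hq0 hq1 (n := p) (2 * a + p + 3) (2 * a + 2 * b + 5 - p)
      (2 * a + 2 * b + 5) (by omega) (by omega)]
    · ring
    all_goals
      push_cast
      ring

theorem Cm_eq {q : ℝ} (hq0 : 0 < q) (hq1 : q < 1) {a b p : ℤ} (h0 : 0 ≤ p) (h1 : p ≤ 2 * b) :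
    ((Cm q (a + b + 1 / 2) (a + 1 / 2) (p - b - 1 / 2) : ℝ) : ℂ) = fCm q a b p := by
  rw [Cm, eps_eq, fCm]
  split_ifs with hp
  -- The argument p - 1 of the first root must be nonnegative, and an odd p ≥ 0 is at least 1.
  · have : 1 ≤ p := by rcases hp with ⟨c, hc⟩; omega
    rw [Complex.ofReal_neg, neg_div, neg_inj, link_div hq0 hq1 (n := 2 * a + p + 2) (p - 1) (2 * b + 1 - p)
      (2 * a + 2 * b + 3) (by omega) (by omega)]
    · ring
    all_goals
      push_cast
      ring
  · rw [Complex.ofReal_neg, neg_div, neg_inj, link_div hq0 hq1 (n := 2 * a + p + 1) (p) (2 * b - p)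
      (2 * a + 2 * b + 3) (by omega) (by omega)]
    · ring
    all_goals
      push_cast
      ring

theorem Hp_eq {q : ℝ} (hq0 : 0 < q) (hq1 : q < 1) {a b p : ℤ} (ha : 0 ≤ a) (h0 : 0 ≤ p) (h1 : p ≤ 2 * b + 1) :
    ((Hp q (a + b + 1 / 2) (a + 1 / 2) (p - b - 1 / 2) : ℝ) : ℂ) = fHp q a b p := by
  rw [Hp, eps_eq, fHp]
  split_ifs with hp
  · rw [link_div hq0 hq1 (n := 2 * a + p + 2) (2 * a + 2 * b + 4 - p) (p + 1) (2 * a + 2 * b + 5) (by omega) (by omega)]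
    · ring
    all_goals
      push_cast
      ring
  · rw [link_div hq0 hq1 (n := p) (2 * b + 2 - p) (2 * a + p + 3) (2 * a + 2 * b + 5) (by omega) (by omega)]
    · ring
    all_goals
      push_cast
      ring

theorem Dp_eq {q : ℝ} (hq0 : 0 < q) (hq1 : q < 1) {a b p : ℤ} (ha : 0 ≤ a) (h0 : 0 ≤ p) (h1 : p ≤ 2 * b + 1) :
    ((Dp q (a + b + 1 / 2) (a + 1 / 2) (p - b - 1 / 2) : ℝ) : ℂ) = fDp q a b p := by
  rw [Dp, eps_eq, fDp]
  split_ifs with hp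
  · rw [link_div hq0 hq1 (n := 0) (2 * a + p + 4) (p + 1) (2 * a + 2 * b + 5) (by omega) (by omega)]
    · rw [zpow_zero, one_mul]
    all_goals
      push_cast
      ring
  · rw [link_div hq0 hq1 (n := 0) (2 * a + p + 3) (p + 2) (2 * a + 2 * b + 5) (by omega) (by omega)]
    · rw [zpow_zero, one_mul]
    all_goals
      push_cast
      ring

theorem Dm_eq {q : ℝ} (hq0 : 0 < q) (hq1 : q < 1) {a b p : ℤ} (ha : 0 ≤ a) (h1 : p ≤ 2 * b) :
    ((Dm q (a + b + 1 / 2) (a + 1 / 2) (p - b - 1 / 2) : ℝ) : ℂ) = fDm q a b p := by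

  rw [Dm, eps_eq, fDm]
  split_ifs with hp
  · rw [Complex.ofReal_neg, neg_div, neg_inj, link_div hq0 hq1 (n := 2 * a + 2 * p + 3) (2 * b + 1 - p) (2 * a + 2 * b + 2 - p)
      (2 * a + 2 * b + 3) (by omega) (by omega)]
    all_goals
      push_cast
      ring
  · rw [Complex.ofReal_neg, neg_div, neg_inj, link_div hq0 hq1 (n := 2 * a + 2 * p + 3) (2 * b - p) (2 * a + 2 * b + 3 - p)
      (2 * a + 2 * b + 3) (by omega) (by omega)]
    all_goals
      push_cast
      ring

theorem D0_eq {q : ℝ} (hq0 : 0 < q) (hq1 : q < 1) {a b p : ℤ} (ha : 0 ≤ a) (h0 : 0 ≤ p) (h1 : p ≤ 2 * b + 1) :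
    ((D0 q (a + b + 1 / 2) (a + 1 / 2) (p - b - 1 / 2) : ℝ) : ℂ) = fD0 q a b p := by
  rw [D0, eps_eq, fD0, ← br_two_mul hq0 hq1]
  split_ifs with hp
  · rw [mul_assoc, Complex.ofReal_mul, link_div_mul hq0 hq1 (n := 4 * a + 2 * b + p + 7)
      (2 * b + 1 - p) (p + 1) (2 * a + 2 * b + 3) (2 * a + 2 * b + 5) (by omega) (by omega)]
    · ring
    all_goals
      push_cast
      ring
  · rw [mul_assoc, Complex.ofReal_mul, link_div_mul hq0 hq1 (n := 2 * a + 2 * b + p + 5)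
      (2 * a + 2 * b + 3 - p) (2 * a + p + 3) (2 * a + 2 * b + 3) (2 * a + 2 * b + 5) (by omega) (by omega)]
    · ring
    all_goals
      push_cast
      ring

theorem br_neg (q x : ℝ) : br q (-x) = -br q x := by
  rw [br, br, neg_neg, ← neg_div, neg_sub]

theorem C0_eq {q : ℝ} (hq0 : 0 < q) (hq1 : q < 1) {a b p : ℤ} (ha : 0 ≤ a) (h0 : 0 ≤ p) (h1 : p ≤ 2 * b + 1) :
    ((C0 q (a + b + 1 / 2) (a + 1 / 2) (p - b - 1 / 2) : ℝ) : ℂ) = fC0 q a b p := by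
  rw [C0, eps_eq, fC0, ← br_two_mul hq0 hq1]
  split_ifs with hp
  · rw [mul_assoc, Complex.ofReal_mul, link_div_mul hq0 hq1 (n := 4 * a + 2 * b + 2 * p + 6)
      (2 * a + 2 * b + 4 - p) (2 * b + 1 - p) (2 * a + 2 * b + 3) (2 * a + 2 * b + 5) (by omega) (by omega)]
    · norm_num1
      ring
    all_goals
      push_cast
      ring
  -- For even p the prefactor is [4ε] = [-2] = -[2], which is the sign in the formal coefficient.
  · rw [mul_assoc, Complex.ofReal_mul, link_div_mul hq0 hq1 (n := 2 * a + 2 * b + 3)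
      (2 * a + p + 3) p (2 * a + 2 * b + 3) (2 * a + 2 * b + 5) (by omega) (by omega),
      show (4 : ℝ) * -(1 / 2) = -2 by norm_num, br_neg, Complex.ofReal_neg]
    · ring
    all_goals
      push_cast
      ring

theorem br_mul_br {q : ℝ} (hq0 : 0 < q) {x y : ℝ} (i j : ℤ) (hx : x = i) (hy : y = j) :
    br q x * br q y = q ^ (-(i + j)) * (btr q i * btr q j) / (q⁻¹ - q) ^ 2 := by
  subst hx hy
  rw [br_eq hq0, br_eq hq0, neg_add, zpow_add₀ hq0.ne', ← Int.cast_neg, ← Int.cast_neg,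
    Real.rpow_intCast, Real.rpow_intCast]
  generalize q⁻¹ - q = K
  ring

theorem sub_div_helper {q : ℝ} (hq0 : 0 < q) (hq1 : q < 1) {x y z : ℤ} (n m : ℤ) {A B C : ℝ}
    (hn : n = x - z) (hm : m = y - z - 2) :
    (q ^ x * A / (q⁻¹ - q) ^ 2 - q ^ (-2 : ℤ) * (q ^ y * B / (q⁻¹ - q) ^ 2)) /
      (q ^ z * C / (q⁻¹ - q) ^ 2) = (q ^ n * A - q ^ m * B) / C := by
  have hq := hq0.ne'
  have h3 := (inv_sub_pos hq0 hq1).ne'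
  have hz := zpow_ne_zero z hq
  rw [hn, hm, zpow_sub₀ hq, zpow_sub₀ hq, zpow_sub₀ hq, zpow_neg, zpow_ofNat]
  generalize q⁻¹ - q = K at *
  field_simp

theorem H0_eq {q : ℝ} (hq0 : 0 < q) (hq1 : q < 1) {a b p : ℤ} :
    ((H0 q (a + b + 1 / 2) (a + 1 / 2) (p - b - 1 / 2) : ℝ) : ℂ) = fH0 q a b p := by
  have hq := hq0.ne'
  have h3 := inv_sub_pos hq0 hq1
  rw [H0, eps_eq, fH0, show (-2 : ℝ) = ((-2 : ℤ) : ℝ) by norm_num, Real.rpow_intCast]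
  split_ifs with hp
  · rw [mul_assoc, br_mul_br hq0 (2 * b + 1 - p) (p + 1), br_mul_br hq0 (2 * a + 2 * b + 4 - p) (2 * a + p + 2),
      br_mul_br hq0 (2 * a + 2 * b + 3) (2 * a + 2 * b + 5), sub_div_helper hq0 hq1 (4 * a + 2 * b + 6) (2 * b)]
    · simp only [bt_eq_btr]
      push_cast
      ring
    all_goals first | omega | (push_cast; ring)
  · rw [mul_assoc, br_mul_br hq0 (2 * a + 2 * b + 3 - p) (2 * a + p + 3), br_mul_br hq0 (2 * b + 2 - p) (p),
      br_mul_br hq0 (2 * a + 2 * b + 3) (2 * a + 2 * b + 5), sub_div_helper hq0 hq1 (2 * b + 2) (4 * a + 2 * b + 4)]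
    · simp only [bt_eq_btr]
      push_cast
      ring
    all_goals first | omega | (push_cast; ring)

theorem nb_eq {q : ℝ} (n : ℤ) : nb q n = (br q n : ℝ) := by
  rw [nb, br, ← Int.cast_neg, Real.rpow_intCast, Real.rpow_intCast]
  push_cast
  rw [zpow_neg]

theorem sn_eq_sqrt {q : ℝ} (hq0 : 0 < q) (hq1 : q < 1) {n : ℤ} (hn : 0 ≤ n) :
    sn q n = (√(br q n) : ℝ) := by
  rw [sn, nb_eq, Real.sqrt_eq_rpow,
    Complex.ofReal_cpow (br_nonneg hq0 hq1 (by exact_mod_cast hn))]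
  norm_num

theorem sqrt_br_br {q : ℝ} (hq0 : 0 < q) (hq1 : q < 1) {x y : ℝ} (i j : ℤ) (hi : 0 ≤ i)
    (hj : 0 ≤ j) (hx : x = i) (hy : y = j) :
    ((√(br q x * br q y) : ℝ) : ℂ) = sn q i * sn q j := by
  subst hx hy
  rw [sn_eq_sqrt hq0 hq1 hi, sn_eq_sqrt hq0 hq1 hj,
    Real.sqrt_mul (br_nonneg hq0 hq1 (by exact_mod_cast hi)), Complex.ofReal_mul]

theorem sqrt_br_br_div {q : ℝ} (hq0 : 0 < q) (hq1 : q < 1) {x y z w : ℝ} (i j k : ℤ) (hi : 0 ≤ i)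
    (hj : 0 ≤ j) (hk : 0 ≤ k) (hx : x = i) (hy : y = j) (hz : z = k) (hw : w = k) :
    ((√(br q x * br q y / (br q z * br q w)) : ℝ) : ℂ) = sn q i * sn q j / nb q k := by
  rw [hz, hw, Real.sqrt_div' _ (mul_self_nonneg _), Real.sqrt_mul_self
    (br_nonneg hq0 hq1 (by exact_mod_cast hk)), Complex.ofReal_div, nb_eq,
    sqrt_br_br hq0 hq1 i j hi hj hx hy]

theorem nb_two {q : ℝ} : nb q 2 = ((br q 2 : ℝ) : ℂ) := by
  rw [nb_eq]
  norm_num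

theorem al_eq {q : ℝ} (hq0 : 0 < q) (hq1 : q < 1) {a b p : ℤ} (ha : 0 ≤ a) (h0 : 0 ≤ p)
    (h1 : p ≤ 2 * b) :
    ((al q (a + b + 1 / 2) (a + 1 / 2) (p - b - 1 / 2) : ℝ) : ℂ) = fal q a b p := by
  rw [al, eps_eq, fal, nb_two]
  split_ifs with hp
  · rw [Complex.ofReal_mul, abs_of_pos (by norm_num), sqrt_br_br_div hq0 hq1 (2 * b + 1 - p)
      (2 * a + p + 4) (2 * a + 3) (by omega) (by omega) (by omega)]
    · push_cast
      ring
    all_goals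
      push_cast
      ring
  · rw [Complex.ofReal_mul, abs_of_neg (by norm_num), sqrt_br_br_div hq0 hq1 (2 * b - p)
      (2 * a + p + 3) (2 * a + 3) (by omega) (by omega) (by omega)]
    · push_cast
      ring
    all_goals
      push_cast
      ring

theorem bl_eq {q : ℝ} (hq0 : 0 < q) (hq1 : q < 1) {a b p : ℤ} (ha : 0 ≤ a) (h0 : 0 ≤ p)
    (h1 : p ≤ 2 * b + 1) :
    ((bl q (a + b + 1 / 2) (a + 1 / 2) (p - b - 1 / 2) : ℝ) : ℂ) = fbl q a b p := by
  have e1 : 2 * ((a : ℝ) + 1 / 2) = ((2 * a + 1 : ℤ) : ℝ) := by push_cast; ring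
  have e2 : ((2 * a + 1 : ℤ) : ℝ) + 2 = ((2 * a + 3 : ℤ) : ℝ) := by push_cast; ring
  rw [bl, eps_eq, fbl, e1, e2, nb_eq, nb_eq]
  split_ifs with hp
  · rw [abs_of_pos (by norm_num), Complex.ofReal_mul, Complex.ofReal_div, sqrt_br_br hq0 hq1
      (2 * b + 1 - p) (p + 1) (by omega) (by omega)]
    · push_cast
      ring
    all_goals
      push_cast
      ring
  · rw [abs_of_neg (by norm_num), Complex.ofReal_mul, Complex.ofReal_div, sqrt_br_br hq0 hq1
      (2 * a + 2 * b + 3 - p) (2 * a + p + 3) (by omega) (by omega)]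
    · push_cast
      ring
    all_goals
      push_cast
      ring

theorem cl_eq {q : ℝ} (hq0 : 0 < q) (hq1 : q < 1) {a b p : ℤ} (ha : 0 ≤ a) (h0 : 0 ≤ p)
    (h1 : p ≤ 2 * b + 1) :
    ((cl q (a + b + 1 / 2) (a + 1 / 2) (p - b - 1 / 2) : ℝ) : ℂ) = fcl q a b p := by
  rw [cl, eps_eq, fcl, nb_two]
  split_ifs with hp
  · rw [Complex.ofReal_mul, abs_of_pos (by norm_num), sqrt_br_br_div hq0 hq1 (p + 1)
      (2 * a + 2 * b + 2 - p) (2 * a + 1) (by omega) (by omega) (by omega)]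
    · push_cast
      ring
    all_goals
      push_cast
      ring
  · rw [Complex.ofReal_mul, abs_of_neg (by norm_num), sqrt_br_br_div hq0 hq1 (p + 2)
      (2 * a + 2 * b + 3 - p) (2 * a + 1) (by omega) (by omega) (by omega)]
    · push_cast
      ring
    all_goals
      push_cast
      ring

/-! ### Integer coordinates of the labels -/

/-- The coordinates `a = j - 1/2`, `u = j + m₁`, `b = l - j`, `p = l + 1/2 - j + m₂`. -/
@[ext]
structure Pt where
  a : ℤ
  u : ℤ
  b : ℤ
  p : ℤ

namespace Pt

instance : DecidableEq Pt := fun x y =>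
  decidable_of_iff (x.a = y.a ∧ x.u = y.u ∧ x.b = y.b ∧ x.p = y.p) Pt.ext_iff.symm

instance : Add Pt := ⟨fun x y => ⟨x.a + y.a, x.u + y.u, x.b + y.b, x.p + y.p⟩⟩

instance : Sub Pt := ⟨fun x y => ⟨x.a - y.a, x.u - y.u, x.b - y.b, x.p - y.p⟩⟩

instance : Neg Pt := ⟨fun x => ⟨-x.a, -x.u, -x.b, -x.p⟩⟩

instance : Zero Pt := ⟨⟨0, 0, 0, 0⟩⟩

theorem add_def (x y : Pt) : x + y = ⟨x.a + y.a, x.u + y.u, x.b + y.b, x.p + y.p⟩ := rfl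

theorem sub_def (x y : Pt) : x - y = ⟨x.a - y.a, x.u - y.u, x.b - y.b, x.p - y.p⟩ := rfl

theorem neg_def (x : Pt) : -x = ⟨-x.a, -x.u, -x.b, -x.p⟩ := rfl

theorem zero_def : (0 : Pt) = ⟨0, 0, 0, 0⟩ := rfl

instance : AddCommGroup Pt where
  add_assoc x y z := by simp [add_def, add_assoc]
  zero_add x := by simp [add_def, zero_def]
  add_zero x := by simp [add_def, zero_def]
  add_comm x y := by simp [add_def, add_comm]
  neg_add_cancel x := by simp [add_def, neg_def, zero_def]
  sub_eq_add_neg x y := by simp [add_def, sub_def, neg_def, sub_eq_add_neg]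
  nsmul := nsmulRec
  zsmul := zsmulRec

/-- The coordinates belong to a label. -/
def Adm (x : Pt) : Prop := 0 ≤ x.u ∧ x.u ≤ 2 * x.a + 1 ∧ 0 ≤ x.p ∧ x.p ≤ 2 * x.b + 1

instance (x : Pt) : Decidable x.Adm := by
  unfold Adm
  infer_instance

/-- The conditions a ≥ 0 and b ≥ 0 need no separate mention: they follow from 0 ≤ 2a+1 and 0 ≤ 2b+1
for integers. -/
theorem admissible_iff (x : Pt) :
    Admissible (x.a + x.b + 1 / 2) (x.u - x.a - 1 / 2) (x.p - x.b - 1 / 2) (x.a + 1 / 2) ↔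
      x.Adm := by
  obtain ⟨a, u, b, p⟩ := x
  simp only [Adm]
  constructor
  · rintro ⟨⟨n, hn⟩, ⟨n', hn'⟩, h, ⟨k, hk⟩, ⟨k', hk'⟩⟩
    have hk0 : |(u : ℝ) - a - 1 / 2| ≤ a + 1 / 2 := by
      have : (0 : ℝ) ≤ k := k.cast_nonneg
      linarith
    have hk0' : |(p : ℝ) - b - 1 / 2| ≤ b + 1 / 2 := by
      have : (0 : ℝ) ≤ k' := k'.cast_nonneg
      linarith
    rw [abs_le] at hk0 hk0'
    have e1 : (0 : ℝ) ≤ u := by linarith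
    have e2 : (u : ℝ) ≤ 2 * a + 1 := by linarith
    have e3 : (0 : ℝ) ≤ p := by linarith
    have e4 : (p : ℝ) ≤ 2 * b + 1 := by linarith
    exact ⟨by exact_mod_cast e1, by exact_mod_cast e2, by exact_mod_cast e3, by exact_mod_cast e4⟩
  · rintro ⟨h1, h2, h3, h4⟩
    -- The quantity is min(w, 2c+1-w). It is applied to (a, u) for m₁ and to (b, p) for m₂.
    have key (c w : ℤ) (h0 : 0 ≤ w) (h1 : w ≤ 2 * c + 1) :
        ∃ n : ℕ, (c : ℝ) + 1 / 2 - |(w : ℝ) - c - 1 / 2| = n := by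
      rcases le_or_gt w c with h | h
      · obtain ⟨n, hn⟩ := Int.eq_ofNat_of_zero_le h0
        have h' : (w : ℝ) ≤ c := by exact_mod_cast h
        refine ⟨n, ?_⟩
        rw [abs_of_nonpos (by linarith), hn]
        push_cast
        ring
      · obtain ⟨n, hn⟩ := Int.eq_ofNat_of_zero_le (a := 2 * c + 1 - w) (by omega)
        have h' : (c : ℝ) + 1 ≤ w := by exact_mod_cast h
        have hn' : (2 * c + 1 - w : ℝ) = n := by exact_mod_cast hn
        refine ⟨n, ?_⟩
        rw [abs_of_nonneg (by linarith), ← hn']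
        ring
    obtain ⟨n, hn⟩ := Int.eq_ofNat_of_zero_le (a := a) (by omega)
    obtain ⟨k, hk⟩ := Int.eq_ofNat_of_zero_le (a := b) (by omega)
    obtain ⟨k', hk'⟩ := key b p h3 h4
    refine ⟨⟨n + k, ?_⟩, ⟨n, ?_⟩, ?_, key a u h1 h2, ⟨k', ?_⟩⟩
    · rw [hn, hk]
      push_cast
      ring
    · rw [hn]
      push_cast
      ring
    · rw [hk]
      push_cast
      have : (0 : ℝ) ≤ k := k.cast_nonneg
      linarith
    · rw [← hk']
      ring

/-- The label with given coordinates. -/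
def label (s : ℤˣ) (x : Pt) (h : x.Adm) : Label :=
  ⟨s, x.a + x.b + 1 / 2, x.u - x.a - 1 / 2, x.p - x.b - 1 / 2, x.a + 1 / 2, x.admissible_iff.2 h⟩

end Pt

theorem Label.exists_pt (i : Label) : ∃ (x : Pt) (h : x.Adm), i = x.label i.s h := by
  obtain ⟨s, l, m₁, m₂, j, h⟩ := i
  obtain ⟨⟨n, hn⟩, ⟨k, hk⟩, hle, ⟨c, hc⟩, ⟨d, hd⟩⟩ := id h
  have e1 : ∃ u : ℤ, m₁ = u - (k : ℤ) - 1 / 2 := by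
    rcases abs_cases m₁ with ⟨e, -⟩ | ⟨e, -⟩
    · exact ⟨2 * k + 1 - c, by push_cast; linarith⟩
    · exact ⟨c, by push_cast; linarith⟩
  have e2 : ∃ p : ℤ, m₂ = p - ((n - k : ℤ) : ℝ) - 1 / 2 := by
    rcases abs_cases m₂ with ⟨e, -⟩ | ⟨e, -⟩
    · exact ⟨2 * (n - k) + 1 - d, by push_cast; linarith⟩
    · exact ⟨d, by push_cast; linarith⟩
  obtain ⟨u, hu⟩ := e1
  obtain ⟨p, hp⟩ := e2
  have el : l = ((k : ℤ) : ℝ) + ((n - k : ℤ) : ℝ) + 1 / 2 := by push_cast; linarith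
  have ej : j = ((k : ℤ) : ℝ) + 1 / 2 := by push_cast; linarith
  subst hu hp el ej
  exact ⟨⟨k, u, n - k, p⟩, (Pt.admissible_iff ⟨k, u, n - k, p⟩).1 h, rfl⟩

/-- The coordinates of a label. -/
def Label.pt (i : Label) : Pt := i.exists_pt.choose

theorem Label.pt_adm (i : Label) : i.pt.Adm := i.exists_pt.choose_spec.choose

theorem Label.label_pt (i : Label) : i.pt.label i.s i.pt_adm = i :=
  i.exists_pt.choose_spec.choose_spec.symm

theorem Pt.label_inj {s t : ℤˣ} {x y : Pt} {hx : x.Adm} {hy : y.Adm} :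
    x.label s hx = y.label t hy ↔ s = t ∧ x = y := by
  constructor
  · intro h
    simp only [Pt.label, Label.mk.injEq] at h
    obtain ⟨hs, h1, h2, h3, h4⟩ := h
    have ea : (x.a : ℝ) = y.a := by linarith
    have eb : (x.b : ℝ) = y.b := by linarith
    have eu : (x.u : ℝ) = y.u := by linarith
    have ep : (x.p : ℝ) = y.p := by linarith
    exact ⟨hs, Pt.ext (by exact_mod_cast ea) (by exact_mod_cast eu) (by exact_mod_cast eb)
      (by exact_mod_cast ep)⟩
  · rintro ⟨rfl, rfl⟩
    rfl

theorem Pt.pt_label (s : ℤˣ) (x : Pt) (h : x.Adm) : (x.label s h).pt = x :=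
  (Pt.label_inj.1 (x.label s h).label_pt).2

theorem Label.ext_pt {i k : Label} (hs : i.s = k.s) (h : i.pt = k.pt) : i = k := by
  rw [← i.label_pt, ← k.label_pt]
  exact Pt.label_inj.2 ⟨hs, h⟩

theorem Label.l_eq (i : Label) : i.l = i.pt.a + i.pt.b + 1 / 2 :=
  (congrArg Label.l i.label_pt).symm

/-- The basis vector with given coordinates. -/
def kt (s : ℤˣ) (x : Pt) : H :=
  ket s (x.a + x.b + 1 / 2) (x.u - x.a - 1 / 2) (x.p - x.b - 1 / 2) (x.a + 1 / 2)

/-- Valid for all lattice points: the coordinates of a label always lie in the region, so for other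
x the condition never holds, in accordance with the convention that the vector is zero. -/
theorem kt_apply (s : ℤˣ) (x : Pt) (i : Label) :
    kt s x i = if i.s = s ∧ i.pt = x then 1 else 0 := by
  classical
  by_cases h : x.Adm
  · rw [kt, ket_apply (x.admissible_iff.2 h)]
    have : (i = ⟨s, x.a + x.b + 1 / 2, x.u - x.a - 1 / 2, x.p - x.b - 1 / 2, x.a + 1 / 2,
        x.admissible_iff.2 h⟩) ↔ (i.s = s ∧ i.pt = x) := by
      change i = x.label s h ↔ _
      constructor
      · rintro rfl
        exact ⟨rfl, x.pt_label s h⟩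
      · rintro ⟨rfl, rfl⟩
        exact i.label_pt.symm
    simp only [this]
  · rw [kt, ket, dif_neg (mt x.admissible_iff.1 h), if_neg]
    · rfl
    · rintro ⟨-, rfl⟩
      exact h i.pt_adm

theorem kt_eq_zero {s : ℤˣ} {x : Pt} (h : ¬x.Adm) : kt s x = 0 := by
  rw [kt, ket, dif_neg (mt x.admissible_iff.1 h)]

theorem kt_label [DecidableEq Label] (i : Label) : kt i.s i.pt = lp.single 2 i (1 : ℂ) := by
  ext k
  rw [kt_apply, lp.coeFn_single, Pi.single_apply]
  congr 1
  rw [eq_iff_iff]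
  exact ⟨fun h => Label.ext_pt h.1 h.2, fun h => by rw [h]; exact ⟨rfl, rfl⟩⟩

theorem ket_eq_kt {s : ℤˣ} {l m₁ m₂ j : ℝ} (x : Pt) (hl : l = x.a + x.b + 1 / 2)
    (hm₁ : m₁ = x.u - x.a - 1 / 2) (hm₂ : m₂ = x.p - x.b - 1 / 2) (hj : j = x.a + 1 / 2) :
    ket s l m₁ m₂ j = kt s x := by
  rw [kt, hl, hm₁, hm₂, hj]

theorem Admissible.exists_pt {l m₁ m₂ j : ℝ} (h : Admissible l m₁ m₂ j) :
    ∃ x : Pt, x.Adm ∧ l = x.a + x.b + 1 / 2 ∧ m₁ = x.u - x.a - 1 / 2 ∧ m₂ = x.p - x.b - 1 / 2 ∧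
      j = x.a + 1 / 2 := by
  obtain ⟨x, hx, e⟩ := Label.exists_pt ⟨1, l, m₁, m₂, j, h⟩
  simp only [Pt.label, Label.mk.injEq] at e
  exact ⟨x, hx, e.2⟩

theorem inner_kt_left (s : ℤˣ) (x : Pt) (h : x.Adm) (v : H) :
    ⟪kt s x, v⟫_ℂ = v (x.label s h) := by
  classical
  have e : kt s x = lp.single 2 (x.label s h) (1 : ℂ) := by
    rw [← kt_label, x.pt_label]
    rfl
  rw [e, lp.inner_single_left]
  simp

theorem clm_ext {E : Type*} [AddCommMonoid E] [Module ℂ E] [TopologicalSpace E] [T2Space E]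
    {T T' : H →L[ℂ] E} (h : ∀ s x, Pt.Adm x → T (kt s x) = T' (kt s x)) : T = T' := by
  classical
  refine lp.ext_continuousLinearMap (by simp) fun i => ?_
  ext
  have := h i.s i.pt i.pt_adm
  rw [kt_label] at this
  exact this

theorem orthonormal_kt : Orthonormal ℂ fun i : Label => kt i.s i.pt := by
  classical
  rw [orthonormal_iff_ite]
  intro i k
  rw [inner_kt_left _ _ i.pt_adm, i.label_pt, kt_apply]
  congr 1
  rw [eq_iff_iff]
  exact ⟨fun h => Label.ext_pt h.1 h.2, fun h => by rw [h]; exact ⟨rfl, rfl⟩⟩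

theorem M_eq_span : Submodule.span ℂ (Set.range fun i : Label => kt i.s i.pt) = M := by
  apply le_antisymm
  · rw [Submodule.span_le]
    rintro _ ⟨i, rfl⟩
    exact Submodule.subset_span ⟨_, _, _, _, _, rfl⟩
  · rw [M, Submodule.span_le]
    rintro _ ⟨s, l, m₁, m₂, j, rfl⟩
    by_cases h : Admissible l m₁ m₂ j
    · obtain ⟨x, hx, h1, h2, h3, h4⟩ := h.exists_pt
      refine Submodule.subset_span ⟨x.label s hx, ?_⟩
      rw [ket_eq_kt x h1 h2 h3 h4]
      change kt s (x.label s hx).pt = _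
      rw [x.pt_label]
    · rw [ket, dif_neg h]
      exact Submodule.zero_mem _

/-- The basis of `M`. -/
def basisM : Module.Basis Label ℂ M :=
  (Module.Basis.span orthonormal_kt.linearIndependent).map (LinearEquiv.ofEq _ _ M_eq_span)

theorem coe_basisM (i : Label) : (basisM i : H) = kt i.s i.pt := by
  rw [basisM, Module.Basis.map_apply, LinearEquiv.coe_ofEq_apply, Module.Basis.span_apply]

/-- The basis vector with given coordinates, as an element of `M`. -/
def mkt (s : ℤˣ) (x : Pt) : M := ⟨kt s x, Submodule.subset_span ⟨_, _, _, _, _, rfl⟩⟩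

theorem coe_mkt (s : ℤˣ) (x : Pt) : (mkt s x : H) = kt s x := rfl

theorem mkt_eq_zero {s : ℤˣ} {x : Pt} (h : ¬x.Adm) : mkt s x = 0 := Subtype.ext (kt_eq_zero h)

theorem mkt_label (i : Label) : mkt i.s i.pt = basisM i := Subtype.ext (coe_basisM i).symm

theorem mkt_eq_basisM (s : ℤˣ) (x : Pt) (h : x.Adm) : mkt s x = basisM (x.label s h) := by
  rw [← mkt_label, x.pt_label]
  rfl

theorem M_ext {σ : ℂ →+* ℂ} {E : Type*} [AddCommMonoid E] [Module ℂ E] {f g : M →ₛₗ[σ] E}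
    (h : ∀ s x, Pt.Adm x → f (mkt s x) = g (mkt s x)) : f = g :=
  basisM.ext fun i => by
    rw [← mkt_label]
    exact h i.s i.pt i.pt_adm

/-! ### Bounded weighted shifts -/

/-- Where g does not vanish the map e is injective, so each coordinate of v is used at most once and
the ℓ²-norm grows at most by the factor C. -/
theorem sum_partialPull_le {g : Label → ℂ} {e : Label → Label} {C : ℝ} (hC : 0 ≤ C)
    (hg : ∀ i, ‖g i‖ ≤ C) (he : Set.InjOn e {i | g i ≠ 0}) (v : H) (s : Finset Label) :
    ∑ i ∈ s, ‖g i * v (e i)‖ ^ (2 : ℝ≥0∞).toReal ≤ (C * ‖v‖) ^ (2 : ℝ≥0∞).toReal := by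
  classical
  have h2 : 0 < (2 : ℝ≥0∞).toReal := by norm_num
  have h1 : ∑ i ∈ s, ‖g i * v (e i)‖ ^ (2 : ℝ≥0∞).toReal =
      ∑ i ∈ s with g i ≠ 0, ‖g i * v (e i)‖ ^ (2 : ℝ≥0∞).toReal := by
    rw [Finset.sum_filter_of_ne]
    intro i _ h hi
    simp [hi] at h
  have he' : Set.InjOn e ↑(s.filter fun i => g i ≠ 0) := fun i hi k hk h =>
    he (Finset.mem_filter.1 hi).2 (Finset.mem_filter.1 hk).2 h
  calc
    _ ≤ ∑ i ∈ s with g i ≠ 0, C ^ (2 : ℝ≥0∞).toReal * ‖v (e i)‖ ^ (2 : ℝ≥0∞).toReal := by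
      rw [h1]
      refine Finset.sum_le_sum fun i _ => ?_
      rw [← Real.mul_rpow hC (norm_nonneg _), norm_mul]
      exact Real.rpow_le_rpow (by positivity)
        (mul_le_mul_of_nonneg_right (hg i) (norm_nonneg _)) h2.le
    _ = C ^ (2 : ℝ≥0∞).toReal *
        ∑ k ∈ (s.filter fun i => g i ≠ 0).image e, ‖v k‖ ^ (2 : ℝ≥0∞).toReal := by
      rw [Finset.sum_image he', Finset.mul_sum]
    _ ≤ C ^ (2 : ℝ≥0∞).toReal * ‖v‖ ^ (2 : ℝ≥0∞).toReal :=
      mul_le_mul_of_nonneg_left (lp.sum_rpow_le_norm_rpow h2 v _) (by positivity)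
    _ = _ := (Real.mul_rpow hC (norm_nonneg _)).symm

/-- The bounded operator `v ↦ (i ↦ g i * v (e i))`. -/
def partialPull (g : Label → ℂ) (e : Label → Label) (C : ℝ) (hC : 0 ≤ C) (hg : ∀ i, ‖g i‖ ≤ C)
    (he : Set.InjOn e {i | g i ≠ 0}) : H →L[ℂ] H :=
  LinearMap.mkContinuous
    { toFun := fun v => ⟨fun i => g i * v (e i), memℓp_gen' (sum_partialPull_le hC hg he v)⟩
      map_add' := fun v w => by
        ext i
        exact mul_add _ _ _
      map_smul' := fun c v => by
        ext i
        simp [mul_left_comm] }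
    C fun v => lp.norm_le_of_forall_sum_le (by norm_num) (by positivity)
      (sum_partialPull_le hC hg he v)

theorem partialPull_apply (g : Label → ℂ) (e : Label → Label) (C : ℝ) (hC : 0 ≤ C)
    (hg : ∀ i, ‖g i‖ ≤ C) (he : Set.InjOn e {i | g i ≠ 0}) (v : H) (i : Label) :
    partialPull g e C hC hg he v i = g i * v (e i) := rfl

/-- Coefficients that are bounded on the labels. -/
def Bdd (f : ℤˣ → Pt → ℂ) : Prop := ∃ C : ℝ, ∀ s x, x.Adm → ‖f s x‖ ≤ C

theorem Bdd.exists_nonneg {f : ℤˣ → Pt → ℂ} (hf : Bdd f) :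
    ∃ C : ℝ, 0 ≤ C ∧ ∀ s x, x.Adm → ‖f s x‖ ≤ C :=
  let ⟨C, hC⟩ := hf
  ⟨max C 0, le_max_right _ _, fun s x hx => (hC s x hx).trans (le_max_left _ _)⟩

theorem exists_weightedShift {f : ℤˣ → Pt → ℂ} (hf : Bdd f) (d : Pt) (t : ℤˣ) :
    ∃ T : H →L[ℂ] H, ∀ v i, T v i = if h : (i.pt - d).Adm then
      f (t * i.s) (i.pt - d) * v ((i.pt - d).label (t * i.s) h) else 0 := by
  obtain ⟨C, hC, hf⟩ := hf.exists_nonneg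
  refine ⟨partialPull (fun i => if (i.pt - d).Adm then f (t * i.s) (i.pt - d) else 0)
    -- The preimage of the label i has sign t * i.s because t² = 1. The value `i` in the other case
    -- is a dummy, since the weight vanishes there.
    (fun i => if h : (i.pt - d).Adm then (i.pt - d).label (t * i.s) h else i) C hC ?_ ?_, ?_⟩
  · intro i
    split_ifs with h
    · exact hf _ _ h
    · simpa using hC
  · intro i hi k hk h
    have hi' : (i.pt - d).Adm := by
      by_contra h'
      simp [h'] at hi
    have hk' : (k.pt - d).Adm := by
      by_contra h'
      simp [h'] at hk
    simp only [hi', hk', dif_pos, Pt.label_inj] at h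
    exact Label.ext_pt (mul_left_cancel h.1) (sub_left_injective h.2)
  · intro v i
    refine (partialPull_apply _ _ C hC _ _ v i).trans ?_
    by_cases h : (i.pt - d).Adm
    · simp only [h, if_pos, dif_pos]
    · simp only [h, if_neg, dif_neg, not_false_eq_true, zero_mul]

open Classical in
/-- The bounded operator sending `kt s x` to `f s x • kt (t * s) (x + d)`; it is zero if the
coefficients are unbounded. -/
def wsh (f : ℤˣ → Pt → ℂ) (d : Pt) (t : ℤˣ) : H →L[ℂ] H :=
  if hf : Bdd f then (exists_weightedShift hf d t).choose else 0

theorem wsh_apply {f : ℤˣ → Pt → ℂ} (hf : Bdd f) (d : Pt) (t : ℤˣ) (v : H) (i : Label) :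
    wsh f d t v i = if h : (i.pt - d).Adm then
      f (t * i.s) (i.pt - d) * v ((i.pt - d).label (t * i.s) h) else 0 := by
  rw [wsh, dif_pos hf]
  exact (exists_weightedShift hf d t).choose_spec v i

theorem wsh_kt {f : ℤˣ → Pt → ℂ} (hf : Bdd f) (d : Pt) (t : ℤˣ) (s : ℤˣ) {x : Pt} (hx : x.Adm) :
    wsh f d t (kt s x) = f s x • kt (t * s) (x + d) := by
  ext i
  rw [wsh_apply hf, lp.coeFn_smul, Pi.smul_apply, kt_apply, smul_eq_mul]
  have ht (s s' : ℤˣ) : t * s = s' ↔ s = t * s' := by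
    rw [← mul_right_inj t, ← mul_assoc, Int.units_mul_self, one_mul]
  split_ifs with h h'
  · have e1 : t * i.s = s := (ht _ _).2 h'.1
    have e2 : i.pt - d = x := sub_eq_iff_eq_add.2 h'.2
    rw [kt_apply, Pt.pt_label, if_pos ⟨e1, e2⟩, e1]
    simp only [e2]
  · rw [kt_apply, Pt.pt_label, if_neg, mul_zero, mul_zero]
    rintro ⟨h1, h2⟩
    exact h' ⟨(ht _ _).1 h1, sub_eq_iff_eq_add.1 h2⟩
  · rename_i h'
    rw [h'.2, add_sub_cancel_right] at h
    exact absurd hx h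
  · rw [mul_zero]

theorem inner_kt_kt (s t : ℤˣ) {x y : Pt} (hx : x.Adm) :
    ⟪kt s x, kt t y⟫_ℂ = if s = t ∧ x = y then 1 else 0 := by
  rw [inner_kt_left _ _ hx, kt_apply, Pt.pt_label]
  rfl

theorem adjoint_ext {T T' : H →L[ℂ] H} (h : ∀ s x t y, Pt.Adm x → Pt.Adm y →
    ⟪T (kt s x), kt t y⟫_ℂ = ⟪kt s x, T' (kt t y)⟫_ℂ) : star T = T' := by
  refine clm_ext fun t y hy => ?_
  ext i
  have h1 := fun v => inner_kt_left i.s i.pt i.pt_adm v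
  rw [i.label_pt] at h1
  rw [← h1, ← h1, ContinuousLinearMap.star_eq_adjoint, ContinuousLinearMap.adjoint_inner_right,
    h _ _ _ _ i.pt_adm hy]

/-! ### Shifts acting on the three spaces -/

/-- A weight and a displacement. -/
structure Sh where
  f : ℤˣ → Pt → ℂ
  d : Pt

namespace Sh

/-- The weight vanishes when the displacement leaves the set of labels. -/
def Stay (t : Sh) : Prop := ∀ s x, Pt.Adm x → ¬(x + t.d).Adm → t.f s x = 0

/-- The two shifts are formally adjoint. -/
def IsTranspose (t t' : Sh) : Prop :=
  t'.d = -t.d ∧ ∀ s x, Pt.Adm x → (x + t.d).Adm → t'.f s (x + t.d) = conj (t.f s x)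

end Sh

/-- The sum of bounded shifts on `H`. -/
def opSum (ts : List Sh) : H →L[ℂ] H := (ts.map fun t => wsh t.f t.d 1).sum

theorem opSum_nil : opSum [] = 0 := rfl

theorem opSum_cons (t : Sh) (ts : List Sh) : opSum (t :: ts) = wsh t.f t.d 1 + opSum ts := rfl

theorem opSum_perm {ts ts' : List Sh} (h : ts.Perm ts') : opSum ts = opSum ts' :=
  (h.map _).sum_eq

theorem opSum_kt {ts : List Sh} (h : ∀ t ∈ ts, Bdd t.f) (s : ℤˣ) {x : Pt} (hx : x.Adm) :
    opSum ts (kt s x) = (ts.map fun t => t.f s x • kt s (x + t.d)).sum := by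
  induction ts with
  | nil => rfl
  | cons t ts ih =>
    rw [opSum_cons, ContinuousLinearMap.add_apply, wsh_kt (h t (by simp)) _ _ _ hx, one_mul,
      ih fun t ht => h t (by simp [ht])]
    rfl

theorem inner_shift (s r : ℤˣ) {x y : Pt} (hx : x.Adm) (hy : y.Adm) {t t' : Sh}
    (h : t.IsTranspose t') :
    ⟪t.f s x • kt s (x + t.d), kt r y⟫_ℂ = ⟪kt s x, t'.f r y • kt r (y + t'.d)⟫_ℂ := by
  rw [inner_smul_left, inner_smul_right, inner_kt_kt _ _ hx, h.1]
  by_cases e : s = r ∧ x + t.d = y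
  · obtain ⟨rfl, rfl⟩ := e
    rw [inner_kt_kt _ _ hy, if_pos ⟨rfl, rfl⟩, if_pos ⟨rfl, by abel⟩, h.2 s x hx hy]
  · by_cases hd : (x + t.d).Adm
    · rw [inner_kt_kt _ _ hd, if_neg e, if_neg, mul_zero, mul_zero]
      rintro ⟨rfl, h'⟩
      exact e ⟨rfl, by rw [h']; abel⟩
    · rw [kt_eq_zero hd, inner_zero_left, if_neg, mul_zero, mul_zero]
      rintro ⟨rfl, h'⟩
      exact hd (by rw [h']; simpa using hy)

theorem star_wsh {t t' : Sh} (ht : Bdd t.f) (ht' : Bdd t'.f) (h : t.IsTranspose t') :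
    star (wsh t.f t.d 1) = wsh t'.f t'.d 1 := by
  refine adjoint_ext fun s x r y hx hy => ?_
  rw [wsh_kt ht _ _ _ hx, wsh_kt ht' _ _ _ hy, one_mul, one_mul, inner_shift s r hx hy h]

theorem star_opSum {ts ts' : List Sh} (h : List.Forall₂ Sh.IsTranspose ts ts')
    (hb : ∀ t ∈ ts, Bdd t.f) (hb' : ∀ t ∈ ts', Bdd t.f) : star (opSum ts) = opSum ts' := by
  induction h with
  | nil => exact star_zero _
  | cons h _ ih =>
    rw [opSum_cons, opSum_cons, star_add, star_wsh (hb _ (by simp)) (hb' _ (by simp)) h,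
      ih (fun t ht => hb t (by simp [ht])) fun t ht => hb' t (by simp [ht])]

/-- The basis vector of the lattice space. -/
def vc (s : ℤˣ) (x : Pt) : Lat := vec s x.a x.u x.b x.p

/-- The sum of shifts on the lattice space. -/
def latSum (ts : List Sh) : Module.End ℂ Lat :=
  latLift fun s a u b p => (ts.map fun t => t.f s ⟨a, u, b, p⟩ • vc s (⟨a, u, b, p⟩ + t.d)).sum

theorem latSum_vc (ts : List Sh) (s : ℤˣ) (x : Pt) :
    latSum ts (vc s x) = (ts.map fun t => t.f s x • vc s (x + t.d)).sum :=
  latLift_vec _ _ _ _ _ _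

theorem lat_map_sum {N : Type*} [AddCommMonoid N] [Module ℂ N] (f : Lat →ₗ[ℂ] N) (l : List Lat) :
    f l.sum = (l.map f).sum := by
  induction l with
  | nil => exact map_zero f
  | cons v l ih => rw [List.sum_cons, map_add, ih, List.map_cons, List.sum_cons]

/-- The projection of the lattice space to `M`. -/
def latToM : Lat →ₗ[ℂ] M := latLift fun s a u b p => mkt s ⟨a, u, b, p⟩

theorem latToM_vc (s : ℤˣ) (x : Pt) : latToM (vc s x) = mkt s x := latLift_vec _ _ _ _ _ _

/-- The inclusion of `M` in the lattice space. -/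
def mToLat : M →ₗ[ℂ] Lat := basisM.constr ℂ fun i => vc i.s i.pt

theorem mToLat_mkt (s : ℤˣ) {x : Pt} (hx : x.Adm) : mToLat (mkt s x) = vc s x := by
  rw [mkt_eq_basisM _ _ hx, mToLat, Module.Basis.constr_basis, x.pt_label]
  rfl

/-- The compression of an operator on the lattice space to `M`. -/
def compr (G : Module.End ℂ Lat) : Module.End ℂ M := latToM ∘ₗ G ∘ₗ mToLat

/-- The operator preserves the subspace `M` of the lattice space. -/
def Pres (G : Module.End ℂ Lat) : Prop := ∀ v, mToLat (latToM (G (mToLat v))) = G (mToLat v)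

/-- Compression would lose the part of G v that lies outside the region; as G leaves the region
invariant, nothing is lost and products are respected. -/
theorem compr_mul (F : Module.End ℂ Lat) {G : Module.End ℂ Lat} (hG : Pres G) :
    compr (F * G) = compr F * compr G := by
  ext1 v
  exact congrArg (fun w => latToM (F w)) (hG v).symm

theorem Pres.mul {F G : Module.End ℂ Lat} (hF : Pres F) (hG : Pres G) : Pres (F * G) := by
  intro v
  change mToLat (latToM (F (G (mToLat v)))) = F (G (mToLat v))
  rw [← hG v, hF]

theorem compr_add (F G : Module.End ℂ Lat) : compr (F + G) = compr F + compr G := by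
  ext1 v
  exact map_add latToM _ _

theorem compr_smul (c : ℂ) (G : Module.End ℂ Lat) : compr (c • G) = c • compr G := by
  ext1 v
  exact map_smul latToM _ _

theorem compr_one : compr 1 = 1 :=
  M_ext fun s x hx => by
    change latToM (mToLat (mkt s x)) = mkt s x
    rw [mToLat_mkt _ hx, latToM_vc]

theorem compr_latSum (ts : List Sh) (s : ℤˣ) {x : Pt} (hx : x.Adm) :
    compr (latSum ts) (mkt s x) = (ts.map fun t => t.f s x • mkt s (x + t.d)).sum := by
  change latToM (latSum ts (mToLat (mkt s x))) = _
  rw [mToLat_mkt _ hx, latSum_vc, lat_map_sum, List.map_map]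
  congr 2
  ext1 t
  simp [latToM_vc]

/-- A shift that would leave the region has weight zero at that point, so the span of the admissible
basis vectors is mapped into itself. -/
theorem pres_latSum {ts : List Sh} (h : ∀ t ∈ ts, t.Stay) : Pres (latSum ts) := by
  suffices e : mToLat ∘ₗ latToM ∘ₗ latSum ts ∘ₗ mToLat = latSum ts ∘ₗ mToLat from
    fun v => LinearMap.congr_fun e v
  refine M_ext fun s x hx => ?_
  simp only [LinearMap.comp_apply]
  rw [mToLat_mkt _ hx, latSum_vc, lat_map_sum, map_list_sum, List.map_map, List.map_map]
  congr 1
  refine List.map_congr_left fun t ht => ?_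
  simp only [Function.comp_apply, map_smul, latToM_vc]
  by_cases hd : (x + t.d).Adm
  · rw [mToLat_mkt _ hd]
  · rw [h t ht s x hx hd, zero_smul, zero_smul]

/-- The bounded operator `T` restricts to the compression of `G`. -/
def Rep (T : H →L[ℂ] H) (G : Module.End ℂ Lat) : Prop := ∀ v : M, T v = compr G v

theorem Rep.mul {S T : H →L[ℂ] H} {F G : Module.End ℂ Lat} (hS : Rep S F) (hT : Rep T G)
    (hG : Pres G) : Rep (S * T) (F * G) := fun v => by
  rw [compr_mul F hG, ContinuousLinearMap.mul_apply, hT, hS]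
  rfl

theorem Rep.add {S T : H →L[ℂ] H} {F G : Module.End ℂ Lat} (hS : Rep S F) (hT : Rep T G) :
    Rep (S + T) (F + G) := fun v => by
  rw [compr_add, ContinuousLinearMap.add_apply, hT, hS]
  rfl

theorem Rep.smul {T : H →L[ℂ] H} {G : Module.End ℂ Lat} (c : ℂ) (hT : Rep T G) :
    Rep (c • T) (c • G) := fun v => by
  rw [compr_smul, ContinuousLinearMap.smul_apply, hT]
  rfl

theorem Rep.one : Rep 1 1 := fun v => by
  rw [compr_one]
  rfl

/-- The transfer principle: both sides of a relation between lattice operators are represented by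
bounded operators, and bounded operators that agree on the basis vectors are equal. -/
theorem Rep.unique {S T : H →L[ℂ] H} {G : Module.End ℂ Lat} (hS : Rep S G) (hT : Rep T G) :
    S = T :=
  clm_ext fun s x _ => (hS (mkt s x)).trans (hT (mkt s x)).symm

theorem rep_opSum {ts : List Sh} (h : ∀ t ∈ ts, Bdd t.f) : Rep (opSum ts) (latSum ts) := by
  suffices e : (opSum ts : H →ₗ[ℂ] H) ∘ₗ M.subtype = M.subtype ∘ₗ compr (latSum ts) from
    fun v => LinearMap.congr_fun e v
  refine M_ext fun s x hx => ?_
  simp only [LinearMap.comp_apply]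
  rw [compr_latSum _ _ hx, map_list_sum, List.map_map]
  exact opSum_kt h s hx

theorem M_induction {P : M → Prop} (h : ∀ s x, Pt.Adm x → P (mkt s x))
    (h_add : ∀ v w, P v → P w → P (v + w)) (h_smul : ∀ (c : ℂ) v, P v → P (c • v)) (h0 : P 0)
    (v : M) : P v := by
  have hv : v ∈ Submodule.span ℂ (Set.range basisM) := by simp [basisM.span_eq]
  induction hv using Submodule.span_induction with
  | mem v hv =>
    obtain ⟨i, rfl⟩ := hv
    rw [← mkt_label]
    exact h _ _ i.pt_adm
  | zero => exact h0
  | add v w _ _ hv hw => exact h_add v w hv hw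
  | smul c v _ hv => exact h_smul c v hv

theorem inner_ext {A B : Module.End ℂ M} (h : ∀ s x t y, Pt.Adm x → Pt.Adm y →
    ⟪(A (mkt s x) : H), kt t y⟫_ℂ = ⟪kt s x, (B (mkt t y) : H)⟫_ℂ) (v w : M) :
    ⟪(A v : H), (w : H)⟫_ℂ = ⟪(v : H), (B w : H)⟫_ℂ := by
  induction w using M_induction with
  | h t y hy =>
    induction v using M_induction with
    | h s x hx => exact h s x t y hx hy
    | h_add v w hv hw =>
      rw [map_add, Submodule.coe_add, Submodule.coe_add, inner_add_left, inner_add_left, hv, hw]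
    | h_smul c v hv =>
      rw [map_smul, Submodule.coe_smul, Submodule.coe_smul, inner_smul_left, inner_smul_left, hv]
    | h0 => simp
  | h_add v w hv hw =>
    rw [map_add, Submodule.coe_add, Submodule.coe_add, inner_add_right, inner_add_right, hv, hw]
  | h_smul c v hv =>
    rw [map_smul, Submodule.coe_smul, Submodule.coe_smul, inner_smul_right, inner_smul_right, hv]
  | h0 => simp

theorem inner_compr {ts ts' : List Sh} (h : List.Forall₂ Sh.IsTranspose ts ts') (v w : M) :
    ⟪(compr (latSum ts) v : H), (w : H)⟫_ℂ = ⟪(v : H), (compr (latSum ts') w : H)⟫_ℂ := by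
  refine inner_ext (fun s x r y hx hy => ?_) v w
  rw [compr_latSum _ _ hx, compr_latSum _ _ hy]
  induction h with
  | nil => simp
  | @cons t t' ts ts' h _ ih =>
    simp only [List.map_cons, List.sum_cons, Submodule.coe_add, inner_add_left, inner_add_right, ih]
    congr 1
    rw [Submodule.coe_smul, Submodule.coe_smul, coe_mkt, coe_mkt, inner_shift s r hx hy h]

/-! ### The generators as sums of shifts -/

/-- A shift whose weight does not depend on the sign. -/
def tE (g : ℤ → ℤ → ℂ) (h : ℤ → ℤ → ℤ → ℂ) (da du db dp : ℤ) : Sh :=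
  ⟨fun _ x => g x.a x.u * h x.a x.b x.p, ⟨da, du, db, dp⟩⟩

/-- A shift whose weight is proportional to the sign. -/
def tO (g : ℤ → ℤ → ℂ) (h : ℤ → ℤ → ℤ → ℂ) (da du db dp : ℤ) : Sh :=
  ⟨fun s x => (s : ℤ) * (g x.a x.u * h x.a x.b x.p), ⟨da, du, db, dp⟩⟩

/-- The shifts that make up `latOp`. -/
def latTerms (q : ℝ) (f g h : ℤ → ℤ → ℂ) (d e k : ℤ) : List Sh :=
  [tE f (fCp q) 1 d 0 0, tO f (fun a b p => -fC0 q a b p) 1 d (-1) (-1), tE f (fCm q) 1 d (-2) (-2),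
    tE g (fHp q) 0 e 1 1, tO g (fH0 q) 0 e 0 0, tE g (fun a b p => fHp q a (b - 1) (p - 1)) 0 e (-1) (-1),
    tE h (fun a b p => fCm q (a - 1) (b + 2) (p + 2)) (-1) k 2 2,
    tO h (fun a b p => -fC0 q (a - 1) (b + 1) (p + 1)) (-1) k 1 1,
    tE h (fun a b p => fCp q (a - 1) b p) (-1) k 0 0]

theorem lat_add_zero (v : Lat) : v + 0 = v := add_zero v

theorem latOp_eq (q : ℝ) (f g h : ℤ → ℤ → ℂ) (d e k : ℤ) :
    latOp q f g h d e k = latSum (latTerms q f g h d e k) := by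
  refine lat_ext' fun s a u b p => ?_
  have e1 := latOp_single q f g h d e k s a u (Finsupp.single (b, p) 1)
  have e2 := latSum_vc (latTerms q f g h d e k) s ⟨a, u, b, p⟩
  have e3 (x : ℤˣ × ℤ × ℤ) (y : ℤ × ℤ) (c : ℂ) :
      (Finsupp.lsingle (R := ℂ) x (c • Finsupp.single y 1) : Lat) = c • vec x.1 x.2.1 x.2.2 y.1 y.2 :=
    map_smul _ _ _
  refine e1.trans (Eq.trans ?_ e2.symm)
  simp only [opc, oph, opct, LinearMap.add_apply, fshift_single, map_add, e3, latTerms, tE, tO,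
    List.map_cons, List.map_nil, List.sum_cons, List.sum_nil, vc, Pt.add_def, Prod.mk_add_mk, mul_one,
    smul_add, smul_smul, add_zero, lat_add_zero, add_assoc]
  simp only [← sub_eq_add_neg, mul_neg, mul_left_comm]

/-- The shifts that make up `x₂`. -/
def terms₂ (q : ℝ) : List Sh :=
  [tE (fun _ _ => 1) (fDp q) 0 0 1 2, tO (fun _ _ => 1) (fD0 q) 0 0 0 1,
    tE (fun _ _ => 1) (fDm q) 0 0 (-1) 0]

/-- The shifts that make up `x₂*`. -/
def terms₂s (q : ℝ) : List Sh :=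
  [tE (fun _ _ => 1) (fun a b p => fDp q a (b - 1) (p - 2)) 0 0 (-1) (-2),
    tO (fun _ _ => 1) (fun a b p => fD0 q a b (p - 1)) 0 0 0 (-1),
    tE (fun _ _ => 1) (fun a b p => fDm q a (b + 1) p) 0 0 1 0]

theorem X2_eq (q : ℝ) : X2 q = latSum (terms₂ q) := by
  refine lat_ext' fun s a u b p => ?_
  have e1 := latFib_single (opd q) s a u (Finsupp.single (b, p) 1)
  have e2 := latSum_vc (terms₂ q) s ⟨a, u, b, p⟩
  have e3 (x : ℤˣ × ℤ × ℤ) (y : ℤ × ℤ) (c : ℂ) :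
      (Finsupp.lsingle (R := ℂ) x (c • Finsupp.single y 1) : Lat) = c • vec x.1 x.2.1 x.2.2 y.1 y.2 :=
    map_smul _ _ _
  refine e1.trans (Eq.trans ?_ e2.symm)
  simp only [opd, LinearMap.add_apply, fshift_single, map_add, e3, terms₂, tE, tO,
    List.map_cons, List.map_nil, List.sum_cons, List.sum_nil, vc, Pt.add_def, Prod.mk_add_mk, mul_one,
    one_mul, add_zero, add_assoc, lat_add_zero, ← sub_eq_add_neg]

theorem X2s_eq (q : ℝ) : X2s q = latSum (terms₂s q) := by
  refine lat_ext' fun s a u b p => ?_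
  have e1 := latFib_single (opdt q) s a u (Finsupp.single (b, p) 1)
  have e2 := latSum_vc (terms₂s q) s ⟨a, u, b, p⟩
  have e3 (x : ℤˣ × ℤ × ℤ) (y : ℤ × ℤ) (c : ℂ) :
      (Finsupp.lsingle (R := ℂ) x (c • Finsupp.single y 1) : Lat) = c • vec x.1 x.2.1 x.2.2 y.1 y.2 :=
    map_smul _ _ _
  refine e1.trans (Eq.trans ?_ e2.symm)
  simp only [opdt, LinearMap.add_apply, fshift_single, map_add, e3, terms₂s, tE, tO,
    List.map_cons, List.map_nil, List.sum_cons, List.sum_nil, vc, Pt.add_def, Prod.mk_add_mk, mul_one,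
    one_mul, add_zero, add_assoc, lat_add_zero, ← sub_eq_add_neg]

/-- The shifts that make up `x₀`. -/
def terms₀ (q : ℝ) : List Sh :=
  latTerms q (fAp q) (fA0 q) (fun a u => fAp q (a - 1) (u - 1)) 1 0 (-1)

/-- The shifts that make up `x₁`. -/
def terms₁ (q : ℝ) : List Sh := latTerms q (fBp q) (fB0 q) (fBm q) 2 1 0

/-- The shifts that make up `x₁*`. -/
def terms₁s (q : ℝ) : List Sh :=
  latTerms q (fun a u => fBm q (a + 1) u) (fun a u => fB0 q a (u - 1))
    (fun a u => fBp q (a - 1) (u - 2)) 0 (-1) (-2)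

theorem X0_eq (q : ℝ) : X0 q = latSum (terms₀ q) := latOp_eq _ _ _ _ _ _ _

theorem X1_eq (q : ℝ) : X1 q = latSum (terms₁ q) := latOp_eq _ _ _ _ _ _ _

theorem X1s_eq (q : ℝ) : X1s q = latSum (terms₁s q) := latOp_eq _ _ _ _ _ _ _

/-! ### The shifts preserve the set of labels -/

theorem sq_zero (q : ℝ) : sq q 0 = 0 := by simp [sq, bt]

theorem sn_zero (q : ℝ) : sn q 0 = 0 := by simp [sn, nb]

/-- The weight vanishes when `(a, u)` leaves the region `0 ≤ u ≤ 2 * a + 1`. -/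
def StayA (g : ℤ → ℤ → ℂ) (da du : ℤ) : Prop :=
  ∀ a u, 0 ≤ u → u ≤ 2 * a + 1 → ¬(0 ≤ u + du ∧ u + du ≤ 2 * (a + da) + 1) → g a u = 0

/-- The weight vanishes when `(b, p)` leaves the region `0 ≤ p ≤ 2 * b + 1`. -/
def StayC (h : ℤ → ℤ → ℤ → ℂ) (db dp : ℤ) : Prop :=
  ∀ a b p, 0 ≤ p → p ≤ 2 * b + 1 → ¬(0 ≤ p + dp ∧ p + dp ≤ 2 * (b + db) + 1) → h a b p = 0

theorem stay_weight {g : ℤ → ℤ → ℂ} {h : ℤ → ℤ → ℤ → ℂ} {da du db dp : ℤ} (hg : StayA g da du)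
    (hh : StayC h db dp) {x : Pt} (hx : x.Adm) (hd : ¬(x + ⟨da, du, db, dp⟩ : Pt).Adm) :
    g x.a x.u * h x.a x.b x.p = 0 := by
  obtain ⟨h1, h2, h3, h4⟩ := hx
  by_cases h5 : 0 ≤ x.u + du ∧ x.u + du ≤ 2 * (x.a + da) + 1
  · rw [hh _ _ _ h3 h4 fun h6 => hd ⟨h5.1, h5.2, h6.1, h6.2⟩, mul_zero]
  · rw [hg _ _ h1 h2 h5, zero_mul]

theorem stay_tE {g : ℤ → ℤ → ℂ} {h : ℤ → ℤ → ℤ → ℂ} {da du db dp : ℤ} (hg : StayA g da du)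
    (hh : StayC h db dp) : (tE g h da du db dp).Stay :=
  fun _ _ hx hd => stay_weight hg hh hx hd

theorem stay_tO {g : ℤ → ℤ → ℂ} {h : ℤ → ℤ → ℤ → ℂ} {da du db dp : ℤ} (hg : StayA g da du)
    (hh : StayC h db dp) : (tO g h da du db dp).Stay :=
  fun s _ hx hd => by
    change ((s : ℤ) : ℂ) * _ = 0
    rw [stay_weight hg hh hx hd, mul_zero]

theorem stayA_of_le {g : ℤ → ℤ → ℂ} {da du : ℤ} (h1 : 0 ≤ du) (h2 : du ≤ 2 * da) :
    StayA g da du := fun a u h h' h'' => absurd ⟨by omega, by omega⟩ h''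

theorem stayC_of_le {h : ℤ → ℤ → ℤ → ℂ} {db dp : ℤ} (h1 : 0 ≤ dp) (h2 : dp ≤ 2 * db) :
    StayC h db dp := fun a b p h h' h'' => absurd ⟨by omega, by omega⟩ h''

/-- The shift leaves the region only from the edges u = 0 and u = 2a+1, and there one of the two
roots has argument 0. The same mechanism works for all the vanishing statements that follow. -/
theorem stayA_Ap (q : ℝ) : StayA (fun a u => fAp q (a - 1) (u - 1)) (-1) (-1) := fun a u h h' h'' => by
  have : u - 1 + 1 = 0 ∨ 2 * (a - 1) + 2 - (u - 1) = 0 := by omega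
  rcases this with e | e <;> simp only [fAp, e, sq_zero, sn_zero, zero_mul, mul_zero, zero_div]

theorem stayA_B0 (q : ℝ) : StayA (fB0 q) 0 1 := fun a u h h' h'' => by
  have e : 2 * a + 1 - u = 0 := by omega
  simp only [fB0, e, sq_zero, sn_zero, zero_mul, mul_zero, zero_div, neg_zero]

theorem stayA_Bm (q : ℝ) : StayA (fBm q) (-1) 0 := fun a u h h' h'' => by
  have : 2 * a + 1 - u = 0 ∨ 2 * a - u = 0 := by omega
  rcases this with e | e <;> simp only [fBm, e, sq_zero, sn_zero, zero_mul, mul_zero, zero_div, neg_zero]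

theorem stayA_B0t (q : ℝ) : StayA (fun a u => fB0 q a (u - 1)) 0 (-1) := fun a u h h' h'' => by
  have e : u - 1 + 1 = 0 := by omega
  simp only [fB0, e, sq_zero, sn_zero, zero_mul, mul_zero, zero_div, neg_zero]

theorem stayA_Bpt (q : ℝ) : StayA (fun a u => fBp q (a - 1) (u - 2)) (-1) (-2) := fun a u h h' h'' => by
  have : u - 2 + 1 = 0 ∨ u - 2 + 2 = 0 := by omega
  rcases this with e | e <;> simp only [fBp, e, sq_zero, sn_zero, zero_mul, mul_zero, zero_div, neg_zero]

/-- In the (b, p) directions the parity of p tells the two edges apart: 2b+1 is odd and 0 is even,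
and the formula for each parity carries the root that vanishes on its own edge. -/
theorem stayC_C0 (q : ℝ) : StayC (fun a b p => -fC0 q a b p) (-1) (-1) := fun a b p h h' h'' => by
  simp only [fC0]
  split_ifs with hp
  · obtain ⟨c, hc⟩ := hp
    have e : 2 * b + 1 - p = 0 := by omega
    simp only [e, sq_zero, zero_mul, mul_zero, zero_div, neg_zero]
  · obtain ⟨c, hc⟩ := Int.not_odd_iff_even.1 hp
    have e : p = 0 := by omega
    simp only [e, sq_zero, zero_mul, mul_zero, zero_div, neg_zero]

theorem stayC_Cm (q : ℝ) : StayC (fCm q) (-2) (-2) := fun a b p h h' h'' => by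
  simp only [fCm]
  split_ifs with hp
  · obtain ⟨c, hc⟩ := hp
    have : p - 1 = 0 ∨ 2 * b + 1 - p = 0 := by omega
    rcases this with e | e <;> simp only [e, sq_zero, sn_zero, zero_mul, mul_zero, zero_div, neg_zero]
  · obtain ⟨c, hc⟩ := Int.not_odd_iff_even.1 hp
    have : p = 0 ∨ 2 * b - p = 0 := by omega
    rcases this with e | e <;> simp only [e, sq_zero, sn_zero, zero_mul, mul_zero, zero_div, neg_zero]

theorem stayC_Hpt (q : ℝ) : StayC (fun a b p => fHp q a (b - 1) (p - 1)) (-1) (-1) := fun a b p h h' h'' => by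
  simp only [fHp]
  split_ifs with hp
  · obtain ⟨c, hc⟩ := hp
    have e : p - 1 + 1 = 0 := by omega
    simp only [e, sq_zero, zero_mul, mul_zero, zero_div, neg_zero]
  · obtain ⟨c, hc⟩ := Int.not_odd_iff_even.1 hp
    have e : 2 * (b - 1) + 2 - (p - 1) = 0 := by omega
    simp only [e, sq_zero, zero_mul, mul_zero, zero_div, neg_zero]

theorem stayC_D0 (q : ℝ) : StayC (fD0 q) 0 1 := fun a b p h h' h'' => by
  simp only [fD0]
  split_ifs with hp
  · obtain ⟨c, hc⟩ := hp
    have e : 2 * b + 1 - p = 0 := by omega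
    simp only [e, sq_zero, zero_mul, mul_zero, zero_div, neg_zero]
  · obtain ⟨c, hc⟩ := Int.not_odd_iff_even.1 hp
    -- The shift leaves the region only from p = 2b+1, which is odd, so nothing is to be shown for
    -- even p.
    omega

theorem stayC_Dm (q : ℝ) : StayC (fDm q) (-1) 0 := fun a b p h h' h'' => by
  simp only [fDm]
  split_ifs with hp
  · obtain ⟨c, hc⟩ := hp
    have e : 2 * b + 1 - p = 0 := by omega
    simp only [e, sq_zero, zero_mul, mul_zero, zero_div, neg_zero]
  · obtain ⟨c, hc⟩ := Int.not_odd_iff_even.1 hp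
    have e : 2 * b - p = 0 := by omega
    simp only [e, sq_zero, zero_mul, mul_zero, zero_div, neg_zero]

theorem stayC_Dpt (q : ℝ) : StayC (fun a b p => fDp q a (b - 1) (p - 2)) (-1) (-2) := fun a b p h h' h'' => by
  simp only [fDp]
  split_ifs with hp
  · obtain ⟨c, hc⟩ := hp
    have e : p - 2 + 1 = 0 := by omega
    simp only [e, sq_zero, zero_mul, mul_zero, zero_div, neg_zero]
  · obtain ⟨c, hc⟩ := Int.not_odd_iff_even.1 hp
    have e : p - 2 + 2 = 0 := by omega
    simp only [e, sq_zero, zero_mul, mul_zero, zero_div, neg_zero]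

theorem stayC_D0t (q : ℝ) : StayC (fun a b p => fD0 q a b (p - 1)) 0 (-1) := fun a b p h h' h'' => by
  simp only [fD0]
  split_ifs with hp
  · obtain ⟨c, hc⟩ := hp
    have e : p - 1 + 1 = 0 := by omega
    simp only [e, sq_zero, zero_mul, mul_zero, zero_div, neg_zero]
  · obtain ⟨c, hc⟩ := Int.not_odd_iff_even.1 hp
    omega

theorem stay_latTerms {q : ℝ} {f g h : ℤ → ℤ → ℂ} {d e k : ℤ} (hf : StayA f 1 d) (hg : StayA g 0 e)
    (hh : StayA h (-1) k) : ∀ t ∈ latTerms q f g h d e k, t.Stay := by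
  simp only [latTerms, List.forall_mem_cons, List.not_mem_nil, false_imp_iff, implies_true, and_true]
  exact ⟨stay_tE hf (stayC_of_le (by simp) (by simp)), stay_tO hf (stayC_C0 q),
    stay_tE hf (stayC_Cm q), stay_tE hg (stayC_of_le (by simp) (by simp)),
    stay_tO hg (stayC_of_le (by simp) (by simp)), stay_tE hg (stayC_Hpt q),
    stay_tE hh (stayC_of_le (by simp) (by simp)), stay_tO hh (stayC_of_le (by simp) (by simp)),
    stay_tE hh (stayC_of_le (by simp) (by simp))⟩

theorem stay_terms₀ (q : ℝ) : ∀ t ∈ terms₀ q, t.Stay :=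
  stay_latTerms (stayA_of_le (by simp) (by simp)) (stayA_of_le (by simp) (by simp)) (stayA_Ap q)

theorem stay_terms₁ (q : ℝ) : ∀ t ∈ terms₁ q, t.Stay :=
  stay_latTerms (stayA_of_le (by simp) (by simp)) (stayA_B0 q) (stayA_Bm q)

theorem stay_terms₁s (q : ℝ) : ∀ t ∈ terms₁s q, t.Stay :=
  stay_latTerms (stayA_of_le (by simp) (by simp)) (stayA_B0t q) (stayA_Bpt q)

theorem stay_terms₂ (q : ℝ) : ∀ t ∈ terms₂ q, t.Stay := by
  simp only [terms₂, List.forall_mem_cons, List.not_mem_nil, false_imp_iff, implies_true, and_true]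
  have h : StayA (fun _ _ => 1) 0 0 := stayA_of_le le_rfl (by simp)
  exact ⟨stay_tE h (stayC_of_le (by simp) (by simp)), stay_tO h (stayC_D0 q),
    stay_tE h (stayC_Dm q)⟩

theorem stay_terms₂s (q : ℝ) : ∀ t ∈ terms₂s q, t.Stay := by
  simp only [terms₂s, List.forall_mem_cons, List.not_mem_nil, false_imp_iff, implies_true, and_true]
  have h : StayA (fun _ _ => 1) 0 0 := stayA_of_le le_rfl (by simp)
  exact ⟨stay_tE h (stayC_Dpt q), stay_tO h (stayC_D0t q),
    stay_tE h (stayC_of_le (by simp) (by simp))⟩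

/-! ### Adjoints -/

theorem Sh.IsTranspose.symm {t t' : Sh} (h : t.IsTranspose t') : t'.IsTranspose t := by
  refine ⟨by rw [h.1, neg_neg], fun s x hx hd => ?_⟩
  rw [h.1] at hd ⊢
  have := h.2 s (x + -t.d) hd (by simpa using hx)
  rw [neg_add_cancel_right] at this
  rw [this, Complex.conj_conj]

/-- Transposing a shift gives its adjoint only if the weights are real. They are so when both ends
of the shift are labels; elsewhere the formal roots may be imaginary, so reality is required on that
range only. -/
theorem conj_weight {g g' : ℤ → ℤ → ℂ} {h h' : ℤ → ℤ → ℤ → ℂ} {da du db dp : ℤ}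
    (hg : ∀ a u, 0 ≤ u → u ≤ 2 * a + 1 → 0 ≤ u + du → u + du ≤ 2 * (a + da) + 1 → ∃ r : ℝ, (r : ℂ) = g a u)
    (hh : ∀ a b p, 0 ≤ a → 0 ≤ p → p ≤ 2 * b + 1 → p + dp ≤ 2 * (b + db) + 1 →
      ∃ r : ℝ, (r : ℂ) = h a b p)
    (hg' : ∀ a u, g' (a + da) (u + du) = g a u)
    (hh' : ∀ a b p, h' (a + da) (b + db) (p + dp) = h a b p) {x : Pt} (hx : x.Adm)
    (hd : (x + ⟨da, du, db, dp⟩ : Pt).Adm) :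
    g' (x.a + da) (x.u + du) * h' (x.a + da) (x.b + db) (x.p + dp) =
      conj (g x.a x.u * h x.a x.b x.p) := by
  obtain ⟨h1, h2, h3, h4⟩ := hx
  obtain ⟨r, hr⟩ := hg _ _ h1 h2 hd.1 hd.2.1
  obtain ⟨r', hr'⟩ := hh x.a _ _ (by omega) h3 h4 hd.2.2.2
  rw [hg', hh', ← hr, ← hr', map_mul, Complex.conj_ofReal, Complex.conj_ofReal]

theorem transpose_tE {g g' : ℤ → ℤ → ℂ} {h h' : ℤ → ℤ → ℤ → ℂ} {da du db dp da' du' db' dp' : ℤ}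
    (hg : ∀ a u, 0 ≤ u → u ≤ 2 * a + 1 → 0 ≤ u + du → u + du ≤ 2 * (a + da) + 1 → ∃ r : ℝ, (r : ℂ) = g a u)
    (hh : ∀ a b p, 0 ≤ a → 0 ≤ p → p ≤ 2 * b + 1 → p + dp ≤ 2 * (b + db) + 1 →
      ∃ r : ℝ, (r : ℂ) = h a b p)
    (hg' : ∀ a u, g' (a + da) (u + du) = g a u)
    (hh' : ∀ a b p, h' (a + da) (b + db) (p + dp) = h a b p) (ha : da' = -da) (hu : du' = -du)
    (hb : db' = -db) (hp : dp' = -dp) :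
    (tE g h da du db dp).IsTranspose (tE g' h' da' du' db' dp') := by
  subst ha hu hb hp
  exact ⟨rfl, fun s x hx hd => conj_weight hg hh hg' hh' hx hd⟩

theorem transpose_tO {g g' : ℤ → ℤ → ℂ} {h h' : ℤ → ℤ → ℤ → ℂ} {da du db dp da' du' db' dp' : ℤ}
    (hg : ∀ a u, 0 ≤ u → u ≤ 2 * a + 1 → 0 ≤ u + du → u + du ≤ 2 * (a + da) + 1 → ∃ r : ℝ, (r : ℂ) = g a u)
    (hh : ∀ a b p, 0 ≤ a → 0 ≤ p → p ≤ 2 * b + 1 → p + dp ≤ 2 * (b + db) + 1 →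
      ∃ r : ℝ, (r : ℂ) = h a b p)
    (hg' : ∀ a u, g' (a + da) (u + du) = g a u)
    (hh' : ∀ a b p, h' (a + da) (b + db) (p + dp) = h a b p) (ha : da' = -da) (hu : du' = -du)
    (hb : db' = -db) (hp : dp' = -dp) :
    (tO g h da du db dp).IsTranspose (tO g' h' da' du' db' dp') := by
  subst ha hu hb hp
  refine ⟨rfl, fun s x hx hd => ?_⟩
  have := conj_weight hg hh hg' hh' hx hd
  simp only [tO, map_mul, map_intCast, Pt.add_def] at this ⊢
  rw [this]

/-- Transposition exchanges the parts that raise and lower j and inverts the order of the three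
displacements of l in each of them. This is why the second list appears reversed. -/
theorem transpose_latTerms {q : ℝ} (hq0 : 0 < q) (hq1 : q < 1) {f g h f' g' h' : ℤ → ℤ → ℂ}
    {d e k d' e' k' : ℤ}
    (hf : ∀ a u, 0 ≤ u → u ≤ 2 * a + 1 → 0 ≤ u + d → u + d ≤ 2 * (a + 1) + 1 → ∃ r : ℝ, (r : ℂ) = f a u)
    (hg : ∀ a u, 0 ≤ u → u ≤ 2 * a + 1 → 0 ≤ u + e → u + e ≤ 2 * (a + 0) + 1 → ∃ r : ℝ, (r : ℂ) = g a u)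
    (hh : ∀ a u, 0 ≤ u → u ≤ 2 * a + 1 → 0 ≤ u + d' → u + d' ≤ 2 * (a + 1) + 1 → ∃ r : ℝ, (r : ℂ) = f' a u)
    (hf' : ∀ a u, h' (a + 1) (u + d) = f a u) (hg' : ∀ a u, g' (a + 0) (u + e) = g a u)
    (hh' : ∀ a u, h (a + 1) (u + d') = f' a u) (hd : k' = -d) (he : e' = -e) (hk : k = -d') :
    List.Forall₂ Sh.IsTranspose (latTerms q f g h d e k) (latTerms q f' g' h' d' e' k').reverse := by
  have hCp : ∀ a b p : ℤ, 0 ≤ a → 0 ≤ p → p ≤ 2 * b + 1 → p + 0 ≤ 2 * (b + 0) + 1 →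
      ∃ r : ℝ, (r : ℂ) = fCp q a b p := fun _ _ _ h h' h'' _ => ⟨_, Cp_eq hq0 hq1 h h' h''⟩
  have hC0 : ∀ a b p : ℤ, 0 ≤ a → 0 ≤ p → p ≤ 2 * b + 1 → p + -1 ≤ 2 * (b + -1) + 1 →
      ∃ r : ℝ, (r : ℂ) = -fC0 q a b p := fun _ _ _ h h' h'' _ =>
    ⟨-_, by rw [← C0_eq hq0 hq1 h h' h'', Complex.ofReal_neg]⟩
  have hCm : ∀ a b p : ℤ, 0 ≤ a → 0 ≤ p → p ≤ 2 * b + 1 → p + -2 ≤ 2 * (b + -2) + 1 →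
      ∃ r : ℝ, (r : ℂ) = fCm q a b p := fun _ _ _ _ h' _ _ => ⟨_, Cm_eq hq0 hq1 h' (by omega)⟩
  have hHp : ∀ a b p : ℤ, 0 ≤ a → 0 ≤ p → p ≤ 2 * b + 1 → p + 1 ≤ 2 * (b + 1) + 1 →
      ∃ r : ℝ, (r : ℂ) = fHp q a b p := fun _ _ _ h h' h'' _ => ⟨_, Hp_eq hq0 hq1 h h' h''⟩
  have hH0 : ∀ a b p : ℤ, 0 ≤ a → 0 ≤ p → p ≤ 2 * b + 1 → p + 0 ≤ 2 * (b + 0) + 1 →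
      ∃ r : ℝ, (r : ℂ) = fH0 q a b p := fun _ _ _ _ _ _ _ => ⟨_, H0_eq hq0 hq1⟩
  have hg2 : ∀ a u, 0 ≤ u → u ≤ 2 * a + 1 → 0 ≤ u + e' → u + e' ≤ 2 * (a + 0) + 1 → ∃ r : ℝ, (r : ℂ) = g' a u := by
    subst he
    intro a u h1 h2 h3 h4
    have := hg a (u + -e) h3 (by omega) (by omega) (by omega)
    rwa [← hg', add_zero, neg_add_cancel_right] at this
  simp only [latTerms, List.reverse_cons, List.reverse_nil, List.nil_append, List.cons_append,
    List.forall₂_cons, List.forall₂_nil_right_iff, and_true]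
  refine ⟨transpose_tE hf hCp hf' (by simp) rfl hd rfl rfl,
    transpose_tO hf hC0 hf' (by simp) rfl hd rfl rfl,
    transpose_tE hf hCm hf' (by simp) rfl hd rfl rfl,
    transpose_tE hg hHp hg' (by simp) rfl he rfl rfl,
    transpose_tO hg hH0 hg' (by simp) rfl he rfl rfl,
    (transpose_tE hg2 hHp (fun a u => ?_) (by simp) rfl (by simp [he]) rfl rfl).symm,
    (transpose_tE hh hCm hh' (by simp) rfl hk rfl rfl).symm,
    (transpose_tO hh hC0 hh' (by simp) rfl hk rfl rfl).symm,
    (transpose_tE hh hCp hh' (by simp) rfl hk rfl rfl).symm⟩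
  rw [← hg']
  simp [he]

theorem transpose_terms₀ {q : ℝ} (hq0 : 0 < q) (hq1 : q < 1) :
    List.Forall₂ Sh.IsTranspose (terms₀ q) (terms₀ q).reverse :=
  transpose_latTerms (f' := fAp q) (d' := 1) hq0 hq1
    (fun _ _ h h' _ _ => ⟨_, Ap_eq hq0 hq1 h h'⟩) (fun _ _ _ _ _ _ => ⟨_, A0_eq hq0 hq1⟩)
    (fun _ _ h h' _ _ => ⟨_, Ap_eq hq0 hq1 h h'⟩) (by simp) (by simp) (by simp) rfl rfl rfl

theorem transpose_terms₁ {q : ℝ} (hq0 : 0 < q) (hq1 : q < 1) :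
    List.Forall₂ Sh.IsTranspose (terms₁ q) (terms₁s q).reverse :=
  transpose_latTerms (d' := 0) hq0 hq1
    (fun _ _ h _ _ _ => ⟨_, Bp_eq hq0 hq1 h⟩) (fun _ _ h h' _ _ => ⟨_, B0_eq hq0 hq1 h h'⟩)
    (fun _ _ _ h _ _ => ⟨_, Bm_eq hq0 hq1 (by omega)⟩) (by simp) (by simp) (by simp) rfl rfl rfl

theorem transpose_terms₂ {q : ℝ} (hq0 : 0 < q) (hq1 : q < 1) :
    List.Forall₂ Sh.IsTranspose (terms₂ q) (terms₂s q) := by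
  have h1 (du : ℤ) : ∀ a u : ℤ, 0 ≤ u → u ≤ 2 * a + 1 → 0 ≤ u + du → u + du ≤ 2 * (a + 0) + 1 →
      ∃ r : ℝ, (r : ℂ) = 1 := fun _ _ _ _ _ _ => ⟨1, Complex.ofReal_one⟩
  simp only [terms₂, terms₂s, List.forall₂_cons, List.forall₂_nil_right_iff, and_true]
  exact ⟨transpose_tE (h1 0) (fun _ _ _ h h' h'' _ => ⟨_, Dp_eq hq0 hq1 h h' h''⟩) (by simp)
      (by simp) rfl rfl rfl rfl,
    transpose_tO (h1 0) (fun _ _ _ h h' h'' _ => ⟨_, D0_eq hq0 hq1 h h' h''⟩) (by simp)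
      (by simp) rfl rfl rfl rfl,
    transpose_tE (h1 0) (fun _ _ _ h _ _ _ => ⟨_, Dm_eq hq0 hq1 h (by omega)⟩) (by simp)
      (by simp) rfl rfl rfl rfl⟩

/-! ### The action of the generators on the basis vectors -/

/-- Coefficients need to agree only when the target is a label, for otherwise the vector is zero.
This supplies the range conditions under which real and formal coefficients coincide. -/
theorem smul_ket_eq {r : ℝ} {c : ℂ} {s : ℤˣ} {l m₁ m₂ j : ℝ} (y : Pt)
    (h : y.Adm → (r : ℂ) = c) (hl : l = y.a + y.b + 1 / 2) (hm₁ : m₁ = y.u - y.a - 1 / 2)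
    (hm₂ : m₂ = y.p - y.b - 1 / 2) (hj : j = y.a + 1 / 2) : r • ket s l m₁ m₂ j = c • kt s y := by
  rw [ket_eq_kt y hl hm₁ hm₂ hj]
  by_cases hy : y.Adm
  · rw [← h hy]
    ext i
    exact (Complex.real_smul (x := r) (z := kt s y i)).trans rfl
  · rw [kt_eq_zero hy, smul_zero, smul_zero]

theorem nine_sum {E : Type*} [AddCommGroup E] {v₁ v₂ v₃ v₄ v₅ v₆ v₇ v₈ v₉ w₁ w₂ w₃ w₄ w₅ w₆ w₇ w₈ w₉ : E}
    (h₁ : v₁ = w₁) (h₂ : -v₂ = w₂) (h₃ : v₃ = w₃) (h₄ : v₄ = w₄) (h₅ : v₅ = w₅) (h₆ : v₆ = w₆)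
    (h₇ : v₇ = w₇) (h₈ : -v₈ = w₈) (h₉ : v₉ = w₉) :
    v₁ - v₂ + v₃ + v₄ + v₅ + v₆ + v₇ - v₈ + v₉ =
      w₁ + (w₂ + (w₃ + (w₄ + (w₅ + (w₆ + (w₇ + (w₈ + (w₉ + 0)))))))) := by
  subst h₁ h₂ h₃ h₄ h₅ h₆ h₇ h₈ h₉
  abel

theorem neg_smul_ket_eq {r : ℝ} {c : ℂ} {s : ℤˣ} {l m₁ m₂ j : ℝ} (y : Pt)
    (h : y.Adm → (r : ℂ) = -c) (hl : l = y.a + y.b + 1 / 2) (hm₁ : m₁ = y.u - y.a - 1 / 2)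
    (hm₂ : m₂ = y.p - y.b - 1 / 2) (hj : j = y.a + 1 / 2) : -(r • ket s l m₁ m₂ j) = c • kt s y := by
  rw [smul_ket_eq y h hl hm₁ hm₂ hj, neg_smul, neg_neg]

theorem Ap_link {q : ℝ} (hq0 : 0 < q) (hq1 : q < 1) {j m : ℝ} (a u : ℤ) (h0 : 0 ≤ u) (h1 : u ≤ 2 * a + 1)
    (hj : j = a + 1 / 2) (hm : m = u - a - 1 / 2) : ((Ap q j m : ℝ) : ℂ) = fAp q a u := by
  rw [hj, hm, Ap_eq hq0 hq1 h0 h1]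

theorem Bp_link {q : ℝ} (hq0 : 0 < q) (hq1 : q < 1) {j m : ℝ} (a u : ℤ) (h0 : 0 ≤ u)
    (hj : j = a + 1 / 2) (hm : m = u - a - 1 / 2) : ((Bp q j m : ℝ) : ℂ) = fBp q a u := by
  rw [hj, hm, Bp_eq hq0 hq1 h0]

theorem Bm_link {q : ℝ} (hq0 : 0 < q) (hq1 : q < 1) {j m : ℝ} (a u : ℤ) (h1 : u ≤ 2 * a)
    (hj : j = a + 1 / 2) (hm : m = u - a - 1 / 2) : ((Bm q j m : ℝ) : ℂ) = fBm q a u := by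
  rw [hj, hm, Bm_eq hq0 hq1 h1]

theorem B0_link {q : ℝ} (hq0 : 0 < q) (hq1 : q < 1) {j m : ℝ} (a u : ℤ) (h0 : 0 ≤ u) (h1 : u ≤ 2 * a + 1)
    (hj : j = a + 1 / 2) (hm : m = u - a - 1 / 2) : ((B0 q j m : ℝ) : ℂ) = fB0 q a u := by
  rw [hj, hm, B0_eq hq0 hq1 h0 h1]

theorem A0_link {q : ℝ} (hq0 : 0 < q) (hq1 : q < 1) {j m : ℝ} (a u : ℤ) 
    (hj : j = a + 1 / 2) (hm : m = u - a - 1 / 2) : ((A0 q j m : ℝ) : ℂ) = fA0 q a u := by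
  rw [hj, hm, A0_eq hq0 hq1 ]

theorem Cp_link {q : ℝ} (hq0 : 0 < q) (hq1 : q < 1) {l j m : ℝ} (a b p : ℤ) (ha : 0 ≤ a) (h0 : 0 ≤ p) (h1 : p ≤ 2 * b + 1)
    (hl : l = a + b + 1 / 2) (hj : j = a + 1 / 2) (hm : m = p - b - 1 / 2) :
    ((Cp q l j m : ℝ) : ℂ) = fCp q a b p := by
  rw [hl, hj, hm, Cp_eq hq0 hq1 ha h0 h1]

theorem C0_link {q : ℝ} (hq0 : 0 < q) (hq1 : q < 1) {l j m : ℝ} (a b p : ℤ) (ha : 0 ≤ a) (h0 : 0 ≤ p) (h1 : p ≤ 2 * b + 1)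
    (hl : l = a + b + 1 / 2) (hj : j = a + 1 / 2) (hm : m = p - b - 1 / 2) :
    ((C0 q l j m : ℝ) : ℂ) = fC0 q a b p := by
  rw [hl, hj, hm, C0_eq hq0 hq1 ha h0 h1]

theorem Hp_link {q : ℝ} (hq0 : 0 < q) (hq1 : q < 1) {l j m : ℝ} (a b p : ℤ) (ha : 0 ≤ a) (h0 : 0 ≤ p) (h1 : p ≤ 2 * b + 1)
    (hl : l = a + b + 1 / 2) (hj : j = a + 1 / 2) (hm : m = p - b - 1 / 2) :
    ((Hp q l j m : ℝ) : ℂ) = fHp q a b p := by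
  rw [hl, hj, hm, Hp_eq hq0 hq1 ha h0 h1]

theorem bl_link {q : ℝ} (hq0 : 0 < q) (hq1 : q < 1) {l j m : ℝ} (a b p : ℤ) (ha : 0 ≤ a) (h0 : 0 ≤ p) (h1 : p ≤ 2 * b + 1)
    (hl : l = a + b + 1 / 2) (hj : j = a + 1 / 2) (hm : m = p - b - 1 / 2) :
    ((bl q l j m : ℝ) : ℂ) = fbl q a b p := by
  rw [hl, hj, hm, bl_eq hq0 hq1 ha h0 h1]

theorem cl_link {q : ℝ} (hq0 : 0 < q) (hq1 : q < 1) {l j m : ℝ} (a b p : ℤ) (ha : 0 ≤ a) (h0 : 0 ≤ p) (h1 : p ≤ 2 * b + 1)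
    (hl : l = a + b + 1 / 2) (hj : j = a + 1 / 2) (hm : m = p - b - 1 / 2) :
    ((cl q l j m : ℝ) : ℂ) = fcl q a b p := by
  rw [hl, hj, hm, cl_eq hq0 hq1 ha h0 h1]

theorem Cm_link {q : ℝ} (hq0 : 0 < q) (hq1 : q < 1) {l j m : ℝ} (a b p : ℤ) (h0 : 0 ≤ p) (h1 : p ≤ 2 * b)
    (hl : l = a + b + 1 / 2) (hj : j = a + 1 / 2) (hm : m = p - b - 1 / 2) :
    ((Cm q l j m : ℝ) : ℂ) = fCm q a b p := by
  rw [hl, hj, hm, Cm_eq hq0 hq1 h0 h1]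

theorem H0_link {q : ℝ} (hq0 : 0 < q) (hq1 : q < 1) {l j m : ℝ} (a b p : ℤ) 
    (hl : l = a + b + 1 / 2) (hj : j = a + 1 / 2) (hm : m = p - b - 1 / 2) :
    ((H0 q l j m : ℝ) : ℂ) = fH0 q a b p := by
  rw [hl, hj, hm, H0_eq hq0 hq1 ]

theorem al_link {q : ℝ} (hq0 : 0 < q) (hq1 : q < 1) {l j m : ℝ} (a b p : ℤ) (ha : 0 ≤ a) (h0 : 0 ≤ p) (h1 : p ≤ 2 * b)
    (hl : l = a + b + 1 / 2) (hj : j = a + 1 / 2) (hm : m = p - b - 1 / 2) :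
    ((al q l j m : ℝ) : ℂ) = fal q a b p := by
  rw [hl, hj, hm, al_eq hq0 hq1 ha h0 h1]

/-- A term by term comparison. In the terms that lower j the coefficients carry the label of the
raising arrow between the same two values of j, so they are matched at a - 1. -/
theorem opSum_terms₀ {q : ℝ} (hq0 : 0 < q) (hq1 : q < 1) (hb : ∀ t ∈ terms₀ q, Bdd t.f) (s : ℤˣ)
    (l m₁ m₂ j : ℝ) (h : Admissible l m₁ m₂ j) : opSum (terms₀ q) (ket s l m₁ m₂ j) =
      (Ap q j m₁ * Cp q l j m₂) • ket s (l + 1) m₁ m₂ (j + 1)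
      - (s * Ap q j m₁ * C0 q l j m₂) • ket s l m₁ m₂ (j + 1)
      + (Ap q j m₁ * Cm q l j m₂) • ket s (l - 1) m₁ m₂ (j + 1)
      + (A0 q j m₁ * Hp q l j m₂) • ket s (l + 1) m₁ m₂ j
      + (s * A0 q j m₁ * H0 q l j m₂) • ket s l m₁ m₂ j
      + (A0 q j m₁ * Hp q (l - 1) j m₂) • ket s (l - 1) m₁ m₂ j
      + (Ap q (j - 1) m₁ * Cm q (l + 1) (j - 1) m₂) • ket s (l + 1) m₁ m₂ (j - 1)
      - (s * Ap q (j - 1) m₁ * C0 q l (j - 1) m₂) • ket s l m₁ m₂ (j - 1)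
      + (Ap q (j - 1) m₁ * Cp q (l - 1) (j - 1) m₂) • ket s (l - 1) m₁ m₂ (j - 1) := by
  obtain ⟨⟨a, u, b, p⟩, hx, rfl, rfl, rfl, rfl⟩ := h.exists_pt
  refine ((opSum_kt hb s hx).trans (Eq.symm ?_))
  obtain ⟨h1, h2, h3, h4⟩ := hx
  dsimp only at h1 h2 h3 h4
  simp only [terms₀, latTerms, List.map_cons, List.map_nil, List.sum_cons, List.sum_nil, tE, tO,
    Pt.add_def]
  refine nine_sum ?_ ?_ ?_ ?_ ?_ ?_ ?_ ?_ ?_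
  · refine smul_ket_eq ⟨a + 1, u + 1, b + 0, p + 0⟩ (fun hy => ?_) ?_ ?_ ?_ ?_
    · obtain ⟨h5, h6, h7, h8⟩ := hy
      dsimp only at h5 h6 h7 h8
      have e1 := Ap_link hq0 hq1 (j := (a : ℝ) + 1 / 2) (m := (u : ℝ) - a - 1 / 2) (a) (u) (by omega) (by omega) (by push_cast; ring) (by push_cast; ring)
      have e2 := Cp_link hq0 hq1 (l := (a : ℝ) + b + 1 / 2) (j := (a : ℝ) + 1 / 2) (m := (p : ℝ) - b - 1 / 2)
        (a) (b) (p) (by omega) (by omega) (by omega) (by push_cast; ring) (by push_cast; ring) (by push_cast; ring)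
      simp only [Complex.ofReal_mul, e1, e2]
    all_goals
      push_cast
      ring
  · refine neg_smul_ket_eq ⟨a + 1, u + 1, b + -1, p + -1⟩ (fun hy => ?_) ?_ ?_ ?_ ?_
    · obtain ⟨h5, h6, h7, h8⟩ := hy
      dsimp only at h5 h6 h7 h8
      have e1 := Ap_link hq0 hq1 (j := (a : ℝ) + 1 / 2) (m := (u : ℝ) - a - 1 / 2) (a) (u) (by omega) (by omega) (by push_cast; ring) (by push_cast; ring)
      have e2 := C0_link hq0 hq1 (l := (a : ℝ) + b + 1 / 2) (j := (a : ℝ) + 1 / 2) (m := (p : ℝ) - b - 1 / 2)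
        (a) (b) (p) (by omega) (by omega) (by omega) (by push_cast; ring) (by push_cast; ring) (by push_cast; ring)
      simp only [Complex.ofReal_mul, Complex.ofReal_intCast, e1, e2]
      ring
    all_goals
      push_cast
      ring
  · refine smul_ket_eq ⟨a + 1, u + 1, b + -2, p + -2⟩ (fun hy => ?_) ?_ ?_ ?_ ?_
    · obtain ⟨h5, h6, h7, h8⟩ := hy
      dsimp only at h5 h6 h7 h8
      have e1 := Ap_link hq0 hq1 (j := (a : ℝ) + 1 / 2) (m := (u : ℝ) - a - 1 / 2) (a) (u) (by omega) (by omega) (by push_cast; ring) (by push_cast; ring)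
      have e2 := Cm_link hq0 hq1 (l := (a : ℝ) + b + 1 / 2) (j := (a : ℝ) + 1 / 2) (m := (p : ℝ) - b - 1 / 2)
        (a) (b) (p) (by omega) (by omega) (by push_cast; ring) (by push_cast; ring) (by push_cast; ring)
      simp only [Complex.ofReal_mul, e1, e2]
    all_goals
      push_cast
      ring
  · refine smul_ket_eq ⟨a + 0, u + 0, b + 1, p + 1⟩ (fun hy => ?_) ?_ ?_ ?_ ?_
    · obtain ⟨h5, h6, h7, h8⟩ := hy
      dsimp only at h5 h6 h7 h8
      have e1 := A0_link hq0 hq1 (j := (a : ℝ) + 1 / 2) (m := (u : ℝ) - a - 1 / 2) (a) (u)  (by push_cast; ring) (by push_cast; ring)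
      have e2 := Hp_link hq0 hq1 (l := (a : ℝ) + b + 1 / 2) (j := (a : ℝ) + 1 / 2) (m := (p : ℝ) - b - 1 / 2)
        (a) (b) (p) (by omega) (by omega) (by omega) (by push_cast; ring) (by push_cast; ring) (by push_cast; ring)
      simp only [Complex.ofReal_mul, e1, e2]
    all_goals
      push_cast
      ring
  · refine smul_ket_eq ⟨a + 0, u + 0, b + 0, p + 0⟩ (fun hy => ?_) ?_ ?_ ?_ ?_
    · obtain ⟨h5, h6, h7, h8⟩ := hy
      dsimp only at h5 h6 h7 h8
      have e1 := A0_link hq0 hq1 (j := (a : ℝ) + 1 / 2) (m := (u : ℝ) - a - 1 / 2) (a) (u)  (by push_cast; ring) (by push_cast; ring)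
      have e2 := H0_link hq0 hq1 (l := (a : ℝ) + b + 1 / 2) (j := (a : ℝ) + 1 / 2) (m := (p : ℝ) - b - 1 / 2)
        (a) (b) (p)  (by push_cast; ring) (by push_cast; ring) (by push_cast; ring)
      simp only [Complex.ofReal_mul, Complex.ofReal_intCast, e1, e2]
      ring
    all_goals
      push_cast
      ring
  · refine smul_ket_eq ⟨a + 0, u + 0, b + -1, p + -1⟩ (fun hy => ?_) ?_ ?_ ?_ ?_
    · obtain ⟨h5, h6, h7, h8⟩ := hy
      dsimp only at h5 h6 h7 h8
      have e1 := A0_link hq0 hq1 (j := (a : ℝ) + 1 / 2) (m := (u : ℝ) - a - 1 / 2) (a) (u)  (by push_cast; ring) (by push_cast; ring)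
      have e2 := Hp_link hq0 hq1 (l := (a : ℝ) + b + 1 / 2 - 1) (j := (a : ℝ) + 1 / 2) (m := (p : ℝ) - b - 1 / 2)
        (a) (b - 1) (p - 1) (by omega) (by omega) (by omega) (by push_cast; ring) (by push_cast; ring) (by push_cast; ring)
      simp only [Complex.ofReal_mul, e1, e2]
    all_goals
      push_cast
      ring
  · refine smul_ket_eq ⟨a + -1, u + -1, b + 2, p + 2⟩ (fun hy => ?_) ?_ ?_ ?_ ?_
    · obtain ⟨h5, h6, h7, h8⟩ := hy
      dsimp only at h5 h6 h7 h8
      have e1 := Ap_link hq0 hq1 (j := (a : ℝ) + 1 / 2 - 1) (m := (u : ℝ) - a - 1 / 2) (a - 1) (u - 1) (by omega) (by omega) (by push_cast; ring) (by push_cast; ring)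
      have e2 := Cm_link hq0 hq1 (l := (a : ℝ) + b + 1 / 2 + 1) (j := (a : ℝ) + 1 / 2 - 1) (m := (p : ℝ) - b - 1 / 2)
        (a - 1) (b + 2) (p + 2) (by omega) (by omega) (by push_cast; ring) (by push_cast; ring) (by push_cast; ring)
      simp only [Complex.ofReal_mul, e1, e2]
    all_goals
      push_cast
      ring
  · refine neg_smul_ket_eq ⟨a + -1, u + -1, b + 1, p + 1⟩ (fun hy => ?_) ?_ ?_ ?_ ?_
    · obtain ⟨h5, h6, h7, h8⟩ := hy
      dsimp only at h5 h6 h7 h8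
      have e1 := Ap_link hq0 hq1 (j := (a : ℝ) + 1 / 2 - 1) (m := (u : ℝ) - a - 1 / 2) (a - 1) (u - 1) (by omega) (by omega) (by push_cast; ring) (by push_cast; ring)
      have e2 := C0_link hq0 hq1 (l := (a : ℝ) + b + 1 / 2) (j := (a : ℝ) + 1 / 2 - 1) (m := (p : ℝ) - b - 1 / 2)
        (a - 1) (b + 1) (p + 1) (by omega) (by omega) (by omega) (by push_cast; ring) (by push_cast; ring) (by push_cast; ring)
      simp only [Complex.ofReal_mul, Complex.ofReal_intCast, e1, e2]
      ring
    all_goals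
      push_cast
      ring
  · refine smul_ket_eq ⟨a + -1, u + -1, b + 0, p + 0⟩ (fun hy => ?_) ?_ ?_ ?_ ?_
    · obtain ⟨h5, h6, h7, h8⟩ := hy
      dsimp only at h5 h6 h7 h8
      have e1 := Ap_link hq0 hq1 (j := (a : ℝ) + 1 / 2 - 1) (m := (u : ℝ) - a - 1 / 2) (a - 1) (u - 1) (by omega) (by omega) (by push_cast; ring) (by push_cast; ring)
      have e2 := Cp_link hq0 hq1 (l := (a : ℝ) + b + 1 / 2 - 1) (j := (a : ℝ) + 1 / 2 - 1) (m := (p : ℝ) - b - 1 / 2)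
        (a - 1) (b) (p) (by omega) (by omega) (by omega) (by push_cast; ring) (by push_cast; ring) (by push_cast; ring)
      simp only [Complex.ofReal_mul, e1, e2]
    all_goals
      push_cast
      ring

theorem opSum_terms₁ {q : ℝ} (hq0 : 0 < q) (hq1 : q < 1) (hb : ∀ t ∈ terms₁ q, Bdd t.f) (s : ℤˣ)
    (l m₁ m₂ j : ℝ) (h : Admissible l m₁ m₂ j) : opSum (terms₁ q) (ket s l m₁ m₂ j) =
      (Bp q j m₁ * Cp q l j m₂) • ket s (l + 1) (m₁ + 1) m₂ (j + 1)
      - (s * Bp q j m₁ * C0 q l j m₂) • ket s l (m₁ + 1) m₂ (j + 1)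
      + (Bp q j m₁ * Cm q l j m₂) • ket s (l - 1) (m₁ + 1) m₂ (j + 1)
      + (B0 q j m₁ * Hp q l j m₂) • ket s (l + 1) (m₁ + 1) m₂ j
      + (s * B0 q j m₁ * H0 q l j m₂) • ket s l (m₁ + 1) m₂ j
      + (B0 q j m₁ * Hp q (l - 1) j m₂) • ket s (l - 1) (m₁ + 1) m₂ j
      + (Bm q j m₁ * Cm q (l + 1) (j - 1) m₂) • ket s (l + 1) (m₁ + 1) m₂ (j - 1)
      - (s * Bm q j m₁ * C0 q l (j - 1) m₂) • ket s l (m₁ + 1) m₂ (j - 1)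
      + (Bm q j m₁ * Cp q (l - 1) (j - 1) m₂) • ket s (l - 1) (m₁ + 1) m₂ (j - 1) := by
  obtain ⟨⟨a, u, b, p⟩, hx, rfl, rfl, rfl, rfl⟩ := h.exists_pt
  refine ((opSum_kt hb s hx).trans (Eq.symm ?_))
  obtain ⟨h1, h2, h3, h4⟩ := hx
  dsimp only at h1 h2 h3 h4
  simp only [terms₁, latTerms, List.map_cons, List.map_nil, List.sum_cons, List.sum_nil, tE, tO,
    Pt.add_def]
  refine nine_sum ?_ ?_ ?_ ?_ ?_ ?_ ?_ ?_ ?_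
  · refine smul_ket_eq ⟨a + 1, u + 2, b + 0, p + 0⟩ (fun hy => ?_) ?_ ?_ ?_ ?_
    · obtain ⟨h5, h6, h7, h8⟩ := hy
      dsimp only at h5 h6 h7 h8
      have e1 := Bp_link hq0 hq1 (j := (a : ℝ) + 1 / 2) (m := (u : ℝ) - a - 1 / 2) (a) (u) (by omega) (by push_cast; ring) (by push_cast; ring)
      have e2 := Cp_link hq0 hq1 (l := (a : ℝ) + b + 1 / 2) (j := (a : ℝ) + 1 / 2) (m := (p : ℝ) - b - 1 / 2)
        (a) (b) (p) (by omega) (by omega) (by omega) (by push_cast; ring) (by push_cast; ring) (by push_cast; ring)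
      simp only [Complex.ofReal_mul, e1, e2]
    all_goals
      push_cast
      ring
  · refine neg_smul_ket_eq ⟨a + 1, u + 2, b + -1, p + -1⟩ (fun hy => ?_) ?_ ?_ ?_ ?_
    · obtain ⟨h5, h6, h7, h8⟩ := hy
      dsimp only at h5 h6 h7 h8
      have e1 := Bp_link hq0 hq1 (j := (a : ℝ) + 1 / 2) (m := (u : ℝ) - a - 1 / 2) (a) (u) (by omega) (by push_cast; ring) (by push_cast; ring)
      have e2 := C0_link hq0 hq1 (l := (a : ℝ) + b + 1 / 2) (j := (a : ℝ) + 1 / 2) (m := (p : ℝ) - b - 1 / 2)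
        (a) (b) (p) (by omega) (by omega) (by omega) (by push_cast; ring) (by push_cast; ring) (by push_cast; ring)
      simp only [Complex.ofReal_mul, Complex.ofReal_intCast, e1, e2]
      ring
    all_goals
      push_cast
      ring
  · refine smul_ket_eq ⟨a + 1, u + 2, b + -2, p + -2⟩ (fun hy => ?_) ?_ ?_ ?_ ?_
    · obtain ⟨h5, h6, h7, h8⟩ := hy
      dsimp only at h5 h6 h7 h8
      have e1 := Bp_link hq0 hq1 (j := (a : ℝ) + 1 / 2) (m := (u : ℝ) - a - 1 / 2) (a) (u) (by omega) (by push_cast; ring) (by push_cast; ring)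
      have e2 := Cm_link hq0 hq1 (l := (a : ℝ) + b + 1 / 2) (j := (a : ℝ) + 1 / 2) (m := (p : ℝ) - b - 1 / 2)
        (a) (b) (p) (by omega) (by omega) (by push_cast; ring) (by push_cast; ring) (by push_cast; ring)
      simp only [Complex.ofReal_mul, e1, e2]
    all_goals
      push_cast
      ring
  · refine smul_ket_eq ⟨a + 0, u + 1, b + 1, p + 1⟩ (fun hy => ?_) ?_ ?_ ?_ ?_
    · obtain ⟨h5, h6, h7, h8⟩ := hy
      dsimp only at h5 h6 h7 h8
      have e1 := B0_link hq0 hq1 (j := (a : ℝ) + 1 / 2) (m := (u : ℝ) - a - 1 / 2) (a) (u) (by omega) (by omega) (by push_cast; ring) (by push_cast; ring)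
      have e2 := Hp_link hq0 hq1 (l := (a : ℝ) + b + 1 / 2) (j := (a : ℝ) + 1 / 2) (m := (p : ℝ) - b - 1 / 2)
        (a) (b) (p) (by omega) (by omega) (by omega) (by push_cast; ring) (by push_cast; ring) (by push_cast; ring)
      simp only [Complex.ofReal_mul, e1, e2]
    all_goals
      push_cast
      ring
  · refine smul_ket_eq ⟨a + 0, u + 1, b + 0, p + 0⟩ (fun hy => ?_) ?_ ?_ ?_ ?_
    · obtain ⟨h5, h6, h7, h8⟩ := hy
      dsimp only at h5 h6 h7 h8
      have e1 := B0_link hq0 hq1 (j := (a : ℝ) + 1 / 2) (m := (u : ℝ) - a - 1 / 2) (a) (u) (by omega) (by omega) (by push_cast; ring) (by push_cast; ring)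
      have e2 := H0_link hq0 hq1 (l := (a : ℝ) + b + 1 / 2) (j := (a : ℝ) + 1 / 2) (m := (p : ℝ) - b - 1 / 2)
        (a) (b) (p)  (by push_cast; ring) (by push_cast; ring) (by push_cast; ring)
      simp only [Complex.ofReal_mul, Complex.ofReal_intCast, e1, e2]
      ring
    all_goals
      push_cast
      ring
  · refine smul_ket_eq ⟨a + 0, u + 1, b + -1, p + -1⟩ (fun hy => ?_) ?_ ?_ ?_ ?_
    · obtain ⟨h5, h6, h7, h8⟩ := hy
      dsimp only at h5 h6 h7 h8
      have e1 := B0_link hq0 hq1 (j := (a : ℝ) + 1 / 2) (m := (u : ℝ) - a - 1 / 2) (a) (u) (by omega) (by omega) (by push_cast; ring) (by push_cast; ring)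
      have e2 := Hp_link hq0 hq1 (l := (a : ℝ) + b + 1 / 2 - 1) (j := (a : ℝ) + 1 / 2) (m := (p : ℝ) - b - 1 / 2)
        (a) (b - 1) (p - 1) (by omega) (by omega) (by omega) (by push_cast; ring) (by push_cast; ring) (by push_cast; ring)
      simp only [Complex.ofReal_mul, e1, e2]
    all_goals
      push_cast
      ring
  · refine smul_ket_eq ⟨a + -1, u + 0, b + 2, p + 2⟩ (fun hy => ?_) ?_ ?_ ?_ ?_
    · obtain ⟨h5, h6, h7, h8⟩ := hy
      dsimp only at h5 h6 h7 h8
      have e1 := Bm_link hq0 hq1 (j := (a : ℝ) + 1 / 2) (m := (u : ℝ) - a - 1 / 2) (a) (u) (by omega) (by push_cast; ring) (by push_cast; ring)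
      have e2 := Cm_link hq0 hq1 (l := (a : ℝ) + b + 1 / 2 + 1) (j := (a : ℝ) + 1 / 2 - 1) (m := (p : ℝ) - b - 1 / 2)
        (a - 1) (b + 2) (p + 2) (by omega) (by omega) (by push_cast; ring) (by push_cast; ring) (by push_cast; ring)
      simp only [Complex.ofReal_mul, e1, e2]
    all_goals
      push_cast
      ring
  · refine neg_smul_ket_eq ⟨a + -1, u + 0, b + 1, p + 1⟩ (fun hy => ?_) ?_ ?_ ?_ ?_
    · obtain ⟨h5, h6, h7, h8⟩ := hy
      dsimp only at h5 h6 h7 h8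
      have e1 := Bm_link hq0 hq1 (j := (a : ℝ) + 1 / 2) (m := (u : ℝ) - a - 1 / 2) (a) (u) (by omega) (by push_cast; ring) (by push_cast; ring)
      have e2 := C0_link hq0 hq1 (l := (a : ℝ) + b + 1 / 2) (j := (a : ℝ) + 1 / 2 - 1) (m := (p : ℝ) - b - 1 / 2)
        (a - 1) (b + 1) (p + 1) (by omega) (by omega) (by omega) (by push_cast; ring) (by push_cast; ring) (by push_cast; ring)
      simp only [Complex.ofReal_mul, Complex.ofReal_intCast, e1, e2]
      ring
    all_goals
      push_cast
      ring
  · refine smul_ket_eq ⟨a + -1, u + 0, b + 0, p + 0⟩ (fun hy => ?_) ?_ ?_ ?_ ?_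
    · obtain ⟨h5, h6, h7, h8⟩ := hy
      dsimp only at h5 h6 h7 h8
      have e1 := Bm_link hq0 hq1 (j := (a : ℝ) + 1 / 2) (m := (u : ℝ) - a - 1 / 2) (a) (u) (by omega) (by push_cast; ring) (by push_cast; ring)
      have e2 := Cp_link hq0 hq1 (l := (a : ℝ) + b + 1 / 2 - 1) (j := (a : ℝ) + 1 / 2 - 1) (m := (p : ℝ) - b - 1 / 2)
        (a - 1) (b) (p) (by omega) (by omega) (by omega) (by push_cast; ring) (by push_cast; ring) (by push_cast; ring)
      simp only [Complex.ofReal_mul, e1, e2]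
    all_goals
      push_cast
      ring

theorem opSum_terms₂ {q : ℝ} (hq0 : 0 < q) (hq1 : q < 1) (hb : ∀ t ∈ terms₂ q, Bdd t.f) (s : ℤˣ)
    (l m₁ m₂ j : ℝ) (h : Admissible l m₁ m₂ j) : opSum (terms₂ q) (ket s l m₁ m₂ j) =
      (Dp q l j m₂) • ket s (l + 1) m₁ (m₂ + 1) j
      + (s * D0 q l j m₂) • ket s l m₁ (m₂ + 1) j
      + (Dm q l j m₂) • ket s (l - 1) m₁ (m₂ + 1) j := by
  obtain ⟨⟨a, u, b, p⟩, hx, rfl, rfl, rfl, rfl⟩ := h.exists_pt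
  refine ((opSum_kt hb s hx).trans (Eq.symm ?_))
  obtain ⟨h1, h2, h3, h4⟩ := hx
  dsimp only at h1 h2 h3 h4
  simp only [terms₂, List.map_cons, List.map_nil, List.sum_cons, List.sum_nil, tE, tO,
    Pt.add_def]
  rw [add_assoc]
  refine congrArg₂ (· + ·) ?_ (congrArg₂ (· + ·) ?_ (Eq.trans ?_ (add_zero _).symm))
  · refine smul_ket_eq ⟨a + 0, u + 0, b + 1, p + 2⟩ (fun hy => ?_) ?_ ?_ ?_ ?_
    · exact (Dp_eq hq0 hq1 (a := a) (by omega) h3 h4).trans (one_mul _).symm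
    all_goals
      push_cast
      ring
  · refine smul_ket_eq ⟨a + 0, u + 0, b + 0, p + 1⟩ (fun hy => ?_) ?_ ?_ ?_ ?_
    · simp only [Complex.ofReal_mul, Complex.ofReal_intCast, D0_eq hq0 hq1 (by omega : 0 ≤ a) h3 h4,
        one_mul]
    all_goals
      push_cast
      ring
  · refine smul_ket_eq ⟨a + 0, u + 0, b + -1, p + 0⟩ (fun hy => ?_) ?_ ?_ ?_ ?_
    · have := hy.2.2.2
      dsimp only at this
      exact (Dm_eq hq0 hq1 (a := a) (b := b) (p := p) (by omega) (by omega)).trans (one_mul _).symm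
    all_goals
      push_cast
      ring

/-! ### Exponential estimates on neighbourhoods of the set of labels -/

/-- The points at distance at most `c` from the set of labels. -/
def Dom (c : ℕ) (x : Pt) : Prop :=
  -(c : ℤ) ≤ x.u ∧ x.u ≤ 2 * x.a + 1 + c ∧ -(c : ℤ) ≤ x.p ∧ x.p ≤ 2 * x.b + 1 + c

theorem Pt.Adm.dom {x : Pt} (h : x.Adm) : Dom 0 x := by simpa [Dom, Pt.Adm] using h

/-- The size of a displacement. -/
def Pt.size (d : Pt) : ℕ :=
  2 * d.a.natAbs + d.u.natAbs + 2 * d.b.natAbs + d.p.natAbs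

theorem Dom.add {c : ℕ} {x : Pt} (h : Dom c x) (d : Pt) : Dom (c + d.size) (x + d) := by
  obtain ⟨h1, h2, h3, h4⟩ := h
  simp only [Dom, Pt.size, Pt.add_def]
  omega

/-- The function `f` is `O(q ^ e)` on each neighbourhood of the set of labels. -/
def BigO (q : ℝ) (f : Pt → ℂ) (e : Pt → ℤ) : Prop :=
  ∀ c : ℕ, ∃ C : ℝ, 0 ≤ C ∧ ∀ x, Dom c x → ‖f x‖ ≤ C * q ^ e x

section estimates

variable {q : ℝ} {f g φ : Pt → ℂ} {e e' : Pt → ℤ}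

/-- Exponents matter only up to a constant depending on the neighbourhood, which the factor C
absorbs. The slack 20(c+1) is merely large enough for all numerical offsets that occur, so every
comparison of exponents becomes linear integer arithmetic. -/
theorem BigO.mono (hq0 : 0 < q) (hq1 : q < 1) (hf : BigO q f e)
    (h : ∀ (c : ℕ) x, Dom c x → e' x ≤ e x + 20 * (c + 1)) : BigO q f e' := by
  intro c
  obtain ⟨C, hC, hf⟩ := hf c
  refine ⟨C * q ^ (-(20 * (c + 1) : ℤ)), by positivity, fun x hx => (hf x hx).trans ?_⟩
  rw [mul_assoc, ← zpow_add₀ hq0.ne']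
  refine mul_le_mul_of_nonneg_left (zpow_le_zpow_right_of_le_one₀ hq0 hq1.le ?_) hC
  have := h c x hx
  omega

theorem BigO.mul (hq0 : 0 < q) (hf : BigO q f e) (hg : BigO q g e') :
    BigO q (fun x => f x * g x) fun x => e x + e' x := by
  intro c
  obtain ⟨C, hC, hf⟩ := hf c
  obtain ⟨C', hC', hg⟩ := hg c
  refine ⟨C * C', by positivity, fun x hx => ?_⟩
  rw [norm_mul, zpow_add₀ hq0.ne', mul_mul_mul_comm]
  exact mul_le_mul (hf x hx) (hg x hx) (norm_nonneg _) (by positivity)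

theorem BigO.add (hf : BigO q f e) (hg : BigO q g e) : BigO q (fun x => f x + g x) e := by
  intro c
  obtain ⟨C, hC, hf⟩ := hf c
  obtain ⟨C', hC', hg⟩ := hg c
  refine ⟨C + C', by positivity, fun x hx => (norm_add_le _ _).trans ?_⟩
  rw [add_mul]
  exact add_le_add (hf x hx) (hg x hx)

theorem BigO.neg (hf : BigO q f e) : BigO q (fun x => -f x) e := by
  simpa only [BigO, norm_neg] using hf

theorem BigO.sub (hf : BigO q f e) (hg : BigO q g e) : BigO q (fun x => f x - g x) e := by
  simpa only [sub_eq_add_neg] using hf.add hg.neg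

theorem BigO.congr (hf : BigO q f e) (h : ∀ x, g x = f x) : BigO q g e := by
  rwa [funext h]

theorem BigO.ite (hq0 : 0 < q) {P : Pt → Prop} [DecidablePred P] (hf : BigO q f e) (hg : BigO q g e) :
    BigO q (fun x => if P x then f x else g x) e := by
  intro c
  obtain ⟨C, hC, hf⟩ := hf c
  obtain ⟨C', hC', hg⟩ := hg c
  refine ⟨max C C', by positivity, fun x hx => ?_⟩
  have hx' : 0 ≤ q ^ e x := (zpow_pos hq0 _).le
  by_cases h : P x
  · simp only [h, if_true]
    exact (hf x hx).trans (mul_le_mul_of_nonneg_right (le_max_left _ _) hx')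
  · simp only [h, if_false]
    exact (hg x hx).trans (mul_le_mul_of_nonneg_right (le_max_right _ _) hx')

theorem BigO.shift (hf : BigO q f e) (d : Pt) : BigO q (fun x => f (x + d)) fun x => e (x + d) := by
  intro c
  obtain ⟨C, hC, hf⟩ := hf (c + d.size)
  exact ⟨C, hC, fun x hx => hf _ (hx.add d)⟩

theorem bigO_const (c : ℂ) : BigO q (fun _ => c) fun _ => 0 :=
  fun _ => ⟨‖c‖, norm_nonneg _, fun _ _ => by simp⟩

theorem bigO_zpow (hq0 : 0 < q) (n : Pt → ℤ) : BigO q (fun x => (q : ℂ) ^ n x) n :=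
  fun _ => ⟨1, zero_le_one, fun x _ => by
    rw [norm_zpow, Complex.norm_real, Real.norm_of_nonneg hq0.le, one_mul]⟩

/-- The function `g` is `1 + O(q ^ e)`. -/
def OneO (q : ℝ) (g : Pt → ℂ) (e : Pt → ℤ) : Prop := BigO q (fun x => g x - 1) e

theorem OneO.bigO (hq0 : 0 < q) (hq1 : q < 1) (hg : OneO q g e)
    (h : ∀ (c : ℕ) x, Dom c x → 0 ≤ e x + 20 * (c + 1)) : BigO q g fun _ => 0 :=
  ((BigO.mono hq0 hq1 hg h).add (bigO_const 1)).congr fun x => by ring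

theorem OneO.mul (hq0 : 0 < q) (hq1 : q < 1) (hf : OneO q f e) (hg : OneO q g e)
    (h : ∀ (c : ℕ) x, Dom c x → 0 ≤ e x + 20 * (c + 1)) : OneO q (fun x => f x * g x) e :=
  (((hf.bigO hq0 hq1 h).mul hq0 hg).mono hq0 hq1 (e' := e) (by intros; omega)).add hf |>.congr
    fun x => by ring

/-- From (√(1-y) - 1)(√(1-y) + 1) = -y with y = q^{2n}: the principal root has nonnegative real
part, so the second factor has modulus at least 1. -/
theorem norm_sq_sub_one (hq0 : 0 < q) (n : ℤ) : ‖sq q n - 1‖ ≤ q ^ (2 * n) := by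
  have h1 : (sq q n - 1) * (sq q n + 1) = -(q : ℂ) ^ (2 * n) := by
    linear_combination sq_sq q n + (bt.eq_1 q n)
  have h2 : ‖sq q n - 1‖ * ‖sq q n + 1‖ = q ^ (2 * n) := by
    rw [← norm_mul, h1, norm_neg, norm_zpow, Complex.norm_real, Real.norm_of_nonneg hq0.le]
  have h3 : 0 ≤ (sq q n).re := by
    rw [sq]
    rcases eq_or_ne (bt q n) 0 with h | h
    · simp [h]
    · rw [Complex.cpow_def_of_ne_zero h, Complex.exp_re]
      refine mul_nonneg (Real.exp_pos _).le (Real.cos_nonneg_of_neg_pi_div_two_le_of_le ?_ ?_)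
      all_goals
        have := Complex.neg_pi_lt_arg (bt q n)
        have := Complex.arg_le_pi (bt q n)
        rw [show Complex.log (bt q n) * (1 / 2) = ((1 / 2 : ℝ) : ℂ) * Complex.log (bt q n) by
          push_cast; ring, Complex.im_ofReal_mul, Complex.log_im]
        linarith
  have h4 : 1 ≤ ‖sq q n + 1‖ := by
    refine le_trans ?_ (Complex.re_le_norm _)
    simpa using h3
  rw [← h2]
  exact le_mul_of_one_le_right (norm_nonneg _) h4

theorem oneO_sq (hq0 : 0 < q) (hq1 : q < 1) (n : Pt → ℤ)
    (h : ∀ (c : ℕ) x, Dom c x → e x ≤ 2 * n x + 20 * (c + 1)) : OneO q (fun x => sq q (n x)) e :=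
  BigO.mono (e := fun x => 2 * n x) hq0 hq1 (fun _ => ⟨1, zero_le_one, fun x _ => by
    rw [one_mul]
    exact norm_sq_sub_one hq0 _⟩) h

/-- The value at n = 1 is the smallest. Negative n are included because the neighbourhoods of the
region contain points with negative coordinates. -/
theorem norm_bt_ge (hq0 : 0 < q) (hq1 : q < 1) {n : ℤ} (hn : n ≠ 0) : 1 - q ^ 2 ≤ ‖bt q n‖ := by
  have h1 : q ^ 2 < 1 := pow_lt_one₀ hq0.le hq1 two_ne_zero
  have e1 : ‖bt q n‖ = |1 - q ^ (2 * n)| := by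
    rw [bt, ← Complex.ofReal_zpow, ← Complex.ofReal_one, ← Complex.ofReal_sub, Complex.norm_real,
      Real.norm_eq_abs]
  rw [e1]
  rcases lt_or_gt_of_ne hn with h | h
  · refine le_trans ?_ (neg_le_abs _)
    have h2 : q ^ (-2 : ℤ) ≤ q ^ (2 * n) := zpow_le_zpow_right_of_le_one₀ hq0 hq1.le (by omega)
    -- Equivalent to (q² - 1)² ≥ 0 after multiplication by q².
    have h3 : 1 + (1 - q ^ 2) ≤ q ^ (-2 : ℤ) := by
      rw [zpow_neg, zpow_ofNat, le_inv_comm₀ (by linarith) (by positivity)]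
      rw [← one_div, le_div_iff₀ (by linarith)]
      nlinarith [sq_nonneg (q ^ 2 - 1)]
    linarith
  · refine le_trans ?_ (le_abs_self _)
    have h2 : q ^ (2 * n) ≤ q ^ (2 : ℤ) := zpow_le_zpow_right_of_le_one₀ hq0 hq1.le (by omega)
    rw [zpow_ofNat] at h2
    linarith

theorem oneO_inv_bt (hq0 : 0 < q) (hq1 : q < 1) (n : Pt → ℤ) (hn : ∀ x, n x ≠ 0)
    (h : ∀ (c : ℕ) x, Dom c x → e x ≤ 2 * n x + 20 * (c + 1)) :
    OneO q (fun x => (bt q (n x))⁻¹) e := by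
  have h1 : 0 < 1 - q ^ 2 := sub_pos.2 (pow_lt_one₀ hq0.le hq1 two_ne_zero)
  refine BigO.mono (e := fun x => 2 * n x) hq0 hq1 (fun _ => ⟨(1 - q ^ 2)⁻¹, by positivity,
    fun x _ => ?_⟩) h
  have h2 := bt_ne_zero hq0 hq1 (hn x)
  have h3 : (bt q (n x))⁻¹ - 1 = (bt q (n x))⁻¹ * (q : ℂ) ^ (2 * n x) := by
    have : (q : ℂ) ^ (2 * n x) = 1 - bt q (n x) := by rw [bt]; ring
    rw [this]
    field_simp
  rw [h3, norm_mul, norm_inv, norm_zpow, Complex.norm_real, Real.norm_of_nonneg hq0.le]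
  have := norm_bt_ge hq0 hq1 (hn x)
  gcongr

theorem bigO_bt (hq0 : 0 < q) (hq1 : q < 1) (n : Pt → ℤ)
    (h : ∀ (c : ℕ) x, Dom c x → 0 ≤ 2 * n x + 20 * (c + 1)) : BigO q (fun x => bt q (n x)) fun _ => 0 :=
  (bigO_const 1).sub ((bigO_zpow hq0 fun x => 2 * n x).mono hq0 hq1 h)

theorem bigO_sq (hq0 : 0 < q) (hq1 : q < 1) (n : Pt → ℤ)
    (h : ∀ (c : ℕ) x, Dom c x → 0 ≤ 2 * n x + 20 * (c + 1)) : BigO q (fun x => sq q (n x)) fun _ => 0 :=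
  (oneO_sq (e := fun _ => 0) hq0 hq1 n h).bigO hq0 hq1 (by intros; omega)

theorem bigO_inv_bt (hq0 : 0 < q) (hq1 : q < 1) (n : Pt → ℤ) (hn : ∀ x, n x ≠ 0)
    (h : ∀ (c : ℕ) x, Dom c x → 0 ≤ 2 * n x + 20 * (c + 1)) :
    BigO q (fun x => (bt q (n x))⁻¹) fun _ => 0 :=
  (oneO_inv_bt (e := fun _ => 0) hq0 hq1 n hn h).bigO hq0 hq1 (by intros; omega)

/-- The variation of a function under a displacement. -/
def osc (E : Pt) (f : Pt → ℂ) (x : Pt) : ℂ := f (x + E) - f x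

/-- A displacement that fixes p fixes its parity, so the two branches never mix. The four directions
of `Est` are all of this kind. -/
theorem osc_ite (hq0 : 0 < q) {E : Pt} (hE : E.p = 0) (hf : BigO q (osc E f) e) (hg : BigO q (osc E g) e) :
    BigO q (osc E fun x => if Odd x.p then f x else g x) e :=
  (hf.ite hq0 (P := fun x => Odd x.p) hg).congr fun x => by
    have : (x + E).p = x.p := by simp [Pt.add_def, hE]
    simp only [osc, this]
    split_ifs <;> rfl

theorem BigO.osc (hq0 : 0 < q) (hq1 : q < 1) (hf : BigO q f e) {E : Pt}
    (h : ∀ (c : ℕ) x, Dom c x → e' x ≤ e x + 20 * (c + 1))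
    (h' : ∀ (c : ℕ) x, Dom c x → e' x ≤ e (x + E) + 20 * (c + 1)) : BigO q (osc E f) e' :=
  ((hf.shift E).mono hq0 hq1 h').sub (hf.mono hq0 hq1 h)

/-- The discrete Leibniz rule: f(x)(g(x+E) - g(x)) + (f(x+E) - f(x)) g(x+E). -/
theorem osc_mul (hq0 : 0 < q) (hq1 : q < 1) {E : Pt} {α β α' β' k : Pt → ℤ} (hf : BigO q f α)
    (hf' : BigO q (S4q.osc E f) α') (hg : BigO q g β) (hg' : BigO q (S4q.osc E g) β')
    (h : ∀ (c : ℕ) x, Dom c x → k x ≤ α x + β' x + 20 * (c + 1))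
    (h' : ∀ (c : ℕ) x, Dom c x → k x ≤ α' x + β (x + E) + 20 * (c + 1)) :
    BigO q (S4q.osc E fun x => f x * g x) k :=
  (((hf.mul hq0 hg').mono hq0 hq1 h).add ((hf'.mul hq0 (hg.shift E)).mono hq0 hq1 h')).congr
    fun x => by
      simp only [S4q.osc]
      ring

end estimates

/-! ### Size and oscillation of the coefficients -/

/-- The common shape of the coefficients. -/
def cf (q : ℝ) (κ : ℂ) (m i j n : ℤ) : ℂ := κ * ((q : ℂ) ^ m * (sq q i * sq q j * (bt q n)⁻¹))

section estimates

variable {q : ℝ} {E : Pt} {κ : ℂ} {m i j n e k : Pt → ℤ}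

theorem bigO_cf (hq0 : 0 < q) (hq1 : q < 1) (hi : ∀ (c : ℕ) x, Dom c x → 0 ≤ 2 * i x + 20 * (c + 1))
    (hj : ∀ (c : ℕ) x, Dom c x → 0 ≤ 2 * j x + 20 * (c + 1))
    (hn : ∀ (c : ℕ) x, Dom c x → 0 ≤ 2 * n x + 20 * (c + 1)) (hn' : ∀ x, n x ≠ 0)
    (he : ∀ (c : ℕ) x, Dom c x → e x ≤ m x + 20 * (c + 1)) :
    BigO q (fun x => cf q κ (m x) (i x) (j x) (n x)) e :=
  BigO.mono (e := fun x => 0 + (m x + (0 + 0 + 0))) hq0 hq1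
    (BigO.mul hq0 (bigO_const κ) (BigO.mul hq0 (bigO_zpow hq0 m)
      (BigO.mul hq0 (BigO.mul hq0 (bigO_sq hq0 hq1 i hi) (bigO_sq hq0 hq1 j hj))
        (bigO_inv_bt hq0 hq1 n hn' hn)))) fun c x hx => by
    have := he c x hx
    omega

theorem osc_zero {f : Pt → ℂ} (h : ∀ x, f (x + E) = f x) : BigO q (osc E f) e :=
  fun _ => ⟨0, le_rfl, fun x _ => by simp [osc, h]⟩

theorem OneO.osc {g : Pt → ℂ} (hq0 : 0 < q) (hq1 : q < 1) (hg : OneO q g e)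
    (h : ∀ (c : ℕ) x, Dom c x → k x ≤ e x + 20 * (c + 1))
    (h' : ∀ (c : ℕ) x, Dom c x → k x ≤ e (x + E) + 20 * (c + 1)) : BigO q (osc E g) k :=
  (BigO.osc (E := E) (f := fun x => g x - 1) hq0 hq1 hg h h').congr fun x => by
    simp only [S4q.osc]
    ring

/-- Either the exponent is invariant under the displacement, or it is large. -/
def Tame (E : Pt) (t i : Pt → ℤ) : Prop := (∀ x, i (x + E) = i x) ∨
  ∀ (c : ℕ) x, Dom c x → t x ≤ 2 * i x + 20 * (c + 1) ∧ t x ≤ 2 * i (x + E) + 20 * (c + 1)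

/-- Either the root does not change at all, or it is 1 + O(q^t) at both ends and the difference is
O(q^t). -/
theorem osc_sq (hq0 : 0 < q) (hq1 : q < 1) {t : Pt → ℤ} (h : Tame E t i) :
    BigO q (osc E fun x => sq q (i x)) t := by
  rcases h with h | h
  · exact osc_zero fun x => by rw [h]
  · exact OneO.osc (e := fun x => 2 * i x) hq0 hq1 (oneO_sq hq0 hq1 i (by intros; omega))
      (fun c x hx => (h c x hx).1) fun c x hx => (h c x hx).2

theorem osc_inv_bt (hq0 : 0 < q) (hq1 : q < 1) (hn : ∀ x, n x ≠ 0) {t : Pt → ℤ} (h : Tame E t n) :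
    BigO q (osc E fun x => (bt q (n x))⁻¹) t := by
  rcases h with h | h
  · exact osc_zero fun x => by rw [h]
  · exact OneO.osc (e := fun x => 2 * n x) hq0 hq1 (oneO_inv_bt hq0 hq1 n hn (by intros; omega))
      (fun c x hx => (h c x hx).1) fun c x hx => (h c x hx).2

/-- The prefactor q^m is invariant under E, so the variation falls on the two roots and the inverse.
These are bounded and each may vary by O(q^{k-m}), which leaves O(q^k) in total. -/
theorem osc_cf (hq0 : 0 < q) (hq1 : q < 1) (hi : ∀ (c : ℕ) x, Dom c x → 0 ≤ 2 * i x + 20 * (c + 1))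
    (hj : ∀ (c : ℕ) x, Dom c x → 0 ≤ 2 * j x + 20 * (c + 1))
    (hn : ∀ (c : ℕ) x, Dom c x → 0 ≤ 2 * n x + 20 * (c + 1)) (hn' : ∀ x, n x ≠ 0)
    (hm : ∀ x, m (x + E) = m x) (ti : Tame E (fun x => k x - m x) i)
    (tj : Tame E (fun x => k x - m x) j) (tn : Tame E (fun x => k x - m x) n) :
    BigO q (osc E fun x => cf q κ (m x) (i x) (j x) (n x)) k := by
  have h1 := osc_mul (k := fun x => k x - m x) hq0 hq1 (bigO_sq hq0 hq1 i hi) (osc_sq hq0 hq1 ti)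
    (bigO_sq hq0 hq1 j hj) (osc_sq hq0 hq1 tj) (by intros; omega) (by intros; omega)
  have h2 := osc_mul (k := fun x => k x - m x) hq0 hq1
    ((bigO_sq hq0 hq1 i hi).mul hq0 (bigO_sq hq0 hq1 j hj)) h1
    (bigO_inv_bt hq0 hq1 n hn' hn) (osc_inv_bt hq0 hq1 hn' tn) (by intros; omega) (by intros; omega)
  refine (BigO.mono hq0 hq1 ((bigO_const κ).mul hq0 ((bigO_zpow hq0 m).mul hq0 h2))
    (by intros; omega)).congr fun x => ?_
  simp only [S4q.osc, cf, hm]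
  ring

theorem oneO_cf (hq0 : 0 < q) (hq1 : q < 1) (he : ∀ (c : ℕ) x, Dom c x → 0 ≤ e x + 20 * (c + 1))
    (hi : ∀ (c : ℕ) x, Dom c x → e x ≤ 2 * i x + 20 * (c + 1))
    (hj : ∀ (c : ℕ) x, Dom c x → e x ≤ 2 * j x + 20 * (c + 1))
    (hn : ∀ (c : ℕ) x, Dom c x → e x ≤ 2 * n x + 20 * (c + 1)) (hn' : ∀ x, n x ≠ 0) :
    OneO q (fun x => cf q 1 0 (i x) (j x) (n x)) e :=
  BigO.congr (((oneO_sq hq0 hq1 i hi).mul hq0 hq1 (oneO_sq hq0 hq1 j hj) he).mul hq0 hq1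
    (oneO_inv_bt hq0 hq1 n hn' hn) he) fun x => by
      simp only [cf]
      rw [zpow_zero]
      ring

end estimates

section coefficients

variable {q : ℝ}

theorem fAp_eq_cf (a u : ℤ) : fAp q a u = cf q (1) (u) (u + 1) (2 * a + 2 - u) (2 * a + 3) := by
  rw [fAp, cf]
  ring

theorem fBp_eq_cf (a u : ℤ) : fBp q a u = cf q (1) (0) (u + 1) (u + 2) (2 * a + 3) := by
  rw [fBp, cf, zpow_zero]
  ring

theorem fBm_eq_cf (a u : ℤ) : fBm q a u = cf q (-1) (2 * u + 1) (2 * a + 1 - u) (2 * a - u) (2 * a + 1) := by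
  rw [fBm, cf]
  ring

theorem fCp_eq_cf (a b p : ℤ) : fCp q a b p = if Odd p then
    cf q (-1) (p - 1) (2 * a + p + 4) (2 * a + 2 * b + 4 - p) (2 * a + 2 * b + 5)
    else cf q (-1) (p) (2 * a + p + 3) (2 * a + 2 * b + 5 - p) (2 * a + 2 * b + 5) := by
  rw [fCp, cf, cf]
  split_ifs <;> ring

theorem fCm_eq_cf (a b p : ℤ) : fCm q a b p = if Odd p then
    cf q (-1) (2 * a + p + 2) (p - 1) (2 * b + 1 - p) (2 * a + 2 * b + 3)
    else cf q (-1) (2 * a + p + 1) (p) (2 * b - p) (2 * a + 2 * b + 3) := by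
  rw [fCm, cf, cf]
  split_ifs <;> ring

theorem fHp_eq_cf (a b p : ℤ) : fHp q a b p = if Odd p then
    cf q (1) (2 * a + p + 2) (2 * a + 2 * b + 4 - p) (p + 1) (2 * a + 2 * b + 5)
    else cf q (1) (p) (2 * b + 2 - p) (2 * a + p + 3) (2 * a + 2 * b + 5) := by
  rw [fHp, cf, cf]
  split_ifs <;> ring

theorem fDp_eq_cf (a b p : ℤ) : fDp q a b p = if Odd p then
    cf q (1) (0) (2 * a + p + 4) (p + 1) (2 * a + 2 * b + 5)
    else cf q (1) (0) (2 * a + p + 3) (p + 2) (2 * a + 2 * b + 5) := by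
  rw [fDp, cf, cf, zpow_zero]
  split_ifs <;> ring

theorem fDm_eq_cf (a b p : ℤ) : fDm q a b p = if Odd p then
    cf q (-1) (2 * a + 2 * p + 3) (2 * b + 1 - p) (2 * a + 2 * b + 2 - p) (2 * a + 2 * b + 3)
    else cf q (-1) (2 * a + 2 * p + 3) (2 * b - p) (2 * a + 2 * b + 3 - p) (2 * a + 2 * b + 3) := by
  rw [fDm, cf, cf]
  split_ifs <;> ring

theorem bigO_Ap (hq0 : 0 < q) (hq1 : q < 1) : BigO q (fun x => fAp q x.a x.u) fun x => x.u := by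
  simp only [fAp_eq_cf]
  exact bigO_cf hq0 hq1 (fun _ _ ⟨_, _, _, _⟩ => by omega)
    (fun _ _ ⟨_, _, _, _⟩ => by omega)
    (fun _ _ ⟨_, _, _, _⟩ => by omega) (fun _ => by omega)
    (fun _ _ ⟨_, _, _, _⟩ => by omega)

theorem bigO_Bp (hq0 : 0 < q) (hq1 : q < 1) : BigO q (fun x => fBp q x.a x.u) fun x => 0 := by
  simp only [fBp_eq_cf]
  exact bigO_cf hq0 hq1 (fun _ _ ⟨_, _, _, _⟩ => by omega)
    (fun _ _ ⟨_, _, _, _⟩ => by omega)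
    (fun _ _ ⟨_, _, _, _⟩ => by omega) (fun _ => by omega)
    (fun _ _ ⟨_, _, _, _⟩ => by omega)

/-- The argument a + 1 appears because lowering parts are treated as transposes of raising shifts:
`fBm` at a + 1 is the raising weight of x₁*. -/
theorem bigO_Bm (hq0 : 0 < q) (hq1 : q < 1) : BigO q (fun x => fBm q (x.a + 1) x.u) fun x => 2 * x.u := by
  simp only [fBm_eq_cf]
  exact bigO_cf hq0 hq1 (fun _ _ ⟨_, _, _, _⟩ => by omega)
    (fun _ _ ⟨_, _, _, _⟩ => by omega)
    (fun _ _ ⟨_, _, _, _⟩ => by omega) (fun _ => by omega)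
    (fun _ _ ⟨_, _, _, _⟩ => by omega)

theorem osc_Ap (hq0 : 0 < q) (hq1 : q < 1) :
    BigO q (osc ⟨1, 0, 0, 0⟩ fun x => fAp q x.a x.u) fun x => 2 * x.a := by
  simp only [fAp_eq_cf]
  exact osc_cf hq0 hq1 (fun _ _ ⟨_, _, _, _⟩ => by omega)
    (fun _ _ ⟨_, _, _, _⟩ => by omega)
    (fun _ _ ⟨_, _, _, _⟩ => by omega) (fun _ => by omega)
    (fun _ => by simp [Pt.add_def]) (.inl fun _ => by simp [Pt.add_def])
    (.inr fun _ _ ⟨_, _, _, _⟩ => by simp only [Pt.add_def]; omega)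
    (.inr fun _ _ ⟨_, _, _, _⟩ => by simp only [Pt.add_def]; omega)

theorem osc_Bp (hq0 : 0 < q) (hq1 : q < 1) :
    BigO q (osc ⟨1, 0, 0, 0⟩ fun x => fBp q x.a x.u) fun x => 2 * x.a := by
  simp only [fBp_eq_cf]
  exact osc_cf hq0 hq1 (fun _ _ ⟨_, _, _, _⟩ => by omega)
    (fun _ _ ⟨_, _, _, _⟩ => by omega)
    (fun _ _ ⟨_, _, _, _⟩ => by omega) (fun _ => by omega)
    (fun _ => by simp [Pt.add_def]) (.inl fun _ => by simp [Pt.add_def])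
    (.inl fun _ => by simp [Pt.add_def])
    (.inr fun _ _ ⟨_, _, _, _⟩ => by simp only [Pt.add_def]; omega)

/-- `fBp` is only bounded, so smallness has to come from the difference: both roots in u tend to 1
exponentially in u. -/
theorem osc_Bp_left (hq0 : 0 < q) (hq1 : q < 1) :
    BigO q (osc ⟨1, 2, 0, 0⟩ fun x => fBp q x.a x.u) fun x => x.u := by
  simp only [fBp_eq_cf]
  exact osc_cf hq0 hq1 (fun _ _ ⟨_, _, _, _⟩ => by omega)
    (fun _ _ ⟨_, _, _, _⟩ => by omega)
    (fun _ _ ⟨_, _, _, _⟩ => by omega) (fun _ => by omega)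
    (fun _ => by simp [Pt.add_def]) (.inr fun _ _ ⟨_, _, _, _⟩ => by simp only [Pt.add_def]; omega)
    (.inr fun _ _ ⟨_, _, _, _⟩ => by simp only [Pt.add_def]; omega)
    (.inr fun _ _ ⟨_, _, _, _⟩ => by simp only [Pt.add_def]; omega)

theorem osc_Bp_diag (hq0 : 0 < q) (hq1 : q < 1) :
    BigO q (osc ⟨1, 1, 0, 0⟩ fun x => fBp q x.a x.u) fun x => x.u := by
  simp only [fBp_eq_cf]
  exact osc_cf hq0 hq1 (fun _ _ ⟨_, _, _, _⟩ => by omega)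
    (fun _ _ ⟨_, _, _, _⟩ => by omega)
    (fun _ _ ⟨_, _, _, _⟩ => by omega) (fun _ => by omega)
    (fun _ => by simp [Pt.add_def]) (.inr fun _ _ ⟨_, _, _, _⟩ => by simp only [Pt.add_def]; omega)
    (.inr fun _ _ ⟨_, _, _, _⟩ => by simp only [Pt.add_def]; omega)
    (.inr fun _ _ ⟨_, _, _, _⟩ => by simp only [Pt.add_def]; omega)

theorem osc_Bm (hq0 : 0 < q) (hq1 : q < 1) :
    BigO q (osc ⟨1, 0, 0, 0⟩ fun x => fBm q (x.a + 1) x.u) fun x => 2 * x.a := by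
  simp only [fBm_eq_cf]
  exact osc_cf hq0 hq1 (fun _ _ ⟨_, _, _, _⟩ => by omega)
    (fun _ _ ⟨_, _, _, _⟩ => by omega)
    (fun _ _ ⟨_, _, _, _⟩ => by omega) (fun _ => by omega)
    (fun _ => by simp [Pt.add_def]) (.inr fun _ _ ⟨_, _, _, _⟩ => by simp only [Pt.add_def]; omega)
    (.inr fun _ _ ⟨_, _, _, _⟩ => by simp only [Pt.add_def]; omega)
    (.inr fun _ _ ⟨_, _, _, _⟩ => by simp only [Pt.add_def]; omega)

theorem bigO_Cp (hq0 : 0 < q) (hq1 : q < 1) :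
    BigO q (fun x => fCp q x.a x.b x.p) fun x => x.p := by
  simp only [fCp_eq_cf]
  exact BigO.ite hq0 (bigO_cf hq0 hq1 (fun _ _ ⟨_, _, _, _⟩ => by omega)
    (fun _ _ ⟨_, _, _, _⟩ => by omega)
    (fun _ _ ⟨_, _, _, _⟩ => by omega) (fun _ => by omega)
    (fun _ _ ⟨_, _, _, _⟩ => by omega))
    (bigO_cf hq0 hq1 (fun _ _ ⟨_, _, _, _⟩ => by omega)
    (fun _ _ ⟨_, _, _, _⟩ => by omega)
    (fun _ _ ⟨_, _, _, _⟩ => by omega) (fun _ => by omega)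
    (fun _ _ ⟨_, _, _, _⟩ => by omega))

theorem bigO_Cm (hq0 : 0 < q) (hq1 : q < 1) :
    BigO q (fun x => fCm q x.a x.b x.p) fun x => 2 * x.a + x.p := by
  simp only [fCm_eq_cf]
  exact BigO.ite hq0 (bigO_cf hq0 hq1 (fun _ _ ⟨_, _, _, _⟩ => by omega)
    (fun _ _ ⟨_, _, _, _⟩ => by omega)
    (fun _ _ ⟨_, _, _, _⟩ => by omega) (fun _ => by omega)
    (fun _ _ ⟨_, _, _, _⟩ => by omega))
    (bigO_cf hq0 hq1 (fun _ _ ⟨_, _, _, _⟩ => by omega)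
    (fun _ _ ⟨_, _, _, _⟩ => by omega)
    (fun _ _ ⟨_, _, _, _⟩ => by omega) (fun _ => by omega)
    (fun _ _ ⟨_, _, _, _⟩ => by omega))

theorem bigO_Hp (hq0 : 0 < q) (hq1 : q < 1) :
    BigO q (fun x => fHp q x.a x.b x.p) fun x => x.p := by
  simp only [fHp_eq_cf]
  exact BigO.ite hq0 (bigO_cf hq0 hq1 (fun _ _ ⟨_, _, _, _⟩ => by omega)
    (fun _ _ ⟨_, _, _, _⟩ => by omega)
    (fun _ _ ⟨_, _, _, _⟩ => by omega) (fun _ => by omega)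
    (fun _ _ ⟨_, _, _, _⟩ => by omega))
    (bigO_cf hq0 hq1 (fun _ _ ⟨_, _, _, _⟩ => by omega)
    (fun _ _ ⟨_, _, _, _⟩ => by omega)
    (fun _ _ ⟨_, _, _, _⟩ => by omega) (fun _ => by omega)
    (fun _ _ ⟨_, _, _, _⟩ => by omega))

theorem bigO_Dp (hq0 : 0 < q) (hq1 : q < 1) :
    BigO q (fun x => fDp q x.a x.b x.p) fun x => 0 := by
  simp only [fDp_eq_cf]
  exact BigO.ite hq0 (bigO_cf hq0 hq1 (fun _ _ ⟨_, _, _, _⟩ => by omega)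
    (fun _ _ ⟨_, _, _, _⟩ => by omega)
    (fun _ _ ⟨_, _, _, _⟩ => by omega) (fun _ => by omega)
    (fun _ _ ⟨_, _, _, _⟩ => by omega))
    (bigO_cf hq0 hq1 (fun _ _ ⟨_, _, _, _⟩ => by omega)
    (fun _ _ ⟨_, _, _, _⟩ => by omega)
    (fun _ _ ⟨_, _, _, _⟩ => by omega) (fun _ => by omega)
    (fun _ _ ⟨_, _, _, _⟩ => by omega))

theorem bigO_Dm (hq0 : 0 < q) (hq1 : q < 1) :
    BigO q (fun x => fDm q x.a x.b x.p) fun x => 2 * x.a + x.p := by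
  simp only [fDm_eq_cf]
  exact BigO.ite hq0 (bigO_cf hq0 hq1 (fun _ _ ⟨_, _, _, _⟩ => by omega)
    (fun _ _ ⟨_, _, _, _⟩ => by omega)
    (fun _ _ ⟨_, _, _, _⟩ => by omega) (fun _ => by omega)
    (fun _ _ ⟨_, _, _, _⟩ => by omega))
    (bigO_cf hq0 hq1 (fun _ _ ⟨_, _, _, _⟩ => by omega)
    (fun _ _ ⟨_, _, _, _⟩ => by omega)
    (fun _ _ ⟨_, _, _, _⟩ => by omega) (fun _ => by omega)
    (fun _ _ ⟨_, _, _, _⟩ => by omega))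

/-- The root in 2a + p does not see b. The other factors are 1 + O(q^{4a+4b-2p}) or better, and
together with the prefactor q^p this gives O(q^{2a+2b}), because p ≤ 2b up to a constant. -/
theorem osc_Cp (hq0 : 0 < q) (hq1 : q < 1) :
    BigO q (osc ⟨0, 0, 1, 0⟩ fun x => fCp q x.a x.b x.p) fun x => 2 * x.a + 2 * x.b := by
  simp only [fCp_eq_cf]
  exact osc_ite hq0 rfl (osc_cf hq0 hq1 (fun _ _ ⟨_, _, _, _⟩ => by omega)
    (fun _ _ ⟨_, _, _, _⟩ => by omega)
    (fun _ _ ⟨_, _, _, _⟩ => by omega) (fun _ => by omega)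
    (fun _ => by simp [Pt.add_def]) (.inl fun _ => by simp [Pt.add_def])
    (.inr fun _ _ ⟨_, _, _, _⟩ => by simp only [Pt.add_def]; omega)
    (.inr fun _ _ ⟨_, _, _, _⟩ => by simp only [Pt.add_def]; omega))
    (osc_cf hq0 hq1 (fun _ _ ⟨_, _, _, _⟩ => by omega)
    (fun _ _ ⟨_, _, _, _⟩ => by omega)
    (fun _ _ ⟨_, _, _, _⟩ => by omega) (fun _ => by omega)
    (fun _ => by simp [Pt.add_def]) (.inl fun _ => by simp [Pt.add_def])
    (.inr fun _ _ ⟨_, _, _, _⟩ => by simp only [Pt.add_def]; omega)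
    (.inr fun _ _ ⟨_, _, _, _⟩ => by simp only [Pt.add_def]; omega))

theorem osc_Cm (hq0 : 0 < q) (hq1 : q < 1) :
    BigO q (osc ⟨0, 0, 1, 0⟩ fun x => fCm q x.a x.b x.p) fun x => 2 * x.a + 2 * x.b := by
  simp only [fCm_eq_cf]
  exact osc_ite hq0 rfl (osc_cf hq0 hq1 (fun _ _ ⟨_, _, _, _⟩ => by omega)
    (fun _ _ ⟨_, _, _, _⟩ => by omega)
    (fun _ _ ⟨_, _, _, _⟩ => by omega) (fun _ => by omega)
    (fun _ => by simp [Pt.add_def]) (.inl fun _ => by simp [Pt.add_def])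
    (.inr fun _ _ ⟨_, _, _, _⟩ => by simp only [Pt.add_def]; omega)
    (.inr fun _ _ ⟨_, _, _, _⟩ => by simp only [Pt.add_def]; omega))
    (osc_cf hq0 hq1 (fun _ _ ⟨_, _, _, _⟩ => by omega)
    (fun _ _ ⟨_, _, _, _⟩ => by omega)
    (fun _ _ ⟨_, _, _, _⟩ => by omega) (fun _ => by omega)
    (fun _ => by simp [Pt.add_def]) (.inl fun _ => by simp [Pt.add_def])
    (.inr fun _ _ ⟨_, _, _, _⟩ => by simp only [Pt.add_def]; omega)
    (.inr fun _ _ ⟨_, _, _, _⟩ => by simp only [Pt.add_def]; omega))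

theorem osc_Hp (hq0 : 0 < q) (hq1 : q < 1) :
    BigO q (osc ⟨0, 0, 1, 0⟩ fun x => fHp q x.a x.b x.p) fun x => 2 * x.b := by
  simp only [fHp_eq_cf]
  exact osc_ite hq0 rfl (osc_cf hq0 hq1 (fun _ _ ⟨_, _, _, _⟩ => by omega)
    (fun _ _ ⟨_, _, _, _⟩ => by omega)
    (fun _ _ ⟨_, _, _, _⟩ => by omega) (fun _ => by omega)
    (fun _ => by simp [Pt.add_def]) (.inr fun _ _ ⟨_, _, _, _⟩ => by simp only [Pt.add_def]; omega)
    (.inl fun _ => by simp [Pt.add_def])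
    (.inr fun _ _ ⟨_, _, _, _⟩ => by simp only [Pt.add_def]; omega))
    (osc_cf hq0 hq1 (fun _ _ ⟨_, _, _, _⟩ => by omega)
    (fun _ _ ⟨_, _, _, _⟩ => by omega)
    (fun _ _ ⟨_, _, _, _⟩ => by omega) (fun _ => by omega)
    (fun _ => by simp [Pt.add_def]) (.inr fun _ _ ⟨_, _, _, _⟩ => by simp only [Pt.add_def]; omega)
    (.inl fun _ => by simp [Pt.add_def])
    (.inr fun _ _ ⟨_, _, _, _⟩ => by simp only [Pt.add_def]; omega))

theorem osc_Dp (hq0 : 0 < q) (hq1 : q < 1) :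
    BigO q (osc ⟨0, 0, 1, 0⟩ fun x => fDp q x.a x.b x.p) fun x => 2 * x.a + 2 * x.b := by
  simp only [fDp_eq_cf]
  exact osc_ite hq0 rfl (osc_cf hq0 hq1 (fun _ _ ⟨_, _, _, _⟩ => by omega)
    (fun _ _ ⟨_, _, _, _⟩ => by omega)
    (fun _ _ ⟨_, _, _, _⟩ => by omega) (fun _ => by omega)
    (fun _ => by simp [Pt.add_def]) (.inl fun _ => by simp [Pt.add_def])
    (.inl fun _ => by simp [Pt.add_def])
    (.inr fun _ _ ⟨_, _, _, _⟩ => by simp only [Pt.add_def]; omega))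
    (osc_cf hq0 hq1 (fun _ _ ⟨_, _, _, _⟩ => by omega)
    (fun _ _ ⟨_, _, _, _⟩ => by omega)
    (fun _ _ ⟨_, _, _, _⟩ => by omega) (fun _ => by omega)
    (fun _ => by simp [Pt.add_def]) (.inl fun _ => by simp [Pt.add_def])
    (.inl fun _ => by simp [Pt.add_def])
    (.inr fun _ _ ⟨_, _, _, _⟩ => by simp only [Pt.add_def]; omega))

theorem osc_Dm (hq0 : 0 < q) (hq1 : q < 1) :
    BigO q (osc ⟨0, 0, 1, 0⟩ fun x => fDm q x.a x.b x.p) fun x => 2 * x.a + 2 * x.b := by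
  simp only [fDm_eq_cf]
  exact osc_ite hq0 rfl (osc_cf hq0 hq1 (fun _ _ ⟨_, _, _, _⟩ => by omega)
    (fun _ _ ⟨_, _, _, _⟩ => by omega)
    (fun _ _ ⟨_, _, _, _⟩ => by omega) (fun _ => by omega)
    (fun _ => by simp [Pt.add_def]) (.inr fun _ _ ⟨_, _, _, _⟩ => by simp only [Pt.add_def]; omega)
    (.inr fun _ _ ⟨_, _, _, _⟩ => by simp only [Pt.add_def]; omega)
    (.inr fun _ _ ⟨_, _, _, _⟩ => by simp only [Pt.add_def]; omega))
    (osc_cf hq0 hq1 (fun _ _ ⟨_, _, _, _⟩ => by omega)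
    (fun _ _ ⟨_, _, _, _⟩ => by omega)
    (fun _ _ ⟨_, _, _, _⟩ => by omega) (fun _ => by omega)
    (fun _ => by simp [Pt.add_def]) (.inr fun _ _ ⟨_, _, _, _⟩ => by simp only [Pt.add_def]; omega)
    (.inr fun _ _ ⟨_, _, _, _⟩ => by simp only [Pt.add_def]; omega)
    (.inr fun _ _ ⟨_, _, _, _⟩ => by simp only [Pt.add_def]; omega))

theorem osc_Cp_a (hq0 : 0 < q) (hq1 : q < 1) :
    BigO q (osc ⟨1, 0, 0, 0⟩ fun x => fCp q x.a x.b x.p) fun x => 2 * x.a + x.p := by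
  simp only [fCp_eq_cf]
  exact osc_ite hq0 rfl (osc_cf hq0 hq1 (fun _ _ ⟨_, _, _, _⟩ => by omega)
    (fun _ _ ⟨_, _, _, _⟩ => by omega)
    (fun _ _ ⟨_, _, _, _⟩ => by omega) (fun _ => by omega)
    (fun _ => by simp [Pt.add_def]) (.inr fun _ _ ⟨_, _, _, _⟩ => by simp only [Pt.add_def]; omega)
    (.inr fun _ _ ⟨_, _, _, _⟩ => by simp only [Pt.add_def]; omega)
    (.inr fun _ _ ⟨_, _, _, _⟩ => by simp only [Pt.add_def]; omega))
    (osc_cf hq0 hq1 (fun _ _ ⟨_, _, _, _⟩ => by omega)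
    (fun _ _ ⟨_, _, _, _⟩ => by omega)
    (fun _ _ ⟨_, _, _, _⟩ => by omega) (fun _ => by omega)
    (fun _ => by simp [Pt.add_def]) (.inr fun _ _ ⟨_, _, _, _⟩ => by simp only [Pt.add_def]; omega)
    (.inr fun _ _ ⟨_, _, _, _⟩ => by simp only [Pt.add_def]; omega)
    (.inr fun _ _ ⟨_, _, _, _⟩ => by simp only [Pt.add_def]; omega))

theorem osc_Dp_a (hq0 : 0 < q) (hq1 : q < 1) :
    BigO q (osc ⟨1, 0, 0, 0⟩ fun x => fDp q x.a x.b x.p) fun x => 2 * x.a + x.p := by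
  simp only [fDp_eq_cf]
  exact osc_ite hq0 rfl (osc_cf hq0 hq1 (fun _ _ ⟨_, _, _, _⟩ => by omega)
    (fun _ _ ⟨_, _, _, _⟩ => by omega)
    (fun _ _ ⟨_, _, _, _⟩ => by omega) (fun _ => by omega)
    (fun _ => by simp [Pt.add_def]) (.inr fun _ _ ⟨_, _, _, _⟩ => by simp only [Pt.add_def]; omega)
    (.inl fun _ => by simp [Pt.add_def])
    (.inr fun _ _ ⟨_, _, _, _⟩ => by simp only [Pt.add_def]; omega))
    (osc_cf hq0 hq1 (fun _ _ ⟨_, _, _, _⟩ => by omega)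
    (fun _ _ ⟨_, _, _, _⟩ => by omega)
    (fun _ _ ⟨_, _, _, _⟩ => by omega) (fun _ => by omega)
    (fun _ => by simp [Pt.add_def]) (.inr fun _ _ ⟨_, _, _, _⟩ => by simp only [Pt.add_def]; omega)
    (.inl fun _ => by simp [Pt.add_def])
    (.inr fun _ _ ⟨_, _, _, _⟩ => by simp only [Pt.add_def]; omega))

/-- This coefficient is not small for large p but tends to 1. It is the reason why the constant κ in
`Est` is needed. -/
theorem oneO_Dp (hq0 : 0 < q) (hq1 : q < 1) :
    OneO q (fun x => fDp q x.a x.b x.p) fun x => x.p := by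
  simp only [fDp_eq_cf]
  refine BigO.congr (BigO.ite hq0 (P := fun x => Odd x.p) (oneO_cf (i := fun x => 2 * x.a + x.p + 4)
    (j := fun x => x.p + 1) (n := fun x => 2 * x.a + 2 * x.b + 5) hq0 hq1 (fun _ _ ⟨_, _, _, _⟩ => by omega)
    (fun _ _ ⟨_, _, _, _⟩ => by omega)
    (fun _ _ ⟨_, _, _, _⟩ => by omega)
    (fun _ _ ⟨_, _, _, _⟩ => by omega) (fun _ => by omega))
    (oneO_cf (i := fun x => 2 * x.a + x.p + 3) (j := fun x => x.p + 2)
    (n := fun x => 2 * x.a + 2 * x.b + 5) hq0 hq1 (fun _ _ ⟨_, _, _, _⟩ => by omega)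
    (fun _ _ ⟨_, _, _, _⟩ => by omega)
    (fun _ _ ⟨_, _, _, _⟩ => by omega)
    (fun _ _ ⟨_, _, _, _⟩ => by omega) (fun _ => by omega))) fun x => ?_
  by_cases h : Odd x.p <;> simp only [h, if_true, if_false]

/-- The common shape of the middle coefficients. -/
def cg (q : ℝ) (κ : ℂ) (m i j n n' : ℤ) : ℂ :=
  κ * ((q : ℂ) ^ m * (sq q i * sq q j * ((bt q n)⁻¹ * (bt q n')⁻¹)))

theorem bigO_cg {κ : ℂ} {m i j n n' e : Pt → ℤ} (hq0 : 0 < q) (hq1 : q < 1)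
    (hi : ∀ (c : ℕ) x, Dom c x → 0 ≤ 2 * i x + 20 * (c + 1))
    (hj : ∀ (c : ℕ) x, Dom c x → 0 ≤ 2 * j x + 20 * (c + 1))
    (hn : ∀ (c : ℕ) x, Dom c x → 0 ≤ 2 * n x + 20 * (c + 1)) (hn' : ∀ x, n x ≠ 0)
    (hr : ∀ (c : ℕ) x, Dom c x → 0 ≤ 2 * n' x + 20 * (c + 1)) (hr' : ∀ x, n' x ≠ 0)
    (he : ∀ (c : ℕ) x, Dom c x → e x ≤ m x + 20 * (c + 1)) :
    BigO q (fun x => cg q κ (m x) (i x) (j x) (n x) (n' x)) e :=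
  BigO.mono (e := fun x => 0 + (m x + (0 + 0 + (0 + 0)))) hq0 hq1
    (BigO.mul hq0 (bigO_const κ) (BigO.mul hq0 (bigO_zpow hq0 m)
      (BigO.mul hq0 (BigO.mul hq0 (bigO_sq hq0 hq1 i hi) (bigO_sq hq0 hq1 j hj))
        (BigO.mul hq0 (bigO_inv_bt hq0 hq1 n hn' hn) (bigO_inv_bt hq0 hq1 n' hr' hr))))) fun c x hx => by
    have := he c x hx
    omega

theorem fB0_eq_cg (a u : ℤ) : fB0 q a u =
    cg q ((1 + (q : ℂ) ^ 2) * ((q : ℂ) ^ (-1 : ℤ) - q)) (2 * a + u + 2) (2 * a + 1 - u)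
      (u + 1) (2 * a + 1) (2 * a + 3) := by
  rw [fB0, cg]
  ring

theorem fC0_eq_cg (a b p : ℤ) : fC0 q a b p = if Odd p then
    cg q ((q : ℂ) ^ (-2 : ℤ) - (q : ℂ) ^ 2) (4 * a + 2 * b + 2 * p + 6) (2 * a + 2 * b + 4 - p)
      (2 * b + 1 - p) (2 * a + 2 * b + 3) (2 * a + 2 * b + 5)
    else cg q (-((q : ℂ) ^ (-2 : ℤ) - (q : ℂ) ^ 2)) (2 * a + 2 * b + 3) (2 * a + p + 3)
      (p) (2 * a + 2 * b + 3) (2 * a + 2 * b + 5) := by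
  rw [fC0, cg, cg]
  split_ifs <;> ring

theorem fD0_eq_cg (a b p : ℤ) : fD0 q a b p = if Odd p then
    cg q ((q : ℂ) ^ (-2 : ℤ) - (q : ℂ) ^ 2) (4 * a + 2 * b + p + 7) (2 * b + 1 - p)
      (p + 1) (2 * a + 2 * b + 3) (2 * a + 2 * b + 5)
    else cg q ((q : ℂ) ^ (-2 : ℤ) - (q : ℂ) ^ 2) (2 * a + 2 * b + p + 5) (2 * a + 2 * b + 3 - p)
      (2 * a + p + 3) (2 * a + 2 * b + 3) (2 * a + 2 * b + 5) := by
  rw [fD0, cg, cg]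
  split_ifs <;> ring

theorem bigO_B0 (hq0 : 0 < q) (hq1 : q < 1) : BigO q (fun x => fB0 q x.a x.u) fun x => 2 * x.a := by
  simp only [fB0_eq_cg]
  exact bigO_cg hq0 hq1 (fun _ _ ⟨_, _, _, _⟩ => by omega)
    (fun _ _ ⟨_, _, _, _⟩ => by omega)
    (fun _ _ ⟨_, _, _, _⟩ => by omega) (fun _ => by omega)
    (fun _ _ ⟨_, _, _, _⟩ => by omega) (fun _ => by omega)
    (fun _ _ ⟨_, _, _, _⟩ => by omega)

theorem bigO_B0_sub (hq0 : 0 < q) (hq1 : q < 1) : BigO q (fun x => fB0 q x.a (x.u - 1)) fun x => 2 * x.a := by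
  simp only [fB0_eq_cg]
  exact bigO_cg hq0 hq1 (fun _ _ ⟨_, _, _, _⟩ => by omega)
    (fun _ _ ⟨_, _, _, _⟩ => by omega)
    (fun _ _ ⟨_, _, _, _⟩ => by omega) (fun _ => by omega)
    (fun _ _ ⟨_, _, _, _⟩ => by omega) (fun _ => by omega)
    (fun _ _ ⟨_, _, _, _⟩ => by omega)

theorem bigO_C0 (hq0 : 0 < q) (hq1 : q < 1) :
    BigO q (fun x => fC0 q x.a x.b x.p) fun x => 2 * x.a + 2 * x.b := by
  simp only [fC0_eq_cg]
  exact BigO.ite hq0 (bigO_cg hq0 hq1 (fun _ _ ⟨_, _, _, _⟩ => by omega)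
    (fun _ _ ⟨_, _, _, _⟩ => by omega)
    (fun _ _ ⟨_, _, _, _⟩ => by omega) (fun _ => by omega)
    (fun _ _ ⟨_, _, _, _⟩ => by omega) (fun _ => by omega)
    (fun _ _ ⟨_, _, _, _⟩ => by omega))
    (bigO_cg hq0 hq1 (fun _ _ ⟨_, _, _, _⟩ => by omega)
    (fun _ _ ⟨_, _, _, _⟩ => by omega)
    (fun _ _ ⟨_, _, _, _⟩ => by omega) (fun _ => by omega)
    (fun _ _ ⟨_, _, _, _⟩ => by omega) (fun _ => by omega)
    (fun _ _ ⟨_, _, _, _⟩ => by omega))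

theorem bigO_D0 (hq0 : 0 < q) (hq1 : q < 1) :
    BigO q (fun x => fD0 q x.a x.b x.p) fun x => 2 * x.a + 2 * x.b := by
  simp only [fD0_eq_cg]
  exact BigO.ite hq0 (bigO_cg hq0 hq1 (fun _ _ ⟨_, _, _, _⟩ => by omega)
    (fun _ _ ⟨_, _, _, _⟩ => by omega)
    (fun _ _ ⟨_, _, _, _⟩ => by omega) (fun _ => by omega)
    (fun _ _ ⟨_, _, _, _⟩ => by omega) (fun _ => by omega)
    (fun _ _ ⟨_, _, _, _⟩ => by omega))
    (bigO_cg hq0 hq1 (fun _ _ ⟨_, _, _, _⟩ => by omega)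
    (fun _ _ ⟨_, _, _, _⟩ => by omega)
    (fun _ _ ⟨_, _, _, _⟩ => by omega) (fun _ => by omega)
    (fun _ _ ⟨_, _, _, _⟩ => by omega) (fun _ => by omega)
    (fun _ _ ⟨_, _, _, _⟩ => by omega))

theorem bigO_A0 (hq0 : 0 < q) (hq1 : q < 1) : BigO q (fun x => fA0 q x.a x.u) fun x => 2 * x.a := by
  have h1 := (((bigO_zpow hq0 fun x => 2 * x.u + 1).mul hq0 (bigO_const ((q : ℂ) ^ (-2 : ℤ) - (q : ℂ) ^ 2))).mul hq0
    (bigO_bt hq0 hq1 (fun x => 2 * x.a + 1 - x.u) (fun _ _ ⟨_, _, _, _⟩ => by omega))).mono (e' := fun _ => 0)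
    hq0 hq1 (fun _ _ ⟨_, _, _, _⟩ => by omega)
  have h2 := ((bigO_const ((q : ℂ) ^ (-1 : ℤ) - q)).mul hq0
    (bigO_bt hq0 hq1 (fun x => 2 * x.a + 1) (fun _ _ ⟨_, _, _, _⟩ => by omega))).mono (e' := fun _ => 0)
    hq0 hq1 (fun _ _ ⟨_, _, _, _⟩ => by omega)
  refine ((((bigO_zpow hq0 fun x => 2 * x.a + 1).mul hq0 (h1.sub h2)).mul hq0
    ((bigO_inv_bt hq0 hq1 (fun x => 2 * x.a + 1) (fun _ => by omega) (fun _ _ ⟨_, _, _, _⟩ => by omega)).mul hq0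
    (bigO_inv_bt hq0 hq1 (fun x => 2 * x.a + 3) (fun _ => by omega) (fun _ _ ⟨_, _, _, _⟩ => by omega)))).mono
    hq0 hq1 (fun _ _ ⟨_, _, _, _⟩ => by omega)).congr fun x => ?_
  rw [fA0]
  ring

/-- This coefficient is a difference and does not have the product shape, but each of its two
summands already has the right order. -/
theorem bigO_H0 (hq0 : 0 < q) (hq1 : q < 1) :
    BigO q (fun x => fH0 q x.a x.b x.p) fun x => 2 * x.b := by
  have h0 := (bigO_inv_bt hq0 hq1 (fun x => 2 * x.a + 2 * x.b + 3) (fun _ => by omega) (fun _ _ ⟨_, _, _, _⟩ => by omega)).mul hq0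
    (bigO_inv_bt hq0 hq1 (fun x => 2 * x.a + 2 * x.b + 5) (fun _ => by omega) (fun _ _ ⟨_, _, _, _⟩ => by omega))
  have h1 := (((bigO_zpow hq0 fun x => 4 * x.a + 2 * x.b + 6).mul hq0 (bigO_bt hq0 hq1 (fun x => 2 * x.b + 1 - x.p) (fun _ _ ⟨_, _, _, _⟩ => by omega))).mul
    hq0 (bigO_bt hq0 hq1 (fun x => x.p + 1) (fun _ _ ⟨_, _, _, _⟩ => by omega))).mono (e' := fun x => 2 * x.b)
    hq0 hq1 (fun _ _ ⟨_, _, _, _⟩ => by omega)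
  have h2 := (((bigO_zpow hq0 fun x => 2 * x.b).mul hq0 (bigO_bt hq0 hq1 (fun x => 2 * x.a + 2 * x.b + 4 - x.p) (fun _ _ ⟨_, _, _, _⟩ => by omega))).mul
    hq0 (bigO_bt hq0 hq1 (fun x => 2 * x.a + x.p + 2) (fun _ _ ⟨_, _, _, _⟩ => by omega))).mono (e' := fun x => 2 * x.b)
    hq0 hq1 (fun _ _ ⟨_, _, _, _⟩ => by omega)
  have h3 := (((bigO_zpow hq0 fun x => 2 * x.b + 2).mul hq0 (bigO_bt hq0 hq1 (fun x => 2 * x.a + 2 * x.b + 3 - x.p) (fun _ _ ⟨_, _, _, _⟩ => by omega))).mul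
    hq0 (bigO_bt hq0 hq1 (fun x => 2 * x.a + x.p + 3) (fun _ _ ⟨_, _, _, _⟩ => by omega))).mono (e' := fun x => 2 * x.b)
    hq0 hq1 (fun _ _ ⟨_, _, _, _⟩ => by omega)
  have h4 := (((bigO_zpow hq0 fun x => 4 * x.a + 2 * x.b + 4).mul hq0 (bigO_bt hq0 hq1 (fun x => 2 * x.b + 2 - x.p) (fun _ _ ⟨_, _, _, _⟩ => by omega))).mul
    hq0 (bigO_bt hq0 hq1 (fun x => x.p) (fun _ _ ⟨_, _, _, _⟩ => by omega))).mono (e' := fun x => 2 * x.b)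
    hq0 hq1 (fun _ _ ⟨_, _, _, _⟩ => by omega)
  refine (BigO.mono hq0 hq1 ((BigO.ite (P := fun x => Odd x.p) hq0 (h1.sub h2) (h3.sub h4)).mul hq0 h0)
    (fun _ _ ⟨_, _, _, _⟩ => by omega)).congr fun x => ?_
  rw [fH0]
  split_ifs <;> ring

end coefficients

/-! ### Commutators with diagonal operators -/

theorem weightedPerm_apply (w : Label → ℝ) (e : Equiv.Perm Label) (v : (weightedPerm w e).domain)
    (i : Label) : weightedPerm w e v i = (w (e.symm i) : ℂ) * (v : H) (e.symm i) := rfl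

theorem mem_weightedPerm (w : Label → ℝ) (e : Equiv.Perm Label) (v : H) :
    v ∈ (weightedPerm w e).domain ↔ ∃ u : H, ∀ i, u i = (w (e.symm i) : ℂ) * v (e.symm i) := by
  constructor
  · intro h
    exact ⟨weightedPerm w e ⟨v, h⟩, fun i => rfl⟩
  · rintro ⟨u, hu⟩
    have h := lp.memℓp u
    rwa [funext hu] at h

/-- The domain condition costs nothing: if the coordinatewise identity holds, the weighted
coordinates of T v are those of the vector S v + T A v, so T v lies in the maximal domain. -/
theorem isCommutator_iff {w : Label → ℝ} {e : Equiv.Perm Label} {T S : H →L[ℂ] H} :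
    IsCommutator (weightedPerm w e) T S ↔ ∀ (v : (weightedPerm w e).domain) i,
      (w (e.symm i) : ℂ) * T v (e.symm i) = S v i + T (weightedPerm w e v) i := by
  constructor
  · intro h v i
    obtain ⟨h1, h2⟩ := h v
    have h3 := weightedPerm_apply w e ⟨T v, h1⟩ i
    rw [← h3, h2, lp.coeFn_sub, Pi.sub_apply, sub_add_cancel]
  · intro h v
    have h1 : T v ∈ (weightedPerm w e).domain :=
      (mem_weightedPerm _ _ _).2 ⟨S v + T (weightedPerm w e v), fun i => (h v i).symm⟩
    refine ⟨h1, lp.ext (funext fun i => ?_)⟩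
    have h3 := weightedPerm_apply w e ⟨T v, h1⟩ i
    rw [lp.coeFn_sub, Pi.sub_apply, h3]
    exact eq_sub_of_add_eq (h v i).symm

section algebra

variable {w : Label → ℝ} {e : Equiv.Perm Label} {T T' S S' : H →L[ℂ] H}

theorem IsCommutator.add (h : IsCommutator (weightedPerm w e) T S)
    (h' : IsCommutator (weightedPerm w e) T' S') :
    IsCommutator (weightedPerm w e) (T + T') (S + S') := by
  rw [isCommutator_iff] at *
  intro v i
  have h1 := h v i
  have h2 := h' v i
  simp only [ContinuousLinearMap.add_apply, lp.coeFn_add, Pi.add_apply, mul_add, h1, h2]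
  ring

theorem IsCommutator.smul (c : ℂ) (h : IsCommutator (weightedPerm w e) T S) :
    IsCommutator (weightedPerm w e) (c • T) (c • S) := by
  rw [isCommutator_iff] at *
  intro v i
  have h1 := h v i
  simp only [ContinuousLinearMap.smul_apply, lp.coeFn_smul, Pi.smul_apply, smul_eq_mul,
    mul_left_comm _ c, h1]
  ring

theorem isCommutator_zero : IsCommutator (weightedPerm w e) 0 0 := by
  rw [isCommutator_iff]
  intro v i
  simp

theorem isCommutator_one : IsCommutator (weightedPerm w e) 1 0 := by
  rw [isCommutator_iff]
  intro v i
  simp [weightedPerm_apply]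

theorem IsCommutator.mul (h : IsCommutator (weightedPerm w e) T S)
    (h' : IsCommutator (weightedPerm w e) T' S') :
    IsCommutator (weightedPerm w e) (T * T') (S * T' + T * S') := by
  intro v
  obtain ⟨h1, h2⟩ := h' v
  obtain ⟨h3, h4⟩ := h ⟨T' v, h1⟩
  refine ⟨h3, ?_⟩
  change S (T' v) + T (S' v) = weightedPerm w e ⟨T (T' v), h3⟩ - T (T' (weightedPerm w e v))
  rw [h4, h2, map_sub]
  abel

end algebra

/-! ### Finite propagation operators and rapidly decaying shifts -/

/-- The eigenvalue `l + 3 / 2` of `|D|`. -/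
def lw (x : Pt) : ℝ := x.a + x.b + 2

theorem Label.l_add (i : Label) : i.l + 3 / 2 = lw i.pt := by
  rw [i.l_eq, lw]
  ring

theorem two_le_lw {x : Pt} (hx : x.Adm) : 2 ≤ lw x := by
  obtain ⟨h1, h2, h3, h4⟩ := hx
  have h5 : (0 : ℝ) ≤ x.a := by exact_mod_cast (by omega : 0 ≤ x.a)
  have h6 : (0 : ℝ) ≤ x.b := by exact_mod_cast (by omega : 0 ≤ x.b)
  rw [lw]
  linarith

theorem lw_add (x d : Pt) : lw (x + d) = lw x + (d.a + d.b) := by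
  simp only [lw, Pt.add_def]
  push_cast
  ring

/-- The change of the eigenvalue of `|D|` under a displacement. -/
def Pt.dl (d : Pt) : ℝ := d.a + d.b

/-- Coefficients that decay faster than all powers. -/
def Rapid (f : ℤˣ → Pt → ℂ) : Prop :=
  ∀ k : ℕ, ∃ C : ℝ, ∀ s x, x.Adm → lw x ^ k * ‖f s x‖ ≤ C

theorem Rapid.bdd {f : ℤˣ → Pt → ℂ} (h : Rapid f) : Bdd f := by
  obtain ⟨C, hC⟩ := h 0
  exact ⟨C, fun s x hx => by simpa using hC s x hx⟩

theorem Rapid.lw_mul {f : ℤˣ → Pt → ℂ} (h : Rapid f) : Rapid fun s x => lw x * f s x := by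
  intro k
  obtain ⟨C, hC⟩ := h (k + 1)
  refine ⟨C, fun s x hx => ?_⟩
  have := two_le_lw hx
  rw [norm_mul, Complex.norm_real, Real.norm_of_nonneg (by linarith), ← mul_assoc, ← pow_succ]
  exact hC s x hx

theorem Rapid.add {f g : ℤˣ → Pt → ℂ} (hf : Rapid f) (hg : Rapid g) :
    Rapid fun s x => f s x + g s x := by
  intro k
  obtain ⟨C, hC⟩ := hf k
  obtain ⟨C', hC'⟩ := hg k
  refine ⟨C + C', fun s x hx => ?_⟩
  have := two_le_lw hx
  calc lw x ^ k * ‖f s x + g s x‖ ≤ lw x ^ k * (‖f s x‖ + ‖g s x‖) := by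
        gcongr
        exact norm_add_le _ _
    _ ≤ C + C' := by
        rw [mul_add]
        exact add_le_add (hC s x hx) (hC' s x hx)

theorem Rapid.bdd_mul {f g : ℤˣ → Pt → ℂ} (hf : Bdd f) (hg : Rapid g) :
    Rapid fun s x => f s x * g s x := by
  intro k
  obtain ⟨C, hC0, hC⟩ := hf.exists_nonneg
  obtain ⟨C', hC'⟩ := hg k
  refine ⟨C * C', fun s x hx => ?_⟩
  have := two_le_lw hx
  rw [norm_mul, mul_left_comm]
  exact mul_le_mul (hC s x hx) (hC' s x hx) (by positivity) hC0

theorem Rapid.const_mul {f : ℤˣ → Pt → ℂ} (c : ℂ) (hf : Rapid f) : Rapid fun s x => c * f s x :=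
  Rapid.bdd_mul (f := fun _ _ => c) ⟨‖c‖, fun _ _ _ => le_rfl⟩ hf

theorem Rapid.flip {f : ℤˣ → Pt → ℂ} (hf : Rapid f) (t : ℤˣ) : Rapid fun s x => f (t * s) x :=
  fun k => let ⟨C, hC⟩ := hf k; ⟨C, fun s x hx => hC _ x hx⟩

/-- A fixed displacement changes the eigenvalue of |D| by a constant, and the eigenvalue is at least
2. Hence the eigenvalues at x and x + d are comparable up to the factor 1 + |d.dl|. -/
theorem Rapid.shift {f : ℤˣ → Pt → ℂ} (hf : Rapid f) (d : Pt) :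
    Rapid fun s x => if (x + d).Adm then f s (x + d) else 0 := by
  intro k
  obtain ⟨C, hC⟩ := hf k
  have hK : 0 ≤ 1 + |d.dl| := by positivity
  refine ⟨(1 + |d.dl|) ^ k * |C|, fun s x hx => ?_⟩
  have h0 := two_le_lw hx
  dsimp only
  split_ifs with h
  · have h1 := two_le_lw h
    have h2 : lw x ≤ (1 + |d.dl|) * lw (x + d) := by
      have h3 := lw_add x d
      have h4 : -d.dl ≤ |d.dl| := neg_le_abs _
      rw [Pt.dl] at *
      nlinarith [abs_nonneg ((d.a : ℝ) + d.b)]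
    calc lw x ^ k * ‖f s (x + d)‖ ≤ ((1 + |d.dl|) * lw (x + d)) ^ k * ‖f s (x + d)‖ := by gcongr
      _ = (1 + |d.dl|) ^ k * (lw (x + d) ^ k * ‖f s (x + d)‖) := by rw [mul_pow, mul_assoc]
      _ ≤ _ := by
        gcongr
        exact (hC s _ h).trans (le_abs_self _)
  · rw [norm_zero, mul_zero]
    positivity

theorem Bdd.shift {f : ℤˣ → Pt → ℂ} (hf : Bdd f) (d : Pt) (t : ℤˣ) :
    Bdd fun s x => if (x + d).Adm then f (t * s) (x + d) else 0 := by
  obtain ⟨C, hC0, hC⟩ := hf.exists_nonneg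
  refine ⟨C, fun s x hx => ?_⟩
  dsimp only
  split_ifs with h
  · exact hC _ _ h
  · simpa using hC0

theorem Bdd.mul {f g : ℤˣ → Pt → ℂ} (hf : Bdd f) (hg : Bdd g) : Bdd fun s x => f s x * g s x := by
  obtain ⟨C, hC0, hC⟩ := hf.exists_nonneg
  obtain ⟨C', hC'⟩ := hg
  refine ⟨C * C', fun s x hx => ?_⟩
  rw [norm_mul]
  exact mul_le_mul (hC s x hx) (hC' s x hx) (norm_nonneg _) hC0

/-- The conditional records that an intermediate vector outside the region is zero, so the path
through it contributes nothing. -/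
theorem wsh_mul {f g : ℤˣ → Pt → ℂ} (hf : Bdd f) (hg : Bdd g) (d e : Pt) (t r : ℤˣ) :
    wsh f d t * wsh g e r =
      wsh (fun s x => (if (x + e).Adm then f (r * s) (x + e) else 0) * g s x) (e + d) (t * r) := by
  refine clm_ext fun s x hx => ?_
  rw [wsh_kt ((hf.shift e r).mul hg) _ _ _ hx, ContinuousLinearMap.mul_apply, wsh_kt hg _ _ _ hx,
    map_smul]
  split_ifs with h
  · rw [wsh_kt hf _ _ _ h, smul_smul, mul_comm, mul_assoc, add_assoc]
  · rw [kt_eq_zero h, map_zero, smul_zero, zero_mul, zero_smul]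

/-- The operators of finite propagation. -/
def FP : Submodule ℂ (H →L[ℂ] H) := Submodule.span ℂ {T | ∃ f d t, Bdd f ∧ T = wsh f d t}

/-- The operators of finite propagation with rapidly decaying coefficients. -/
def SM : Submodule ℂ (H →L[ℂ] H) := Submodule.span ℂ {T | ∃ f d t, Rapid f ∧ T = wsh f d t}

theorem Bdd.mem_FP {f : ℤˣ → Pt → ℂ} (hf : Bdd f) (d : Pt) (t : ℤˣ) : wsh f d t ∈ FP :=
  Submodule.subset_span ⟨f, d, t, hf, rfl⟩

theorem Rapid.mem_SM {f : ℤˣ → Pt → ℂ} (hf : Rapid f) (d : Pt) (t : ℤˣ) : wsh f d t ∈ SM :=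
  Submodule.subset_span ⟨f, d, t, hf, rfl⟩

theorem SM_le_FP : SM ≤ FP := by
  refine Submodule.span_mono ?_
  rintro _ ⟨f, d, t, hf, rfl⟩
  exact ⟨f, d, t, hf.bdd, rfl⟩

theorem mul_mem_of_span {A B C : Set (H →L[ℂ] H)}
    (h : ∀ S ∈ A, ∀ T ∈ B, S * T ∈ Submodule.span ℂ C) {S T : H →L[ℂ] H}
    (hS : S ∈ Submodule.span ℂ A) (hT : T ∈ Submodule.span ℂ B) : S * T ∈ Submodule.span ℂ C := by
  induction hS using Submodule.span_induction with
  | mem S hS =>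
    induction hT using Submodule.span_induction with
    | mem T hT => exact h S hS T hT
    | zero => rw [mul_zero]; exact Submodule.zero_mem _
    | add T T' _ _ h1 h2 => rw [mul_add]; exact Submodule.add_mem _ h1 h2
    | smul c T _ h1 => rw [mul_smul_comm]; exact Submodule.smul_mem _ c h1
  | zero => rw [zero_mul]; exact Submodule.zero_mem _
  | add S S' _ _ h1 h2 => rw [add_mul]; exact Submodule.add_mem _ h1 h2
  | smul c S _ h1 => rw [smul_mul_assoc]; exact Submodule.smul_mem _ c h1

theorem FP_mul {S T : H →L[ℂ] H} (hS : S ∈ FP) (hT : T ∈ FP) : S * T ∈ FP := by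
  refine mul_mem_of_span ?_ hS hT
  rintro _ ⟨f, d, t, hf, rfl⟩ _ ⟨g, e, r, hg, rfl⟩
  rw [wsh_mul hf hg]
  exact ((hf.shift e r).mul hg).mem_FP _ _

/-- With `SM_mul_FP` this is the two-sided ideal property on which the passage from generators to
words rests. -/
theorem FP_mul_SM {S T : H →L[ℂ] H} (hS : S ∈ FP) (hT : T ∈ SM) : S * T ∈ SM := by
  refine mul_mem_of_span ?_ hS hT
  rintro _ ⟨f, d, t, hf, rfl⟩ _ ⟨g, e, r, hg, rfl⟩
  rw [wsh_mul hf hg.bdd]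
  exact (Rapid.bdd_mul (hf.shift e r) hg).mem_SM _ _

theorem SM_mul_FP {S T : H →L[ℂ] H} (hS : S ∈ SM) (hT : T ∈ FP) : S * T ∈ SM := by
  refine mul_mem_of_span ?_ hS hT
  rintro _ ⟨f, d, t, hf, rfl⟩ _ ⟨g, e, r, hg, rfl⟩
  rw [wsh_mul hf.bdd hg]
  have h := Rapid.bdd_mul hg ((hf.flip r).shift e)
  simp only [mul_comm (g _ _)] at h
  exact h.mem_SM _ _

theorem one_mem_FP : (1 : H →L[ℂ] H) ∈ FP := by
  have hb : Bdd fun _ _ => 1 := ⟨1, fun _ _ _ => by simp⟩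
  have : (1 : H →L[ℂ] H) = wsh (fun _ _ => 1) 0 1 := clm_ext fun s x hx => by
    rw [wsh_kt hb _ _ _ hx]
    simp
  rw [this]
  exact hb.mem_FP _ _

/-! ### Rapidly decaying operators are smoothing -/

theorem wsh_lw_apply {f : ℤˣ → Pt → ℂ} (hf : Bdd f) (hf' : Bdd fun s x => (lw x : ℂ) * f s x)
    (d : Pt) (t : ℤˣ) (v : H) (i : Label) : ((i.l + 3 / 2 : ℝ) : ℂ) * wsh f d t v i =
      wsh (fun s x => (lw x : ℂ) * f s x) d t v i + (d.dl : ℂ) * wsh f d t v i := by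
  rw [wsh_apply hf, wsh_apply hf', i.l_add]
  split_ifs with h
  · have : lw i.pt = lw (i.pt - d) + d.dl := by
      rw [Pt.dl, ← lw_add, sub_add_cancel]
    rw [this]
    push_cast
    ring
  · simp

/-- |D| is diagonal and a shift by d changes its eigenvalue by the constant d.dl, so the commutator
is d.dl times the shift itself. -/
theorem exists_isCommutator_absD {T : H →L[ℂ] H} (hT : T ∈ SM) :
    ∃ S ∈ SM, IsCommutator (absD 1) T S := by
  induction hT using Submodule.span_induction with
  | mem T hT =>
    obtain ⟨f, d, t, hf, rfl⟩ := hT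
    refine ⟨(d.dl : ℂ) • wsh f d t, SM.smul_mem _ (hf.mem_SM d t), isCommutator_iff.2 fun v i => ?_⟩
    have h1 : wsh f d t (absD 1 v) i = wsh (fun s x => (lw x : ℂ) * f s x) d t v i := by
      rw [wsh_apply hf.bdd, wsh_apply hf.lw_mul.bdd]
      split_ifs with h
      · have h2 : absD 1 v ((i.pt - d).label (t * i.s) h) =
            (lw (i.pt - d) : ℂ) * (v : H) ((i.pt - d).label (t * i.s) h) := by
          change ((((((i.pt - d).label (t * i.s) h).l + 3 / 2) ^ 1 : ℝ)) : ℂ) * _ = _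
          rw [pow_one, Label.l_add, Pt.pt_label]
          rfl
        rw [h2]
        ring
      · rfl
    have h2 := wsh_lw_apply hf.bdd hf.lw_mul.bdd d t v i
    change (((i.l + 3 / 2) ^ 1 : ℝ) : ℂ) * wsh f d t v i = _ + wsh f d t (absD 1 v) i
    rw [h1, pow_one, h2, ContinuousLinearMap.smul_apply, lp.coeFn_smul, Pi.smul_apply, smul_eq_mul,
      add_comm]
  | zero => exact ⟨0, SM.zero_mem, isCommutator_zero⟩
  | add T T' _ _ h h' =>
    obtain ⟨S, hS, h⟩ := h
    obtain ⟨S', hS', h'⟩ := h'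
    exact ⟨S + S', SM.add_mem hS hS', h.add h'⟩
  | smul c T _ h =>
    obtain ⟨S, hS, h⟩ := h
    exact ⟨c • S, SM.smul_mem c hS, h.smul c⟩

/-- The eigenvalue at the target of a shift is the one at the source plus d.dl, and a rapidly
decaying weight absorbs the factor. -/
theorem exists_absD_mul {T : H →L[ℂ] H} (hT : T ∈ SM) (k : ℕ) :
    ∃ S ∈ SM, ∀ v i, S v i = (((i : Label).l + 3 / 2 : ℝ) : ℂ) ^ k * T v i := by
  induction k with
  | zero => exact ⟨T, hT, by simp⟩
  | succ k ih =>
    obtain ⟨R, hR, h⟩ := ih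
    suffices ∃ S ∈ SM, ∀ v i, S v i = (((i : Label).l + 3 / 2 : ℝ) : ℂ) * R v i by
      obtain ⟨S, hS, h'⟩ := this
      exact ⟨S, hS, fun v i => by rw [h', h, pow_succ']; ring⟩
    clear h
    induction hR using Submodule.span_induction with
    | mem T hT =>
      obtain ⟨f, d, t, hf, rfl⟩ := hT
      refine ⟨wsh (fun s x => (lw x : ℂ) * f s x) d t + (d.dl : ℂ) • wsh f d t,
        SM.add_mem (hf.lw_mul.mem_SM d t) (SM.smul_mem _ (hf.mem_SM d t)), fun v i => ?_⟩
      rw [wsh_lw_apply hf.bdd hf.lw_mul.bdd]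
      rfl
    | zero => exact ⟨0, SM.zero_mem, by simp⟩
    | add T T' _ _ h h' =>
      obtain ⟨S, hS, h⟩ := h
      obtain ⟨S', hS', h'⟩ := h'
      refine ⟨S + S', SM.add_mem hS hS', fun v i => ?_⟩
      rw [ContinuousLinearMap.add_apply, ContinuousLinearMap.add_apply, lp.coeFn_add, lp.coeFn_add,
        Pi.add_apply, Pi.add_apply, h, h', mul_add]
    | smul c T _ h =>
      obtain ⟨S, hS, h⟩ := h
      refine ⟨c • S, SM.smul_mem c hS, fun v i => ?_⟩
      rw [ContinuousLinearMap.smul_apply, ContinuousLinearMap.smul_apply, lp.coeFn_smul,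
        lp.coeFn_smul, Pi.smul_apply, Pi.smul_apply, h, smul_eq_mul, smul_eq_mul, mul_left_comm]

theorem OP0_of_SM {T : H →L[ℂ] H} (hT : T ∈ SM) : OP0 T := by
  intro n
  induction n generalizing T with
  | zero => trivial
  | succ n ih =>
    obtain ⟨S, hS, h⟩ := exists_isCommutator_absD hT
    exact ⟨S, h, ih hS⟩

theorem smoothing_of_SM {T : H →L[ℂ] H} (hT : T ∈ SM) : Smoothing T := by
  intro k
  obtain ⟨S, hS, h⟩ := exists_absD_mul hT k
  refine ⟨S, OP0_of_SM hS, fun v => ?_⟩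
  have h1 : ∀ i, S v i = (((i.l + 3 / 2) ^ k : ℝ) : ℂ) * T v i := fun i => by
    rw [h]
    push_cast
    rfl
  exact ⟨(mem_weightedPerm _ _ _).2 ⟨S v, h1⟩, lp.ext (funext h1)⟩

/-! ### Commutators with the Dirac operator -/

theorem D_apply (v : D.domain) (i : Label) :
    D v i = ((i.l + 3 / 2 : ℝ) : ℂ) * (v : H) (Label.flip i) := rfl

theorem Label.flip_pt (i : Label) : (Label.flip i).pt = i.pt := by
  have h : i.pt.label (-i.s) i.pt_adm =
      (Label.flip i).pt.label (Label.flip i).s (Label.flip i).pt_adm := by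
    rw [Label.label_pt]
    exact congrArg Label.flip i.label_pt
  exact (Pt.label_inj.1 h).2.symm

theorem Label.flip_s (i : Label) : (Label.flip i).s = -i.s := rfl

theorem Pt.flip_label (s : ℤˣ) (x : Pt) (h : x.Adm) : Label.flip (x.label s h) = x.label (-s) h := rfl

/-- D followed by the shift and the shift followed by D reach the same vector of opposite chirality,
with weights lw(x) f(-s, x) and (lw(x) + d.dl) f(s, x). For weights independent of the sign the
unbounded part of the difference cancels. -/
theorem isCommutator_D {f : ℤˣ → Pt → ℂ} (hf : Bdd f)
    (hg : Bdd fun s x => (lw x : ℂ) * (f s x - f (-s) x)) (d : Pt) (t : ℤˣ) :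
    IsCommutator D (wsh f d t) (wsh (fun s x => (lw x : ℂ) * (f s x - f (-s) x)) d (-t) +
      (d.dl : ℂ) • wsh f d (-t)) := by
  refine isCommutator_iff.2 fun v i => ?_
  change ((i.l + 3 / 2 : ℝ) : ℂ) * wsh f d t v (Label.flip i) = _ + wsh f d t (D v) i
  rw [ContinuousLinearMap.add_apply, lp.coeFn_add, Pi.add_apply, ContinuousLinearMap.smul_apply,
    lp.coeFn_smul, Pi.smul_apply, smul_eq_mul, wsh_apply hg, wsh_apply hf, wsh_apply hf,
    wsh_apply hf, i.l_add]
  simp only [Label.flip_pt, Label.flip_s]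
  split_ifs with h
  · have hD : D v ((i.pt - d).label (t * i.s) h) =
        (lw (i.pt - d) : ℂ) * (v : H) ((i.pt - d).label (-(t * i.s)) h) := by
      refine (D_apply v _).trans ?_
      rw [Label.l_add, Pt.flip_label, Pt.pt_label]
    have : lw i.pt = lw (i.pt - d) + d.dl := by
      rw [Pt.dl, ← lw_add, sub_add_cancel]
    simp only [mul_neg, neg_mul, neg_neg, this, hD]
    push_cast
    ring
  · simp

theorem exists_isCommutator_D {T : H →L[ℂ] H} (hT : T ∈ SM) : ∃ S ∈ SM, IsCommutator D T S := by
  induction hT using Submodule.span_induction with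
  | mem T hT =>
    obtain ⟨f, d, t, hf, rfl⟩ := hT
    have h : Rapid fun s x => (lw x : ℂ) * (f s x - f (-s) x) := by
      have := (hf.add ((hf.flip (-1)).const_mul (-1))).lw_mul
      simpa [sub_eq_add_neg] using this
    exact ⟨_, SM.add_mem (h.mem_SM d (-t)) (SM.smul_mem _ (hf.mem_SM d (-t))),
      isCommutator_D hf.bdd h.bdd d t⟩
  | zero => exact ⟨0, SM.zero_mem, isCommutator_zero⟩
  | add T T' _ _ h h' =>
    obtain ⟨S, hS, h⟩ := h
    obtain ⟨S', hS', h'⟩ := h'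
    exact ⟨S + S', SM.add_mem hS hS', h.add h'⟩
  | smul c T _ h =>
    obtain ⟨S, hS, h⟩ := h
    exact ⟨c • S, SM.smul_mem c hS, h.smul c⟩

theorem isCommutator_D_even {f : Pt → ℂ} (hf : Bdd fun _ => f) (d : Pt) (t : ℤˣ) :
    IsCommutator D (wsh (fun _ => f) d t) ((d.dl : ℂ) • wsh (fun _ => f) d (-t)) := by
  have h : Bdd fun _ x => (lw x : ℂ) * (f x - f x) := ⟨0, fun _ _ _ => by simp⟩
  have h1 := isCommutator_D hf h d t
  have h2 : wsh (fun _ x => (lw x : ℂ) * (f x - f x)) d (-t) = 0 := clm_ext fun s x hx => by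
    rw [wsh_kt h _ _ _ hx]
    simp
  rwa [h2, zero_add] at h1

/-! ### The real structure in coordinates -/

/-- The reflection `(m₁, m₂) ↦ (-m₁, -m₂)` in coordinates. -/
def Pt.refl (x : Pt) : Pt := ⟨x.a, 2 * x.a + 1 - x.u, x.b, 2 * x.b + 1 - x.p⟩

/-- The linear part of the reflection. -/
def Pt.lref (d : Pt) : Pt := ⟨d.a, 2 * d.a - d.u, d.b, 2 * d.b - d.p⟩

theorem Pt.refl_refl (x : Pt) : x.refl.refl = x := by
  ext <;> simp [refl]

theorem Pt.refl_add (x d : Pt) : (x + d).refl = x.refl + d.lref := by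
  ext <;> simp only [refl, lref, add_def] <;> ring

theorem Pt.adm_refl {x : Pt} : x.refl.Adm ↔ x.Adm := by
  simp only [Adm, refl]
  omega

/-- The phase `(-1) ^ (l + 1 / 2 + j + m₁)` in coordinates. -/
def Pt.ph (x : Pt) : ℂ := (-1) ^ (x.a + x.b + 1 + x.u)

theorem Pt.conj_ph (x : Pt) : conj x.ph = x.ph := by
  simp [ph]

/-- 2l + 1 = 2(a+b+1) is even, so the power of i is (-1)^{a+b+1} and the phase is real. -/
theorem phase_eq {l m j : ℝ} (x : Pt) (hl : l = x.a + x.b + 1 / 2) (hm : m = x.u - x.a - 1 / 2)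
    (hj : j = x.a + 1 / 2) : phase l m j = x.ph := by
  have h1 : ((2 * l + 1 : ℝ) : ℂ) = ((2 * (x.a + x.b + 1) : ℤ) : ℂ) := by
    rw [hl]
    push_cast
    ring
  have h2 : ((j + m : ℝ) : ℂ) = (x.u : ℂ) := by
    rw [hj, hm]
    push_cast
    ring
  rw [phase, h1, h2, Complex.cpow_intCast, Complex.cpow_intCast, zpow_mul, zpow_ofNat,
    Complex.I_sq, Pt.ph, zpow_add₀ (by norm_num) (x.a + x.b + 1)]

theorem J_kt (s : ℤˣ) (x : Pt) : J (kt s x) = x.ph • kt s x.refl := by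
  rw [kt, J_ket, phase_eq x rfl rfl rfl]
  congr 1
  refine ket_eq_kt _ rfl ?_ ?_ rfl
  all_goals
    simp only [Pt.refl]
    push_cast
    ring

/-- u and its reflection add up to 2a + 1, so the two exponents have odd sum; this is J² = -1 on
basis vectors. -/
theorem Pt.ph_mul_ph_refl (x : Pt) : x.ph * x.refl.ph = -1 := by
  rw [ph, ph, ← zpow_add₀ (by norm_num)]
  exact Odd.neg_one_zpow ⟨2 * x.a + x.b + 1, by simp only [refl]; ring⟩

theorem J_smul (c : ℂ) (v : H) : J (c • v) = conj c • J v := J.map_smulₛₗ c v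

theorem J_J (v : H) : J (J v) = -v := by
  have h : ((J : H →L⋆[ℂ] H).comp (J : H →L⋆[ℂ] H) : H →L[ℂ] H) = -1 := clm_ext fun s x _ => by
    change J (J (kt s x)) = -kt s x
    rw [J_kt, J_smul, J_kt, smul_smul, x.conj_ph, x.ph_mul_ph_refl, x.refl_refl, neg_one_smul]
  exact DFunLike.congr_fun h v

theorem JbJ_apply (b : H →L[ℂ] H) (v : H) : JbJ b v = J (b (J v)) := rfl

theorem JbJ_add (b c : H →L[ℂ] H) : JbJ (b + c) = JbJ b + JbJ c := by
  ext1 v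
  exact map_add J _ _

theorem JbJ_zero : JbJ 0 = 0 := by
  ext1 v
  exact map_zero J

theorem JbJ_smul (a : ℂ) (b : H →L[ℂ] H) : JbJ (a • b) = conj a • JbJ b := by
  ext1 v
  exact J_smul _ _

theorem JbJ_one : JbJ 1 = -1 := by
  ext1 v
  exact J_J v

/-- The sign comes from J² = -1 inserted between the factors. It is harmless for membership in the
ideal. -/
theorem JbJ_mul (b c : H →L[ℂ] H) : JbJ (b * c) = -(JbJ b * JbJ c) := by
  ext1 v
  change J (b (c (J v))) = -J (b (J (J (c (J v)))))
  rw [J_J, map_neg, map_neg, neg_neg]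

theorem Bdd.refl {f : ℤˣ → Pt → ℂ} (hf : Bdd f) : Bdd fun s x => conj (f s x.refl) := by
  obtain ⟨C, hC⟩ := hf
  exact ⟨C, fun s x hx => by rw [RCLike.norm_conj]; exact hC s _ (Pt.adm_refl.2 hx)⟩

theorem Rapid.refl {f : ℤˣ → Pt → ℂ} (hf : Rapid f) : Rapid fun s x => conj (f s x.refl) := by
  intro k
  obtain ⟨C, hC⟩ := hf k
  exact ⟨C, fun s x hx => by rw [RCLike.norm_conj]; exact hC s _ (Pt.adm_refl.2 hx)⟩

theorem JbJ_wsh {f : ℤˣ → Pt → ℂ} (hf : Bdd f) (d : Pt) (t : ℤˣ) :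
    JbJ (wsh f d t) =
      ((-1 : ℂ) ^ (d.a + d.b + d.u + 1)) • wsh (fun s x => conj (f s x.refl)) d.lref t := by
  refine clm_ext fun s x hx => ?_
  rw [JbJ_apply, J_kt, map_smul, wsh_kt hf _ _ _ (Pt.adm_refl.2 hx), J_smul, J_smul, J_kt,
    Pt.refl_add, Pt.refl_refl, ContinuousLinearMap.smul_apply, wsh_kt hf.refl _ _ _ hx,
    smul_smul, smul_smul, smul_smul]
  congr 1
  have h : x.ph * (x.refl + d).ph = (-1) ^ (d.a + d.b + d.u + 1) := by
    rw [Pt.ph, Pt.ph, ← zpow_add₀ (by norm_num)]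
    have : x.a + x.b + 1 + x.u + ((x.refl + d).a + (x.refl + d).b + 1 + (x.refl + d).u) =
        2 * (2 * x.a + x.b + 1) + (d.a + d.b + d.u + 1) := by
      simp only [Pt.refl, Pt.add_def]
      ring
    rw [this, zpow_add₀ (by norm_num), zpow_mul]
    norm_num
  rw [← h, x.conj_ph]
  ring

/-! ### Commutation up to rapidly decaying operators -/

/-- The operators commute up to rapidly decaying operators. -/
def NearComm (S T : H →L[ℂ] H) : Prop := S * T - T * S ∈ SM

theorem NearComm.zero_left (T : H →L[ℂ] H) : NearComm 0 T := by
  simp [NearComm]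

theorem NearComm.zero_right (S : H →L[ℂ] H) : NearComm S 0 := by
  simp [NearComm]

theorem NearComm.one_left (T : H →L[ℂ] H) : NearComm 1 T := by
  simp [NearComm]

theorem NearComm.one_right (S : H →L[ℂ] H) : NearComm S 1 := by
  simp [NearComm]

section nearComm

variable {R S T : H →L[ℂ] H}

theorem NearComm.symm (h : NearComm S T) : NearComm T S := by
  rw [NearComm, ← neg_sub]
  exact SM.neg_mem h

theorem NearComm.add_left (h : NearComm R T) (h' : NearComm S T) : NearComm (R + S) T := by
  have := SM.add_mem h h'
  rwa [NearComm, show (R + S) * T - T * (R + S) = R * T - T * R + (S * T - T * S) by noncomm_ring]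

theorem NearComm.smul_left (c : ℂ) (h : NearComm S T) : NearComm (c • S) T := by
  have := SM.smul_mem c h
  rwa [NearComm, smul_mul_assoc, mul_smul_comm, ← smul_sub]

/-- The commutator with T is a derivation, and both resulting terms stay in the ideal. -/
theorem NearComm.mul_left (hR : R ∈ FP) (hS : S ∈ FP) (h : NearComm R T) (h' : NearComm S T) :
    NearComm (R * S) T := by
  have := SM.add_mem (FP_mul_SM hR h') (SM_mul_FP h hS)
  rwa [NearComm, show R * S * T - T * (R * S) = R * (S * T - T * S) + (R * T - T * R) * S by
    noncomm_ring]

theorem NearComm.of_SM_left (hS : S ∈ SM) (hT : T ∈ FP) : NearComm S T :=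
  SM.sub_mem (SM_mul_FP hS hT) (FP_mul_SM hT hS)

theorem NearComm.add_right (h : NearComm T R) (h' : NearComm T S) : NearComm T (R + S) :=
  (h.symm.add_left h'.symm).symm

theorem NearComm.smul_right (c : ℂ) (h : NearComm T S) : NearComm T (c • S) :=
  (h.symm.smul_left c).symm

theorem NearComm.mul_right (hR : R ∈ FP) (hS : S ∈ FP) (h : NearComm T R) (h' : NearComm T S) :
    NearComm T (R * S) :=
  (h.symm.mul_left hR hS h'.symm).symm

end nearComm

theorem JbJ_mem_FP {b : H →L[ℂ] H} (hb : b ∈ FP) : JbJ b ∈ FP := by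
  induction hb using Submodule.span_induction with
  | mem T hT =>
    obtain ⟨f, d, t, hf, rfl⟩ := hT
    rw [JbJ_wsh hf]
    exact FP.smul_mem _ (hf.refl.mem_FP _ _)
  | zero => rw [JbJ_zero]; exact FP.zero_mem
  | add T T' _ _ h h' => rw [JbJ_add]; exact FP.add_mem h h'
  | smul c T _ h => rw [JbJ_smul]; exact FP.smul_mem _ h

theorem JbJ_mem_SM {b : H →L[ℂ] H} (hb : b ∈ SM) : JbJ b ∈ SM := by
  induction hb using Submodule.span_induction with
  | mem T hT =>
    obtain ⟨f, d, t, hf, rfl⟩ := hT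
    rw [JbJ_wsh hf.bdd]
    exact SM.smul_mem _ (hf.refl.mem_SM _ _)
  | zero => rw [JbJ_zero]; exact SM.zero_mem
  | add T T' _ _ h h' => rw [JbJ_add]; exact SM.add_mem h h'
  | smul c T _ h => rw [JbJ_smul]; exact SM.smul_mem _ h

/-- The weights of a shift of even type. -/
def StayF (f : Pt → ℂ) (d : Pt) : Prop := ∀ x : Pt, x.Adm → ¬(x + d).Adm → f x = 0

/-- Both orders reach the same point, so the commutator is a single shift with weight f(x+e) g(x) -
g(x+d) f(x), a difference of oscillations. The vanishing of weights at exits is needed: otherwise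
one order might be cut off at an intermediate point while the other is not. -/
theorem nearComm_wsh {f g : Pt → ℂ} {d e : Pt} (hf : Bdd fun _ => f) (hg : Bdd fun _ => g)
    (hfd : StayF f d) (hge : StayF g e) (r : ℤˣ) (h1 : Rapid fun _ x => osc e f x * g x)
    (h2 : Rapid fun _ x => osc d g x * f x) :
    NearComm (wsh (fun _ => f) d r) (wsh (fun _ => g) e 1) := by
  have h3 : Rapid fun _ x => osc e f x * g x + -1 * (osc d g x * f x) := h1.add (h2.const_mul (-1))
  have e1 : wsh (fun _ => f) d r * wsh (fun _ => g) e 1 - wsh (fun _ => g) e 1 * wsh (fun _ => f) d r =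
      wsh (fun _ x => osc e f x * g x + -1 * (osc d g x * f x)) (d + e) r := by
    refine clm_ext fun s x hx => ?_
    rw [ContinuousLinearMap.sub_apply, ContinuousLinearMap.mul_apply, ContinuousLinearMap.mul_apply,
      wsh_kt hf _ _ _ hx, wsh_kt hg _ _ _ hx, map_smul, map_smul, wsh_kt h3.bdd _ _ _ hx]
    have e2 : g x • wsh (fun _ => f) d r (kt (1 * s) (x + e)) =
        (f (x + e) * g x) • kt (r * s) (x + (d + e)) := by
      by_cases h : (x + e).Adm
      · rw [wsh_kt hf _ _ _ h, smul_smul, one_mul, mul_comm, add_assoc, add_comm e]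
      · rw [hge x hx h, zero_smul, mul_zero, zero_smul]
    have e3 : f x • wsh (fun _ => g) e 1 (kt (r * s) (x + d)) =
        (g (x + d) * f x) • kt (r * s) (x + (d + e)) := by
      by_cases h : (x + d).Adm
      · rw [wsh_kt hg _ _ _ h, smul_smul, one_mul, mul_comm, add_assoc]
      · rw [hfd x hx h, zero_smul, mul_zero, zero_smul]
    rw [e2, e3, ← sub_smul]
    congr 1
    simp only [osc]
    ring
  rw [NearComm, e1]
  exact h3.mem_SM _ _

/-! ### The coefficients of the generators -/

section

variable {q : ℝ} {f g : Pt → ℂ} {d e E : Pt} {k : Pt → ℤ}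

theorem Dom.refl {c : ℕ} {x : Pt} (h : Dom c x) : Dom c x.refl := by
  obtain ⟨h1, h2, h3, h4⟩ := h
  simp only [Dom, Pt.refl]
  omega

theorem BigO.refl (hf : BigO q f k) : BigO q (fun x => f x.refl) fun x => k x.refl := by
  intro c
  obtain ⟨C, hC, hf⟩ := hf c
  exact ⟨C, hC, fun x hx => hf _ hx.refl⟩

theorem BigO.rapid (hq0 : 0 < q) (hq1 : q < 1) (hf : BigO q f fun x => 2 * x.a + 2 * x.b) :
    Rapid fun _ => f := by
  intro k
  obtain ⟨C, hC, hf⟩ := hf 0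
  have h1 := (tendsto_pow_const_mul_const_pow_of_abs_lt_one k (r := q ^ 2) (by
    rw [abs_of_pos (by positivity)]
    exact pow_lt_one₀ hq0.le hq1 two_ne_zero)).bddAbove_range
  obtain ⟨K, hK⟩ := h1
  -- The factor q⁻⁴ compensates the offset in lw = a + b + 2.
  refine ⟨C * (q ^ (-4 : ℤ) * K), fun s x hx => ?_⟩
  have h0 := two_le_lw hx
  obtain ⟨n, hn⟩ := Int.eq_ofNat_of_zero_le (a := x.a + x.b + 2) (by
    obtain ⟨h1, h2, h3, h4⟩ := hx
    omega)
  have h2 : lw x = n := by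
    rw [lw]
    exact_mod_cast hn
  have h3 : q ^ (2 * x.a + 2 * x.b) = q ^ (-4 : ℤ) * (q ^ 2) ^ n := by
    rw [← pow_mul, ← zpow_natCast, ← zpow_add₀ hq0.ne']
    congr 1
    push_cast
    omega
  have h4 : (n : ℝ) ^ k * (q ^ 2) ^ n ≤ K := hK ⟨n, rfl⟩
  calc lw x ^ k * ‖f x‖ ≤ lw x ^ k * (C * q ^ (2 * x.a + 2 * x.b)) := by
        gcongr
        exact hf x hx.dom
    _ = C * (q ^ (-4 : ℤ) * ((n : ℝ) ^ k * (q ^ 2) ^ n)) := by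
        rw [h3, h2]
        ring
    _ ≤ _ := by gcongr

theorem BigO.bdd (hq0 : 0 < q) (hq1 : q < 1) (hf : BigO q f k) (hk : ∀ x : Pt, x.Adm → 0 ≤ k x) :
    Bdd fun _ => f := by
  obtain ⟨C, hC, hf⟩ := hf 0
  refine ⟨C, fun s x hx => (hf x hx.dom).trans ?_⟩
  exact mul_le_of_le_one_right hC (zpow_le_one₀ hq0 hq1.le (hk x hx))

theorem osc_neg (h : BigO q (osc E f) k) : BigO q (osc (-E) f) fun x => k (x + -E) :=
  (h.shift (-E)).neg.congr fun x => by
    simp only [osc, neg_add_cancel_right]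
    ring

/-! ### The pairwise estimate behind the commutant and first order conditions -/

/-- The displacements of the main components of the generators, with the order of the
coefficients. -/
inductive Dir : Pt → (Pt → ℤ) → Prop
  | vertical : Dir ⟨0, 0, 1, 2⟩ fun _ => 0
  | raising : Dir ⟨1, 2, 0, 0⟩ fun x => x.p
  | lowering : Dir ⟨1, 0, 0, 0⟩ fun x => 2 * x.u + x.p
  | diagonal : Dir ⟨1, 1, 0, 0⟩ fun x => x.u + x.p

/-- The displacement is small. -/
def Pt.Near (d : Pt) : Prop := (-1 ≤ d.a ∧ d.a ≤ 1) ∧ (-2 ≤ d.u ∧ d.u ≤ 2) ∧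
  (-2 ≤ d.b ∧ d.b ≤ 2) ∧ (-2 ≤ d.p ∧ d.p ≤ 2)

/-- The estimates satisfied by the coefficients of even type. -/
structure Est (q : ℝ) (f : Pt → ℂ) (d : Pt) : Prop where
  near : d.Near
  const : ∃ κ, BigO q (fun x => f x - κ) fun x => x.p
  osc₁ : BigO q (osc ⟨0, 0, 1, 0⟩ f) fun x => 2 * x.a + 2 * x.b
  osc₂ : BigO q (osc ⟨1, 0, 0, 0⟩ f) fun x => 2 * x.a + x.p
  osc₃ : BigO q (osc ⟨1, 2, 0, 0⟩ f) fun x => x.u + x.p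
  osc₄ : BigO q (osc ⟨1, 1, 0, 0⟩ f) fun x => x.u + x.p
  typ : BigO q f (fun x => 2 * x.a + x.p) ∨ ∃ E k, Dir E k ∧ BigO q f k ∧ (d = E ∨ d = -E)

theorem Est.bdd (hq0 : 0 < q) (hq1 : q < 1) (h : Est q f d) : Bdd fun _ => f := by
  obtain ⟨κ, h⟩ := h.const
  exact BigO.bdd (k := fun _ => 0) hq0 hq1 (((h.mono (e' := fun _ => 0) hq0 hq1
    fun _ _ ⟨_, _, _, _⟩ => by omega).add (bigO_const κ)).congr fun x => by ring) fun _ _ => le_rfl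

/-- Reflection replaces u by 2a - u and p by 2b - p, up to constants. If g is of order 2a + p, its
reflection has order 2a + 2b - p, and a variation of f of order p suffices in any small direction.
For the main displacements the exponents of the variation of f and of the reflected g are: vertical
(2a+2b) + 0; raising (2a+p) + (2b-p); lowering (u+p) + (4a-2u+2b-p), which is large enough because u
≤ 2a; diagonal (u+p) + (2a-u+2b-p). The linear part of the reflection carries (0,0,1,2) to
(0,0,1,0), exchanges (1,2,0,0) with (1,0,0,0) and fixes (1,1,0,0). This explains the four directions
in `Est`. -/
theorem Est.pair (hq0 : 0 < q) (hq1 : q < 1) (hf : Est q f d) (hg : Est q g e) :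
    BigO q (fun x => osc e.lref f x * g x.refl) fun x => 2 * x.a + 2 * x.b := by
  rcases hg.typ with h | ⟨E, k, hE, h, rfl | rfl⟩
  · obtain ⟨κ, hκ⟩ := hf.const
    have h1 : BigO q (osc e.lref f) fun x => x.p := by
      obtain ⟨⟨h1, h2⟩, ⟨h3, h4⟩, ⟨h5, h6⟩, ⟨h7, h8⟩⟩ := hg.near
      refine (BigO.osc (E := e.lref) (f := fun x => f x - κ) (e' := fun x => x.p) hq0 hq1 hκ
        (by intros; omega) fun c x _ => ?_).congr fun x => ?_
      · simp only [Pt.add_def, Pt.lref]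
        omega
      · simp only [osc]
        ring
    exact (h1.mul hq0 h.refl).mono hq0 hq1 fun c x ⟨_, _, _, _⟩ => by
      simp only [Pt.refl]
      omega
  · cases hE
    · exact (BigO.mul hq0 hf.osc₁ h.refl).mono hq0 hq1 fun c x ⟨_, _, _, _⟩ => by omega
    · exact (BigO.mul hq0 hf.osc₂ h.refl).mono hq0 hq1 fun c x ⟨_, _, _, _⟩ => by
        simp only [Pt.refl]
        omega
    · exact (BigO.mul hq0 hf.osc₃ h.refl).mono hq0 hq1 fun c x ⟨_, _, _, _⟩ => by
        simp only [Pt.refl]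
        omega
    · exact (BigO.mul hq0 hf.osc₄ h.refl).mono hq0 hq1 fun c x ⟨_, _, _, _⟩ => by
        simp only [Pt.refl]
        omega
  · cases hE
    · exact (BigO.mul hq0 (osc_neg hf.osc₁) h.refl).mono hq0 hq1 fun c x ⟨_, _, _, _⟩ => by
        simp only [Pt.add_def, Pt.neg_def]
        omega
    · exact (BigO.mul hq0 (osc_neg hf.osc₂) h.refl).mono hq0 hq1 fun c x ⟨_, _, _, _⟩ => by
        simp only [Pt.refl, Pt.add_def, Pt.neg_def]
        omega
    · exact (BigO.mul hq0 (osc_neg hf.osc₃) h.refl).mono hq0 hq1 fun c x ⟨_, _, _, _⟩ => by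
        simp only [Pt.refl, Pt.add_def, Pt.neg_def]
        omega
    · exact (BigO.mul hq0 (osc_neg hf.osc₄) h.refl).mono hq0 hq1 fun c x ⟨_, _, _, _⟩ => by
        simp only [Pt.refl, Pt.add_def, Pt.neg_def]
        omega

/-- All exponents are linear in the coordinates and d is small, so moving the base point by -d costs
only a constant. -/
theorem Est.transpose (hq0 : 0 < q) (hq1 : q < 1) (hf : Est q f d) :
    Est q (fun x => f (x + -d)) (-d) := by
  obtain ⟨⟨h1, h2⟩, ⟨h3, h4⟩, ⟨h5, h6⟩, ⟨h7, h8⟩⟩ := hf.near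
  have ho {E k} (h : BigO q (osc E f) k) (hk : ∀ (c : ℕ) x, Dom c x → k x ≤ k (x + -d) + 20 * (c + 1)) :
      BigO q (osc E fun x => f (x + -d)) k :=
    ((h.shift (-d)).mono hq0 hq1 hk).congr fun x => by simp only [osc, add_right_comm x E]
  obtain ⟨κ, hκ⟩ := hf.const
  refine ⟨?_, ⟨κ, (hκ.shift (-d)).mono hq0 hq1 fun c x _ => ?_⟩, ho hf.osc₁ fun c x _ => ?_,
    ho hf.osc₂ fun c x _ => ?_, ho hf.osc₃ fun c x _ => ?_, ho hf.osc₄ fun c x _ => ?_, ?_⟩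
  · simp only [Pt.Near, Pt.neg_def]
    omega
  · simp only [Pt.add_def, Pt.neg_def]
    omega
  · simp only [Pt.add_def, Pt.neg_def]
    omega
  · simp only [Pt.add_def, Pt.neg_def]
    omega
  · simp only [Pt.add_def, Pt.neg_def]
    omega
  · simp only [Pt.add_def, Pt.neg_def]
    omega
  · rcases hf.typ with h | ⟨E, k, hE, h, hd⟩
    · refine Or.inl ((h.shift (-d)).mono hq0 hq1 fun c x _ => ?_)
      simp only [Pt.add_def, Pt.neg_def]
      omega
    · refine Or.inr ⟨E, k, hE, (h.shift (-d)).mono hq0 hq1 fun c x _ => ?_,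
        hd.symm.imp (fun h => by rw [h, neg_neg]) fun h => by rw [h]⟩
      cases hE
      all_goals
        simp only [Pt.add_def, Pt.neg_def]
        omega

/-- For weights of order 2a + p, size alone controls three of the four oscillations, because u ≤ 2a
+ 1. Only the variation in b, where order 2a + 2b is demanded, must be given. -/
theorem Est.of_bigO (hq0 : 0 < q) (hq1 : q < 1) (hd : d.Near)
    (h : BigO q f fun x => 2 * x.a + x.p)
    (h₁ : BigO q (osc ⟨0, 0, 1, 0⟩ f) fun x => 2 * x.a + 2 * x.b) : Est q f d where
  near := hd
  const := ⟨0, (h.mono hq0 hq1 fun c x ⟨_, _, _, _⟩ => by omega).congr fun x => sub_zero _⟩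
  osc₁ := h₁
  osc₂ := h.osc hq0 hq1 (by intros; omega) fun c x ⟨_, _, _, _⟩ => by
    simp only [Pt.add_def]
    omega
  osc₃ := h.osc hq0 hq1 (fun c x ⟨_, _, _, _⟩ => by omega) fun c x ⟨_, _, _, _⟩ => by
    simp only [Pt.add_def]
    omega
  osc₄ := h.osc hq0 hq1 (fun c x ⟨_, _, _, _⟩ => by omega) fun c x ⟨_, _, _, _⟩ => by
    simp only [Pt.add_def]
    omega
  typ := Or.inl h

theorem Est.of_bigO_up (hq0 : 0 < q) (hq1 : q < 1) (hE : Dir d k) (hk : BigO q f k) (hd : d.Near)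
    (h : BigO q f fun x => x.u + x.p)
    (h₁ : BigO q (osc ⟨0, 0, 1, 0⟩ f) fun x => 2 * x.a + 2 * x.b)
    (h₂ : BigO q (osc ⟨1, 0, 0, 0⟩ f) fun x => 2 * x.a + x.p) : Est q f d where
  near := hd
  const := ⟨0, (h.mono hq0 hq1 fun c x ⟨_, _, _, _⟩ => by omega).congr fun x => sub_zero _⟩
  osc₁ := h₁
  osc₂ := h₂
  osc₃ := h.osc hq0 hq1 (fun c x ⟨_, _, _, _⟩ => by omega) fun c x ⟨_, _, _, _⟩ => by
    simp only [Pt.add_def]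
    omega
  osc₄ := h.osc hq0 hq1 (fun c x ⟨_, _, _, _⟩ => by omega) fun c x ⟨_, _, _, _⟩ => by
    simp only [Pt.add_def]
    omega
  typ := Or.inr ⟨d, k, hE, hk, Or.inl rfl⟩

/-- A shift whose weight is of even type, or rapidly decaying. -/
def Sh.Good (q : ℝ) (t : Sh) : Prop := (∃ f, t.f = (fun _ => f) ∧ Est q f t.d) ∨ Rapid t.f

theorem Sh.Good.bdd (hq0 : 0 < q) (hq1 : q < 1) {t : Sh} (h : t.Good q) : Bdd t.f := by
  rcases h with ⟨f, hf, h⟩ | h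
  · rw [hf]
    exact h.bdd hq0 hq1
  · exact h.bdd

theorem Rapid.conj {f : ℤˣ → Pt → ℂ} (hf : Rapid f) : Rapid fun s x => conj (f s x) := by
  intro k
  obtain ⟨C, hC⟩ := hf k
  exact ⟨C, fun s x hx => by rw [RCLike.norm_conj]; exact hC s _ hx⟩

theorem Est.nearComm (hq0 : 0 < q) (hq1 : q < 1) (hf : Est q f d) (hg : Est q g e)
    (hfd : StayF f d) (hge : StayF g e) (r : ℤˣ) :
    NearComm (wsh (fun _ => f) d r) (JbJ (wsh (fun _ => g) e 1)) := by
  have hf' := hf.bdd hq0 hq1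
  have hg' := hg.bdd hq0 hq1
  rw [JbJ_wsh hg']
  refine NearComm.smul_right _ (nearComm_wsh hf' hg'.refl hfd (fun x hx h => ?_) r ?_ ?_)
  · dsimp only
    rw [hge x.refl (Pt.adm_refl.2 hx), map_zero]
    rwa [← Pt.adm_refl, Pt.refl_add, Pt.refl_refl]
  · have h := (Est.pair hq0 hq1 hf hg).rapid hq0 hq1
    intro k
    obtain ⟨C, hC⟩ := h k
    refine ⟨C, fun s x hx => le_of_eq_of_le ?_ (hC s x hx)⟩
    rw [norm_mul, norm_mul, RCLike.norm_conj]
  -- The second half of the commutator weight is the reflection of the first half for the pair with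
  -- f and g interchanged.
  · have h := ((Est.pair hq0 hq1 hg hf).rapid hq0 hq1).refl.conj
    intro k
    obtain ⟨C, hC⟩ := h k
    refine ⟨C, fun s x hx => le_of_eq_of_le ?_ (hC s x hx)⟩
    dsimp only
    rw [Complex.conj_conj, norm_mul, norm_mul, Pt.refl_refl]
    congr 2
    rw [osc, osc, Pt.refl_add, ← map_sub, RCLike.norm_conj]

end

/-! ### From shifts to arbitrary elements of the algebra -/

section generators

variable {q : ℝ}

/-- A rapidly decaying weight on either side puts everything into the ideal. In the remaining case
the commutator with D is a multiple of the same shift with the sign exchanged, so `Est.nearComm`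
applies to both. The commutator is fixed before the second shift is chosen, so one operator serves
all b. -/
theorem exists_isCommutator_shift (hq0 : 0 < q) (hq1 : q < 1) {t : Sh} (h : t.Good q)
    (hs : t.Stay) : ∃ c ∈ FP, IsCommutator D (wsh t.f t.d 1) c ∧
      ∀ t' : Sh, t'.Good q → t'.Stay → NearComm (wsh t.f t.d 1) (JbJ (wsh t'.f t'.d 1)) ∧
        NearComm c (JbJ (wsh t'.f t'.d 1)) := by
  have hb := h.bdd hq0 hq1
  rcases h with ⟨f, hf, h⟩ | h
  · rw [hf] at hb ⊢
    have hf' : StayF f t.d := fun x hx hd => by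
      have := hs 1 x hx hd
      rwa [hf] at this
    refine ⟨_, FP.smul_mem _ (hb.mem_FP t.d (-1)), isCommutator_D_even hb t.d 1, fun t' ht' hs' => ?_⟩
    have hb' := ht'.bdd hq0 hq1
    rcases ht' with ⟨g, hg, h'⟩ | h'
    · rw [hg]
      have hg' : StayF g t'.d := fun x hx hd => by
        have := hs' 1 x hx hd
        rwa [hg] at this
      exact ⟨h.nearComm hq0 hq1 h' hf' hg' 1, (h.nearComm hq0 hq1 h' hf' hg' (-1)).smul_left _⟩
    · have hS := JbJ_mem_SM (h'.mem_SM t'.d 1)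
      exact ⟨(NearComm.of_SM_left hS (hb.mem_FP _ _)).symm,
        (NearComm.of_SM_left hS (FP.smul_mem _ (hb.mem_FP _ _))).symm⟩
  · obtain ⟨c, hc, hc'⟩ := exists_isCommutator_D (h.mem_SM t.d 1)
    refine ⟨c, SM_le_FP hc, hc', fun t' ht' _ => ?_⟩
    have hF := JbJ_mem_FP ((ht'.bdd hq0 hq1).mem_FP t'.d 1)
    exact ⟨NearComm.of_SM_left (h.mem_SM _ _) hF, NearComm.of_SM_left hc hF⟩

theorem opSum_mem_FP {ts : List Sh} (h : ∀ t ∈ ts, Bdd t.f) : opSum ts ∈ FP := by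
  induction ts with
  | nil => exact FP.zero_mem
  | cons t ts ih =>
    rw [opSum_cons]
    exact FP.add_mem ((h t (by simp)).mem_FP _ _) (ih fun t ht => h t (by simp [ht]))

theorem exists_isCommutator_opSum (hq0 : 0 < q) (hq1 : q < 1) {ts : List Sh}
    (h : ∀ t ∈ ts, t.Good q ∧ t.Stay) : ∃ c ∈ FP, IsCommutator D (opSum ts) c ∧
      ∀ t' : Sh, t'.Good q → t'.Stay → NearComm (opSum ts) (JbJ (wsh t'.f t'.d 1)) ∧
        NearComm c (JbJ (wsh t'.f t'.d 1)) := by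
  induction ts with
  | nil =>
    exact ⟨0, FP.zero_mem, isCommutator_zero, fun _ _ _ => ⟨NearComm.zero_left _, NearComm.zero_left _⟩⟩
  | cons t ts ih =>
    obtain ⟨c, hc, hc', h1⟩ := exists_isCommutator_shift hq0 hq1 (h t (by simp)).1 (h t (by simp)).2
    obtain ⟨e, he, he', h2⟩ := ih fun t ht => h t (by simp [ht])
    refine ⟨c + e, FP.add_mem hc he, hc'.add he', fun t' ht' hs' => ?_⟩
    obtain ⟨h3, h4⟩ := h1 t' ht' hs'
    obtain ⟨h5, h6⟩ := h2 t' ht' hs'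
    exact ⟨h3.add_left h5, h4.add_left h6⟩

theorem nearComm_JbJ_opSum {T : H →L[ℂ] H}
    (hT : ∀ t : Sh, t.Good q → t.Stay → NearComm T (JbJ (wsh t.f t.d 1))) {ts : List Sh}
    (h : ∀ t ∈ ts, t.Good q ∧ t.Stay) : NearComm T (JbJ (opSum ts)) := by
  induction ts with
  | nil =>
    rw [opSum_nil, JbJ_zero]
    exact NearComm.zero_right _
  | cons t ts ih =>
    rw [opSum_cons, JbJ_add]
    exact (hT t (h t (by simp)).1 (h t (by simp)).2).add_right (ih fun t ht => h t (by simp [ht]))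

/-- A homomorphism whose values on generators are sums of good shifts satisfies the commutant and
the first order conditions up to rapidly decaying operators. -/
theorem first_order (hq0 : 0 < q) (hq1 : q < 1) {X : Type*} (φ : FreeAlgebra ℂ X →ₐ[ℂ] (H →L[ℂ] H))
    (hφ : ∀ x, ∃ ts : List Sh, (∀ t ∈ ts, t.Good q ∧ t.Stay) ∧ φ (FreeAlgebra.ι ℂ x) = opSum ts)
    (a : FreeAlgebra ℂ X) : ∃ c ∈ FP, IsCommutator D (φ a) c ∧
      ∀ b, NearComm (φ a) (JbJ (φ b)) ∧ NearComm c (JbJ (φ b)) := by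
  have hFP (a : FreeAlgebra ℂ X) : φ a ∈ FP := by
    induction a using FreeAlgebra.induction with
    | grade0 c =>
      rw [AlgHom.commutes, Algebra.algebraMap_eq_smul_one]
      exact FP.smul_mem _ one_mem_FP
    | grade1 x =>
      obtain ⟨ts, h, e⟩ := hφ x
      rw [e]
      exact opSum_mem_FP fun t ht => (h t ht).1.bdd hq0 hq1
    | mul a b ha hb => rw [map_mul]; exact FP_mul ha hb
    | add a b ha hb => rw [map_add]; exact FP.add_mem ha hb
  -- For fixed T, near commutation with J b J passes from single shifts to all words b; it is used
  -- for φ(a) and for its commutator with D alike.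
  have key {T : H →L[ℂ] H}
      (hT : ∀ t : Sh, t.Good q → t.Stay → NearComm T (JbJ (wsh t.f t.d 1)))
      (b : FreeAlgebra ℂ X) : NearComm T (JbJ (φ b)) := by
    induction b using FreeAlgebra.induction with
    | grade0 c =>
      rw [AlgHom.commutes, Algebra.algebraMap_eq_smul_one, JbJ_smul, JbJ_one, ← neg_one_smul ℂ,
        smul_smul]
      exact (NearComm.one_right T).smul_right _
    | grade1 x =>
      obtain ⟨ts, h, e⟩ := hφ x
      rw [e]
      exact nearComm_JbJ_opSum hT h
    | mul a b ha hb =>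
      rw [map_mul, JbJ_mul, ← neg_one_smul ℂ]
      exact (NearComm.mul_right (JbJ_mem_FP (hFP a)) (JbJ_mem_FP (hFP b)) ha hb).smul_right _
    | add a b ha hb =>
      rw [map_add, JbJ_add]
      exact ha.add_right hb
  induction a using FreeAlgebra.induction with
  | grade0 c =>
    rw [AlgHom.commutes, Algebra.algebraMap_eq_smul_one]
    refine ⟨0, FP.zero_mem, ?_, fun b => ⟨(NearComm.one_left _).smul_left c, NearComm.zero_left _⟩⟩
    have := IsCommutator.smul (e := Label.flip) (w := fun i => i.l + 3 / 2) c isCommutator_one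
    rwa [smul_zero] at this
  | grade1 x =>
    obtain ⟨ts, h, e⟩ := hφ x
    obtain ⟨c, hc, hc', h'⟩ := exists_isCommutator_opSum hq0 hq1 h
    rw [e]
    exact ⟨c, hc, hc', fun b => ⟨key (fun t ht hs => (h' t ht hs).1) b,
      key (fun t ht hs => (h' t ht hs).2) b⟩⟩
  -- [D, ab] = [D, a] b + a [D, b]. Each factor nearly commutes with J r J and lies in `FP`, hence
  -- so does the sum.
  | mul a b ha hb =>
    obtain ⟨c, hc, hc', h⟩ := ha
    obtain ⟨e, he, he', h'⟩ := hb
    rw [map_mul]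
    refine ⟨c * φ b + φ a * e, FP.add_mem (FP_mul hc (hFP b)) (FP_mul (hFP a) he), hc'.mul he',
      fun r => ⟨NearComm.mul_left (hFP a) (hFP b) (h r).1 (h' r).1, NearComm.add_left ?_ ?_⟩⟩
    · exact NearComm.mul_left hc (hFP b) (h r).2 (h' r).1
    · exact NearComm.mul_left (hFP a) he (h r).1 (h' r).2
  | add a b ha hb =>
    obtain ⟨c, hc, hc', h⟩ := ha
    obtain ⟨e, he, he', h'⟩ := hb
    rw [map_add]
    exact ⟨c + e, FP.add_mem hc he, hc'.add he',
      fun r => ⟨(h r).1.add_left (h' r).1, (h r).2.add_left (h' r).2⟩⟩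

end generators

/-! ### The shifts of the generators satisfy the estimates -/

section

variable {q : ℝ}

theorem Est.of_transpose (hq0 : 0 < q) (hq1 : q < 1) {f g : Pt → ℂ} {d d' : Pt} (h : Est q f d)
    (hd : d' = -d) (hg : ∀ x, g x = f (x + -d)) : Est q g d' := by
  rw [hd, funext hg]
  exact h.transpose hq0 hq1

theorem est_Dp (hq0 : 0 < q) (hq1 : q < 1) :
    Est q (fun x => fDp q x.a x.b x.p) ⟨0, 0, 1, 2⟩ where
  near := ⟨by decide, by decide, by decide, by decide⟩
  const := ⟨1, oneO_Dp hq0 hq1⟩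
  osc₁ := osc_Dp hq0 hq1
  osc₂ := osc_Dp_a hq0 hq1
  osc₃ := (osc_Dp_a hq0 hq1).mono hq0 hq1 fun c x ⟨_, _, _, _⟩ => by omega
  osc₄ := (osc_Dp_a hq0 hq1).mono hq0 hq1 fun c x ⟨_, _, _, _⟩ => by omega
  typ := Or.inr ⟨_, _, .vertical, bigO_Dp hq0 hq1, Or.inl rfl⟩

theorem est_Dm (hq0 : 0 < q) (hq1 : q < 1) :
    Est q (fun x => fDm q x.a x.b x.p) ⟨0, 0, -1, 0⟩ :=
  .of_bigO hq0 hq1 ⟨by decide, by decide, by decide, by decide⟩ (bigO_Dm hq0 hq1) (osc_Dm hq0 hq1)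

/-- Products in which the first factor does not depend on `l` and `m₂`. -/
theorem osc_mul_right (hq0 : 0 < q) (hq1 : q < 1) {f : ℤ → ℤ → ℂ} {h : Pt → ℂ} {α β : Pt → ℤ}
    (hf : BigO q (fun x => f x.a x.u) α) (hh : BigO q (osc ⟨0, 0, 1, 0⟩ h) β)
    (hβ : ∀ (c : ℕ) x, Dom c x → 2 * x.a + 2 * x.b ≤ α x + β x + 20 * (c + 1)) :
    BigO q (osc ⟨0, 0, 1, 0⟩ fun x => f x.a x.u * h x) fun x => 2 * x.a + 2 * x.b :=
  ((hf.mul hq0 hh).mono hq0 hq1 hβ).congr fun x => by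
    simp only [osc, Pt.add_def, add_zero]
    ring

/-- C⁻ is already of order 2a + p, and a bounded factor in (a, u) does not spoil this. In
`est_mul_Hp` the same order arises as 2a from A⁰ or B⁰ and p from H⁺. -/
theorem est_mul_Cm (hq0 : 0 < q) (hq1 : q < 1) {f : ℤ → ℤ → ℂ} {α : Pt → ℤ} {d : ℤ}
    (hd : -2 ≤ d ∧ d ≤ 2) (hf : BigO q (fun x => f x.a x.u) α)
    (hα : ∀ (c : ℕ) x, Dom c x → 0 ≤ α x + 10 * (c + 1)) :
    Est q (fun x => f x.a x.u * fCm q x.a x.b x.p) ⟨1, d, -2, -2⟩ :=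
  .of_bigO hq0 hq1 ⟨⟨by simp, by simp⟩, hd, ⟨by simp, by simp⟩, ⟨by simp, by simp⟩⟩
    ((hf.mul hq0 (bigO_Cm hq0 hq1)).mono hq0 hq1 fun c x hx => by
      have := hα c x hx
      omega)
    (osc_mul_right hq0 hq1 hf (osc_Cm hq0 hq1) fun c x hx => by
      have := hα c x hx
      omega)

theorem est_mul_Hp (hq0 : 0 < q) (hq1 : q < 1) {f : ℤ → ℤ → ℂ} {d : ℤ}
    (hd : -2 ≤ d ∧ d ≤ 2) (hf : BigO q (fun x => f x.a x.u) fun x => 2 * x.a) :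
    Est q (fun x => f x.a x.u * fHp q x.a x.b x.p) ⟨0, d, 1, 1⟩ :=
  .of_bigO hq0 hq1 ⟨⟨by simp, by simp⟩, hd, ⟨by simp, by simp⟩, ⟨by simp, by simp⟩⟩
    ((hf.mul hq0 (bigO_Hp hq0 hq1)).mono hq0 hq1 fun c x hx => by omega)
    (osc_mul_right hq0 hq1 hf (osc_Hp hq0 hq1) fun c x hx => by omega)

theorem osc_mul_Cp_a (hq0 : 0 < q) (hq1 : q < 1) {f : ℤ → ℤ → ℂ} {α : Pt → ℤ}
    (hf : BigO q (fun x => f x.a x.u) α) (hα : ∀ (c : ℕ) x, Dom c x → 0 ≤ α x + 10 * (c + 1))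
    (hf' : BigO q (osc ⟨1, 0, 0, 0⟩ fun x => f x.a x.u) fun x => 2 * x.a) :
    BigO q (osc ⟨1, 0, 0, 0⟩ fun x => f x.a x.u * fCp q x.a x.b x.p) fun x => 2 * x.a + x.p :=
  osc_mul hq0 hq1 hf hf' (bigO_Cp hq0 hq1) (osc_Cp_a hq0 hq1)
    (fun c x hx => by
      have := hα c x hx
      omega)
    fun c x _ => by
      simp only [Pt.add_def]
      omega

theorem osc_mul_Cp (hq0 : 0 < q) (hq1 : q < 1) {f : ℤ → ℤ → ℂ} {α : Pt → ℤ}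
    (hf : BigO q (fun x => f x.a x.u) α) (hα : ∀ (c : ℕ) x, Dom c x → 0 ≤ α x + 10 * (c + 1)) :
    BigO q (osc ⟨0, 0, 1, 0⟩ fun x => f x.a x.u * fCp q x.a x.b x.p) fun x => 2 * x.a + 2 * x.b :=
  osc_mul_right hq0 hq1 hf (osc_Cp hq0 hq1) fun c x hx => by
    have := hα c x hx
    omega

theorem est_Ap_Cp (hq0 : 0 < q) (hq1 : q < 1) :
    Est q (fun x => fAp q x.a x.u * fCp q x.a x.b x.p) ⟨1, 1, 0, 0⟩ :=
  have h0 : ∀ (c : ℕ) x, Dom c x → 0 ≤ x.u + 10 * ((c : ℤ) + 1) := fun c x ⟨_, _, _, _⟩ => by omega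
  have h := (bigO_Ap hq0 hq1).mul hq0 (bigO_Cp hq0 hq1)
  .of_bigO_up hq0 hq1 .diagonal h ⟨by decide, by decide, by decide, by decide⟩ h
    (osc_mul_Cp hq0 hq1 (bigO_Ap hq0 hq1) h0)
    (osc_mul_Cp_a hq0 hq1 (bigO_Ap hq0 hq1) h0 (osc_Ap hq0 hq1))

theorem est_Bm_Cp (hq0 : 0 < q) (hq1 : q < 1) :
    Est q (fun x => fBm q (x.a + 1) x.u * fCp q x.a x.b x.p) ⟨1, 0, 0, 0⟩ :=
  have h0 : ∀ (c : ℕ) x, Dom c x → 0 ≤ 2 * x.u + 10 * ((c : ℤ) + 1) :=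
    fun c x ⟨_, _, _, _⟩ => by omega
  have h := (bigO_Bm hq0 hq1).mul hq0 (bigO_Cp hq0 hq1)
  .of_bigO_up hq0 hq1 .lowering h ⟨by decide, by decide, by decide, by decide⟩
    (h.mono hq0 hq1 fun c x ⟨_, _, _, _⟩ => by omega)
    (osc_mul_Cp (f := fun a u => fBm q (a + 1) u) hq0 hq1 (bigO_Bm hq0 hq1) h0)
    (osc_mul_Cp_a (f := fun a u => fBm q (a + 1) u) hq0 hq1 (bigO_Bm hq0 hq1) h0 (osc_Bm hq0 hq1))

/-- Here the weight has only order p, so the oscillations of order u + p do not follow from size.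
They come from the variation of B⁺, of order u, times the size of C⁺, and from the variation of C⁺
in a. -/
theorem est_Bp_Cp (hq0 : 0 < q) (hq1 : q < 1) :
    Est q (fun x => fBp q x.a x.u * fCp q x.a x.b x.p) ⟨1, 2, 0, 0⟩ where
  near := ⟨by decide, by decide, by decide, by decide⟩
  const := ⟨0, (((bigO_Bp hq0 hq1).mul hq0 (bigO_Cp hq0 hq1)).mono hq0 hq1
    (by intros; omega)).congr fun x => sub_zero _⟩
  osc₁ := osc_mul_Cp hq0 hq1 (bigO_Bp hq0 hq1) (by intros; omega)
  osc₂ := osc_mul_Cp_a hq0 hq1 (bigO_Bp hq0 hq1) (by intros; omega) (osc_Bp hq0 hq1)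
  osc₃ := osc_mul hq0 hq1 (bigO_Bp hq0 hq1) (osc_Bp_left hq0 hq1) (bigO_Cp hq0 hq1)
    (β' := fun x => 2 * x.a + x.p) ((osc_Cp_a hq0 hq1).congr fun _ => rfl)
    (fun c x ⟨_, _, _, _⟩ => by omega) fun c x _ => by
      simp only [Pt.add_def]
      omega
  osc₄ := osc_mul hq0 hq1 (bigO_Bp hq0 hq1) (osc_Bp_diag hq0 hq1) (bigO_Cp hq0 hq1)
    (β' := fun x => 2 * x.a + x.p) ((osc_Cp_a hq0 hq1).congr fun _ => rfl)
    (fun c x ⟨_, _, _, _⟩ => by omega) fun c x _ => by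
      simp only [Pt.add_def]
      omega
  typ := Or.inr ⟨_, _, .raising, ((bigO_Bp hq0 hq1).mul hq0 (bigO_Cp hq0 hq1)).mono hq0 hq1
    (by intros; omega), Or.inl rfl⟩

theorem good_tE {g : ℤ → ℤ → ℂ} {h : ℤ → ℤ → ℤ → ℂ} {da du db dp : ℤ}
    (H : Est q (fun x => g x.a x.u * h x.a x.b x.p) ⟨da, du, db, dp⟩) :
    (tE g h da du db dp).Good q := Or.inl ⟨_, rfl, H⟩

/-- Weights proportional to the sign do not yield bounded commutators with D by cancellation; they
are admitted because they decay faster than every power of l. -/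
theorem good_tO (hq0 : 0 < q) (hq1 : q < 1) {g : ℤ → ℤ → ℂ} {h : ℤ → ℤ → ℤ → ℂ} {da du db dp : ℤ}
    (H : BigO q (fun x => g x.a x.u * h x.a x.b x.p) fun x => 2 * x.a + 2 * x.b) :
    (tO g h da du db dp).Good q :=
  Or.inr (Rapid.bdd_mul (f := fun s _ => ((s : ℤ) : ℂ)) ⟨1, fun s _ _ => by
    rcases Int.units_eq_one_or s with rfl | rfl <;> simp⟩ (H.rapid hq0 hq1))

/-- The terms that lower l at fixed j, or lower j, are read as transposes of raising terms. The
functions g' and h' are the corresponding raising weights, for which the estimates are stated. -/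
theorem good_latTerms (hq0 : 0 < q) (hq1 : q < 1) {f g g' h : ℤ → ℤ → ℂ} {d e k : ℤ} {α β : Pt → ℤ}
    (hf : BigO q (fun x => f x.a x.u) α) (hα : ∀ (c : ℕ) x, Dom c x → 0 ≤ α x + 10 * (c + 1))
    (hβ : ∀ (c : ℕ) x, Dom c x → 0 ≤ β x + 10 * (c + 1)) (hd : -2 ≤ d ∧ d ≤ 2)
    (he : -2 ≤ e ∧ e ≤ 2) (hk : -2 ≤ k ∧ k ≤ 2)
    (hg : BigO q (fun x => g x.a x.u) fun x => 2 * x.a)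
    (hg' : BigO q (fun x => g' x.a x.u) fun x => 2 * x.a) (hgg' : ∀ a u, g a u = g' a (u + e))
    (h1 : Est q (fun x => f x.a x.u * fCp q x.a x.b x.p) ⟨1, d, 0, 0⟩)
    (h2 : Est q (fun x => h x.a x.u * fCp q (x.a - 1) x.b x.p) ⟨-1, k, 0, 0⟩)
    {h' : ℤ → ℤ → ℂ} (hh' : BigO q (fun x => h' x.a x.u) β)
    (hhh' : ∀ a u, h a u = h' (a - 1) (u + k)) :
    ∀ t ∈ latTerms q f g h d e k, t.Good q := by
  intro t ht
  simp only [latTerms, List.mem_cons, List.not_mem_nil, or_false] at ht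
  rcases ht with rfl | rfl | rfl | rfl | rfl | rfl | rfl | rfl | rfl
  · exact good_tE h1
  · refine good_tO hq0 hq1 ((hf.mul hq0 (bigO_C0 hq0 hq1).neg).mono hq0 hq1 fun c x hx => ?_)
    have := hα c x hx
    omega
  · exact good_tE (est_mul_Cm hq0 hq1 hd hf hα)
  · exact good_tE (est_mul_Hp hq0 hq1 he hg)
  · exact good_tO hq0 hq1 ((hg.mul hq0 (bigO_H0 hq0 hq1)).mono hq0 hq1 fun c x hx => by omega)
  · refine good_tE ((est_mul_Hp (d := -e) hq0 hq1 (by omega) hg').of_transpose hq0 hq1 ?_ fun x => ?_)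
    · simp [Pt.neg_def]
    · simp only [Pt.add_def, Pt.neg_def, hgg', neg_neg, neg_zero, add_zero, sub_eq_add_neg]
  · refine good_tE ((est_mul_Cm (d := -k) hq0 hq1 (by omega) hh' hβ).of_transpose hq0 hq1 ?_ fun x => ?_)
    · simp [Pt.neg_def]
    · simp only [Pt.add_def, Pt.neg_def, hhh', neg_neg, sub_eq_add_neg]
  · refine good_tO hq0 hq1 (((((hh'.mul hq0 (bigO_C0 hq0 hq1).neg).mono
      (e' := fun x => 2 * x.a + 2 * x.b) hq0 hq1 fun c x hx => ?_).shift ⟨-1, k, 1, 1⟩).mono hq0 hq1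
      fun c x _ => ?_).congr fun x => ?_)
    · have := hβ c x hx
      omega
    · simp only [Pt.add_def]
      omega
    · simp only [Pt.add_def, hhh', sub_eq_add_neg]
  · exact good_tE h2

theorem good_terms₀ (hq0 : 0 < q) (hq1 : q < 1) : ∀ t ∈ terms₀ q, t.Good q :=
  have h0 : ∀ (c : ℕ) x, Dom c x → 0 ≤ x.u + 10 * ((c : ℤ) + 1) := fun c x ⟨_, _, _, _⟩ => by omega
  good_latTerms hq0 hq1 (bigO_Ap hq0 hq1) h0 h0 (by decide) (by decide) (by decide)
    (bigO_A0 hq0 hq1) (bigO_A0 hq0 hq1) (fun a u => by rw [add_zero]) (est_Ap_Cp hq0 hq1)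
    ((est_Ap_Cp hq0 hq1).of_transpose hq0 hq1 rfl fun x => by
      simp only [Pt.add_def, Pt.neg_def, neg_zero, add_zero, sub_eq_add_neg])
    (bigO_Ap hq0 hq1) fun a u => rfl

theorem good_terms₁ (hq0 : 0 < q) (hq1 : q < 1) : ∀ t ∈ terms₁ q, t.Good q :=
  good_latTerms (g' := fun a u => fB0 q a (u - 1)) hq0 hq1 (bigO_Bp hq0 hq1) (by intros; omega)
    (fun c x ⟨_, _, _, _⟩ => by omega) (by decide) (by decide) (by decide)
    (bigO_B0 hq0 hq1) (bigO_B0_sub hq0 hq1) (fun a u => by rw [add_sub_cancel_right])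
    (est_Bp_Cp hq0 hq1)
    ((est_Bm_Cp hq0 hq1).of_transpose hq0 hq1 rfl fun x => by
      simp only [Pt.add_def, Pt.neg_def, neg_zero, add_zero, sub_eq_add_neg, neg_add_cancel_right])
    (h' := fun a u => fBm q (a + 1) u) (bigO_Bm hq0 hq1) fun a u => by
      rw [sub_add_cancel, add_zero]

theorem good_terms₁s (hq0 : 0 < q) (hq1 : q < 1) : ∀ t ∈ terms₁s q, t.Good q :=
  good_latTerms (f := fun a u => fBm q (a + 1) u) hq0 hq1 (bigO_Bm hq0 hq1)
    (fun c x ⟨_, _, _, _⟩ => by omega) (by intros; omega) (by decide) (by decide) (by decide)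
    (bigO_B0_sub hq0 hq1) (bigO_B0 hq0 hq1) (fun a u => rfl) (est_Bm_Cp hq0 hq1)
    ((est_Bp_Cp hq0 hq1).of_transpose hq0 hq1 rfl fun x => by
      simp only [Pt.add_def, Pt.neg_def, neg_zero, add_zero, sub_eq_add_neg])
    (bigO_Bp hq0 hq1) fun a u => rfl

theorem good_terms₂ (hq0 : 0 < q) (hq1 : q < 1) : ∀ t ∈ terms₂ q, t.Good q := by
  intro t ht
  simp only [terms₂, List.mem_cons, List.not_mem_nil, or_false] at ht
  rcases ht with rfl | rfl | rfl
  · exact good_tE (by simpa only [one_mul] using est_Dp hq0 hq1)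
  · exact good_tO hq0 hq1 (by simpa only [one_mul] using bigO_D0 hq0 hq1)
  · exact good_tE (by simpa only [one_mul] using est_Dm hq0 hq1)

theorem good_terms₂s (hq0 : 0 < q) (hq1 : q < 1) : ∀ t ∈ terms₂s q, t.Good q := by
  intro t ht
  simp only [terms₂s, List.mem_cons, List.not_mem_nil, or_false] at ht
  rcases ht with rfl | rfl | rfl
  · exact good_tE ((est_Dp hq0 hq1).of_transpose hq0 hq1 rfl fun x => by
      simp only [Pt.add_def, Pt.neg_def, neg_zero, add_zero, sub_eq_add_neg, one_mul])
  · exact good_tO hq0 hq1 ((((bigO_D0 hq0 hq1).shift ⟨0, 0, 0, -1⟩).mono hq0 hq1 fun c x _ => by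
      simp only [Pt.add_def]
      omega).congr fun x => by simp only [Pt.add_def, add_zero, sub_eq_add_neg, one_mul])
  · exact good_tE ((est_Dm hq0 hq1).of_transpose hq0 hq1 rfl fun x => by
      simp only [Pt.add_def, Pt.neg_def, neg_zero, add_zero, neg_neg, one_mul])

end

/-! ### The representation of the quantum sphere -/

section

variable {q : ℝ}

theorem SphereGen.forall {P : SphereGen → Prop} (h0 : P (.x 0)) (h1 : P (.x 1)) (h2 : P (.x 2))
    (h0' : P (.xs 0)) (h1' : P (.xs 1)) (h2' : P (.xs 2)) (g : SphereGen) : P g := by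
  rcases g with i | i <;> fin_cases i <;> assumption

/-- The shifts that make up the generators. -/
def genTerms (q : ℝ) : SphereGen → List Sh
  | .x 0 => terms₀ q
  | .x 1 => terms₁ q
  | .x 2 => terms₂ q
  | .xs 0 => terms₀ q
  | .xs 1 => terms₁s q
  | .xs 2 => terms₂s q

theorem genTerms_x₀ (q : ℝ) : genTerms q (.x 0) = terms₀ q := rfl

theorem genTerms_x₁ (q : ℝ) : genTerms q (.x 1) = terms₁ q := rfl

theorem genTerms_x₂ (q : ℝ) : genTerms q (.x 2) = terms₂ q := rfl

theorem genTerms_x₀s (q : ℝ) : genTerms q (.xs 0) = terms₀ q := rfl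

theorem genTerms_x₁s (q : ℝ) : genTerms q (.xs 1) = terms₁s q := rfl

theorem genTerms_x₂s (q : ℝ) : genTerms q (.xs 2) = terms₂s q := rfl

theorem good_genTerms (hq0 : 0 < q) (hq1 : q < 1) (g : SphereGen) :
    ∀ t ∈ genTerms q g, t.Good q ∧ t.Stay := by
  have h {ts : List Sh} (hg : ∀ t ∈ ts, t.Good q) (hs : ∀ t ∈ ts, t.Stay) :
      ∀ t ∈ ts, t.Good q ∧ t.Stay := fun t ht => ⟨hg t ht, hs t ht⟩
  induction g using SphereGen.forall with
  | h0 => rw [genTerms_x₀]; exact h (good_terms₀ hq0 hq1) (stay_terms₀ q)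
  | h1 => rw [genTerms_x₁]; exact h (good_terms₁ hq0 hq1) (stay_terms₁ q)
  | h2 => rw [genTerms_x₂]; exact h (good_terms₂ hq0 hq1) (stay_terms₂ q)
  | h0' => rw [genTerms_x₀s]; exact h (good_terms₀ hq0 hq1) (stay_terms₀ q)
  | h1' => rw [genTerms_x₁s]; exact h (good_terms₁s hq0 hq1) (stay_terms₁s q)
  | h2' => rw [genTerms_x₂s]; exact h (good_terms₂s hq0 hq1) (stay_terms₂s q)

/-- The bounded operators that represent the generators. -/
def genOp (q : ℝ) (g : SphereGen) : H →L[ℂ] H := opSum (genTerms q g)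

theorem bdd_genTerms (hq0 : 0 < q) (hq1 : q < 1) (g : SphereGen) : ∀ t ∈ genTerms q g, Bdd t.f :=
  fun t ht => (good_genTerms hq0 hq1 g t ht).1.bdd hq0 hq1

theorem star_genOp (hq0 : 0 < q) (hq1 : q < 1) (g : SphereGen) :
    star (genOp q g) = genOp q g.adj := by
  have hb := bdd_genTerms hq0 hq1
  have e0 : genOp q (.xs 0) = genOp q (.x 0) := by rw [genOp, genOp, genTerms_x₀, genTerms_x₀s]
  have h0 : star (genOp q (.x 0)) = genOp q (.x 0) := by
    have h := hb (.x 0)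
    rw [genTerms_x₀] at h
    rw [genOp, genTerms_x₀, star_opSum (transpose_terms₀ hq0 hq1) h
      fun t ht => h t (List.mem_reverse.1 ht)]
    exact opSum_perm (List.reverse_perm _)
  have h1 : star (genOp q (.x 1)) = genOp q (.xs 1) := by
    have h := hb (.x 1)
    have h' := hb (.xs 1)
    rw [genTerms_x₁] at h
    rw [genTerms_x₁s] at h'
    rw [genOp, genOp, genTerms_x₁, genTerms_x₁s, star_opSum (transpose_terms₁ hq0 hq1) h
      fun t ht => h' t (List.mem_reverse.1 ht)]
    exact opSum_perm (List.reverse_perm _)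
  have h2 : star (genOp q (.x 2)) = genOp q (.xs 2) := by
    have h := hb (.x 2)
    have h' := hb (.xs 2)
    rw [genTerms_x₂] at h
    rw [genTerms_x₂s] at h'
    rw [genOp, genOp, genTerms_x₂, genTerms_x₂s, star_opSum (transpose_terms₂ hq0 hq1) h h']
  induction g using SphereGen.forall with
  | h0 => rw [SphereGen.adj, e0, h0]
  | h1 => rw [SphereGen.adj, h1]
  | h2 => rw [SphereGen.adj, h2]
  | h0' => rw [SphereGen.adj, e0, h0]
  | h1' => rw [SphereGen.adj, ← h1, star_star]
  | h2' => rw [SphereGen.adj, ← h2, star_star]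

/-- The lattice operators that represent the generators. -/
def genLat (q : ℝ) (g : SphereGen) : Module.End ℂ Lat := latSum (genTerms q g)

theorem rep_genOp (hq0 : 0 < q) (hq1 : q < 1) (g : SphereGen) : Rep (genOp q g) (genLat q g) :=
  rep_opSum (bdd_genTerms hq0 hq1 g)

theorem rep_genOp_mul (hq0 : 0 < q) (hq1 : q < 1) (g h : SphereGen) :
    Rep (genOp q g * genOp q h) (genLat q g * genLat q h) :=
  (rep_genOp hq0 hq1 g).mul (rep_genOp hq0 hq1 h)
    (pres_latSum fun t ht => (good_genTerms hq0 hq1 h t ht).2)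

theorem genOp_comm (hq0 : 0 < q) (hq1 : q < 1) {g h : SphereGen}
    (e : genLat q g * genLat q h = (q : ℂ) ^ 2 • (genLat q h * genLat q g)) :
    genOp q g * genOp q h = (q : ℂ) ^ 2 • (genOp q h * genOp q g) := by
  have h1 := rep_genOp_mul hq0 hq1 g h
  rw [e] at h1
  exact h1.unique ((rep_genOp_mul hq0 hq1 h g).smul _)

theorem genOp_comm_adj (hq0 : 0 < q) (hq1 : q < 1) {g h : SphereGen}
    (e : genOp q g * genOp q h = (q : ℂ) ^ 2 • (genOp q h * genOp q g)) :
    genOp q h.adj * genOp q g.adj = (q : ℂ) ^ 2 • (genOp q g.adj * genOp q h.adj) := by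
  have h1 := congrArg star e
  rw [star_mul, star_smul, star_mul] at h1
  simp only [star_genOp hq0 hq1] at h1
  simpa using h1

/-- Only relations needing an honest computation are carried over from the lattice; the others are
adjoints of these or consequences of x₀ = x₀*. -/
theorem genOp_relations (hq0 : 0 < q) (hq1 : q < 1) ⦃a b : FreeAlgebra ℂ SphereGen⦄
    (h : SphereRel q a b) :
    FreeAlgebra.lift ℂ (genOp q) a = FreeAlgebra.lift ℂ (genOp q) b := by
  have l0 : genLat q (.x 0) = X0 q := by rw [genLat, genTerms_x₀, X0_eq]
  have l1 : genLat q (.x 1) = X1 q := by rw [genLat, genTerms_x₁, X1_eq]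
  have l2 : genLat q (.x 2) = X2 q := by rw [genLat, genTerms_x₂, X2_eq]
  have l1' : genLat q (.xs 1) = X1s q := by rw [genLat, genTerms_x₁s, X1s_eq]
  have l2' : genLat q (.xs 2) = X2s q := by rw [genLat, genTerms_x₂s, X2s_eq]
  have e0 : genOp q (.xs 0) = genOp q (.x 0) := by rw [genOp, genOp, genTerms_x₀, genTerms_x₀s]
  have h01 : genOp q (.x 0) * genOp q (.x 1) = (q : ℂ) ^ 2 • (genOp q (.x 1) * genOp q (.x 0)) :=
    genOp_comm hq0 hq1 (by rw [l0, l1]; exact X0_mul_X1 hq0 hq1)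
  have h02 : genOp q (.x 0) * genOp q (.x 2) = (q : ℂ) ^ 2 • (genOp q (.x 2) * genOp q (.x 0)) :=
    genOp_comm hq0 hq1 (by rw [l0, l2]; exact latOp_mul_X2 hq0 hq1 _ _ _ _ _ _)
  have h12 : genOp q (.x 1) * genOp q (.x 2) = (q : ℂ) ^ 2 • (genOp q (.x 2) * genOp q (.x 1)) :=
    genOp_comm hq0 hq1 (by rw [l1, l2]; exact latOp_mul_X2 hq0 hq1 _ _ _ _ _ _)
  have h12' : genOp q (.xs 1) * genOp q (.x 2) = (q : ℂ) ^ 2 • (genOp q (.x 2) * genOp q (.xs 1)) :=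
    genOp_comm hq0 hq1 (by rw [l1', l2]; exact latOp_mul_X2 hq0 hq1 _ _ _ _ _ _)
  have hr₁ : genOp q (.xs 1) * genOp q (.x 1) = genOp q (.x 1) * genOp q (.xs 1) +
      (1 - (q : ℂ) ^ 4) • (genOp q (.x 0) * genOp q (.x 0)) := by
    have h1 := rep_genOp_mul hq0 hq1 (.xs 1) (.x 1)
    rw [l1', l1, X1s_mul_X1 hq0 hq1, ← l0, ← l1, ← l1'] at h1
    exact h1.unique ((rep_genOp_mul hq0 hq1 _ _).add ((rep_genOp_mul hq0 hq1 _ _).smul _))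
  have hr₂ : genOp q (.xs 2) * genOp q (.x 2) = (q : ℂ) ^ 4 • (genOp q (.x 2) * genOp q (.xs 2)) +
      (1 - (q : ℂ) ^ 4) • 1 := by
    have h1 := rep_genOp_mul hq0 hq1 (.xs 2) (.x 2)
    rw [l2', l2, X2s_mul_X2 hq0 hq1, ← l2, ← l2'] at h1
    exact h1.unique (((rep_genOp_mul hq0 hq1 _ _).smul _).add (Rep.one.smul _))
  have hs : genOp q (.x 0) * genOp q (.x 0) + genOp q (.x 1) * genOp q (.xs 1) +
      genOp q (.x 2) * genOp q (.xs 2) = 1 := by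
    have h1 := ((rep_genOp_mul hq0 hq1 (.x 0) (.x 0)).add (rep_genOp_mul hq0 hq1 (.x 1) (.xs 1))).add
      (rep_genOp_mul hq0 hq1 (.x 2) (.xs 2))
    rw [l0, l1, l1', l2, l2', sphere_rel hq0 hq1] at h1
    exact h1.unique Rep.one
  have hcomm : ∀ i j : Fin 3, i < j →
      genOp q (.x i) * genOp q (.x j) = (q : ℂ) ^ 2 • (genOp q (.x j) * genOp q (.x i)) := by
    rw [Fin.forall_fin_succ, Fin.forall_fin_two]
    simp only [Fin.forall_fin_succ]
    simp [h01, h02, h12]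
  have hmixed : ∀ i j : Fin 3, i ≠ j →
      genOp q (.xs i) * genOp q (.x j) = (q : ℂ) ^ 2 • (genOp q (.x j) * genOp q (.xs i)) := by
    -- Of the mixed relations only the one for x₁*, x₂ is new. The relation for x₂*, x₁ is its
    -- adjoint, and those involving x₀ come from x₀ = x₀*.
    have h10 := genOp_comm_adj hq0 hq1 h01
    have h20 := genOp_comm_adj hq0 hq1 h02
    have h21 := genOp_comm_adj hq0 hq1 h12'
    simp only [SphereGen.adj, e0] at h10 h20 h21
    intro i j
    fin_cases i <;> fin_cases j
    all_goals simp [e0, h01, h02, h10, h20, h12', h21]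
  cases h with
  | selfadjoint => simp only [FreeAlgebra.lift_ι_apply, e0]
  | comm i j hij => simpa only [map_mul, map_smul, FreeAlgebra.lift_ι_apply] using hcomm i j hij
  | comm_adj i j hij =>
    simpa only [map_mul, map_smul, FreeAlgebra.lift_ι_apply, SphereGen.adj] using
      genOp_comm_adj hq0 hq1 (hcomm i j hij)
  | mixed i j hij =>
    simpa only [map_mul, map_smul, FreeAlgebra.lift_ι_apply] using hmixed i j hij
  | radial₁ =>
    simp only [map_mul, map_smul, map_sub, FreeAlgebra.lift_ι_apply]
    rw [hr₁, add_sub_cancel_left]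
  -- [x₂*, x₂] = (1 - q⁴)(1 - x₂x₂*) = (1 - q⁴)(x₀² + x₁x₁*) by the sphere relation, and the first
  -- radial relation turns this into x₁*x₁ - q⁴ x₁x₁*.
  | radial₂ =>
    simp only [map_mul, map_smul, map_sub, FreeAlgebra.lift_ι_apply]
    rw [hr₁, hr₂, ← hs]
    module
  | sphere =>
    simpa only [map_mul, map_add, map_one, FreeAlgebra.lift_ι_apply] using hs

/-- The representation of `𝒜(S⁴_q)` as a homomorphism of algebras. -/
def sphereHom (hq0 : 0 < q) (hq1 : q < 1) : Sphere q →ₐ[ℂ] (H →L[ℂ] H) :=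
  RingQuot.liftAlgHom ℂ ⟨FreeAlgebra.lift ℂ (genOp q), genOp_relations hq0 hq1⟩

theorem sphereHom_mk (hq0 : 0 < q) (hq1 : q < 1) (a : FreeAlgebra ℂ SphereGen) :
    sphereHom hq0 hq1 (Sphere.mk q a) = FreeAlgebra.lift ℂ (genOp q) a :=
  RingQuot.liftAlgHom_mkAlgHom_apply ℂ _ (genOp_relations hq0 hq1) a

theorem Sphere.star_mk_ι (g : SphereGen) :
    star (mk q (FreeAlgebra.ι ℂ g)) = mk q (FreeAlgebra.ι ℂ g.adj) := by
  change (starHom q (mk q _)).unop = _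
  rw [starHom_mk, preStar, conjLift_ι]
  rfl

theorem sphereHom_star (hq0 : 0 < q) (hq1 : q < 1) (a : Sphere q) :
    sphereHom hq0 hq1 (star a) = star (sphereHom hq0 hq1 a) := by
  obtain ⟨a, rfl⟩ := Sphere.mk_surjective q a
  induction a using FreeAlgebra.induction with
  | grade0 c =>
    rw [AlgHom.commutes, Algebra.algebraMap_eq_smul_one, star_smul, star_one, map_smul, map_smul,
      map_one, star_smul, star_one]
  | grade1 g =>
    rw [Sphere.star_mk_ι, sphereHom_mk, sphereHom_mk, FreeAlgebra.lift_ι_apply,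
      FreeAlgebra.lift_ι_apply, star_genOp hq0 hq1]
  | mul a b ha hb => rw [map_mul, star_mul, map_mul, map_mul, star_mul, ha, hb]
  | add a b ha hb => rw [map_add, star_add, map_add, map_add, star_add, ha, hb]

/-- The representation of `𝒜(S⁴_q)`. -/
def sphereRep (hq0 : 0 < q) (hq1 : q < 1) : Sphere q →⋆ₐ[ℂ] (H →L[ℂ] H) :=
  { sphereHom hq0 hq1 with map_star' := sphereHom_star hq0 hq1 }

theorem sphereRep_mk (hq0 : 0 < q) (hq1 : q < 1) (a : FreeAlgebra ℂ SphereGen) :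
    sphereRep hq0 hq1 (Sphere.mk q a) = FreeAlgebra.lift ℂ (genOp q) a :=
  sphereHom_mk hq0 hq1 a

theorem sphereRep_ι (hq0 : 0 < q) (hq1 : q < 1) (g : SphereGen) :
    sphereRep hq0 hq1 (Sphere.mk q (FreeAlgebra.ι ℂ g)) = opSum (genTerms q g) := by
  rw [sphereRep_mk, FreeAlgebra.lift_ι_apply, genOp]

theorem isSpinorRep_sphereRep (hq0 : 0 < q) (hq1 : q < 1) :
    IsSpinorRep q (sphereRep hq0 hq1) where
  x₀ s l m₁ m₂ j h := by
    rw [Sphere.x, sphereRep_ι]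
    have hb := bdd_genTerms hq0 hq1 (.x 0)
    rw [genTerms_x₀] at hb ⊢
    exact opSum_terms₀ hq0 hq1 hb s l m₁ m₂ j h
  x₁ s l m₁ m₂ j h := by
    rw [Sphere.x, sphereRep_ι]
    have hb := bdd_genTerms hq0 hq1 (.x 1)
    rw [genTerms_x₁] at hb ⊢
    exact opSum_terms₁ hq0 hq1 hb s l m₁ m₂ j h
  x₂ s l m₁ m₂ j h := by
    rw [Sphere.x, sphereRep_ι]
    have hb := bdd_genTerms hq0 hq1 (.x 2)
    rw [genTerms_x₂] at hb ⊢
    exact opSum_terms₂ hq0 hq1 hb s l m₁ m₂ j h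

theorem sphereRep_first_order (hq0 : 0 < q) (hq1 : q < 1) (a b : Sphere q) :
    Smoothing (sphereRep hq0 hq1 a * JbJ (sphereRep hq0 hq1 b) -
      JbJ (sphereRep hq0 hq1 b) * sphereRep hq0 hq1 a) ∧
    ∃ c : H →L[ℂ] H, IsCommutator D (sphereRep hq0 hq1 a) c ∧
      Smoothing (c * JbJ (sphereRep hq0 hq1 b) - JbJ (sphereRep hq0 hq1 b) * c) := by
  obtain ⟨a, rfl⟩ := Sphere.mk_surjective q a
  obtain ⟨b, rfl⟩ := Sphere.mk_surjective q b
  obtain ⟨c, -, hc, h⟩ := first_order hq0 hq1 (FreeAlgebra.lift ℂ (genOp q))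
    (fun g => ⟨genTerms q g, good_genTerms hq0 hq1 g, FreeAlgebra.lift_ι_apply _ _⟩) a
  rw [sphereRep_mk, sphereRep_mk]
  exact ⟨smoothing_of_SM (h b).1, c, hc, smoothing_of_SM (h b).2⟩

end

/-! ### The generators of the symmetry algebra as sums of shifts -/

section

variable {q : ℝ}

/-- A diagonal operator as a shift. -/
def tD (f : ℤ → ℤ → ℤ → ℤ → ℂ) : Sh := ⟨fun _ x => f x.a x.u x.b x.p, 0⟩

/-- The shifts that make up the generators of the symmetry algebra. -/
def uqTerms (q : ℝ) : UqGen → List Sh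
  | .K 0 => [tD fun a u _ _ => qhalf q * (q : ℂ) ^ (u - a)]
  | .K 1 => [tD fun a u b p => (q : ℂ) ^ (p - b - u + a)]
  | .Kinv 0 => [tD fun a u _ _ => (qhalf q * (q : ℂ) ^ (u - a))⁻¹]
  | .Kinv 1 => [tD fun a u b p => ((q : ℂ) ^ (p - b - u + a))⁻¹]
  | .E 0 => [tE (fun a u => sn q (2 * a + 1 - u) * sn q (u + 1)) (fun _ _ _ => 1) 0 1 0 0]
  | .E 1 => [tE (fun a u => sn q (2 * a + 2 - u) * sn q (2 * a + 3 - u)) (fal q) 1 0 (-1) 0,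
      tE (fun a u => sn q u * sn q (2 * a + 2 - u)) (fbl q) 0 (-1) 0 1,
      tE (fun _ u => sn q u * sn q (u - 1)) (fcl q) (-1) (-2) 1 2]
  | .F 0 => [tE (fun a u => sn q (2 * a + 2 - u) * sn q u) (fun _ _ _ => 1) 0 (-1) 0 0]
  | .F 1 => [tE (fun a u => sn q (2 * a - u) * sn q (2 * a + 1 - u))
        (fun a b p => fal q (a - 1) (b + 1) p) (-1) 0 1 0,
      tE (fun a u => sn q (u + 1) * sn q (2 * a + 1 - u)) (fun a b p => fbl q a b (p - 1)) 0 1 0 (-1),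
      tE (fun _ u => sn q (u + 2) * sn q (u + 1)) (fun a b p => fcl q (a + 1) (b - 1) (p - 2))
        1 2 (-1) (-2)]

theorem UqGen.forall {P : UqGen → Prop} (hK₁ : P (.K 0)) (hK₂ : P (.K 1)) (hK₁' : P (.Kinv 0))
    (hK₂' : P (.Kinv 1)) (hE₁ : P (.E 0)) (hE₂ : P (.E 1)) (hF₁ : P (.F 0)) (hF₂ : P (.F 1))
    (g : UqGen) : P g := by
  rcases g with i | i | i | i <;> fin_cases i <;> assumption

/-- The lattice operators that represent the generators of the symmetry algebra. -/
def uqLat (q : ℝ) (g : UqGen) : Module.End ℂ Lat := latSum (uqTerms q g)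

theorem uqLat_K₁ (q : ℝ) : uqLat q (.K 0) = Z1 q := by
  refine lat_ext' fun s a u b p => Eq.trans (latSum_vc _ s ⟨a, u, b, p⟩) ?_
  rw [Z1, latDiag, latLift_vec]
  simp [uqTerms, tD, vc, lat_add_zero]

theorem uqLat_K₂ (q : ℝ) : uqLat q (.K 1) = Z2 q := by
  refine lat_ext' fun s a u b p => Eq.trans (latSum_vc _ s ⟨a, u, b, p⟩) ?_
  rw [Z2, latDiag, latLift_vec]
  simp [uqTerms, tD, vc, lat_add_zero]

theorem uqLat_Kinv₁ (q : ℝ) : uqLat q (.Kinv 0) = Z1' q := by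
  refine lat_ext' fun s a u b p => Eq.trans (latSum_vc _ s ⟨a, u, b, p⟩) ?_
  rw [Z1', latDiag, latLift_vec]
  simp [uqTerms, tD, vc, lat_add_zero]

theorem uqLat_Kinv₂ (q : ℝ) : uqLat q (.Kinv 1) = Z2' q := by
  refine lat_ext' fun s a u b p => Eq.trans (latSum_vc _ s ⟨a, u, b, p⟩) ?_
  rw [Z2', latDiag, latLift_vec]
  simp [uqTerms, tD, vc, lat_add_zero]

theorem uqLat_E₁ (q : ℝ) : uqLat q (.E 0) = Y1 q := by
  refine lat_ext' fun s a u b p => Eq.trans (latSum_vc _ s ⟨a, u, b, p⟩) ?_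
  rw [Y1, latLift_vec]
  simp [uqTerms, tE, vc, lat_add_zero, Pt.add_def]

theorem uqLat_F₁ (q : ℝ) : uqLat q (.F 0) = Y1s q := by
  refine lat_ext' fun s a u b p => Eq.trans (latSum_vc _ s ⟨a, u, b, p⟩) ?_
  rw [Y1s, latLift_vec]
  simp [uqTerms, tE, vc, lat_add_zero, Pt.add_def, sub_eq_add_neg]

theorem uqLat_E₂ (q : ℝ) : uqLat q (.E 1) = Y2 q := by
  refine lat_ext' fun s a u b p => Eq.trans (latSum_vc _ s ⟨a, u, b, p⟩) ?_
  rw [Y2, latLift_vec]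
  simp only [uqTerms, tE, vc, lat_add_zero, Pt.add_def, List.map_cons, List.map_nil, List.sum_cons,
    List.sum_nil, add_zero, ← sub_eq_add_neg]
  exact (add_assoc (G := Lat) _ _ _).symm

theorem uqLat_F₂ (q : ℝ) : uqLat q (.F 1) = Y2s q := by
  refine lat_ext' fun s a u b p => Eq.trans (latSum_vc _ s ⟨a, u, b, p⟩) ?_
  rw [Y2s, latLift_vec]
  simp only [uqTerms, tE, vc, lat_add_zero, Pt.add_def, List.map_cons, List.map_nil, List.sum_cons,
    List.sum_nil, add_zero, ← sub_eq_add_neg]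
  exact (add_assoc (G := Lat) _ _ _).symm

theorem stayC_al (q : ℝ) : StayC (fal q) (-1) 0 := fun a b p h h' h'' => by
  simp only [fal]
  split_ifs with hp
  · obtain ⟨c, hc⟩ := hp
    have e : 2 * b + 1 - p = 0 := by omega
    simp only [e, sn_zero, zero_mul, zero_div]
  · obtain ⟨c, hc⟩ := Int.not_odd_iff_even.1 hp
    have e : 2 * b - p = 0 := by omega
    simp only [e, sn_zero, zero_mul, zero_div]

theorem stayC_bl (q : ℝ) : StayC (fbl q) 0 1 := fun a b p h h' h'' => by
  have e : 2 * b + 1 - p = 0 := by omega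
  have hp : Odd p := ⟨b, by omega⟩
  simp only [fbl, if_pos hp, e, sn_zero, zero_mul, zero_div]

theorem stayC_blt (q : ℝ) : StayC (fun a b p => fbl q a b (p - 1)) 0 (-1) := fun a b p h h' h'' => by
  have e : p - 1 + 1 = 0 := by omega
  have hp : Odd (p - 1) := ⟨-1, by omega⟩
  simp only [fbl, if_pos hp, e, sn_zero, mul_zero, zero_div]

theorem stayC_clt (q : ℝ) : StayC (fun a b p => fcl q (a + 1) (b - 1) (p - 2)) (-1) (-2) :=
  fun a b p h h' h'' => by
  simp only [fcl]
  split_ifs with hp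
  · obtain ⟨c, hc⟩ := hp
    have e : p - 2 + 1 = 0 := by omega
    simp only [e, sn_zero, zero_mul, zero_div, neg_zero]
  · obtain ⟨c, hc⟩ := Int.not_odd_iff_even.1 hp
    have e : p - 2 + 2 = 0 := by omega
    simp only [e, sn_zero, zero_mul, zero_div, neg_zero]

/-- The weight is a product of two square roots one of which vanishes outside the region. -/
theorem stayA_sn_mul {f g : ℤ → ℤ → ℤ} {da du : ℤ}
    (h : ∀ a u, 0 ≤ u → u ≤ 2 * a + 1 → ¬(0 ≤ u + du ∧ u + du ≤ 2 * (a + da) + 1) →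
      f a u = 0 ∨ g a u = 0) : StayA (fun a u => sn q (f a u) * sn q (g a u)) da du :=
  fun a u h1 h2 h3 => by
    rcases h a u h1 h2 h3 with e | e <;> simp only [e, sn_zero, zero_mul, mul_zero]

theorem stay_tD (f : ℤ → ℤ → ℤ → ℤ → ℂ) : (tD f).Stay :=
  fun _ x hx hd => absurd ((add_zero x).symm ▸ hx) hd

theorem stay_uqTerms (q : ℝ) (g : UqGen) : ∀ t ∈ uqTerms q g, t.Stay := by
  have h1 : StayC (fun _ _ _ => 1) 0 0 := stayC_of_le le_rfl (by simp)
  induction g using UqGen.forall <;>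
    simp only [uqTerms, List.forall_mem_cons, List.not_mem_nil, false_imp_iff, implies_true, and_true]
  iterate 4 exact stay_tD _
  · exact stay_tE (stayA_sn_mul (by omega)) h1
  · exact ⟨stay_tE (stayA_of_le (by simp) (by simp)) (stayC_al q),
      stay_tE (stayA_sn_mul (by omega)) (stayC_bl q),
      stay_tE (stayA_sn_mul (by omega)) (stayC_of_le (by simp) (by simp))⟩
  · exact stay_tE (stayA_sn_mul (by omega)) h1
  · exact ⟨stay_tE (stayA_sn_mul (by omega)) (stayC_of_le (by simp) (by simp)),
      stay_tE (stayA_sn_mul (by omega)) (stayC_blt q),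
      stay_tE (stayA_of_le (by simp) (by simp)) (stayC_clt q)⟩

theorem exists_real_sn_mul (hq0 : 0 < q) (hq1 : q < 1) {i j : ℤ} (hi : 0 ≤ i) (hj : 0 ≤ j) :
    ∃ r : ℝ, (r : ℂ) = sn q i * sn q j :=
  ⟨_, sqrt_br_br hq0 hq1 i j hi hj rfl rfl⟩

theorem transpose_tD {f : ℤ → ℤ → ℤ → ℤ → ℂ} (h : ∀ a u b p, conj (f a u b p) = f a u b p) :
    (tD f).IsTranspose (tD f) :=
  ⟨neg_zero.symm, fun s x _ _ => by
    change f _ _ _ _ = conj (f _ _ _ _)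
    rw [h, show x + (tD f).d = x from add_zero x]⟩

theorem transpose_E₁ (hq0 : 0 < q) (hq1 : q < 1) :
    List.Forall₂ Sh.IsTranspose (uqTerms q (.E 0)) (uqTerms q (.F 0)) := by
  simp only [uqTerms, List.forall₂_cons, List.forall₂_nil_right_iff, and_true]
  refine transpose_tE (fun a u _ _ _ _ => exists_real_sn_mul hq0 hq1 (by omega) (by omega))
    (fun _ _ _ _ _ _ _ => ⟨1, by simp⟩) (fun a u => ?_) (fun _ _ _ => rfl) rfl rfl rfl rfl
  congr 2 <;> ring

theorem transpose_E₂ (hq0 : 0 < q) (hq1 : q < 1) :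
    List.Forall₂ Sh.IsTranspose (uqTerms q (.E 1)) (uqTerms q (.F 1)) := by
  simp only [uqTerms, List.forall₂_cons, List.forall₂_nil_right_iff, and_true]
  refine ⟨transpose_tE (fun a u _ _ _ _ => exists_real_sn_mul hq0 hq1 (by omega) (by omega))
      (fun a b p h h' _ _ => ⟨_, al_eq hq0 hq1 h h' (by omega)⟩) (fun a u => ?_)
      (by simp) rfl rfl rfl rfl,
    transpose_tE (fun a u _ _ _ _ => exists_real_sn_mul hq0 hq1 (by omega) (by omega))
      (fun a b p h h' h'' _ => ⟨_, bl_eq hq0 hq1 h h' h''⟩) (fun a u => ?_)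
      (by simp) rfl rfl rfl rfl,
    transpose_tE (fun a u _ _ _ _ => exists_real_sn_mul hq0 hq1 (by omega) (by omega))
      (fun a b p h h' h'' _ => ⟨_, cl_eq hq0 hq1 h h' h''⟩) (fun a u => ?_)
      (by simp) rfl rfl rfl rfl⟩ <;>
  congr 2 <;> ring

theorem transpose_uqTerms (hq0 : 0 < q) (hq1 : q < 1) (g : UqGen) :
    List.Forall₂ Sh.IsTranspose (uqTerms q g) (uqTerms q g.adj) := by
  have hsymm {ts ts' : List Sh} (h : List.Forall₂ Sh.IsTranspose ts ts') :
      List.Forall₂ Sh.IsTranspose ts' ts := h.flip.imp fun _ _ h => Sh.IsTranspose.symm h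
  induction g using UqGen.forall with
  | hE₁ => exact transpose_E₁ hq0 hq1
  | hE₂ => exact transpose_E₂ hq0 hq1
  | hF₁ => exact hsymm (transpose_E₁ hq0 hq1)
  | hF₂ => exact hsymm (transpose_E₂ hq0 hq1)
  | _ =>
    simp only [UqGen.adj, uqTerms, List.forall₂_cons, List.forall₂_nil_right_iff, and_true]
    exact transpose_tD fun a u b p => by simp [qhalf]

/-! ### Formal adjoints on the span of the basis -/

/-- The two operators on `M` are formally adjoint. -/
def IsAdj (A B : Module.End ℂ M) : Prop := ∀ v w : M, ⟪(A v : H), (w : H)⟫_ℂ = ⟪(v : H), (B w : H)⟫_ℂ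

theorem IsAdj.mul {A A' B B' : Module.End ℂ M} (hA : IsAdj A A') (hB : IsAdj B B') :
    IsAdj (A * B) (B' * A') := fun v w => (hA _ _).trans (hB _ _)

theorem IsAdj.add {A A' B B' : Module.End ℂ M} (hA : IsAdj A A') (hB : IsAdj B B') :
    IsAdj (A + B) (A' + B') := fun v w => by
  simp only [LinearMap.add_apply, Submodule.coe_add, inner_add_left, inner_add_right, hA v w, hB v w]

theorem IsAdj.smul {A A' : Module.End ℂ M} (c : ℂ) (hA : IsAdj A A') :
    IsAdj (c • A) (conj c • A') := fun v w => by
  simp only [LinearMap.smul_apply, Submodule.coe_smul, inner_smul_left, inner_smul_right, hA v w]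

/-- Testing against (B - C) w, which lies in M itself. Uniqueness makes the adjoint of any relation
on M a relation, although the operators need not be bounded. -/
theorem IsAdj.unique {A B C : Module.End ℂ M} (hB : IsAdj A B) (hC : IsAdj A C) : B = C := by
  ext1 w
  refine Subtype.ext (ext_inner_left ℂ fun v => ?_)
  have h : ∀ v : M, ⟪(v : H), (B w : H) - (C w : H)⟫_ℂ = 0 := fun v => by
    rw [inner_sub_right, ← hB, ← hC, sub_self]
  have := h (B w - C w)
  rw [Submodule.coe_sub, inner_self_eq_zero, sub_eq_zero] at this
  rw [this]

/-! ### The representation of the symmetry algebra -/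

/-- The operators on `M` that represent the generators. -/
def uqOp (q : ℝ) (g : UqGen) : Module.End ℂ M := compr (uqLat q g)

theorem isAdj_uqOp (hq0 : 0 < q) (hq1 : q < 1) (g : UqGen) : IsAdj (uqOp q g) (uqOp q g.adj) :=
  inner_compr (transpose_uqTerms hq0 hq1 g)

theorem pres_uqLat (q : ℝ) (g : UqGen) : Pres (uqLat q g) := pres_latSum (stay_uqTerms q g)

theorem uqOp_mul (q : ℝ) (g h : UqGen) : uqOp q g * uqOp q h = compr (uqLat q g * uqLat q h) :=
  (compr_mul _ (pres_uqLat q h)).symm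

theorem uqOp_mul₃ (q : ℝ) (g h k : UqGen) :
    uqOp q g * uqOp q h * uqOp q k = compr (uqLat q g * uqLat q h * uqLat q k) := by
  rw [uqOp_mul, uqOp, compr_mul _ (pres_uqLat q k)]

theorem uqOp_mul₄ (q : ℝ) (g h k l : UqGen) :
    uqOp q g * uqOp q h * uqOp q k * uqOp q l =
      compr (uqLat q g * uqLat q h * uqLat q k * uqLat q l) := by
  rw [uqOp_mul₃, uqOp, compr_mul _ (pres_uqLat q l)]

end

section

variable {q : ℝ}

theorem uqOp_relations_E (hq0 : 0 < q) (hq1 : q < 1) :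
    (∀ i, uqOp q (.E i) * uqOp q (.F i) - uqOp q (.F i) * uqOp q (.E i) =
      (qi q i - (qi q i)⁻¹)⁻¹ • (uqOp q (.K i) * uqOp q (.K i) -
        uqOp q (.Kinv i) * uqOp q (.Kinv i))) ∧
    (∀ i j, i ≠ j → uqOp q (.E i) * uqOp q (.F j) = uqOp q (.F j) * uqOp q (.E i)) ∧
    (∀ i, uqOp q (.K i) * uqOp q (.E i) * uqOp q (.Kinv i) = qi q i • uqOp q (.E i)) ∧
    ∀ i j, i ≠ j → uqOp q (.K i) * uqOp q (.E j) * uqOp q (.Kinv i) =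
      (q : ℂ)⁻¹ • uqOp q (.E j) := by
  have e12 : uqOp q (.E 0) * uqOp q (.F 1) = uqOp q (.F 1) * uqOp q (.E 0) := by
    simp only [uqOp_mul, uqLat_E₁, uqLat_F₂, Y1_mul_Y2s hq0 hq1]
  -- The adjoint of the relation just proved.
  have e21 : uqOp q (.E 1) * uqOp q (.F 0) = uqOp q (.F 0) * uqOp q (.E 1) := by
    have h1 := (isAdj_uqOp hq0 hq1 (.E 0)).mul (isAdj_uqOp hq0 hq1 (.F 1))
    rw [e12] at h1
    exact h1.unique ((isAdj_uqOp hq0 hq1 (.F 1)).mul (isAdj_uqOp hq0 hq1 (.E 0)))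
  refine ⟨Fin.forall_fin_two.2 ⟨?_, ?_⟩, ?_, Fin.forall_fin_two.2 ⟨?_, ?_⟩, ?_⟩
  · simp only [uqOp_mul, uqLat_E₁, uqLat_F₁, uqLat_K₁, uqLat_Kinv₁, Y1_mul_Y1s hq0 hq1, compr_add,
      compr_smul, add_sub_cancel_left, qi, Fin.val_zero, zero_add, pow_one]
    module
  · simp only [uqOp_mul, uqLat_E₂, uqLat_F₂, uqLat_K₂, uqLat_Kinv₂, Y2_mul_Y2s hq0 hq1, compr_add,
      compr_smul, add_sub_cancel_left, qi, Fin.val_one, one_add_one_eq_two]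
    module
  · intro i j h
    rcases (by omega : i = 0 ∧ j = 1 ∨ i = 1 ∧ j = 0) with ⟨rfl, rfl⟩ | ⟨rfl, rfl⟩
    exacts [e12, e21]
  · rw [uqOp_mul₃, uqLat_E₁, uqLat_K₁, uqLat_Kinv₁, Z1_Y1 hq0 hq1, compr_smul, ← uqLat_E₁]
    simp only [qi, uqOp, Fin.val_zero, Fin.val_one, zero_add, pow_one, one_add_one_eq_two]
  · rw [uqOp_mul₃, uqLat_E₂, uqLat_K₂, uqLat_Kinv₂, Z2_Y2 hq0 hq1, compr_smul, ← uqLat_E₂]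
    simp only [qi, uqOp, Fin.val_zero, Fin.val_one, zero_add, pow_one, one_add_one_eq_two]
  · intro i j h
    rcases (by omega : i = 0 ∧ j = 1 ∨ i = 1 ∧ j = 0) with ⟨rfl, rfl⟩ | ⟨rfl, rfl⟩
    · rw [uqOp_mul₃, uqLat_E₂, uqLat_K₁, uqLat_Kinv₁, Z1_Y2 hq0 hq1, compr_smul, ← uqLat_E₂, uqOp]
    · rw [uqOp_mul₃, uqLat_E₁, uqLat_K₂, uqLat_Kinv₂, Z2_Y1 hq0 hq1, compr_smul, ← uqLat_E₁, uqOp]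

theorem IsAdj.congr {A A' B B' : Module.End ℂ M} (hA : IsAdj A A') (hB : IsAdj B B') (h : A = B) :
    A' = B' := hA.unique (h ▸ hB)

theorem uqOp_relations (hq0 : 0 < q) (hq1 : q < 1) ⦃a b : FreeAlgebra ℂ UqGen⦄
    (h : UqRel q a b) :
    FreeAlgebra.lift ℂ (uqOp q) a = FreeAlgebra.lift ℂ (uqOp q) b := by
  obtain ⟨hEF, hEF', hKE, hKE'⟩ := uqOp_relations_E hq0 hq1
  have adj := isAdj_uqOp hq0 hq1
  have cK : uqOp q (.K 0) * uqOp q (.K 1) = uqOp q (.K 1) * uqOp q (.K 0) := by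
    simp only [uqOp_mul, uqLat_K₁, uqLat_K₂, Z1_mul_Z2 hq0 hq1]
  have hKK : ∀ i, uqOp q (.K i) * uqOp q (.Kinv i) = 1 := by
    refine Fin.forall_fin_two.2 ⟨?_, ?_⟩
    · simp only [uqOp_mul, uqLat_K₁, uqLat_Kinv₁, Z1_mul_Z1' hq0 hq1, compr_one]
    · simp only [uqOp_mul, uqLat_K₂, uqLat_Kinv₂, Z2_mul_Z2' hq0 hq1, compr_one]
  have hKK' : ∀ i, uqOp q (.Kinv i) * uqOp q (.K i) = 1 := by
    refine Fin.forall_fin_two.2 ⟨?_, ?_⟩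
    · simp only [uqOp_mul, uqLat_K₁, uqLat_Kinv₁, Z1'_mul_Z1 hq0 hq1, compr_one]
    · simp only [uqOp_mul, uqLat_K₂, uqLat_Kinv₂, Z2'_mul_Z2 hq0 hq1, compr_one]
  have s1 : uqOp q (.E 0) * uqOp q (.E 1) * uqOp q (.E 1) +
      uqOp q (.E 1) * uqOp q (.E 1) * uqOp q (.E 0) =
      ((q : ℂ) ^ 2 + ((q : ℂ) ^ 2)⁻¹) • (uqOp q (.E 1) * uqOp q (.E 0) * uqOp q (.E 1)) := by
    simp only [uqOp_mul₃, uqLat_E₁, uqLat_E₂, ← compr_add, ← compr_smul, Y_serre₁ hq0 hq1]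
  have s2 : uqOp q (.E 0) * uqOp q (.E 0) * uqOp q (.E 0) * uqOp q (.E 1) +
      ((q : ℂ) ^ 2 + 1 + ((q : ℂ) ^ 2)⁻¹) •
        (uqOp q (.E 0) * uqOp q (.E 1) * uqOp q (.E 0) * uqOp q (.E 0)) =
      uqOp q (.E 1) * uqOp q (.E 0) * uqOp q (.E 0) * uqOp q (.E 0) +
      ((q : ℂ) ^ 2 + 1 + ((q : ℂ) ^ 2)⁻¹) •
        (uqOp q (.E 0) * uqOp q (.E 0) * uqOp q (.E 1) * uqOp q (.E 0)) := by
    simp only [uqOp_mul₄, uqLat_E₁, uqLat_E₂, ← compr_add, ← compr_smul, Y_serre₂ hq0 hq1]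
  have conj_pow : conj ((q : ℂ) ^ 2 + ((q : ℂ) ^ 2)⁻¹) = (q : ℂ) ^ 2 + ((q : ℂ) ^ 2)⁻¹ := by simp
  have conj_pow' : conj ((q : ℂ) ^ 2 + 1 + ((q : ℂ) ^ 2)⁻¹) =
      (q : ℂ) ^ 2 + 1 + ((q : ℂ) ^ 2)⁻¹ := by simp
  cases h with
  | K_comm => simpa only [map_mul, FreeAlgebra.lift_ι_apply] using cK
  | K_mul_inv i => simpa only [map_mul, map_one, FreeAlgebra.lift_ι_apply] using hKK i
  | K_inv_mul i => simpa only [map_mul, map_one, FreeAlgebra.lift_ι_apply] using hKK' i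
  | EF i => simpa only [map_mul, map_sub, map_smul, FreeAlgebra.lift_ι_apply] using hEF i
  | EF_comm i j hij => simpa only [map_mul, FreeAlgebra.lift_ι_apply] using hEF' i j hij
  | KE i => simpa only [map_mul, map_smul, FreeAlgebra.lift_ι_apply] using hKE i
  | KE' i j hij => simpa only [map_mul, map_smul, FreeAlgebra.lift_ι_apply] using hKE' i j hij
  -- From here on the relations for the F's are adjoints of those for the E's. The structure
  -- constants are real, so conjugation leaves them unchanged.
  | KF i =>
    have := (((adj (.K i)).mul (adj (.E i))).mul (adj (.Kinv i))).congr ((adj (.E i)).smul _) (hKE i)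
    simpa only [map_mul, map_smul, FreeAlgebra.lift_ι_apply, UqGen.adj, ← mul_assoc,
      Uq.conj_qi] using this
  | KF' i j hij =>
    have := (((adj (.K i)).mul (adj (.E j))).mul (adj (.Kinv i))).congr ((adj (.E j)).smul _)
      (hKE' i j hij)
    simpa only [map_mul, map_smul, FreeAlgebra.lift_ι_apply, UqGen.adj, ← mul_assoc,
      map_inv₀, Complex.conj_ofReal] using this
  | serre_E₁ =>
    simpa only [serre₁, map_mul, map_smul, map_add, FreeAlgebra.lift_ι_apply] using s1
  | serre_E₂ =>
    simp only [serre₂, map_mul, map_smul, map_sub, FreeAlgebra.lift_ι_apply, smul_sub]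
    rw [sub_eq_sub_iff_add_eq_add, s2, add_comm]
  | serre_F₁ =>
    have := ((((adj (.E 0)).mul (adj (.E 1))).mul (adj (.E 1))).add
      (((adj (.E 1)).mul (adj (.E 1))).mul (adj (.E 0)))).congr
      ((((adj (.E 1)).mul (adj (.E 0))).mul (adj (.E 1))).smul _) s1
    simp only [UqGen.adj, ← mul_assoc, conj_pow] at this
    simp only [serre₁, map_mul, map_smul, map_add, FreeAlgebra.lift_ι_apply]
    rw [← this, add_comm]
  | serre_F₂ =>
    have := (((((adj (.E 0)).mul (adj (.E 0))).mul (adj (.E 0))).mul (adj (.E 1))).add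
      (((((adj (.E 0)).mul (adj (.E 1))).mul (adj (.E 0))).mul (adj (.E 0))).smul _)).congr
      (((((adj (.E 1)).mul (adj (.E 0))).mul (adj (.E 0))).mul (adj (.E 0))).add
      (((((adj (.E 0)).mul (adj (.E 0))).mul (adj (.E 1))).mul (adj (.E 0))).smul _)) s2
    simp only [UqGen.adj, ← mul_assoc, conj_pow'] at this
    simp only [serre₂, map_mul, map_smul, map_sub, FreeAlgebra.lift_ι_apply, smul_sub]
    rw [sub_eq_sub_iff_add_eq_add, ← this, add_comm]

/-- The representation of `U_q(so(5))`. -/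
def uqRep (hq0 : 0 < q) (hq1 : q < 1) : Uq q →ₐ[ℂ] Module.End ℂ M :=
  RingQuot.liftAlgHom ℂ ⟨FreeAlgebra.lift ℂ (uqOp q), uqOp_relations hq0 hq1⟩

theorem uqRep_mk (hq0 : 0 < q) (hq1 : q < 1) (a : FreeAlgebra ℂ UqGen) :
    uqRep hq0 hq1 (Uq.mk q a) = FreeAlgebra.lift ℂ (uqOp q) a :=
  RingQuot.liftAlgHom_mkAlgHom_apply ℂ _ (uqOp_relations hq0 hq1) a

theorem uqRep_ι (hq0 : 0 < q) (hq1 : q < 1) (g : UqGen) :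
    uqRep hq0 hq1 (Uq.mk q (FreeAlgebra.ι ℂ g)) = uqOp q g := by
  rw [uqRep_mk, FreeAlgebra.lift_ι_apply]

theorem isAdj_uqRep (hq0 : 0 < q) (hq1 : q < 1) (h : Uq q) :
    IsAdj (uqRep hq0 hq1 h) (uqRep hq0 hq1 (star h)) := by
  obtain ⟨h, rfl⟩ := Uq.mk_surjective q h
  induction h using FreeAlgebra.induction with
  | grade0 c =>
    rw [AlgHom.commutes, Algebra.algebraMap_eq_smul_one, star_smul, star_one, map_smul, map_smul,
      map_one]
    exact IsAdj.smul c fun _ _ => rfl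
  | grade1 g =>
    rw [Uq.star_mk_ι, uqRep_ι, uqRep_ι]
    exact isAdj_uqOp hq0 hq1 g
  | mul a b ha hb => 
    rw [map_mul, star_mul, map_mul, map_mul]
    exact ha.mul hb
  | add a b ha hb =>
    rw [map_add, star_add, map_add, map_add]
    exact ha.add hb

theorem uqRep_mket (hq0 : 0 < q) (hq1 : q < 1) (g : UqGen) (s : ℤˣ) {l m₁ m₂ j : ℝ} {x : Pt}
    (hx : x.Adm) (hl : l = x.a + x.b + 1 / 2) (hm₁ : m₁ = x.u - x.a - 1 / 2)
    (hm₂ : m₂ = x.p - x.b - 1 / 2) (hj : j = x.a + 1 / 2) :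
    (uqRep hq0 hq1 (Uq.mk q (FreeAlgebra.ι ℂ g)) (mket s l m₁ m₂ j) : H) =
      ((uqTerms q g).map fun t => t.f s x • kt s (x + t.d)).sum := by
  subst hl hm₁ hm₂ hj
  rw [uqRep_ι, uqOp, uqLat]
  refine (congrArg (M.subtype) (compr_latSum _ _ hx)).trans ?_
  rw [map_list_sum, List.map_map]
  rfl

theorem isSpinorAction_uqRep (hq0 : 0 < q) (hq1 : q < 1) :
    IsSpinorAction q (uqRep hq0 hq1) where
  star_rep := isAdj_uqRep hq0 hq1
  K₁ s l m₁ m₂ j h := by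
    obtain ⟨x, hx, hl, hm₁, hm₂, hj⟩ := h.exists_pt
    rw [Uq.K, uqRep_mket hq0 hq1 _ _ hx hl hm₁ hm₂ hj]
    simp only [uqTerms, List.map_cons, List.map_nil, List.sum_cons, List.sum_nil, add_zero, tD]
    refine (smul_ket_eq x (fun _ => ?_) hl hm₁ hm₂ hj).symm
    rw [qhalf, hm₁, eq_comm, ← Complex.ofReal_zpow, ← Complex.ofReal_mul, ← Real.rpow_intCast,
      ← Real.rpow_add hq0]
    congr 2
    push_cast
    ring
  K₂ s l m₁ m₂ j h := by
    obtain ⟨x, hx, hl, hm₁, hm₂, hj⟩ := h.exists_pt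
    rw [Uq.K, uqRep_mket hq0 hq1 _ _ hx hl hm₁ hm₂ hj]
    simp only [uqTerms, List.map_cons, List.map_nil, List.sum_cons, List.sum_nil, add_zero, tD]
    refine (smul_ket_eq x (fun _ => ?_) hl hm₁ hm₂ hj).symm
    rw [hm₁, hm₂, eq_comm, ← Complex.ofReal_zpow, ← Real.rpow_intCast]
    congr 2
    push_cast
    ring
  E₁ s l m₁ m₂ j h := by
    obtain ⟨⟨a, u, b, p⟩, hx, hl, hm₁, hm₂, hj⟩ := h.exists_pt
    rw [Uq.E, uqRep_mket hq0 hq1 _ _ hx hl hm₁ hm₂ hj]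
    obtain ⟨h1, h2, h3, h4⟩ := hx
    simp only [uqTerms, List.map_cons, List.map_nil, List.sum_cons, List.sum_nil, add_zero, tE, mul_one,
      Pt.add_def] at *
    refine (smul_ket_eq _ (fun _ => ?_) ?_ ?_ ?_ ?_).symm
    · exact sqrt_br_br hq0 hq1 (2 * a + 1 - u) (u + 1) (by omega) (by omega)
        (by rw [hj, hm₁]; push_cast; ring) (by rw [hj, hm₁]; push_cast; ring)
    · exact hl
    · rw [hm₁]
      push_cast
      ring
    · exact hm₂
    · exact hj
  E₂ s l m₁ m₂ j h := by
    obtain ⟨⟨a, u, b, p⟩, hx, hl, hm₁, hm₂, hj⟩ := h.exists_pt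
    rw [Uq.E, uqRep_mket hq0 hq1 _ _ hx hl hm₁ hm₂ hj]
    obtain ⟨h1, h2, h3, h4⟩ := hx
    dsimp only at *
    simp only [uqTerms, List.map_cons, List.map_nil, List.sum_cons, List.sum_nil, add_zero, tE,
      Pt.add_def]
    rw [← add_assoc]
    refine (congrArg₂ (· + ·) (congrArg₂ (· + ·) ?_ ?_) ?_).symm
    · refine smul_ket_eq _ (fun hy => ?_) ?_ ?_ ?_ ?_
      · have := hy.2.2.2
        dsimp only at this
        rw [Complex.ofReal_mul, al_link hq0 hq1 a b p (by omega) h3 (by omega) hl hj hm₂,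
          sqrt_br_br hq0 hq1 (2 * a + 2 - u) (2 * a + 3 - u) (by omega) (by omega)
            (by rw [hj, hm₁]; push_cast; ring) (by rw [hj, hm₁]; push_cast; ring)]
      all_goals
        simp only [hl, hm₁, hm₂, hj]
        push_cast
        ring
    · refine smul_ket_eq _ (fun hy => ?_) ?_ ?_ ?_ ?_
      · rw [Complex.ofReal_mul, bl_link hq0 hq1 a b p (by omega) h3 h4 hl hj hm₂,
          sqrt_br_br hq0 hq1 u (2 * a + 2 - u) (by omega) (by omega)
            (by rw [hj, hm₁]; push_cast; ring) (by rw [hj, hm₁]; push_cast; ring)]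
      · exact hl
      · rw [hm₁]
        push_cast
        ring
      · rw [hm₂]
        push_cast
        ring
      · exact hj
    · refine smul_ket_eq _ (fun hy => ?_) ?_ ?_ ?_ ?_
      · have := hy.1
        dsimp only at this
        rw [Complex.ofReal_mul, cl_link hq0 hq1 a b p (by omega) h3 h4 hl hj hm₂,
          sqrt_br_br hq0 hq1 u (u - 1) (by omega) (by omega)
            (by rw [hj, hm₁]; push_cast; ring) (by rw [hj, hm₁]; push_cast; ring)]
      all_goals
        simp only [hl, hm₁, hm₂, hj]
        push_cast
        ring

end

/-! ### Diagonal operators -/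

theorem kt_mem_M (s : ℤˣ) (x : Pt) : kt s x ∈ M := (mkt s x).2

theorem hasSum_kt (v : H) : HasSum (fun i : Label => v i • kt i.s i.pt) v := by
  classical
  refine (lp.hasSum_single (by simp) v).congr_fun fun i => ?_
  rw [kt_label, ← lp.single_smul, smul_eq_mul, mul_one]

theorem dense_M : Dense (M : Set H) := fun v =>
  mem_closure_of_tendsto (hasSum_kt v) <| Filter.Eventually.of_forall fun s =>
    M.sum_mem fun i _ => M.smul_mem _ (kt_mem_M _ _)

theorem mem_graph_diag (w : Label → ℝ) (f g : H) :
    (f, g) ∈ (weightedPerm w (Equiv.refl _)).graph ↔ ∀ i, g i = w i * f i := by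
  rw [LinearPMap.mem_graph_iff]
  constructor
  · rintro ⟨v, rfl, rfl⟩ i
    exact weightedPerm_apply w _ v i
  · intro h
    exact ⟨⟨f, (mem_weightedPerm _ _ _).2 ⟨g, h⟩⟩, rfl, lp.ext (funext fun i => (h i).symm)⟩

section

variable {w : Label → ℝ} {P : M →ₗ[ℂ] H}

theorem graph_mk_le (hP : ∀ v i, P v i = w i * (v : H) i) :
    (LinearPMap.mk M P).graph ≤ (weightedPerm w (Equiv.refl _)).graph := by
  rintro ⟨f, g⟩ h
  obtain ⟨v, rfl, rfl⟩ := (LinearPMap.mem_graph_iff _).1 h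
  exact (mem_graph_diag _ _ _).2 (hP v)

/-- M is a core of the maximal diagonal operator: the finite partial sums of the expansions of f and
of its image converge simultaneously, hence in the graph. -/
theorem graph_diag_le (hP : ∀ v i, P v i = w i * (v : H) i) {f g : H}
    (h : (f, g) ∈ (weightedPerm w (Equiv.refl _)).graph) :
    (f, g) ∈ (LinearPMap.mk M P).graph.topologicalClosure := by
  rw [mem_graph_diag] at h
  refine mem_closure_of_tendsto ((hasSum_kt f).prodMk (hasSum_kt g)) <|
    Filter.Eventually.of_forall fun s => Submodule.sum_mem _ fun i _ =>
      (LinearPMap.mem_graph_iff _).2 ⟨f i • mkt i.s i.pt, rfl, ?_⟩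
  refine (map_smul P _ _).trans ?_
  ext k
  rw [lp.coeFn_smul, lp.coeFn_smul, Pi.smul_apply, Pi.smul_apply, hP, h, coe_mkt, kt_apply]
  by_cases hk : k.s = i.s ∧ k.pt = i.pt
  · rw [Label.ext_pt hk.1 hk.2]
    simp [mul_comm]
  · simp [hk]

theorem dense_domain_diag (w : Label → ℝ) :
    Dense ((weightedPerm w (Equiv.refl _)).domain : Set H) := by
  refine dense_M.mono fun v hv => ?_
  induction hv using Submodule.span_induction with
  | mem v hv =>
    obtain ⟨s, l, m₁, m₂, j, rfl⟩ := hv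
    by_cases h : Admissible l m₁ m₂ j
    · obtain ⟨x, hx, h1, h2, h3, h4⟩ := h.exists_pt
      rw [ket_eq_kt x h1 h2 h3 h4]
      refine (mem_weightedPerm _ _ _).2 ⟨(w (x.label s hx) : ℂ) • kt s x, fun i => ?_⟩
      rw [lp.coeFn_smul, Pi.smul_apply, Equiv.refl_symm, Equiv.refl_apply, kt_apply]
      split_ifs with hi
      · rw [show i = x.label s hx from Label.ext_pt hi.1 (hi.2.trans (x.pt_label s hx).symm),
          smul_eq_mul]
      · simp
    · rw [ket, dif_neg h]
      exact Submodule.zero_mem _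
  | zero => exact Submodule.zero_mem _
  | add v w _ _ hv hw => exact Submodule.add_mem _ hv hw
  | smul c v _ hv => exact Submodule.smul_mem _ c hv

/-- Pairing with basis vectors forces an element of the adjoint graph to have coordinates w(i) f(i),
so on its maximal domain a real diagonal operator equals its adjoint. -/
theorem isSelfAdjoint_diag (w : Label → ℝ) : IsSelfAdjoint (weightedPerm w (Equiv.refl _)) := by
  rw [LinearPMap.isSelfAdjoint_def]
  refine LinearPMap.eq_of_eq_graph ?_
  rw [LinearPMap.adjoint_graph_eq_graph_adjoint (dense_domain_diag w)]
  ext ⟨f, g⟩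
  rw [Submodule.mem_adjoint_iff, mem_graph_diag]
  constructor
  · intro h i
    have h1 := h (kt i.s i.pt) ((w i : ℂ) • kt i.s i.pt) ((mem_graph_diag _ _ _).2 fun k => by
      rw [lp.coeFn_smul, Pi.smul_apply, kt_apply]
      split_ifs with hk
      · rw [Label.ext_pt hk.1 hk.2, smul_eq_mul]
      · simp)
    rw [inner_smul_left, inner_kt_left _ _ i.pt_adm, inner_kt_left _ _ i.pt_adm, i.label_pt,
      Complex.conj_ofReal] at h1
    exact (sub_eq_zero.1 h1).symm
  · intro h a b hab
    rw [mem_graph_diag] at hab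
    rw [lp.inner_eq_tsum, lp.inner_eq_tsum, sub_eq_zero]
    refine tsum_congr fun i => ?_
    simp only [hab, h, RCLike.inner_apply, map_mul, Complex.conj_ofReal]
    ring

theorem isSelfAdjoint_closure_mk (hP : ∀ v i, P v i = w i * (v : H) i) :
    IsSelfAdjoint (LinearPMap.mk M P).closure := by
  have hw := isSelfAdjoint_diag w
  have hle := LinearPMap.le_of_le_graph (graph_mk_le hP)
  have hc := hw.isClosed.isClosable.leIsClosable hle
  have e : (LinearPMap.mk M P).closure = weightedPerm w (Equiv.refl _) := by
    refine LinearPMap.eq_of_eq_graph ?_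
    rw [← hc.graph_closure_eq_closure_graph]
    exact le_antisymm (Submodule.topologicalClosure_minimal _ (graph_mk_le hP) hw.isClosed)
      fun x hx => graph_diag_le hP hx
  rwa [e]

theorem inner_diag_nonneg (hw : ∀ i, 0 ≤ w i) (hP : ∀ v i, P v i = w i * (v : H) i) (v : M) :
    0 ≤ (⟪(v : H), P v⟫_ℂ).re := by
  refine (Complex.hasSum_re (lp.hasSum_inner (v : H) (P v))).nonneg fun i => ?_
  rw [hP, RCLike.inner_apply, mul_assoc, Complex.mul_conj, ← Complex.ofReal_mul, Complex.ofReal_re]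
  exact mul_nonneg (hw i) (Complex.normSq_nonneg _)

theorem denseRange_diag (hw : ∀ i, w i ≠ 0) (hP : ∀ v i, P v i = w i * (v : H) i) :
    DenseRange P := by
  refine dense_M.mono fun v hv => ?_
  change v ∈ LinearMap.range P
  rw [← M_eq_span] at hv
  refine Submodule.span_le.2 ?_ hv
  rintro _ ⟨i, rfl⟩
  refine ⟨(w i : ℂ)⁻¹ • mkt i.s i.pt, ?_⟩
  ext k
  rw [hP, Submodule.coe_smul, coe_mkt, lp.coeFn_smul, Pi.smul_apply, kt_apply]
  split_ifs with hk
  · rw [Label.ext_pt hk.1 hk.2, smul_eq_mul, mul_one, mul_inv_cancel₀]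
    exact_mod_cast hw i
  · simp

end

/-! ### The real structure, the grading and the Dirac operator -/

theorem J_apply (v : H) (i : Label) : J v i =
    phase i.l (-i.m₁) i.j * conj (v (Label.neg i)) := rfl

theorem J_γ (v : H) : J (γ v) = γ (J v) := by
  ext i
  rw [J_apply, γ, phasePerm_apply, phasePerm_apply, J_apply]
  simp only [map_mul, map_intCast, Equiv.refl_symm, Equiv.refl_apply]
  exact mul_left_comm _ _ _

theorem J_D_apply (v : D.domain) (i : Label) :
    J (D v) i = ((i.l + 3 / 2 : ℝ) : ℂ) * J (v : H) (Label.flip i) := by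
  rw [J_apply, D_apply, J_apply, map_mul, Complex.conj_ofReal]
  exact mul_left_comm _ _ _

theorem J_mem_D_domain {v : H} (hv : v ∈ D.domain) : J v ∈ D.domain :=
  (mem_weightedPerm _ _ _).2 ⟨J (D ⟨v, hv⟩), J_D_apply ⟨v, hv⟩⟩

theorem J_mem_D_domain_iff (v : H) : J v ∈ D.domain ↔ v ∈ D.domain := by
  refine ⟨fun h => ?_, J_mem_D_domain⟩
  have h1 := D.domain.neg_mem (J_mem_D_domain h)
  rwa [J_J, neg_neg] at h1

theorem J_D (v : D.domain) (h : J v ∈ D.domain) : J (D v) = D ⟨J v, h⟩ := by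
  ext i
  rw [J_D_apply, D_apply]

/-! ### The equivariant antilinear operator -/

section

variable {q : ℝ}

/-- The exponent `m₁ + 3 * m₂` in coordinates. -/
def Pt.wt (x : Pt) : ℤ := x.u - x.a + 3 * (x.p - x.b) - 2

/-- The diagonal operator `q ^ (m₁ + 3 * m₂)` on `M`. -/
def absT (q : ℝ) : Module.End ℂ M :=
  compr (latSum [tD fun a u b p => (q : ℂ) ^ Pt.wt ⟨a, u, b, p⟩])

theorem absT_mkt (q : ℝ) (s : ℤˣ) {x : Pt} (hx : x.Adm) :
    absT q (mkt s x) = (q : ℂ) ^ x.wt • mkt s x := by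
  rw [absT, compr_latSum _ _ hx]
  simp [tD]

theorem J_mem_M (v : M) : J (v : H) ∈ M := by
  induction v using M_induction with
  | h s x hx =>
    rw [coe_mkt, J_kt]
    exact M.smul_mem _ (kt_mem_M _ _)
  | h_add v w hv hw =>
    rw [Submodule.coe_add, map_add]
    exact M.add_mem hv hw
  | h_smul c v hv =>
    rw [Submodule.coe_smul, J_smul]
    exact M.smul_mem _ hv
  | h0 => simp

/-- The equivariant antilinear operator. -/
def antiT (q : ℝ) : M →ₛₗ[starRingEnd ℂ] M where
  toFun v := ⟨J (absT q v : H), J_mem_M _⟩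
  map_add' v w := Subtype.ext (by simp)
  map_smul' c v := Subtype.ext (by
    change J (absT q (c • v) : H) = conj c • J (absT q v : H)
    rw [map_smul, Submodule.coe_smul, J_smul])

theorem coe_antiT (q : ℝ) (v : M) : (antiT q v : H) = J (absT q v : H) := rfl

theorem antiT_smul (q : ℝ) (c : ℂ) (v : M) : antiT q (c • v) = conj c • antiT q v :=
  (antiT q).map_smulₛₗ c v

theorem antiT_mkt (q : ℝ) (s : ℤˣ) {x : Pt} (hx : x.Adm) :
    antiT q (mkt s x) = (x.ph * (q : ℂ) ^ x.wt) • mkt s x.refl := by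
  refine Subtype.ext ?_
  rw [coe_antiT, absT_mkt q s hx, Submodule.coe_smul, J_smul, coe_mkt, J_kt, smul_smul, map_zpow₀,
    Complex.conj_ofReal, mul_comm, Submodule.coe_smul, coe_mkt]

/-- The exponent m₁ + 3m₂ is odd under the reflection, so the positive weights cancel and only J² =
-1 remains. -/
theorem antiT_antiT (hq0 : 0 < q) (v : M) : antiT q (antiT q v) = -v := by
  induction v using M_induction with
  | h s x hx =>
    rw [antiT_mkt q s hx, antiT_smul, antiT_mkt q s (Pt.adm_refl.2 hx), smul_smul, Pt.refl_refl,
      ← neg_one_smul ℂ (mkt s x)]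
    congr 1
    have h : (q : ℂ) ^ x.wt * (q : ℂ) ^ x.refl.wt = 1 := by
      rw [← zpow_add₀ (by exact_mod_cast hq0.ne')]
      have : x.wt + x.refl.wt = 0 := by
        simp only [Pt.wt, Pt.refl]
        ring
      rw [this, zpow_zero]
    rw [map_mul, map_zpow₀, Complex.conj_ofReal, x.conj_ph, mul_mul_mul_comm, h, mul_one,
      x.ph_mul_ph_refl]
  | h_add v w hv hw => rw [map_add, map_add, hv, hw, neg_add]
  | h_smul c v hv => rw [antiT_smul, antiT_smul, hv, Complex.conj_conj, smul_neg]
  | h0 => rw [map_zero, map_zero, neg_zero]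

theorem antiT_absT (q : ℝ) : ∀ v i, (M.subtype ∘ₗ absT q) v i =
    ((q ^ i.pt.wt : ℝ) : ℂ) * (v : H) i := by
  intro v i
  induction v using M_induction with
  | h s x hx =>
    change (absT q (mkt s x) : H) i = _
    rw [absT_mkt q s hx, Submodule.coe_smul, lp.coeFn_smul, Pi.smul_apply, coe_mkt, kt_apply]
    split_ifs with h
    · rw [h.2, Complex.ofReal_zpow, smul_eq_mul]
    · simp
  | h_add v w hv hw =>
    rw [map_add, lp.coeFn_add, Pi.add_apply, hv, hw, Submodule.coe_add, lp.coeFn_add, Pi.add_apply,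
      mul_add]
  | h_smul c v hv =>
    rw [map_smul, lp.coeFn_smul, Pi.smul_apply, hv, Submodule.coe_smul, lp.coeFn_smul, Pi.smul_apply,
      smul_eq_mul, smul_eq_mul, mul_left_comm]
  | h0 =>
    rw [map_zero, Submodule.coe_zero, lp.coeFn_zero, Pi.zero_apply, mul_zero]

theorem isAntiunitaryPart_J (hq0 : 0 < q) : IsAntiunitaryPart J (antiT q) :=
  ⟨M.subtype ∘ₗ absT q, inner_diag_nonneg (fun _ => (zpow_pos hq0 _).le) (antiT_absT q),
    isSelfAdjoint_closure_mk (antiT_absT q),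
    denseRange_diag (fun _ => (zpow_pos hq0 _).ne') (antiT_absT q), coe_antiT q⟩

theorem antiT_mket (q : ℝ) (s : ℤˣ) (l m₁ m₂ j : ℝ) (h : Admissible l m₁ m₂ j) :
    (antiT q (mket s l m₁ m₂ j) : H) =
      (phase l m₁ j * (q ^ (m₁ + 3 * m₂) : ℝ)) • ket s l (-m₁) (-m₂) j := by
  obtain ⟨x, hx, hl, hm₁, hm₂, hj⟩ := h.exists_pt
  have e : mket s l m₁ m₂ j = mkt s x := Subtype.ext (ket_eq_kt x hl hm₁ hm₂ hj)
  have e' : m₁ + 3 * m₂ = x.wt := by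
    rw [hm₁, hm₂, Pt.wt]
    push_cast
    ring
  have e'' : ket s l (-m₁) (-m₂) j = kt s x.refl := by
    refine ket_eq_kt _ hl ?_ ?_ hj
    · rw [hm₁, Pt.refl]
      push_cast
      ring
    · rw [hm₂, Pt.refl]
      push_cast
      ring
  rw [e, antiT_mkt q s hx, Submodule.coe_smul, coe_mkt, phase_eq x hl hm₁ hj, e', Real.rpow_intCast,
    Complex.ofReal_zpow, e'']

/-- Conjugation by the antilinear operator turns the shift `t` into a multiple of `t'`. -/
def Sh.IsReflection (q : ℝ) (c : ℂ) (t t' : Sh) : Prop :=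
  t'.d = t.d.lref ∧ ∀ s x, Pt.Adm x → (x + t.d).Adm →
    conj (t.f s x) * ((-1) ^ (t.d.a + t.d.b + t.d.u) *
      (q : ℂ) ^ (t.d.u - t.d.a + 3 * (t.d.p - t.d.b))) = c * t'.f s x.refl

/-- The phase and the weight at x + d differ from those at x by factors depending only on d, so
carrying T across a shift costs a constant and reflects the shift. If the target is not a label,
neither is its reflection, and both sides vanish. -/
theorem antiT_shift (hq0 : 0 < q) {c : ℂ} {t t' : Sh} (h : t.IsReflection q c t') (s : ℤˣ) {x : Pt}
    (hx : x.Adm) : antiT q (t.f s x • mkt s (x + t.d)) =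
      c • (x.ph * (q : ℂ) ^ x.wt) • t'.f s x.refl • mkt s (x.refl + t'.d) := by
  have hq : (q : ℂ) ≠ 0 := by exact_mod_cast hq0.ne'
  by_cases hd : (x + t.d).Adm
  · rw [antiT_smul, antiT_mkt q s hd, Pt.refl_add, h.1, smul_smul, smul_smul, smul_smul]
    congr 1
    have h1 : (x + t.d).ph = x.ph * (-1) ^ (t.d.a + t.d.b + t.d.u) := by
      rw [Pt.ph, Pt.ph, ← zpow_add₀ (by norm_num)]
      congr 1
      simp only [Pt.add_def]
      ring
    have h2 : (q : ℂ) ^ (x + t.d).wt =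
        (q : ℂ) ^ x.wt * (q : ℂ) ^ (t.d.u - t.d.a + 3 * (t.d.p - t.d.b)) := by
      rw [← zpow_add₀ hq]
      congr 1
      simp only [Pt.add_def, Pt.wt]
      ring
    have h3 := h.2 s x hx hd
    rw [h1, h2]
    linear_combination (x.ph * (q : ℂ) ^ x.wt) * h3
  · have hd' : ¬(x.refl + t'.d).Adm := by rwa [h.1, ← Pt.refl_add, Pt.adm_refl]
    rw [mkt_eq_zero hd, mkt_eq_zero hd', smul_zero, smul_zero, smul_zero, smul_zero, map_zero]

theorem antiT_compr (hq0 : 0 < q) {c : ℂ} {ts ts' : List Sh}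
    (h : List.Forall₂ (Sh.IsReflection q c) ts ts') (v : M) :
    antiT q (compr (latSum ts) v) = c • compr (latSum ts') (antiT q v) := by
  induction v using M_induction with
  | h s x hx =>
    rw [compr_latSum _ _ hx, antiT_mkt q s hx, map_smul, compr_latSum _ _ (Pt.adm_refl.2 hx)]
    induction h with
    | nil =>
      rw [List.map_nil, List.map_nil, List.sum_nil, smul_zero, smul_zero, map_zero]
    | @cons t t' ts ts' h _ ih =>
      rw [List.map_cons, List.sum_cons, List.map_cons, List.sum_cons]
      refine (map_add (antiT q) _ _).trans
        ((congrArg₂ (· + ·) (antiT_shift hq0 h s hx) ih).trans ?_)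
      rw [← smul_add, ← smul_add]
  | h_add v w hv hw => rw [map_add, map_add, map_add, map_add, hv, hw, smul_add]
  | h_smul a v hv => rw [map_smul, antiT_smul, antiT_smul, map_smul, hv, smul_comm]
  | h0 => rw [map_zero, map_zero, map_zero, smul_zero]

theorem conj_eq_of_exists_real {z : ℂ} (h : ∃ r : ℝ, (r : ℂ) = z) : conj z = z := by
  obtain ⟨r, rfl⟩ := h
  exact Complex.conj_ofReal r

/-- The reflection turns the part of E₂ that raises j into the part of F₂ that raises j, whose
coefficient is a transposed c_l. The parity of p changes, which exchanges the two formulas, and the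
minus sign is the one in c_l. -/
theorem fal_refl (q : ℝ) (a b p : ℤ) : fcl q (a + 1) (b - 1) (2 * b + 1 - p - 2) = -fal q a b p := by
  have h : Odd (2 * b + 1 - p - 2) ↔ ¬Odd p := by
    rw [Int.not_odd_iff_even]
    constructor
    · rintro ⟨c, hc⟩
      exact ⟨b - 1 - c, by omega⟩
    · rintro ⟨c, hc⟩
      exact ⟨b - 1 - c, by omega⟩
  simp only [fcl, fal, h]
  split_ifs <;> ring_nf

theorem fbl_refl (q : ℝ) (a b p : ℤ) : fbl q a b (2 * b + 1 - p - 1) = fbl q a b p := by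
  have h : Odd (2 * b + 1 - p - 1) ↔ Odd p := by
    constructor
    · rintro ⟨c, hc⟩
      exact ⟨b - 1 - c, by omega⟩
    · rintro ⟨c, hc⟩
      exact ⟨b - 1 - c, by omega⟩
  simp only [fbl, h]
  split_ifs <;> ring_nf

theorem fcl_refl (q : ℝ) (a b p : ℤ) : fal q (a - 1) (b + 1) (2 * b + 1 - p) = -fcl q a b p := by
  have h := fal_refl q (a - 1) (b + 1) (2 * b + 1 - p)
  rw [eq_neg_iff_add_eq_zero] at h ⊢
  rw [← h, add_comm]
  congr 2 <;> ring

theorem reflection_K₁ (hq0 : 0 < q) :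
    List.Forall₂ (Sh.IsReflection q 1) (uqTerms q (.K 0)) (uqTerms q (.Kinv 0)) := by
  have hq : (q : ℂ) ≠ 0 := by exact_mod_cast hq0.ne'
  simp only [uqTerms, List.forall₂_cons, List.forall₂_nil_right_iff, and_true]
  refine ⟨by simp [tD, Pt.lref, Pt.zero_def], fun s x _ _ => ?_⟩
  have h := qhalf_sq hq0
  have h' := qhalf_ne_zero hq0
  have e : 2 * x.a + 1 - x.u - x.a = -(x.u - x.a) + 1 := by ring
  have hc : conj (qhalf q) = qhalf q := Complex.conj_ofReal _
  simp only [tD, Pt.zero_def, Pt.refl, map_mul, map_zpow₀, Complex.conj_ofReal, e, zpow_add₀ hq,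
    zpow_neg, hc]
  simp only [mul_zero, sub_self, add_zero, zpow_zero, zpow_one, mul_one, mul_inv, inv_inv, one_mul]
  -- q^{1/2} = q^{-1/2} q; the extra q matches the offset 1 in u ↦ 2a + 1 - u.
  have h1 : (qhalf q)⁻¹ = qhalf q * q := by
    field_simp
    rw [h]
    field_simp
  rw [h1]
  field_simp

theorem reflection_K₂ :
    List.Forall₂ (Sh.IsReflection q 1) (uqTerms q (.K 1)) (uqTerms q (.Kinv 1)) := by
  simp only [uqTerms, List.forall₂_cons, List.forall₂_nil_right_iff, and_true]
  refine ⟨by simp [tD, Pt.lref, Pt.zero_def], fun s x _ _ => ?_⟩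
  have e : 2 * x.b + 1 - x.p - x.b - (2 * x.a + 1 - x.u) + x.a = -(x.p - x.b - x.u + x.a) := by ring
  simp only [tD, Pt.zero_def, Pt.refl, map_zpow₀, Complex.conj_ofReal, e, zpow_neg, inv_inv]
  simp

theorem reflection_E₁ (hq0 : 0 < q) (hq1 : q < 1) :
    List.Forall₂ (Sh.IsReflection q (-q)) (uqTerms q (.E 0)) (uqTerms q (.F 0)) := by
  simp only [uqTerms, List.forall₂_cons, List.forall₂_nil_right_iff, and_true]
  refine ⟨by simp [tE, Pt.lref], fun s x hx _ => ?_⟩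
  obtain ⟨h1, h2, h3, h4⟩ := hx
  have e1 : 2 * x.a + 2 - (2 * x.a + 1 - x.u) = x.u + 1 := by ring
  simp only [tE, Pt.refl, mul_one, e1]
  rw [conj_eq_of_exists_real (exists_real_sn_mul hq0 hq1 (by omega) (by omega))]
  simp
  ring

/-- All three parts of E₂ change (m₁, m₂) by (-1, 1), hence the weight by q^{-1+3} = q². The sign -1
comes from the phase in the part that keeps j, and from the relation between a_l and c_l in the
other two parts. -/
theorem reflection_E₂ (hq0 : 0 < q) (hq1 : q < 1) :
    List.Forall₂ (Sh.IsReflection q (-q ^ 2)) (uqTerms q (.E 1)) (uqTerms q (.F 1)).reverse := by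
  simp only [uqTerms, List.reverse_cons, List.reverse_nil, List.nil_append, List.cons_append,
    List.forall₂_cons, List.forall₂_nil_right_iff, and_true]
  refine ⟨⟨by simp [tE, Pt.lref], fun s x hx hd => ?_⟩, ⟨by simp [tE, Pt.lref], fun s x hx hd => ?_⟩,
    ⟨by simp [tE, Pt.lref], fun s x hx hd => ?_⟩⟩
  all_goals
    obtain ⟨h1, h2, h3, h4⟩ := hx
    obtain ⟨h1', h2', h3', h4'⟩ := hd
    simp only [tE, Pt.add_def] at h1' h2' h3' h4'
    simp only [tE, Pt.refl, map_mul (starRingEnd ℂ) (sn _ _ * sn _ _)]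
  · rw [conj_eq_of_exists_real (exists_real_sn_mul hq0 hq1 (by omega) (by omega)),
      conj_eq_of_exists_real ⟨_, al_eq hq0 hq1 (a := x.a) (by omega) h3 (by omega)⟩, fal_refl,
      show 2 * x.a + 1 - x.u + 2 = 2 * x.a + 3 - x.u by ring,
      show 2 * x.a + 1 - x.u + 1 = 2 * x.a + 2 - x.u by ring]
    norm_num
    ring
  · rw [conj_eq_of_exists_real (exists_real_sn_mul hq0 hq1 (by omega) (by omega)),
      conj_eq_of_exists_real ⟨_, bl_eq hq0 hq1 (a := x.a) (by omega) h3 (by omega)⟩, fbl_refl,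
      show 2 * x.a + 1 - (2 * x.a + 1 - x.u) = x.u by ring,
      show 2 * x.a + 1 - x.u + 1 = 2 * x.a + 2 - x.u by ring]
    norm_num
    ring
  · rw [conj_eq_of_exists_real (exists_real_sn_mul hq0 hq1 (by omega) (by omega)),
      conj_eq_of_exists_real ⟨_, cl_eq hq0 hq1 (a := x.a) (by omega) h3 (by omega)⟩, fcl_refl,
      show 2 * x.a + 1 - (2 * x.a + 1 - x.u) = x.u by ring,
      show 2 * x.a - (2 * x.a + 1 - x.u) = x.u - 1 by ring]
    norm_num
    ring

theorem compr_perm {ts ts' : List Sh} (h : ts.Perm ts') :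
    compr (latSum ts) = compr (latSum ts') :=
  M_ext fun s x hx => by
    rw [compr_latSum _ _ hx, compr_latSum _ _ hx]
    exact (h.map _).sum_eq

theorem antiT_E (hq0 : 0 < q) (hq1 : q < 1) (i : Fin 2) (v : M) :
    antiT q (uqOp q (.E i) v) = (-qi q i) • uqOp q (.F i) (antiT q v) := by
  revert i
  refine Fin.forall_fin_two.2 ⟨?_, ?_⟩
  · rw [qi, Fin.val_zero, zero_add, pow_one]
    exact antiT_compr hq0 (reflection_E₁ hq0 hq1) v
  · rw [qi, Fin.val_one, one_add_one_eq_two, uqOp, uqOp, uqLat, uqLat,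
      ← compr_perm (List.reverse_perm (uqTerms q (.F 1)))]
    exact antiT_compr hq0 (reflection_E₂ hq0 hq1) v

/-- Follows from the relation for E by applying T on both sides, since T² = -1. -/
theorem antiT_F (hq0 : 0 < q) (hq1 : q < 1) (i : Fin 2) (v : M) :
    antiT q (uqOp q (.F i) v) = (-(qi q i)⁻¹) • uqOp q (.E i) (antiT q v) := by
  have hq : qi q i ≠ 0 := pow_ne_zero _ (by exact_mod_cast hq0.ne')
  have h := congrArg (antiT q) (antiT_E hq0 hq1 i (antiT q v))
  rw [antiT_antiT hq0, antiT_antiT hq0, antiT_smul, map_neg, map_neg, map_neg, Uq.conj_qi, smul_neg,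
    neg_smul, neg_neg] at h
  rw [neg_smul, ← smul_neg, h, inv_smul_smul₀ hq]

theorem antiT_K (hq0 : 0 < q) (i : Fin 2) (v : M) :
    antiT q (uqOp q (.K i) v) = uqOp q (.Kinv i) (antiT q v) := by
  rw [← one_smul ℂ (uqOp q (.Kinv i) (antiT q v))]
  revert i
  exact Fin.forall_fin_two.2 ⟨antiT_compr hq0 (reflection_K₁ hq0) v, antiT_compr hq0 reflection_K₂ v⟩

theorem antiT_Kinv (hq0 : 0 < q) (i : Fin 2) (v : M) :
    antiT q (uqOp q (.Kinv i) v) = uqOp q (.K i) (antiT q v) := by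
  have h := congrArg (antiT q) (antiT_K hq0 i (antiT q v))
  rw [antiT_antiT hq0, antiT_antiT hq0, map_neg, map_neg, neg_inj] at h
  exact h.symm

/-- The map h ↦ S(h)* is multiplicative and antilinear, being composed of two anti-automorphisms of
which one is antilinear. Intertwining by the antilinear T therefore has to be checked on generators
only. -/
theorem antiT_uqRep (hq0 : 0 < q) (hq1 : q < 1) (h : Uq q) (v : M) :
    antiT q (uqRep hq0 hq1 h v) = uqRep hq0 hq1 (star (Uq.antipode q h)) (antiT q v) := by
  obtain ⟨h, rfl⟩ := Uq.mk_surjective q h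
  induction h using FreeAlgebra.induction generalizing v with
  | grade0 c =>
    have e : Uq.antipode q (Uq.mk q (algebraMap ℂ _ c)) = algebraMap ℂ _ c := by
      rw [Uq.antipode, AlgHom.commutes, AlgHom.commutes]
      rfl
    rw [e, AlgHom.commutes, Algebra.algebraMap_eq_smul_one, star_smul, star_one, map_smul, map_smul,
      map_one]
    exact antiT_smul q c v
  | grade1 g =>
    rw [Uq.antipode_mk_ι, uqRep_ι]
    rcases g with i | i | i | i
    · rw [Uq.antipodeGen, Uq.Kinv, Uq.star_mk_ι, uqRep_ι, antiT_K hq0, UqGen.adj]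
    · rw [Uq.antipodeGen, Uq.K, Uq.star_mk_ι, uqRep_ι, antiT_Kinv hq0, UqGen.adj]
    · rw [Uq.antipodeGen, Uq.E, star_neg, star_smul, Uq.star_mk_ι, map_neg, map_smul, uqRep_ι,
        antiT_E hq0 hq1, UqGen.adj, neg_smul]
      congr 2
      exact (Uq.conj_qi q i).symm
    · rw [Uq.antipodeGen, Uq.F, star_neg, star_smul, Uq.star_mk_ι, map_neg, map_smul, uqRep_ι,
        antiT_F hq0 hq1, UqGen.adj, neg_smul, star_inv₀]
      congr 3
      exact (Uq.conj_qi q i).symm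
  | mul a b ha hb =>
    have e : Uq.antipode q (Uq.mk q (a * b)) =
        Uq.antipode q (Uq.mk q b) * Uq.antipode q (Uq.mk q a) := by
      rw [Uq.antipode, map_mul, map_mul, MulOpposite.unop_mul]
      rfl
    rw [e, map_mul, map_mul, star_mul, map_mul, Module.End.mul_apply, ha, hb]
    rfl
  | add a b ha hb =>
    have e : Uq.antipode q (Uq.mk q (a + b)) =
        Uq.antipode q (Uq.mk q a) + Uq.antipode q (Uq.mk q b) := by
      rw [Uq.antipode, map_add, map_add, MulOpposite.unop_add]
      rfl
    rw [e, map_add, map_add, star_add, map_add, LinearMap.add_apply, map_add, ha, hb]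
    rfl

end

end S4q

end

theorem mainTheorem9 (q : ℝ) (hq0 : 0 < q) (hq1 : q < 1) :
    ∃ (π : S4q.Sphere q →⋆ₐ[ℂ] (S4q.H →L[ℂ] S4q.H)) (σ : S4q.Uq q →ₐ[ℂ] Module.End ℂ S4q.M),
      S4q.IsSpinorRep q π ∧ S4q.IsSpinorAction q σ ∧
      -- `J² = -1`, `Jγ = γJ` and `JD = DJ`
      (∀ v, S4q.J (S4q.J v) = -v) ∧
      (∀ v, S4q.J (S4q.γ v) = S4q.γ (S4q.J v)) ∧
      (∀ v : S4q.H, S4q.J v ∈ S4q.D.domain ↔ v ∈ S4q.D.domain) ∧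
      (∀ (v : S4q.D.domain) (h : S4q.J v ∈ S4q.D.domain), S4q.J (S4q.D v) = S4q.D ⟨S4q.J v, h⟩) ∧
      -- `J` is the antiunitary part of an equivariant antilinear operator `T`
      (∃ T : S4q.M →ₛₗ[starRingEnd ℂ] S4q.M,
        (∀ s l m₁ m₂ j, S4q.Admissible l m₁ m₂ j →
          (T (S4q.mket s l m₁ m₂ j) : S4q.H) =
            (S4q.phase l m₁ j * (q ^ (m₁ + 3 * m₂) : ℝ)) • S4q.ket s l (-m₁) (-m₂) j) ∧
        (∀ (h : S4q.Uq q) (v : S4q.M), T (σ h v) = σ (star (S4q.Uq.antipode q h)) (T v)) ∧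
        S4q.IsAntiunitaryPart S4q.J T) ∧
      -- the commutant and the first order condition modulo smoothing operators
      ∀ a b : S4q.Sphere q,
        S4q.Smoothing (π a * S4q.JbJ (π b) - S4q.JbJ (π b) * π a) ∧
        ∃ c : S4q.H →L[ℂ] S4q.H, S4q.IsCommutator S4q.D (π a) c ∧
          S4q.Smoothing (c * S4q.JbJ (π b) - S4q.JbJ (π b) * c) := by
  refine ⟨S4q.sphereRep hq0 hq1, S4q.uqRep hq0 hq1, S4q.isSpinorRep_sphereRep hq0 hq1,
    S4q.isSpinorAction_uqRep hq0 hq1, S4q.J_J, S4q.J_γ, S4q.J_mem_D_domain_iff, S4q.J_D,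
    ⟨S4q.antiT q, S4q.antiT_mket q, S4q.antiT_uqRep hq0 hq1, S4q.isAntiunitaryPart_J hq0⟩,
    S4q.sphereRep_first_order hq0 hq1⟩
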